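/- Consider the Chaplygin gas system \[ \partial_t\rho+\partial_x(\rho u)=0,\qquad \partial_t(\rho u)+\partial_x\Big(\rho u^2-\frac1\rho\Big)=0,\qquad t>0, \] with energy density $\eta=\rho u^2+\frac1\rho$, energy flux $Q=\rho u^3-\frac u\rho$ and characteristic speeds $\lambda_1(\rho,u)=u-\frac1\rho$, $\lambda_2(\rho,u)=u+\frac1\rho$. Let $U_0=(\rho_0,u_0)$, $U_1=(\rho_1,u_1)$ with $\rho_0,\rho_1>0$, let $\xi_\delta>0$, and consider the delta Riemann data \[ (\rho,u)(x,0)=\begin{cases}(\rho_0,u_0),&x<0\\(\rho_1,u_1),&x>0\end{cases}\;+\;(\xi_\delta,0)\,\delta . \] For $\mu>0$ and $u_\delta\in\mathbb R$ the data are approximated by the step function $U_{\mu}$ that equals $U_0$ for $x<-\frac\mu2$, $(\frac{\xi_\delta}\mu,u_\delta)$ for $-\frac\mu2<x<\frac\mu2$, and $U_1$ for $x>\frac\mu2$. *Admissible solutions.* An admissible solution with step initial data consists of constant states of positive density separated by finitely many fronts, each of which is either a contact discontinuity ($\lambda_k$ is the same on both sides and equals the speed of the front, $k=1$ or $2$),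 or an overcompressive shadow wave: a front $x=c(t)$ between a left state $U_l$ and a right state $U_r$ which carries a delta mass of strength $\xi(t)>0$, with $\lambda_2(U_r)\le c'\le\lambda_1(U_l)$ and \[ \xi'=c'[\rho]-[\rho u],\qquad (\xi c')'=c'[\rho u]-[\rho u^2-\rho^{-1}],\qquad [\,\cdot\,]=\cdot|_{U_r}-\cdot|_{U_l}; \] initially no front carries mass, and when fronts collide (at finitely many times) the solution is continued by fronts of the same kinds with conservation of the point masses $\xi$ and the point momenta $\xi c'$. A shadow wave is the limit as $\varepsilon\to0+$ of the states $\big(\frac{\xi(t)}{\varepsilon(t-\tau)},c'(t)\big)$ in the strip $|x-c(t)|<\frac\varepsilon2(t-\tau)$, where $\tau$ is the time at which the wave starts if it starts with zero strength, and any earlier time otherwise; this gives piecewise constant functions $U^\varepsilon$. Distributional statements about the solution refer to the limit $\varepsilon\to0+$. Put $H_{[-L,L]}(t)=\lim_{\varepsilon\to0+}\int_{-L}^L\eta(U^\varepsilon(x,t))\,dx$. *Backward energy condition.* A value $u_\delta$ has least initial dissipation if for every $L>0$ and every other value $\tilde u_\delta$, for all sufficiently small $\mu>0$, admissible solutions $U,\tilde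 U$ (on a short time interval) with the data $U_\mu$ for $u_\delta$ and for $\tilde u_\delta$, respectively, satisfy $\frac{d}{dt}H_{[-L,L]}(U)(0+)\ge\frac{d}{dt}H_{[-L,L]}(\tilde U)(0+)$. The value $u_\delta$ satisfies the backward energy condition if it has least initial dissipation and, compared with every other value that has it, its total initial energy $\int_{-L}^L\eta(U_\mu)\,dx$ is not larger, for every $L>0$ and all sufficiently small $\mu>0$. **Theorem.** There is exactly one value $u_\delta$ that satisfies the backward energy condition. For this value, an admissible solution with data $U_\mu$ exists for all times if $\mu>0$ is small enough, every such solution is a weak solution of the system (in the limit $\varepsilon\to0+$), and $\rho$, $u$ and $\rho u$ converge in the sense of distributions on $t>0$, as first $\varepsilon\to0+$ and then $\mu\to0+$, to limits that do not depend on the choice of the admissible solutions. Moreover: 1. If $\lambda_1(\rho_0,u_0)>\lambda_2(\rho_1,u_1)$, the limit is a weighted delta shock \[ (\rho,u)(x,t)=\begin{cases}(\rho_0,u_0),&x<c(t)\\(\rho_1,u_1),&x>c(t)\end{cases}\;+\;(\xi(t),0)\,\delta(x-c(t)), \] and $\rho u$ converges to its piecewise constant part plus $\xi(t)c'(t)\,\delta(x-c(t))$.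 Here $(c,\xi)$ is an overcompressive front as above, joining $U_0$ to $U_1$, with $c(0)=0$, $c'(0)=u_\delta$, $\xi(0)=\xi_\delta$. 2. If $\lambda_1(\rho_0,u_0)\le\lambda_2(\rho_1,u_1)$, then \[ u_\delta=\begin{cases}\lambda_2(\rho_1,u_1),&\text{if }\lambda_2(\rho_1,u_1)<0\\ \lambda_1(\rho_0,u_0),&\text{if }\lambda_1(\rho_0,u_0)>0\\ 0,&\text{otherwise,}\end{cases} \] and for all sufficiently small $\mu>0$ the solution locally conserves energy, that is $\partial_t\eta+\partial_xQ=0$ in the sense of distributions (in the limit $\varepsilon\to0+$), with the initial energy density $\eta(U_\mu)$. -/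

import Mathlib

open Filter Topology MeasureTheory
open scoped ContDiff

noncomputable section

namespace Chaplygin

/-- A gas state: density and velocity. -/
@[ext]
structure State where
  rho : ℝ
  vel : ℝ

namespace State

def lam1 (U : State) : ℝ := U.vel - 1 / U.rho

def lam2 (U : State) : ℝ := U.vel + 1 / U.rho

/-- Momentum density `ρ u` (which is also the mass flux). -/
def mom (U : State) : ℝ := U.rho * U.vel

/-- Momentum flux `ρ u² - 1/ρ`. -/
def momFlux (U : State) : ℝ := U.rho * U.vel ^ 2 - 1 / U.rho

/-- Energy density `η = ρ u² + 1/ρ`. -/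
def energy (U : State) : ℝ := U.rho * U.vel ^ 2 + 1 / U.rho

/-- Energy flux `Q = ρ u³ - u/ρ`. -/
def energyFlux (U : State) : ℝ := U.rho * U.vel ^ 3 - U.vel / U.rho

end State

/-! ### Distributions -/

/-- Test functions on the `(x, t)` plane (their support may meet `t = 0`). -/
def IsTest (φ : ℝ × ℝ → ℝ) : Prop := ContDiff ℝ ∞ φ ∧ HasCompactSupport φ

def dx (φ : ℝ × ℝ → ℝ) (x t : ℝ) : ℝ := fderiv ℝ φ (x, t) (1, 0)

def dt (φ : ℝ × ℝ → ℝ) (x t : ℝ) : ℝ := fderiv ℝ φ (x, t) (0, 1)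

/-- The weak form of `∂ₜ q(U) + ∂ₓ f(U) = 0`, `t > 0`, with `q(U) = q(U₀)` at `t = 0`,
tested with `φ` (up to the sign). -/
def residual (U : ℝ → ℝ → State) (U₀ : ℝ → State) (q f : State → ℝ) (φ : ℝ × ℝ → ℝ) : ℝ :=
  (∫ t in Set.Ioi (0 : ℝ), ∫ x, (q (U x t) * dt φ x t + f (U x t) * dx φ x t))
    + ∫ x, q (U₀ x) * φ (x, 0)

/-- The net `U^ε` satisfies `∂ₜ q(U) + ∂ₓ f(U) = 0` with initial datum `U₀` in the limit
`ε → 0+`, in the sense of distributions. -/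
def SatisfiesLaw (U : ℝ → ℝ → ℝ → State) (U₀ : ℝ → State) (q f : State → ℝ) : Prop :=
  ∀ φ, IsTest φ → Tendsto (fun ε => residual (U ε) U₀ q f φ) (𝓝[>] 0) (𝓝 0)

/-- Approximate (weak) solution of the Chaplygin system. -/
def IsWeakSolution (U : ℝ → ℝ → ℝ → State) (U₀ : ℝ → State) : Prop :=
  SatisfiesLaw U U₀ State.rho State.mom ∧ SatisfiesLaw U U₀ State.mom State.momFlux

/-- Local conservation of energy in the sense of distributions. -/
def ConservesEnergy (U : ℝ → ℝ → ℝ → State) (U₀ : ℝ → State) : Prop :=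
  SatisfiesLaw U U₀ State.energy State.energyFlux

/-! ### Fronts

`J` is a closed time interval, `L` and `R` are the states to the left and to the right of the
front `x = pos t`, which moves with speed `speed t` and carries a delta mass of strength `str t`
(and the momentum `str t * speed t`). -/

def IsFront (J : Set ℝ) (pos speed : ℝ → ℝ) : Prop :=
  ContinuousOn pos J ∧ ContinuousOn speed J ∧ ∀ t ∈ interior J, HasDerivAt pos (speed t) t

/-- A contact discontinuity of the first or of the second family. -/
def IsContact (L R : State) (J : Set ℝ) (speed str : ℝ → ℝ) : Prop :=
  L ≠ R ∧ (∀ t ∈ J, str t = 0) ∧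
    ((L.lam1 = R.lam1 ∧ ∀ t ∈ J, speed t = L.lam1) ∨
      (L.lam2 = R.lam2 ∧ ∀ t ∈ J, speed t = L.lam2))

/-- An overcompressive shadow wave (delta shock): positive strength, `λ₂(R) ≤ speed ≤ λ₁(L)`, and
the generalized Rankine-Hugoniot conditions for mass and momentum. -/
def IsShadow (L R : State) (J : Set ℝ) (speed str : ℝ → ℝ) : Prop :=
  ContinuousOn str J ∧ ∀ t ∈ interior J,
    0 < str t ∧ R.lam2 ≤ speed t ∧ speed t ≤ L.lam1 ∧
    HasDerivAt str (speed t * (R.rho - L.rho) - (R.mom - L.mom)) t ∧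
    HasDerivAt (fun τ => str τ * speed τ)
      (speed t * (R.mom - L.mom) - (R.momFlux - L.momFlux)) t

/-! ### Wave patterns -/

/-- `n` fronts `x = pos i t`, `i < n`, that separate the constant states `state 0, …, state n`
(front `i` lies between `state i` and `state (i + 1)`; values at larger indices are irrelevant).
A shadow wave is resolved by a strip of half-width `(ε / 2) * (t - org i)`, that is
`(ε / 2) * t + x_ε` with `x_ε = -(ε / 2) * org i`. -/
structure Pattern where
  n : ℕ
  state : ℕ → State
  pos : ℕ → ℝ → ℝ
  speed : ℕ → ℝ → ℝ
  str : ℕ → ℝ → ℝ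
  org : ℕ → ℝ

namespace Pattern

open Classical in
/-- The piecewise constant function, without the shadow wave strips. -/
def base (P : Pattern) (x t : ℝ) : State :=
  P.state ((Finset.range P.n).filter (fun i => P.pos i t < x)).card

/-- `(x, t)` lies in the strip of the `i`-th front, which is a shadow wave. -/
def InStrip (P : Pattern) (ε x t : ℝ) (i : ℕ) : Prop :=
  i < P.n ∧ 0 < P.str i t ∧ |x - P.pos i t| < ε / 2 * (t - P.org i)

open Classical in
/-- The net of piecewise constant (in `x`) functions: inside the strip of a shadow wave
the density is its strength divided by the width of the strip, and the velocity is the speed of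
the front. (Strips overlap only shortly before a collision; then the first one counts.) -/
def net (P : Pattern) (ε x t : ℝ) : State :=
  if h : ∃ i, P.InStrip ε x t i then
    ⟨P.str (Nat.find h) t / (ε * (t - P.org (Nat.find h))), P.speed (Nat.find h) t⟩
  else P.base x t

/-- On the closed time interval `J` with left end `a` the pattern consists of states of positive
density, separated by contact discontinuities and overcompressive shadow waves that do not meet
in the interior of `J`. -/
def IsAdmissibleOn (P : Pattern) (a : ℝ) (J : Set ℝ) : Prop :=
  (∀ i ≤ P.n, 0 < (P.state i).rho) ∧
  (∀ t ∈ interior J, ∀ i, i + 1 < P.n → P.pos i t < P.pos (i + 1) t) ∧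
  ∀ i < P.n, IsFront J (P.pos i) (P.speed i) ∧
    (IsContact (P.state i) (P.state (i + 1)) J (P.speed i) (P.str i) ∨
      (IsShadow (P.state i) (P.state (i + 1)) J (P.speed i) (P.str i) ∧
        ((P.str i a = 0 ∧ P.org i = a) ∨ (0 < P.str i a ∧ P.org i < a))))

open Classical in
/-- Total strength of the fronts that are at the point `x` at time `t`. -/
def massAt (P : Pattern) (x t : ℝ) : ℝ :=
  ∑ i ∈ (Finset.range P.n).filter (fun i => P.pos i t = x), P.str i t

open Classical in
/-- Total momentum carried by the fronts that are at the point `x` at time `t`. -/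
def momAt (P : Pattern) (x t : ℝ) : ℝ :=
  ∑ i ∈ (Finset.range P.n).filter (fun i => P.pos i t = x), P.str i t * P.speed i t

/-- The pattern starts at time `a` from the step function `U` (equality off a finite set)
with point masses `m` and point momenta `q`. -/
def StartsFrom (P : Pattern) (a : ℝ) (U : ℝ → State) (m q : ℝ → ℝ) : Prop :=
  (∀ᶠ x in cofinite, P.base x a = U x) ∧
    (∀ x, P.massAt x a = m x) ∧ ∀ x, P.momAt x a = q x

end Pattern

/-! ### Wave tracking -/

/-- A solution that is obtained by following wave interactions: `slab k` is the pattern on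
`[T k, T (k + 1)]` for `k < K`, and `slab K` is the pattern on `[T K, ∞)`. -/
structure WaveTracking where
  K : ℕ
  T : ℕ → ℝ
  slab : ℕ → Pattern

namespace WaveTracking

/-- The time interval of the `k`-th slab. -/
def times (W : WaveTracking) (k : ℕ) : Set ℝ :=
  if k < W.K then Set.Icc (W.T k) (W.T (k + 1)) else Set.Ici (W.T k)

open Classical in
/-- The net `U^ε(x, t)` for all `t ≥ 0`. -/
def net (W : WaveTracking) (ε x t : ℝ) : State :=
  (W.slab ((Finset.Icc 1 W.K).filter (fun k => W.T k ≤ t)).card).net ε x t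

/-- `W` is an admissible solution, for all `t ≥ 0`, with the initial step function `U₀`:
all patterns are admissible, `T 1 < … < T K` are times at which fronts collide, and the solution
is continued there with conservation of the point masses and point momenta. -/
def IsSolution (W : WaveTracking) (U₀ : ℝ → State) : Prop :=
  W.T 0 = 0 ∧
  (∀ k < W.K, W.T k < W.T (k + 1)) ∧
  (∀ k ≤ W.K, (W.slab k).IsAdmissibleOn (W.T k) (W.times k)) ∧
  (W.slab 0).StartsFrom 0 U₀ (fun _ => 0) (fun _ => 0) ∧
  ∀ k < W.K,
    (∃ i, i + 1 < (W.slab k).n ∧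
      (W.slab k).pos i (W.T (k + 1)) = (W.slab k).pos (i + 1) (W.T (k + 1))) ∧
    (W.slab (k + 1)).StartsFrom (W.T (k + 1))
      (fun x => (W.slab k).base x (W.T (k + 1)))
      (fun x => (W.slab k).massAt x (W.T (k + 1)))
      (fun x => (W.slab k).momAt x (W.T (k + 1)))

end WaveTracking

/-! ### Delta Riemann data and the backward energy condition -/

/-- The approximation of the delta Riemann data: the delta mass `ξ` at the origin is replaced by
the state `(ξ / μ, v)` on an interval of length `μ`. -/
def deltaData (U₀ U₁ : State) (ξ μ v x : ℝ) : State :=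
  if x < -(μ / 2) then U₀ else if x < μ / 2 then ⟨ξ / μ, v⟩ else U₁

/-- Total energy in `[-ℓ, ℓ]`. -/
def totalEnergy (ℓ : ℝ) (U : ℝ → State) : ℝ := ∫ x in (-ℓ)..ℓ, (U x).energy

/-- The admissible solution that starts from the step function `U₀` has
`d/dt H_{[-ℓ, ℓ]}(0+) = d`, where `H_{[-ℓ, ℓ]}(t)` is the limit, as `ε → 0+`, of the
total energies at time `t`. Only the solution up to some positive time matters. -/
def HasInitialEnergyRate (U₀ : ℝ → State) (ℓ d : ℝ) : Prop :=
  ∃ (P : Pattern) (b : ℝ) (H : ℝ → ℝ), 0 < b ∧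
    P.IsAdmissibleOn 0 (Set.Icc 0 b) ∧ P.StartsFrom 0 U₀ (fun _ => 0) (fun _ => 0) ∧
    (∀ t ∈ Set.Ico 0 b,
      Tendsto (fun ε => totalEnergy ℓ (fun x => P.net ε x t)) (𝓝[>] 0) (𝓝 (H t))) ∧
    HasDerivWithinAt H d (Set.Ici 0) 0

/-- The solution for the value `v` dissipates the least energy initially: compared with any other
value `v'`, its energy rate at `0+` is at least as large, for all small enough `μ`. -/
def HasLeastDissipation (U₀ U₁ : State) (ξ v : ℝ) : Prop :=
  ∀ ℓ > 0, ∀ v' : ℝ, ∀ᶠ μ in 𝓝[>] (0 : ℝ), ∃ d d' : ℝ,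
    HasInitialEnergyRate (deltaData U₀ U₁ ξ μ v) ℓ d ∧
    HasInitialEnergyRate (deltaData U₀ U₁ ξ μ v') ℓ d' ∧ d' ≤ d

/-- The backward energy condition: least initial dissipation and, among all values with this
property, least total initial energy. -/
def BackwardEnergy (U₀ U₁ : State) (ξ v : ℝ) : Prop :=
  HasLeastDissipation U₀ U₁ ξ v ∧
  ∀ v', HasLeastDissipation U₀ U₁ ξ v' → ∀ ℓ > 0, ∀ᶠ μ in 𝓝[>] (0 : ℝ),
    totalEnergy ℓ (deltaData U₀ U₁ ξ μ v) ≤ totalEnergy ℓ (deltaData U₀ U₁ ξ μ v')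

/-- `W μ`, `μ > 0` small, are admissible solutions for the approximated delta Riemann data with
the value `v`. -/
def IsApproximatingFamily (U₀ U₁ : State) (ξ v : ℝ) (W : ℝ → WaveTracking) : Prop :=
  ∀ᶠ μ in 𝓝[>] (0 : ℝ), (W μ).IsSolution (deltaData U₀ U₁ ξ μ v)

/-- `g(U)` converges to `Λ` in the sense of distributions, when first `ε → 0+` and
then `μ → 0+`. -/
def TendstoDistrib (W : ℝ → WaveTracking) (g : State → ℝ) (Λ : (ℝ × ℝ → ℝ) → ℝ) : Prop :=
  ∀ φ, IsTest φ → ∃ I : ℝ → ℝ,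
    (∀ᶠ μ in 𝓝[>] (0 : ℝ),
      Tendsto (fun ε => ∫ t in Set.Ioi (0 : ℝ), ∫ x, g ((W μ).net ε x t) * φ (x, t))
        (𝓝[>] 0) (𝓝 (I μ))) ∧
    Tendsto I (𝓝[>] 0) (𝓝 (Λ φ))

/-- The distribution `(a for x < c(t), b for x > c(t)) + w(t) δ(x - c(t))` on `t > 0`. -/
def jumpPlusDelta (a b : ℝ) (c w : ℝ → ℝ) (φ : ℝ × ℝ → ℝ) : ℝ :=
  (∫ t in Set.Ioi (0 : ℝ), ∫ x, (if x < c t then a else b) * φ (x, t))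
    + ∫ t in Set.Ioi (0 : ℝ), w t * φ (c t, t)

/-- An overcompressive weighted delta shock with front `c`, speed `s` and strength `w` joining `U₀`
to `U₁`, which starts from the origin with strength `ξ` and speed `v`. -/
def IsWeightedDeltaShock (U₀ U₁ : State) (ξ v : ℝ) (c s w : ℝ → ℝ) : Prop :=
  IsFront (Set.Ici 0) c s ∧ IsShadow U₀ U₁ (Set.Ici 0) s w ∧ c 0 = 0 ∧ s 0 = v ∧ w 0 = ξ

end Chaplygin

end

/-! The eigenvalues `lam1`, `lam2` are coordinates on the states (`State.ext_lam`), and both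
characteristic fields are linearly degenerate: a contact of family k keeps λₖ. If λ₁(A) < λ₂(B),
then A and B are joined by at most two contacts, through the state with coordinates (λ₁(A), λ₂(B));
otherwise a shadow wave is needed. Two cubic or quadratic polynomials in the front speed s control
such a wave. `pull` is ρ(s - λ₁)(s - λ₂), and a shadow wave that starts with zero strength runs
straight with speed s when the pulls of both sides agree at s (`exists_isRay_shadow`). `excess` is
(s - u) `pull`, and its jump across the wave is the rate of energy loss
(`IsShadow.hasDerivAt_energy`). Contacts move at zeros of `pull` and lose nothing.

Choice of the value. The concentrated state (ξ/μ, v) has the eigenvalues v ∓ μ/ξ. On its left there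
is a shadow wave for small μ if v < λ₁(U₀), and there are only contacts if v ≥ λ₁(U₀); similarly on
its right with λ₂(U₁) < v. Equality of the pulls gives (s - v)² = (μ/ξ)² + (μ/ξ) `pull`(s)
(`sq_sub_eq_of_pull_eq`), so these shadow waves have speeds tending to v, and the dissipation tends
to `loss` v = `lossLeft` + `lossRight` (`fanLoss_left`, `fanLoss_right`, `exists_rate`). If λ₁(U₀) ≤
λ₂(U₁), this vanishes exactly on the interval between the two numbers, and there the dissipation is
zero already for small μ, not only in the limit. The initial energy depends on v only through ξ v²
(`totalEnergy_deltaData`), which selects the point of the interval closest to 0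
(`backwardEnergy_iff_of_le`). If λ₂(U₁) < λ₁(U₀), `loss` is strictly convex on [λ₂(U₁), λ₁(U₀)] and
larger outside than at the nearer endpoint, so its minimizer is unique (`exists_loss_lt`) and the
second criterion decides nothing.

Uniqueness. The one-sided states at a point, with the mass and momentum concentrated there,
determine the fan that leaves it: the coordinates of the end states decide the wave types, and a
shadow wave is determined because its path lies on a conic (`RankineHugoniot.unique`,
`IsAdmissibleOn.fan_unique`). Hence patterns agree, and so do whole solutions
(`WaveTracking.IsSolution.unique`). It suffices to compute with one explicit solution, and initial
energy rates are well defined (`HasInitialEnergyRate.unique`).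

Weak form. As ε → 0 the net acts at a fixed time through `slice`: the step function plus a delta of
weight `str * α speed` on each front, α being the coefficient of ρ in the quantity. The jump
conditions make the time derivative of the slice of a density the sum of two slices
(`IsAdmissibleOn.integral_slice`). Conservation of point masses and momenta prevents jumps of the
slices of mass and momentum at collisions, so the weak form telescopes (`IsSolution.satisfiesLaw`).
For the energy one also needs that no mass is present at a collision and that excesses agree across
shadow waves.

Limit without dissipation. The two inner contacts have speeds v ± μ/ξ and meet at the time ξ/2. The
regions between the fronts are thin and dense, but width times value stays continuous (`IsContent`),
so the slices are continuous functions `before`, `after` of μ/ξ up to μ = 0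
(`Meeting.exists_tendstoDistrib`).

Limit in the overcompressive case. All waves merge, within a time that tends to 0, into one shadow
wave whose strength, speed and position tend to ξ, v and 0, while the slices stay bounded
(`Collapse`, `nonempty_collapse`). The explicit shadow waves depend continuously on these data,
which gives the weighted delta shock (`Collapse.tendstoDistrib`). When v is an endpoint of the
interval, one side consists of two contacts, which the shadow wave overtakes one after the other. -/

namespace Chaplygin

/-! ### Algebra of states -/

namespace State

theorem vel_eq (U : State) : U.vel = (U.lam1 + U.lam2) / 2 := by
  simp only [lam1, lam2]; ring

theorem one_div_rho (U : State) : 1 / U.rho = (U.lam2 - U.lam1) / 2 := by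
  simp only [lam1, lam2]; ring

/-- The velocity is the mean of the eigenvalues and `1 / rho` is half their difference. Inversion is
injective on all reals, zero included, so no positivity is needed. -/
theorem ext_lam {U V : State} (h₁ : U.lam1 = V.lam1) (h₂ : U.lam2 = V.lam2) : U = V := by
  have hv : U.vel = V.vel := by rw [U.vel_eq, V.vel_eq, h₁, h₂]
  have hr : 1 / U.rho = 1 / V.rho := by rw [U.one_div_rho, V.one_div_rho, h₁, h₂]
  exact State.ext (by simpa using hr) hv

theorem lam1_lt_lam2 {U : State} (h : 0 < U.rho) : U.lam1 < U.lam2 := by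
  have := one_div_pos.2 h
  simp only [lam1, lam2]; linarith

theorem rho_mul (U : State) (h : 0 < U.rho) : U.rho * (U.lam2 - U.lam1) = 2 := by
  simp only [lam1, lam2]; field_simp; ring

/-- The state with characteristic speeds `a` and `b`. -/
noncomputable def ofLam (a b : ℝ) : State := ⟨2 / (b - a), (a + b) / 2⟩

@[simp] theorem lam1_ofLam (a b : ℝ) : (ofLam a b).lam1 = a := by
  simp only [ofLam, lam1, one_div_div]; ring

@[simp] theorem lam2_ofLam (a b : ℝ) : (ofLam a b).lam2 = b := by
  simp only [ofLam, lam2, one_div_div]; ring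

theorem rho_ofLam_pos {a b : ℝ} (h : a < b) : 0 < (ofLam a b).rho :=
  div_pos two_pos (sub_pos.2 h)

/-- `ρ s² - 2 s ρ u + (ρ u² - 1/ρ)`, the momentum flux seen from a frame that moves with
speed `s`. -/
noncomputable def pull (U : State) (s : ℝ) : ℝ := U.rho * s ^ 2 - 2 * s * U.mom + U.momFlux

/-- The eigenvalues are the roots of this quadratic, so it vanishes for a front that moves with a
contact and is nonnegative for speeds outside of the two eigenvalues, which are the speeds in an
overcompressive front. -/
theorem pull_eq {U : State} (h : 0 < U.rho) (s : ℝ) :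
    U.pull s = U.rho * (s - U.lam1) * (s - U.lam2) := by
  simp only [pull, mom, momFlux, lam1, lam2]; field_simp; ring

/-- The energy flux seen from a frame that moves with speed `s`. -/
noncomputable def excess (U : State) (s : ℝ) : ℝ := (s - U.vel) * U.pull s

theorem excess_eq {U : State} (h : 0 < U.rho) (s : ℝ) :
    U.excess s = s * U.energy - U.energyFlux - 3 * s ^ 2 * U.mom + 2 * s * U.momFlux
      + s ^ 3 * U.rho := by
  simp only [excess, pull, mom, momFlux, energy, energyFlux]; field_simp; ring

/-- The flux relative to a frame that moves with an eigenvalue is exactly ±1. Each side of an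
overcompressive front therefore feeds it with rate at least 1, which is where the growth rate 2 of
shadow waves comes from. -/
theorem mass_flux_right {U : State} (h : 0 < U.rho) {s : ℝ} (hs : U.lam2 ≤ s) :
    1 ≤ s * U.rho - U.mom := by
  have h1 : U.rho * (U.lam2 - U.vel) = 1 := by simp only [lam2]; field_simp; ring
  simp only [mom]; nlinarith

theorem mass_flux_left {U : State} (h : 0 < U.rho) {s : ℝ} (hs : s ≤ U.lam1) :
    1 ≤ U.mom - s * U.rho := by
  have h1 : U.rho * (U.vel - U.lam1) = 1 := by simp only [lam1]; field_simp; ring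
  simp only [mom]; nlinarith

theorem pull_nonneg_right {U : State} (h : 0 < U.rho) {s : ℝ} (hs : U.lam2 ≤ s) :
    0 ≤ U.pull s := by
  rw [pull_eq h]
  have := lam1_lt_lam2 h
  exact mul_nonneg (mul_nonneg h.le (by linarith)) (by linarith)

theorem pull_nonneg_left {U : State} (h : 0 < U.rho) {s : ℝ} (hs : s ≤ U.lam1) :
    0 ≤ U.pull s := by
  rw [pull_eq h, mul_assoc]
  have := lam1_lt_lam2 h
  exact mul_nonneg h.le (mul_nonneg_of_nonpos_of_nonpos (by linarith) (by linarith))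

end State

/-! ### Elementary calculus on intervals -/

theorem exists_eq_add_deriv_mul {f f' : ℝ → ℝ} {a b : ℝ} (hf : ContinuousOn f (Set.Icc a b))
    (h : ∀ t ∈ Set.Ioo a b, HasDerivAt f (f' t) t) (hab : a < b) :
    ∃ c ∈ Set.Ioo a b, f b = f a + f' c * (b - a) := by
  obtain ⟨c, hc, hc'⟩ := exists_hasDerivAt_eq_slope f f' hab hf h
  refine ⟨c, hc, ?_⟩
  rw [hc']; field_simp [(sub_pos.2 hab).ne']; ring

theorem eq_left_of_hasDerivAt_zero {f : ℝ → ℝ} {a b : ℝ} (hf : ContinuousOn f (Set.Icc a b))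
    (h : ∀ t ∈ Set.Ioo a b, HasDerivAt f 0 t) {t : ℝ} (ht : t ∈ Set.Icc a b) : f t = f a := by
  rcases ht.1.eq_or_lt with rfl | hat
  · rfl
  obtain ⟨c, -, hc⟩ := exists_eq_add_deriv_mul (f' := fun _ => 0)
    (hf.mono (Set.Icc_subset_Icc_right ht.2)) (fun τ hτ => h τ ⟨hτ.1, hτ.2.trans_le ht.2⟩) hat
  simpa using hc

/-- After the last time at which `f` is nonnegative, the mean value theorem yields a point with `f`
negative and yet a nonnegative slope. -/
theorem nonneg_of_barrier {f f' : ℝ → ℝ} {a b : ℝ} (hf : ContinuousOn f (Set.Icc a b))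
    (h : ∀ t ∈ Set.Ioo a b, HasDerivAt f (f' t) t)
    (hb : ∀ t ∈ Set.Ioo a b, f t < 0 → 0 ≤ f' t) (ha : 0 ≤ f a) {t : ℝ}
    (ht : t ∈ Set.Icc a b) : 0 ≤ f t := by
  by_contra! hneg
  have hcl : IsClosed {x ∈ Set.Icc a t | 0 ≤ f x} :=
    (hf.mono (Set.Icc_subset_Icc_right ht.2)).preimage_isClosed_of_isClosed
      isClosed_Icc isClosed_Ici
  have hcomp : IsCompact {x ∈ Set.Icc a t | 0 ≤ f x} :=
    isCompact_Icc.of_isClosed_subset hcl (fun x hx => hx.1)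
  obtain ⟨τ, ⟨hτ, hτ0⟩, hmax⟩ := hcomp.exists_isGreatest ⟨a, ⟨le_rfl, ht.1⟩, ha⟩
  have hτt : τ < t := lt_of_le_of_ne hτ.2 (by rintro rfl; exact absurd hτ0 (not_le.2 hneg))
  obtain ⟨c, hc, hc'⟩ := exists_eq_add_deriv_mul (f' := f')
    (hf.mono (Set.Icc_subset_Icc hτ.1 ht.2))
    (fun x hx => h x ⟨hτ.1.trans_lt hx.1, hx.2.trans_le ht.2⟩) hτt
  have hc0 : f c < 0 := by
    by_contra! h0
    exact absurd (hmax ⟨⟨hτ.1.trans hc.1.le, hc.2.le⟩, h0⟩) (not_le.2 hc.1)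
  have := hb c ⟨hτ.1.trans_lt hc.1, hc.2.trans_le ht.2⟩ hc0
  nlinarith [sub_pos.2 hτt]

/-! ### Fronts that satisfy the generalized Rankine-Hugoniot conditions -/

/-- The generalized Rankine-Hugoniot conditions for mass and momentum. -/
structure RankineHugoniot (L R : State) (J : Set ℝ) (pos speed str : ℝ → ℝ) : Prop where
  front : IsFront J pos speed
  cont : ContinuousOn str J
  mass : ∀ t ∈ interior J, HasDerivAt str (speed t * (R.rho - L.rho) - (R.mom - L.mom)) t
  mom : ∀ t ∈ interior J, HasDerivAt (fun τ => str τ * speed τ)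
    (speed t * (R.mom - L.mom) - (R.momFlux - L.momFlux)) t

theorem IsShadow.rankineHugoniot {L R : State} {J : Set ℝ} {pos speed str : ℝ → ℝ}
    (h : IsShadow L R J speed str) (hf : IsFront J pos speed) :
    RankineHugoniot L R J pos speed str :=
  ⟨hf, h.1, fun t ht => (h.2 t ht).2.2.2.1, fun t ht => (h.2 t ht).2.2.2.2⟩

theorem IsFront.mono {J J' : Set ℝ} {pos speed : ℝ → ℝ} (h : IsFront J pos speed) (hJ : J' ⊆ J) :
    IsFront J' pos speed :=
  ⟨h.1.mono hJ, h.2.1.mono hJ, fun t ht => h.2.2 t (interior_mono hJ ht)⟩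

theorem IsShadow.mono {L R : State} {J J' : Set ℝ} {speed str : ℝ → ℝ}
    (h : IsShadow L R J speed str) (hJ : J' ⊆ J) : IsShadow L R J' speed str :=
  ⟨h.1.mono hJ, fun t ht => h.2 t (interior_mono hJ ht)⟩

theorem IsContact.mono {L R : State} {J J' : Set ℝ} {speed str : ℝ → ℝ}
    (h : IsContact L R J speed str) (hJ : J' ⊆ J) : IsContact L R J' speed str :=
  ⟨h.1, fun t ht => h.2.1 t (hJ ht), h.2.2.imp (fun h' => ⟨h'.1, fun t ht => h'.2 t (hJ ht)⟩)
    (fun h' => ⟨h'.1, fun t ht => h'.2 t (hJ ht)⟩)⟩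

namespace RankineHugoniot

variable {L R : State} {a b : ℝ} {pos speed str pos' speed' str' : ℝ → ℝ}

theorem str_eq (h : RankineHugoniot L R (Set.Icc a b) pos speed str) {t : ℝ}
    (ht : t ∈ Set.Icc a b) :
    str t = str a + (R.rho - L.rho) * (pos t - pos a) - (R.mom - L.mom) * (t - a) := by
  have := eq_left_of_hasDerivAt_zero
    (f := fun t => str t - (R.rho - L.rho) * pos t + (R.mom - L.mom) * t)
    ((h.cont.sub (h.front.1.const_smul (R.rho - L.rho))).add (by fun_prop)) (fun t ht => by
      have ht' : t ∈ interior (Set.Icc a b) := by rwa [interior_Icc]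
      refine (((h.mass t ht').sub ((h.front.2.2 t ht').const_mul (R.rho - L.rho))).add
        ((hasDerivAt_id t).const_mul (R.mom - L.mom))).congr_deriv ?_
      ring) ht
  linarith

theorem mom_eq (h : RankineHugoniot L R (Set.Icc a b) pos speed str) {t : ℝ}
    (ht : t ∈ Set.Icc a b) :
    str t * speed t = str a * speed a + (R.mom - L.mom) * (pos t - pos a)
      - (R.momFlux - L.momFlux) * (t - a) := by
  have := eq_left_of_hasDerivAt_zero
    (f := fun t => str t * speed t - (R.mom - L.mom) * pos t + (R.momFlux - L.momFlux) * t)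
    (((h.cont.mul h.front.2.1).sub (h.front.1.const_smul (R.mom - L.mom))).add (by fun_prop))
    (fun t ht => by
      have ht' : t ∈ interior (Set.Icc a b) := by rwa [interior_Icc]
      refine (((h.mom t ht').sub ((h.front.2.2 t ht').const_mul (R.mom - L.mom))).add
        ((hasDerivAt_id t).const_mul (R.momFlux - L.momFlux))).congr_deriv ?_
      ring) ht
  linarith

/-- Multiplying the speed by the strength, both known from `str_eq` and `mom_eq`, gives an exact
derivative. So the path satisfies a quadratic equation with explicit coefficients and no
differential equation has to be solved. -/
theorem conic (h : RankineHugoniot L R (Set.Icc a b) pos speed str) {t : ℝ}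
    (ht : t ∈ Set.Icc a b) :
    (R.rho - L.rho) * (pos t - pos a) ^ 2 / 2 + str a * (pos t - pos a)
      - (R.mom - L.mom) * (t - a) * (pos t - pos a)
      = str a * speed a * (t - a) - (R.momFlux - L.momFlux) * (t - a) ^ 2 / 2 := by
  have := eq_left_of_hasDerivAt_zero
    (f := fun t => (R.rho - L.rho) * (pos t - pos a) ^ 2 / 2 + str a * (pos t - pos a)
      - (R.mom - L.mom) * (t - a) * (pos t - pos a)
      - (str a * speed a * (t - a) - (R.momFlux - L.momFlux) * (t - a) ^ 2 / 2))
    (by have := h.front.1; fun_prop)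
    (fun t ht => by
      have ht' : t ∈ interior (Set.Icc a b) := by rwa [interior_Icc]
      have hX : HasDerivAt (fun t => pos t - pos a) (speed t) t :=
        (h.front.2.2 t ht').sub_const _
      have hT : HasDerivAt (fun t : ℝ => t - a) 1 t := (hasDerivAt_id t).sub_const _
      refine ((((((hX.pow 2).const_mul (R.rho - L.rho)).div_const 2).add
        (hX.const_mul (str a))).sub ((hT.const_mul (R.mom - L.mom)).mul hX)).sub
        ((hT.const_mul (str a * speed a)).sub
          (((hT.pow 2).const_mul (R.momFlux - L.momFlux)).div_const 2))).congr_deriv ?_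
      have h1 := h.str_eq ⟨ht.1.le, ht.2.le⟩
      have h2 := h.mom_eq ⟨ht.1.le, ht.2.le⟩
      rw [h1] at h2
      simp only [Nat.cast_ofNat, Nat.add_one_sub_one, pow_one]
      linarith) ht
  simp only [sub_self] at this
  linarith

/-- The difference of the two conics factors as the difference of the positions times the sum of the
strengths, and the latter is positive. -/
theorem unique (h : RankineHugoniot L R (Set.Icc a b) pos speed str)
    (h' : RankineHugoniot L R (Set.Icc a b) pos' speed' str') (hab : a < b)
    (hpos : ∀ t ∈ Set.Ioo a b, 0 < str t) (hpos' : ∀ t ∈ Set.Ioo a b, 0 < str' t)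
    (hp : pos a = pos' a) (hm : str a = str' a)
    (hq : str a * speed a = str' a * speed' a) {t : ℝ} (ht : t ∈ Set.Icc a b) :
    pos t = pos' t ∧ speed t = speed' t ∧ str t = str' t := by
  have key : Set.EqOn pos pos' (Set.Ioo a b) := by
    intro t ht
    have htc : t ∈ Set.Icc a b := ⟨ht.1.le, ht.2.le⟩
    have e1 := h.conic htc
    have e2 := h'.conic htc
    have s1 := h.str_eq htc
    have s2 := h'.str_eq htc
    rw [← hp, ← hm] at s2 e2
    rw [← hm] at hq
    have h0 : (pos t - pos' t) * (str t + str' t) = 0 := by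
      rw [s1, s2]; linear_combination 2 * e1 - 2 * e2 + 2 * (t - a) * hq
    rcases mul_eq_zero.1 h0 with h0 | h0
    · linarith
    · have := hpos t ht; have := hpos' t ht; linarith
  -- The strength may vanish at `a`, where momentum does not determine the speed; the endpoints are
  -- reached by continuity.
  have hcl : Set.Icc a b ⊆ closure (Set.Ioo a b) := by rw [closure_Ioo hab.ne]
  have kpos := key.of_subset_closure h.front.1 h'.front.1 Set.Ioo_subset_Icc_self hcl
  have kstr : Set.EqOn str str' (Set.Icc a b) := fun t ht => by
    rw [h.str_eq ht, h'.str_eq ht, kpos ht, hp, hm]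
  have kspeed : Set.EqOn speed speed' (Set.Ioo a b) := fun t ht => by
    have htc : t ∈ Set.Icc a b := ⟨ht.1.le, ht.2.le⟩
    have e1 := h.mom_eq htc
    have e2 := h'.mom_eq htc
    rw [← hq, ← kpos htc, ← hp, ← e1, ← kstr htc] at e2
    exact (mul_left_cancel₀ (hpos t ht).ne' e2).symm
  exact ⟨kpos ht, kspeed.of_subset_closure h.front.2.1 h'.front.2.1 Set.Ioo_subset_Icc_self hcl ht,
    kstr ht⟩

/-- The barrier function `r * str - str * speed` has the derivative `(speed - r) * (r [ρ] - [ρu])`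
plus the jump of `pull r`. Both terms are nonnegative while the speed exceeds `r`. -/
theorem speed_le (h : RankineHugoniot L R (Set.Icc a b) pos speed str)
    (hpos : ∀ t ∈ Set.Icc a b, 0 < str t) {r : ℝ} (hr : L.pull r ≤ R.pull r)
    (hk : R.mom - L.mom ≤ r * (R.rho - L.rho)) (ha : speed a ≤ r) {t : ℝ}
    (ht : t ∈ Set.Icc a b) : speed t ≤ r := by
  have := nonneg_of_barrier (f := fun t => r * str t - str t * speed t)
    (f' := fun t => r * (speed t * (R.rho - L.rho) - (R.mom - L.mom))
      - (speed t * (R.mom - L.mom) - (R.momFlux - L.momFlux)))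
    ((h.cont.const_smul r).sub (h.cont.mul h.front.2.1))
    (fun t ht => by
      have ht' : t ∈ interior (Set.Icc a b) := by rwa [interior_Icc]
      exact ((h.mass t ht').const_mul r).sub (h.mom t ht'))
    (fun t ht hneg => by
      have := hpos t ⟨ht.1.le, ht.2.le⟩
      have hs : r < speed t := by
        by_contra! hs
        nlinarith
      have e : r * (speed t * (R.rho - L.rho) - (R.mom - L.mom))
          - (speed t * (R.mom - L.mom) - (R.momFlux - L.momFlux))
          = (speed t - r) * (r * (R.rho - L.rho) - (R.mom - L.mom)) + (R.pull r - L.pull r) := by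
        simp only [State.pull]; ring
      rw [e]
      exact add_nonneg (mul_nonneg (by linarith) (by linarith)) (by linarith))
    (by have := hpos a ⟨le_rfl, ht.1.trans ht.2⟩; nlinarith) ht
  have h0 := hpos t ht
  by_contra! hs
  nlinarith

/-- The same barrier argument with all signs reversed. -/
theorem le_speed (h : RankineHugoniot L R (Set.Icc a b) pos speed str)
    (hpos : ∀ t ∈ Set.Icc a b, 0 < str t) {r : ℝ} (hr : R.pull r ≤ L.pull r)
    (hk : R.mom - L.mom ≤ r * (R.rho - L.rho)) (ha : r ≤ speed a) {t : ℝ}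
    (ht : t ∈ Set.Icc a b) : r ≤ speed t := by
  have := nonneg_of_barrier (f := fun t => str t * speed t - r * str t)
    (f' := fun t => (speed t * (R.mom - L.mom) - (R.momFlux - L.momFlux))
      - r * (speed t * (R.rho - L.rho) - (R.mom - L.mom)))
    ((h.cont.mul h.front.2.1).sub (h.cont.const_smul r))
    (fun t ht => by
      have ht' : t ∈ interior (Set.Icc a b) := by rwa [interior_Icc]
      exact (h.mom t ht').sub ((h.mass t ht').const_mul r))
    (fun t ht hneg => by
      have := hpos t ⟨ht.1.le, ht.2.le⟩
      have hs : speed t < r := by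
        by_contra! hs
        nlinarith
      have e : (speed t * (R.mom - L.mom) - (R.momFlux - L.momFlux))
          - r * (speed t * (R.rho - L.rho) - (R.mom - L.mom))
          = (r - speed t) * (r * (R.rho - L.rho) - (R.mom - L.mom)) + (L.pull r - R.pull r) := by
        simp only [State.pull]; ring
      rw [e]
      exact add_nonneg (mul_nonneg (by linarith) (by linarith)) (by linarith))
    (by have := hpos a ⟨le_rfl, ht.1.trans ht.2⟩; nlinarith) ht
  have h0 := hpos t ht
  by_contra! hs
  nlinarith

end RankineHugoniot

/-- The strength of a shadow wave grows at least with rate `2`. -/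
theorem IsShadow.le_str {L R : State} {a b : ℝ} {speed str : ℝ → ℝ} (hL : 0 < L.rho)
    (hR : 0 < R.rho) (h : IsShadow L R (Set.Icc a b) speed str) {t : ℝ} (ht : t ∈ Set.Icc a b) :
    str a + 2 * (t - a) ≤ str t := by
  rcases ht.1.eq_or_lt with rfl | hat
  · simp
  obtain ⟨c, hc, he⟩ := exists_eq_add_deriv_mul
    (f' := fun t => speed t * (R.rho - L.rho) - (R.mom - L.mom))
    (h.1.mono (Set.Icc_subset_Icc_right ht.2))
    (fun τ hτ => (h.2 τ (by rw [interior_Icc]; exact ⟨hτ.1, hτ.2.trans_le ht.2⟩)).2.2.2.1) hat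
  have hc' := h.2 c (by rw [interior_Icc]; exact ⟨hc.1, hc.2.trans_le ht.2⟩)
  have h1 := State.mass_flux_right hR hc'.2.1
  have h2 := State.mass_flux_left hL hc'.2.2.1
  rw [he]
  nlinarith [sub_pos.2 hat]

end Chaplygin

namespace Chaplygin

/-! ### Single waves -/

theorem IsFront.le_pos {a b c : ℝ} {pos speed : ℝ → ℝ} (h : IsFront (Set.Icc a b) pos speed)
    (hc : ∀ t ∈ Set.Ioo a b, c ≤ speed t) {t : ℝ} (ht : t ∈ Set.Icc a b) :
    pos a + c * (t - a) ≤ pos t := by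
  rcases ht.1.eq_or_lt with rfl | hat
  · simp
  obtain ⟨τ, hτ, he⟩ := exists_eq_add_deriv_mul (h.1.mono (Set.Icc_subset_Icc_right ht.2))
    (fun τ hτ => h.2.2 τ (by rw [interior_Icc]; exact ⟨hτ.1, hτ.2.trans_le ht.2⟩)) hat
  have := hc τ ⟨hτ.1, hτ.2.trans_le ht.2⟩
  nlinarith [sub_pos.2 hat]

theorem IsFront.pos_le {a b c : ℝ} {pos speed : ℝ → ℝ} (h : IsFront (Set.Icc a b) pos speed)
    (hc : ∀ t ∈ Set.Ioo a b, speed t ≤ c) {t : ℝ} (ht : t ∈ Set.Icc a b) :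
    pos t ≤ pos a + c * (t - a) := by
  rcases ht.1.eq_or_lt with rfl | hat
  · simp
  obtain ⟨τ, hτ, he⟩ := exists_eq_add_deriv_mul (h.1.mono (Set.Icc_subset_Icc_right ht.2))
    (fun τ hτ => h.2.2 τ (by rw [interior_Icc]; exact ⟨hτ.1, hτ.2.trans_le ht.2⟩)) hat
  have := hc τ ⟨hτ.1, hτ.2.trans_le ht.2⟩
  nlinarith [sub_pos.2 hat]

theorem IsFront.pos_eq {a b c : ℝ} {pos speed : ℝ → ℝ} (h : IsFront (Set.Icc a b) pos speed)
    (hc : ∀ t ∈ Set.Icc a b, speed t = c) {t : ℝ} (ht : t ∈ Set.Icc a b) :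
    pos t = pos a + c * (t - a) :=
  le_antisymm (h.pos_le (fun t ht => (hc t ⟨ht.1.le, ht.2.le⟩).le) ht)
    (h.le_pos (fun t ht => (hc t ⟨ht.1.le, ht.2.le⟩).ge) ht)

/-- A contact discontinuity of the first family. -/
def IsContact1 (L R : State) (J : Set ℝ) (speed str : ℝ → ℝ) : Prop :=
  L ≠ R ∧ (∀ t ∈ J, str t = 0) ∧ L.lam1 = R.lam1 ∧ ∀ t ∈ J, speed t = L.lam1

/-- A contact discontinuity of the second family. -/
def IsContact2 (L R : State) (J : Set ℝ) (speed str : ℝ → ℝ) : Prop :=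
  L ≠ R ∧ (∀ t ∈ J, str t = 0) ∧ L.lam2 = R.lam2 ∧ ∀ t ∈ J, speed t = L.lam2

theorem IsContact.cases {L R : State} {J : Set ℝ} {speed str : ℝ → ℝ}
    (h : IsContact L R J speed str) : IsContact1 L R J speed str ∨ IsContact2 L R J speed str := by
  rcases h with ⟨h1, h2, h3 | h3⟩
  · exact .inl ⟨h1, h2, h3⟩
  · exact .inr ⟨h1, h2, h3⟩

/-- A front with its position that is a contact discontinuity or a shadow wave. -/
def IsWave (L R : State) (J : Set ℝ) (pos speed str : ℝ → ℝ) : Prop :=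
  IsFront J pos speed ∧ (IsContact1 L R J speed str ∨ IsContact2 L R J speed str ∨
    IsShadow L R J speed str)

namespace IsWave

variable {L R : State} {a b t : ℝ} {pos speed str : ℝ → ℝ}

/-- This bound and the next three compare a wave with the characteristics of its neighbouring states
that leave the same point. Together they restrict which waves can share a starting point. -/
theorem lam1_right_le (h : IsWave L R (Set.Icc a b) pos speed str) (hR : 0 < R.rho)
    (ht : t ∈ Set.Icc a b) : pos a + R.lam1 * (t - a) ≤ pos t := by
  have h12 := State.lam1_lt_lam2 hR
  refine h.1.le_pos (fun τ hτ => ?_) ht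
  rcases h.2 with h' | h' | h'
  · rw [h'.2.2.2 τ ⟨hτ.1.le, hτ.2.le⟩, h'.2.2.1]
  · rw [h'.2.2.2 τ ⟨hτ.1.le, hτ.2.le⟩, h'.2.2.1]; exact h12.le
  · exact h12.le.trans (h'.2 τ (by rwa [interior_Icc])).2.1

theorem contact1_or_le (h : IsWave L R (Set.Icc a b) pos speed str)
    (ht : t ∈ Set.Icc a b) : IsContact1 L R (Set.Icc a b) speed str ∨
      pos a + R.lam2 * (t - a) ≤ pos t := by
  rcases h.2 with h' | h' | h'
  · exact .inl h'
  · refine .inr (h.1.le_pos (fun τ hτ => ?_) ht)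
    rw [h'.2.2.2 τ ⟨hτ.1.le, hτ.2.le⟩, h'.2.2.1]
  · exact .inr (h.1.le_pos (fun τ hτ => (h'.2 τ (by rwa [interior_Icc])).2.1) ht)

theorem le_lam2_left (h : IsWave L R (Set.Icc a b) pos speed str) (hL : 0 < L.rho)
    (ht : t ∈ Set.Icc a b) : pos t ≤ pos a + L.lam2 * (t - a) := by
  have h12 := State.lam1_lt_lam2 hL
  refine h.1.pos_le (fun τ hτ => ?_) ht
  rcases h.2 with h' | h' | h'
  · rw [h'.2.2.2 τ ⟨hτ.1.le, hτ.2.le⟩]; exact h12.le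
  · rw [h'.2.2.2 τ ⟨hτ.1.le, hτ.2.le⟩]
  · exact (h'.2 τ (by rwa [interior_Icc])).2.2.1.trans h12.le

theorem contact2_or_le (h : IsWave L R (Set.Icc a b) pos speed str)
    (ht : t ∈ Set.Icc a b) : IsContact2 L R (Set.Icc a b) speed str ∨
      pos t ≤ pos a + L.lam1 * (t - a) := by
  rcases h.2 with h' | h' | h'
  · refine .inr (h.1.pos_le (fun τ hτ => ?_) ht)
    rw [h'.2.2.2 τ ⟨hτ.1.le, hτ.2.le⟩]
  · exact .inl h'
  · exact .inr (h.1.pos_le (fun τ hτ => (h'.2 τ (by rwa [interior_Icc])).2.2.1) ht)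

end IsWave

theorem IsContact1.not_contact2 {L R : State} {J : Set ℝ} {speed str : ℝ → ℝ}
    (h : IsContact1 L R J speed str) : ¬ IsContact2 L R J speed str :=
  fun h' => h.1 (State.ext_lam h.2.2.1 h'.2.2.1)

/-! ### Order of the fronts -/

/-- For sorted fronts the indices left of a point form an initial segment, so counting them is the
same as finding the threshold index. -/
theorem filter_range_eq_range_card {n : ℕ} {p : ℕ → Prop} [DecidablePred p]
    (h : ∀ i j, i ≤ j → j < n → p j → p i) :
    (Finset.range n).filter p = Finset.range ((Finset.range n).filter p).card := by
  induction n with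
  | zero => simp
  | succ n ih =>
    by_cases hn : p n
    · have : (Finset.range (n + 1)).filter p = Finset.range (n + 1) :=
        Finset.filter_true_of_mem fun i hi =>
          h i n (Nat.lt_succ_iff.1 (Finset.mem_range.1 hi)) n.lt_succ_self hn
      rw [this, Finset.card_range]
    · rw [Finset.range_add_one, Finset.filter_insert, if_neg hn]
      exact ih fun i j hij hj => h i j hij (hj.trans n.lt_succ_self)

namespace Pattern

variable {P P' : Pattern} {a b t x : ℝ} {i j : ℕ}

theorem IsAdmissibleOn.mono {J J' : Set ℝ} (h : P.IsAdmissibleOn a J) (hJ : J' ⊆ J) :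
    P.IsAdmissibleOn a J' :=
  ⟨h.1, fun t ht => h.2.1 t (interior_mono hJ ht), fun i hi =>
    ⟨(h.2.2 i hi).1.mono hJ, (h.2.2 i hi).2.imp (fun h' => h'.mono hJ)
      (fun h' => ⟨h'.1.mono hJ, h'.2⟩)⟩⟩

theorem IsAdmissibleOn.isWave {J : Set ℝ} (h : P.IsAdmissibleOn a J) (hi : i < P.n) :
    IsWave (P.state i) (P.state (i + 1)) J (P.pos i) (P.speed i) (P.str i) := by
  refine ⟨(h.2.2 i hi).1, ?_⟩
  rcases (h.2.2 i hi).2 with h' | h'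
  · exact h'.cases.imp_right .inl
  · exact .inr (.inr h'.1)

/-- The fronts are ordered at time `t`. -/
def Sorted (P : Pattern) (t : ℝ) : Prop := ∀ i j, i ≤ j → j < P.n → P.pos i t ≤ P.pos j t

theorem IsAdmissibleOn.pos_lt {J : Set ℝ} (h : P.IsAdmissibleOn a J) (ht : t ∈ interior J)
    (hij : i < j) (hj : j < P.n) : P.pos i t < P.pos j t := by
  induction j, hij using Nat.le_induction with
  | base => exact h.2.1 t ht i hj
  | succ k hk ih => exact (ih (Nat.lt_of_succ_lt hj)).trans (h.2.1 t ht k hj)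

theorem IsAdmissibleOn.sorted (h : P.IsAdmissibleOn a (Set.Icc a b)) (hab : a < b)
    (ht : t ∈ Set.Icc a b) : P.Sorted t := by
  intro i j hij hj
  rcases hij.eq_or_lt with rfl | hij
  · rfl
  have hcl : t ∈ closure (Set.Ioo a b) := by rwa [closure_Ioo hab.ne]
  have := mem_closure_iff_nhdsWithin_neBot.1 hcl
  have c1 := ((h.2.2 i (hij.trans hj)).1.1 t ht).mono_left
    (nhdsWithin_mono t Set.Ioo_subset_Icc_self)
  have c2 := ((h.2.2 j hj).1.1 t ht).mono_left (nhdsWithin_mono t Set.Ioo_subset_Icc_self)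
  refine le_of_tendsto_of_tendsto c1 c2 ?_
  filter_upwards [self_mem_nhdsWithin] with s hs
  exact (h.pos_lt (by rwa [interior_Icc]) hij hj).le

open Classical in
/-- The number of fronts to the left of `x`. -/
noncomputable def lo (P : Pattern) (t x : ℝ) : ℕ :=
  ((Finset.range P.n).filter (fun i => P.pos i t < x)).card

open Classical in
/-- The number of fronts at `x` or to the left of `x`. -/
noncomputable def hi (P : Pattern) (t x : ℝ) : ℕ :=
  ((Finset.range P.n).filter (fun i => P.pos i t ≤ x)).card

theorem base_eq (P : Pattern) (x t : ℝ) : P.base x t = P.state (P.lo t x) := rfl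

theorem lo_le (P : Pattern) (t x : ℝ) : P.lo t x ≤ P.n :=
  (Finset.card_filter_le _ _).trans (Finset.card_range _).le

theorem hi_le (P : Pattern) (t x : ℝ) : P.hi t x ≤ P.n :=
  (Finset.card_filter_le _ _).trans (Finset.card_range _).le

theorem lo_le_hi (P : Pattern) (t x : ℝ) : P.lo t x ≤ P.hi t x := by
  classical
  refine Finset.card_le_card (fun i hi => ?_)
  simp only [Finset.mem_filter] at hi ⊢
  exact ⟨hi.1, hi.2.le⟩

theorem Sorted.lt_iff (h : P.Sorted t) : (i < P.n ∧ P.pos i t < x) ↔ i < P.lo t x := by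
  classical
  have := filter_range_eq_range_card (n := P.n) (p := fun i => P.pos i t < x)
    (fun i j hij hj hx => (h i j hij hj).trans_lt hx)
  have := Finset.ext_iff.1 this i
  rwa [Finset.mem_filter, Finset.mem_range, Finset.mem_range] at this

theorem Sorted.le_iff (h : P.Sorted t) : (i < P.n ∧ P.pos i t ≤ x) ↔ i < P.hi t x := by
  classical
  have := filter_range_eq_range_card (n := P.n) (p := fun i => P.pos i t ≤ x)
    (fun i j hij hj hx => (h i j hij hj).trans hx)
  have := Finset.ext_iff.1 this i
  rwa [Finset.mem_filter, Finset.mem_range, Finset.mem_range] at this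

theorem Sorted.eq_iff (h : P.Sorted t) :
    (i < P.n ∧ P.pos i t = x) ↔ P.lo t x ≤ i ∧ i < P.hi t x := by
  rw [← h.le_iff, ← not_lt, ← h.lt_iff]
  constructor
  · rintro ⟨h1, rfl⟩; exact ⟨fun h => lt_irrefl _ h.2, h1, le_rfl⟩
  · rintro ⟨h1, h2, h3⟩
    exact ⟨h2, le_antisymm h3 (not_lt.1 fun h => h1 ⟨h2, h⟩)⟩

open Classical in
theorem Sorted.filter_eq (h : P.Sorted t) :
    (Finset.range P.n).filter (fun i => P.pos i t = x) = Finset.Ico (P.lo t x) (P.hi t x) := by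
  ext i
  rw [Finset.mem_filter, Finset.mem_range, h.eq_iff, Finset.mem_Ico]

theorem eventually_lo_left (P : Pattern) (t x : ℝ) : ∀ᶠ y in 𝓝[<] x, P.lo t y = P.lo t x := by
  classical
  have : ∀ᶠ y in 𝓝[<] x, ∀ i ∈ Finset.range P.n, P.pos i t < y ↔ P.pos i t < x := by
    rw [Filter.eventually_all_finset]
    intro i _
    by_cases hi : P.pos i t < x
    · filter_upwards [nhdsWithin_le_nhds (lt_mem_nhds hi)] with y hy
      exact ⟨fun _ => hi, fun _ => hy⟩
    · filter_upwards [self_mem_nhdsWithin] with y hy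
      exact ⟨fun h => h.trans hy, fun h => absurd h hi⟩
  filter_upwards [this] with y hy
  exact congrArg Finset.card (Finset.filter_congr hy)

theorem eventually_lo_right (P : Pattern) (t x : ℝ) : ∀ᶠ y in 𝓝[>] x, P.lo t y = P.hi t x := by
  classical
  have : ∀ᶠ y in 𝓝[>] x, ∀ i ∈ Finset.range P.n, P.pos i t < y ↔ P.pos i t ≤ x := by
    rw [Filter.eventually_all_finset]
    intro i _
    by_cases hi : P.pos i t ≤ x
    · filter_upwards [self_mem_nhdsWithin] with y hy
      exact ⟨fun _ => hi, fun _ => hi.trans_lt hy⟩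
    · filter_upwards [nhdsWithin_le_nhds (gt_mem_nhds (not_le.1 hi))] with y hy
      exact ⟨fun h => absurd (h.trans hy) (lt_irrefl _), fun h => absurd h hi⟩
  filter_upwards [this] with y hy
  exact congrArg Finset.card (Finset.filter_congr hy)

/-- Equality off a finite set still determines one-sided limits in `x`, and next to a point the step
function is constant on each side. -/
theorem StartsFrom.state_lo {U : ℝ → State} {m q m' q' : ℝ → ℝ} (h : P.StartsFrom a U m q)
    (h' : P'.StartsFrom a U m' q') (x : ℝ) : P.state (P.lo a x) = P'.state (P'.lo a x) := by
  have hc : 𝓝[<] x ≤ cofinite :=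
    (nhdsWithin_mono x (t := {x}ᶜ) (fun y (hy : y < x) => hy.ne)).trans (nhdsNE_le_cofinite x)
  obtain ⟨y, h1, h2, h3, h4⟩ := ((P.eventually_lo_left a x).and
    ((P'.eventually_lo_left a x).and ((h.1.filter_mono hc).and (h'.1.filter_mono hc)))).exists
  rw [← h1, ← h2, ← base_eq, ← base_eq]
  exact h3.trans h4.symm

theorem StartsFrom.state_hi {U : ℝ → State} {m q m' q' : ℝ → ℝ} (h : P.StartsFrom a U m q)
    (h' : P'.StartsFrom a U m' q') (x : ℝ) : P.state (P.hi a x) = P'.state (P'.hi a x) := by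
  have hc : 𝓝[>] x ≤ cofinite :=
    (nhdsWithin_mono x (t := {x}ᶜ) (fun y (hy : x < y) => hy.ne')).trans (nhdsNE_le_cofinite x)
  obtain ⟨y, h1, h2, h3, h4⟩ := ((P.eventually_lo_right a x).and
    ((P'.eventually_lo_right a x).and ((h.1.filter_mono hc).and (h'.1.filter_mono hc)))).exists
  rw [← h1, ← h2, ← base_eq, ← base_eq]
  exact h3.trans h4.symm

/-! ### The fan of waves that start at one point -/

/-- If the left wave were not a 1-contact, it would be at least as fast as λ₂ of the common middle
state, which the right wave cannot exceed; then they could not separate. The other half uses λ₁ in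
the same way. -/
theorem IsAdmissibleOn.adjacent (h : P.IsAdmissibleOn a (Set.Icc a b)) (hab : a < b)
    (hi : i + 1 < P.n) (he : P.pos i a = P.pos (i + 1) a) :
    IsContact1 (P.state i) (P.state (i + 1)) (Set.Icc a b) (P.speed i) (P.str i) ∧
      IsContact2 (P.state (i + 1)) (P.state (i + 2)) (Set.Icc a b) (P.speed (i + 1))
        (P.str (i + 1)) := by
  obtain ⟨t, ht⟩ := Set.nonempty_Ioo.2 hab
  have htc : t ∈ Set.Icc a b := ⟨ht.1.le, ht.2.le⟩
  have hlt := h.2.1 t (by rwa [interior_Icc]) i hi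
  have w1 := h.isWave (Nat.lt_of_succ_lt hi)
  have w2 := h.isWave hi
  have hrho := h.1 (i + 1) hi.le
  constructor
  · refine (w1.contact1_or_le htc).resolve_right fun h1 => ?_
    have := w2.le_lam2_left hrho htc
    linarith
  · refine (w2.contact2_or_le htc).resolve_right fun h1 => ?_
    have := w1.lam1_right_le hrho htc
    linarith

/-- The possible fans at `x`. -/
theorem IsAdmissibleOn.fan (h : P.IsAdmissibleOn a (Set.Icc a b)) (hab : a < b) (x : ℝ) :
    P.hi a x = P.lo a x ∨ (P.hi a x = P.lo a x + 1) ∨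
    (P.hi a x = P.lo a x + 2 ∧
      IsContact1 (P.state (P.lo a x)) (P.state (P.lo a x + 1)) (Set.Icc a b) (P.speed (P.lo a x))
        (P.str (P.lo a x)) ∧
      IsContact2 (P.state (P.lo a x + 1)) (P.state (P.lo a x + 2)) (Set.Icc a b)
        (P.speed (P.lo a x + 1)) (P.str (P.lo a x + 1))) := by
  have hs := h.sorted hab ⟨le_rfl, hab.le⟩
  have hle := P.lo_le_hi a x
  rcases hle.eq_or_lt with he | hlt
  · exact .inl he.symm
  have mem : ∀ {i}, P.lo a x ≤ i → i < P.hi a x → i < P.n ∧ P.pos i a = x :=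
    fun h1 h2 => hs.eq_iff.2 ⟨h1, h2⟩
  rcases (Nat.succ_le_of_lt hlt).eq_or_lt with he | hlt2
  · exact .inr (.inl he.symm)
  have m0 := mem le_rfl hlt
  have m1 := mem (Nat.le_succ _) hlt2
  have adj := h.adjacent hab m1.1 (m0.2.trans m1.2.symm)
  refine .inr (.inr ⟨?_, adj⟩)
  rcases (Nat.succ_le_of_lt hlt2).eq_or_lt with he | hlt3
  · exact he.symm
  have m2 := mem ((Nat.le_succ _).trans (Nat.le_succ _)) hlt3
  -- With a third wave the middle one would be a contact of both families, hence join a state to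
  -- itself.
  exact absurd adj.2 (h.adjacent hab m2.1 (m1.2.trans m2.2.symm)).1.not_contact2

theorem StartsFrom.massAt_single {U : ℝ → State} {m q : ℝ → ℝ} (h : P.StartsFrom a U m q)
    (hs : P.Sorted a) (he : P.hi a x = P.lo a x + 1) :
    P.str (P.lo a x) a = m x ∧ P.str (P.lo a x) a * P.speed (P.lo a x) a = q x := by
  rw [← h.2.1 x, ← h.2.2 x, massAt, momAt, hs.filter_eq, he]
  simp

/-- Two patterns have the same states and the same fronts on `J`. -/
structure Agree (P P' : Pattern) (J : Set ℝ) : Prop where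
  n_eq : P.n = P'.n
  state_eq : ∀ i ≤ P.n, P.state i = P'.state i
  front_eq : ∀ i < P.n, ∀ t ∈ J,
    P.pos i t = P'.pos i t ∧ P.speed i t = P'.speed i t ∧ P.str i t = P'.str i t

/-- The end states fix the type: two kinds of contact at once would force `L = R`, and a contact
together with the overcompressive condition contradicts λ₁ < λ₂. Among shadow waves the initial mass
and momentum decide. -/
theorem wave_unique {L R : State} {pos speed str pos' speed' str' : ℝ → ℝ} (hab : a < b)
    (hL : 0 < L.rho) (hR : 0 < R.rho)
    (h : IsWave L R (Set.Icc a b) pos speed str) (h' : IsWave L R (Set.Icc a b) pos' speed' str')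
    (hp : pos a = pos' a) (hm : str a = str' a) (hq : str a * speed a = str' a * speed' a)
    (ht : t ∈ Set.Icc a b) : pos t = pos' t ∧ speed t = speed' t ∧ str t = str' t := by
  have lL := State.lam1_lt_lam2 hL
  have lR := State.lam1_lt_lam2 hR
  have hsh : ∀ {speed str}, IsShadow L R (Set.Icc a b) speed str → R.lam2 ≤ L.lam1 := by
    intro speed str hsh
    obtain ⟨t, ht⟩ := Set.nonempty_Ioo.2 hab
    have := hsh.2 t (by rwa [interior_Icc])
    exact this.2.1.trans this.2.2.1
  have hcc : ∀ {c : ℝ}, (∀ t ∈ Set.Icc a b, speed t = c) → (∀ t ∈ Set.Icc a b, speed' t = c) →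
      (∀ t ∈ Set.Icc a b, str t = 0) → (∀ t ∈ Set.Icc a b, str' t = 0) →
      pos t = pos' t ∧ speed t = speed' t ∧ str t = str' t := by
    intro c h1 h2 h3 h4
    exact ⟨by rw [h.1.pos_eq h1 ht, h'.1.pos_eq h2 ht, hp], by rw [h1 t ht, h2 t ht],
      by rw [h3 t ht, h4 t ht]⟩
  rcases h.2 with k | k | k <;> rcases h'.2 with k' | k' | k'
  · exact hcc k.2.2.2 k'.2.2.2 k.2.1 k'.2.1
  · exact absurd (State.ext_lam k.2.2.1 k'.2.2.1) k.1
  · have := hsh k'; have := k.2.2.1; linarith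
  · exact absurd (State.ext_lam k'.2.2.1 k.2.2.1) k.1
  · exact hcc k.2.2.2 k'.2.2.2 k.2.1 k'.2.1
  · have := hsh k'; have := k.2.2.1; linarith
  · have := hsh k; have := k'.2.2.1; linarith
  · have := hsh k; have := k'.2.2.1; linarith
  · exact (k.rankineHugoniot h.1).unique (k'.rankineHugoniot h'.1) hab
      (fun t ht => (k.2 t (by rwa [interior_Icc])).1)
      (fun t ht => (k'.2 t (by rwa [interior_Icc])).1) hp hm hq ht

/-- These alternatives, a condition on the end states alone, exclude a single wave where the states
coincide or where a genuine pair of contacts is present. -/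
theorem wave_lam {L R : State} {pos speed str : ℝ → ℝ} (hab : a < b)
    (h : IsWave L R (Set.Icc a b) pos speed str) :
    (L.lam1 = R.lam1 ∧ L.lam2 ≠ R.lam2) ∨ (L.lam2 = R.lam2 ∧ L.lam1 ≠ R.lam1) ∨
      R.lam2 ≤ L.lam1 := by
  rcases h.2 with k | k | k
  · exact .inl ⟨k.2.2.1, fun e => k.1 (State.ext_lam k.2.2.1 e)⟩
  · exact .inr (.inl ⟨k.2.2.1, fun e => k.1 (State.ext_lam e k.2.2.1)⟩)
  · obtain ⟨t, ht⟩ := Set.nonempty_Ioo.2 hab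
    have := k.2 t (by rwa [interior_Icc])
    exact .inr (.inr (this.2.1.trans this.2.2.1))

/-- The end states of the fan at `x` are the one-sided states of the common initial function. Of the
nine combinations of wave numbers only the diagonal ones survive; for two waves the middle state is
forced to have λ₁ of the left and λ₂ of the right end state. -/
theorem IsAdmissibleOn.fan_unique {U : ℝ → State} {m q : ℝ → ℝ}
    (h : P.IsAdmissibleOn a (Set.Icc a b)) (h' : P'.IsAdmissibleOn a (Set.Icc a b)) (hab : a < b)
    (hS : P.StartsFrom a U m q) (hS' : P'.StartsFrom a U m q) (x : ℝ) :
    ∃ k, P.hi a x = P.lo a x + k ∧ P'.hi a x = P'.lo a x + k ∧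
      (∀ j ≤ k, P.state (P.lo a x + j) = P'.state (P'.lo a x + j)) ∧
      ∀ j < k, ∀ t ∈ Set.Icc a b, P.pos (P.lo a x + j) t = P'.pos (P'.lo a x + j) t ∧
        P.speed (P.lo a x + j) t = P'.speed (P'.lo a x + j) t ∧
        P.str (P.lo a x + j) t = P'.str (P'.lo a x + j) t := by
  have hs := h.sorted hab ⟨le_rfl, hab.le⟩
  have hs' := h'.sorted hab ⟨le_rfl, hab.le⟩
  have eA := hS.state_lo hS' x
  have eB := hS.state_hi hS' x
  have pA := State.lam1_lt_lam2 (h.1 _ (P.lo_le a x))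
  have pB := State.lam1_lt_lam2 (h.1 _ (P.hi_le a x))
  have single : P.hi a x = P.lo a x + 1 →
      IsWave (P.state (P.lo a x)) (P.state (P.hi a x)) (Set.Icc a b) (P.pos (P.lo a x))
        (P.speed (P.lo a x)) (P.str (P.lo a x)) ∧ P.pos (P.lo a x) a = x := by
    intro e
    have hm := hs.eq_iff.2 ⟨le_rfl, (Nat.lt_succ_self _).trans_eq e.symm⟩
    rw [e]; exact ⟨h.isWave hm.1, hm.2⟩
  have single' : P'.hi a x = P'.lo a x + 1 →
      IsWave (P'.state (P'.lo a x)) (P'.state (P'.hi a x)) (Set.Icc a b) (P'.pos (P'.lo a x))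
        (P'.speed (P'.lo a x)) (P'.str (P'.lo a x)) ∧ P'.pos (P'.lo a x) a = x := by
    intro e
    have hm := hs'.eq_iff.2 ⟨le_rfl, (Nat.lt_succ_self _).trans_eq e.symm⟩
    rw [e]; exact ⟨h'.isWave hm.1, hm.2⟩
  rcases h.fan hab x with e | e | ⟨e, c1, c2⟩ <;>
    rcases h'.fan hab x with e' | e' | ⟨e', c1', c2'⟩
  · refine ⟨0, e, e', fun j hj => ?_, fun j hj => absurd hj j.not_lt_zero⟩
    rw [Nat.le_zero.1 hj]; exact eA
  · have := wave_lam hab (single' e').1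
    rw [← eA, ← eB, e] at this
    rcases this with h1 | h1 | h1
    · exact absurd rfl h1.2
    · exact absurd rfl h1.2
    · linarith
  · rw [e', e, eA] at eB
    exact absurd (State.ext_lam c1'.2.2.1 ((congrArg State.lam2 eB).trans c2'.2.2.1.symm)) c1'.1
  · have := wave_lam hab (single e).1
    rw [eA, eB, e'] at this
    rw [eA] at pA
    rcases this with h1 | h1 | h1
    · exact absurd rfl h1.2
    · exact absurd rfl h1.2
    · linarith
  · obtain ⟨w, wx⟩ := single e
    obtain ⟨w', wx'⟩ := single' e'
    have hm := hS.massAt_single hs e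
    have hm' := hS'.massAt_single hs' e'
    refine ⟨1, e, e', fun j hj => ?_, fun j hj t ht => ?_⟩
    · interval_cases j
      · exact eA
      · rwa [← e, ← e']
    · rw [Nat.lt_one_iff.1 hj]
      rw [← eA, ← eB] at w'
      exact wave_unique hab (h.1 _ (P.lo_le a x)) (h.1 _ (P.hi_le a x)) w w'
        (wx.trans wx'.symm) (hm.1.trans hm'.1.symm) (hm.2.trans hm'.2.symm) ht
  · have hr : 0 < (P'.state (P'.lo a x + 1)).rho :=
      h'.1 _ ((by omega : P'.lo a x + 1 ≤ P'.hi a x).trans (P'.hi_le a x))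
    have pM := State.lam1_lt_lam2 hr
    have := wave_lam hab (single e).1
    rw [eA, eB, e'] at this
    rcases this with h1 | h1 | h1
    · exact absurd (State.ext_lam (c1'.2.2.1.symm.trans h1.1) c2'.2.2.1) c2'.1
    · exact absurd (State.ext_lam c1'.2.2.1 (h1.1.trans c2'.2.2.1.symm)) c1'.1
    · have := c1'.2.2.1; have := c2'.2.2.1; linarith
  · rw [e', e, ← eA] at eB
    exact absurd (State.ext_lam c1.2.2.1 ((congrArg State.lam2 eB.symm).trans c2.2.2.1.symm)) c1.1
  · have hr : 0 < (P.state (P.lo a x + 1)).rho :=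
      h.1 _ ((by omega : P.lo a x + 1 ≤ P.hi a x).trans (P.hi_le a x))
    have pM := State.lam1_lt_lam2 hr
    have := wave_lam hab (single' e').1
    rw [← eA, ← eB, e] at this
    rcases this with h1 | h1 | h1
    · exact absurd (State.ext_lam (c1.2.2.1.symm.trans h1.1) c2.2.2.1) c2.1
    · exact absurd (State.ext_lam c1.2.2.1 (h1.1.trans c2.2.2.1.symm)) c1.1
    · have := c1.2.2.1; have := c2.2.2.1; linarith
  · rw [e, e'] at eB
    have eM : P.state (P.lo a x + 1) = P'.state (P'.lo a x + 1) := State.ext_lam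
      (by rw [← c1.2.2.1, ← c1'.2.2.1, eA]) (by rw [c2.2.2.1, c2'.2.2.1, eB])
    have hmem : ∀ j < 2, P.lo a x + j < P.n ∧ P.pos (P.lo a x + j) a = x :=
      fun j hj => hs.eq_iff.2 ⟨Nat.le_add_right _ _, by omega⟩
    have hmem' : ∀ j < 2, P'.lo a x + j < P'.n ∧ P'.pos (P'.lo a x + j) a = x :=
      fun j hj => hs'.eq_iff.2 ⟨Nat.le_add_right _ _, by omega⟩
    have hst : ∀ j ≤ 2, P.state (P.lo a x + j) = P'.state (P'.lo a x + j) := by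
      intro j hj
      interval_cases j
      · exact eA
      · exact eM
      · exact eB
    refine ⟨2, e, e', hst, fun j hj t ht => ?_⟩
    have w := h.isWave (hmem j hj).1
    have w' := h'.isWave (hmem' j hj).1
    rw [← hst j hj.le, add_assoc, ← hst (j + 1) hj, ← add_assoc] at w'
    have z : P.str (P.lo a x + j) a = 0 := by
      interval_cases j
      · exact c1.2.1 a ⟨le_rfl, hab.le⟩
      · exact c2.2.1 a ⟨le_rfl, hab.le⟩
    have z' : P'.str (P'.lo a x + j) a = 0 := by
      interval_cases j
      · exact c1'.2.1 a ⟨le_rfl, hab.le⟩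
      · exact c2'.2.1 a ⟨le_rfl, hab.le⟩
    exact wave_unique hab (h.1 _ (hmem j hj).1.le) (h.1 _ (hmem j hj).1) w w'
      ((hmem j hj).2.trans (hmem' j hj).2.symm) (z.trans z'.symm) (by rw [z, z', zero_mul, zero_mul])
      ht

/-- The difference of `hi` and `lo` at `x` is the multiplicity of `x` in the multiset of front
positions. Equal multiplicities give equal multisets, hence equal counts to the left of every point.
-/
theorem lo_eq_of_fans
    (hk : ∀ x, ∃ k, P.hi a x = P.lo a x + k ∧ P'.hi a x = P'.lo a x + k) :
    P.n = P'.n ∧ ∀ x, P.lo a x = P'.lo a x := by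
  classical
  have hcount : ∀ (P : Pattern) (x : ℝ), P.hi a x = P.lo a x +
      ((Finset.range P.n).val.map (fun i => P.pos i a)).count x := by
    intro P x
    rw [Multiset.count_map, hi, lo, ← Finset.filter_val, Finset.card_val,
      ← Finset.card_union_of_disjoint]
    · congr 1
      ext i
      simp only [Finset.mem_filter, Finset.mem_union, le_iff_lt_or_eq, eq_comm (a := x)]
      tauto
    · rw [Finset.disjoint_filter]
      intro i _ h1 h2
      exact h1.ne h2.symm
  have hM : (Finset.range P.n).val.map (fun i => P.pos i a)
      = (Finset.range P'.n).val.map (fun i => P'.pos i a) := by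
    refine Multiset.ext.2 fun x => ?_
    obtain ⟨k, h1, h2⟩ := hk x
    have := hcount P x
    have := hcount P' x
    omega
  refine ⟨by simpa using congrArg Multiset.card hM, fun x => ?_⟩
  have := congrArg (Multiset.countP (· < x)) hM
  rwa [Multiset.countP_map, Multiset.countP_map, ← Finset.filter_val, ← Finset.filter_val] at this

/-- Uniqueness of the continuation by admissible waves. -/
theorem IsAdmissibleOn.agree {U : ℝ → State} {m q : ℝ → ℝ}
    (h : P.IsAdmissibleOn a (Set.Icc a b)) (h' : P'.IsAdmissibleOn a (Set.Icc a b)) (hab : a < b)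
    (hS : P.StartsFrom a U m q) (hS' : P'.StartsFrom a U m q) : P.Agree P' (Set.Icc a b) := by
  have hs := h.sorted hab ⟨le_rfl, hab.le⟩
  have fan := h.fan_unique h' hab hS hS'
  obtain ⟨hn, hlo⟩ := lo_eq_of_fans (fun x => by
    obtain ⟨k, h1, h2, -⟩ := fan x
    exact ⟨k, h1, h2⟩)
  have main : ∀ i < P.n, (P.state i = P'.state i ∧ P.state (i + 1) = P'.state (i + 1)) ∧
      ∀ t ∈ Set.Icc a b,
        P.pos i t = P'.pos i t ∧ P.speed i t = P'.speed i t ∧ P.str i t = P'.str i t := by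
    intro i hi
    have hi' := hs.eq_iff.1 ⟨hi, rfl⟩
    obtain ⟨k, h1, -, h3, h4⟩ := fan (P.pos i a)
    rw [← hlo] at h3 h4
    have e : i = P.lo a (P.pos i a) + (i - P.lo a (P.pos i a)) := by omega
    have l : i - P.lo a (P.pos i a) < k := by omega
    have s1 := h3 _ l.le
    have s2 := h3 _ (Nat.succ_le_of_lt l)
    have s3 := h4 _ l
    rw [Nat.succ_eq_add_one, ← add_assoc] at s2
    rw [← e] at s1 s2 s3
    exact ⟨⟨s1, s2⟩, s3⟩
  refine ⟨hn, fun i hi => ?_, fun i hi => (main i hi).2⟩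
  rcases hi.lt_or_eq with hi | hi
  · exact (main i hi).1.1
  · cases i with
    | zero =>
      have e := hS.state_lo hS' 0
      have l1 := P.lo_le a 0
      have l2 := P'.lo_le a 0
      have z1 : P.lo a 0 = 0 := by omega
      have z2 : P'.lo a 0 = 0 := by omega
      rwa [z1, z2] at e
    | succ j => exact (main j (by omega)).1.2

namespace Agree

variable {J : Set ℝ}

theorem symm (h : P.Agree P' J) : P'.Agree P J :=
  ⟨h.n_eq.symm, fun i hi => (h.state_eq i (hi.trans_eq h.n_eq.symm)).symm, fun i hi t ht => by
    obtain ⟨h1, h2, h3⟩ := h.front_eq i (hi.trans_eq h.n_eq.symm) t ht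
    exact ⟨h1.symm, h2.symm, h3.symm⟩⟩

theorem base (h : P.Agree P' J) (ht : t ∈ J) (x : ℝ) : P.base x t = P'.base x t := by
  have : P.lo t x = P'.lo t x := by
    rw [lo, lo, ← h.n_eq]
    exact congrArg Finset.card (Finset.filter_congr fun i hi => by
      rw [(h.front_eq i (Finset.mem_range.1 hi) t ht).1])
  rw [base_eq, base_eq, ← this]
  exact h.state_eq _ (P.lo_le t x)

theorem massAt (h : P.Agree P' J) (ht : t ∈ J) (x : ℝ) : P.massAt x t = P'.massAt x t := by
  rw [Pattern.massAt, Pattern.massAt, ← h.n_eq]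
  refine Finset.sum_congr (Finset.filter_congr fun i hi => ?_) fun i hi => ?_
  · rw [(h.front_eq i (Finset.mem_range.1 hi) t ht).1]
  · exact (h.front_eq i (Finset.mem_range.1 (Finset.mem_filter.1 hi).1) t ht).2.2

theorem momAt (h : P.Agree P' J) (ht : t ∈ J) (x : ℝ) : P.momAt x t = P'.momAt x t := by
  rw [Pattern.momAt, Pattern.momAt, ← h.n_eq]
  refine Finset.sum_congr (Finset.filter_congr fun i hi => ?_) fun i hi => ?_
  · rw [(h.front_eq i (Finset.mem_range.1 hi) t ht).1]
  · obtain ⟨-, h2, h3⟩ := h.front_eq i (Finset.mem_range.1 (Finset.mem_filter.1 hi).1) t ht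
    rw [h2, h3]

end Agree

end Pattern

/-! ### Uniqueness of wave tracking -/

namespace WaveTracking

variable {W W' : WaveTracking} {U₀ : ℝ → State}

theorem Icc_subset_times {k : ℕ} (hk : k < W.K) : Set.Icc (W.T k) (W.T (k + 1)) ⊆ W.times k := by
  rw [times, if_pos hk]

theorem times_of_lt {k : ℕ} (hk : k < W.K) : W.times k = Set.Icc (W.T k) (W.T (k + 1)) :=
  if_pos hk

theorem times_last : W.times W.K = Set.Ici (W.T W.K) := if_neg (lt_irrefl _)

/-- The solutions have the same fronts in the slab `k`, with the same left end. -/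
def AgreeAt (W W' : WaveTracking) (k : ℕ) : Prop :=
  W.T k = W'.T k ∧ (W.slab k).Agree (W'.slab k) (W.times k ∩ W'.times k)

/-- If the other solution continued past this collision time, the colliding fronts, which it shares,
would have to be strictly ordered there. -/
theorem IsSolution.end_le (h : W.IsSolution U₀) (h' : W'.IsSolution U₀) {k : ℕ}
    (hk : k < W.K) (hk' : k ≤ W'.K) (hag : W.AgreeAt W' k) :
    k < W'.K ∧ W'.T (k + 1) ≤ W.T (k + 1) := by
  by_contra hcon
  obtain ⟨⟨i, hi, he⟩, -⟩ := h.2.2.2.2 k hk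
  have hmem : W.T (k + 1) ∈ W.times k := by
    rw [times_of_lt hk]; exact ⟨(h.2.1 k hk).le, le_rfl⟩
  have hint : W.T (k + 1) ∈ interior (W'.times k) := by
    have hlt : W'.T k < W.T (k + 1) := hag.1 ▸ h.2.1 k hk
    rw [times]
    split_ifs with hlt'
    · rw [interior_Icc]
      exact ⟨hlt, not_le.1 fun hle => hcon ⟨hlt', hle⟩⟩
    · rwa [interior_Ici]
  have hlt := (h'.2.2.1 k hk').2.1 _ hint i (by rw [← hag.2.n_eq]; exact hi)
  have hm : W.T (k + 1) ∈ W.times k ∩ W'.times k := ⟨hmem, interior_subset hint⟩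
  rw [← (hag.2.front_eq i (Nat.lt_of_succ_lt hi) _ hm).1,
    ← (hag.2.front_eq (i + 1) hi _ hm).1] at hlt
  exact absurd he hlt.ne

theorem AgreeAt.symm {k : ℕ} (h : W.AgreeAt W' k) : W'.AgreeAt W k :=
  ⟨h.1.symm, by rw [Set.inter_comm]; exact h.2.symm⟩

/-- It is not yet known that the slabs end at the same time, so agreement is shown on every compact
interval contained in both. -/
theorem agree_of_starts {k : ℕ} (hT : W.T k = W'.T k)
    (ha : (W.slab k).IsAdmissibleOn (W.T k) (W.times k))
    (ha' : (W'.slab k).IsAdmissibleOn (W'.T k) (W'.times k))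
    {b₀ : ℝ} (hb₀ : W.T k < b₀) (hsub : Set.Icc (W.T k) b₀ ⊆ W.times k ∩ W'.times k)
    {U : ℝ → State} {m q : ℝ → ℝ} (hS : (W.slab k).StartsFrom (W.T k) U m q)
    (hS' : (W'.slab k).StartsFrom (W.T k) U m q) : W.AgreeAt W' k := by
  refine ⟨hT, ?_⟩
  have key : ∀ b, W.T k < b → Set.Icc (W.T k) b ⊆ W.times k ∩ W'.times k →
      (W.slab k).Agree (W'.slab k) (Set.Icc (W.T k) b) := fun b hb hs =>
    (ha.mono (hs.trans Set.inter_subset_left)).agree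
      ((hT ▸ ha').mono (hs.trans Set.inter_subset_right)) hb hS hS'
  have k0 := key b₀ hb₀ hsub
  refine ⟨k0.n_eq, k0.state_eq, fun i hi t ht => ?_⟩
  have oc : Set.OrdConnected (W.times k ∩ W'.times k) := by
    simp only [times]
    split_ifs <;> infer_instance
  have hTk : W.T k ∈ W.times k ∩ W'.times k := hsub ⟨le_rfl, hb₀.le⟩
  have htk : W.T k ≤ t := by
    have := ht.1
    rw [times] at this
    split_ifs at this
    · exact this.1
    · exact this
  rcases htk.eq_or_lt with e | hlt
  · rw [← e]; exact k0.front_eq i hi _ ⟨le_rfl, hb₀.le⟩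
  · exact (key t hlt (oc.out hTk ht)).front_eq i hi t ⟨hlt.le, le_rfl⟩

theorem exists_Icc_subset_times {k : ℕ} (hK : k ≤ W.K) (hmono : ∀ k < W.K, W.T k < W.T (k + 1)) :
    ∃ b, W.T k < b ∧ Set.Icc (W.T k) b ⊆ W.times k := by
  rcases hK.lt_or_eq with h | rfl
  · exact ⟨_, hmono k h, W.Icc_subset_times h⟩
  · exact ⟨W.T W.K + 1, by linarith, by rw [times_last]; exact Set.Icc_subset_Ici_self⟩

/-- Induction on slabs: agreement on one slab forces the same end by `end_le` in both directions,
and then the continuations start from the same states, masses and momenta. -/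
theorem IsSolution.agreeAt (h : W.IsSolution U₀) (h' : W'.IsSolution U₀) (k : ℕ)
    (hk : k ≤ W.K) : k ≤ W'.K ∧ W.AgreeAt W' k := by
  have common : ∀ k, k ≤ W.K → k ≤ W'.K → W.T k = W'.T k →
      ∃ b, W.T k < b ∧ Set.Icc (W.T k) b ⊆ W.times k ∩ W'.times k := by
    intro k hk hk' e
    obtain ⟨b, hb, hs⟩ := exists_Icc_subset_times hk h.2.1
    obtain ⟨b', hb', hs'⟩ := exists_Icc_subset_times hk' h'.2.1
    refine ⟨min b b', lt_min hb (e ▸ hb'), Set.subset_inter ?_ ?_⟩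
    · exact (Set.Icc_subset_Icc_right (min_le_left _ _)).trans hs
    · rw [e]; exact (Set.Icc_subset_Icc_right (min_le_right _ _)).trans hs'
  induction k with
  | zero =>
    have e : W.T 0 = W'.T 0 := h.1.trans h'.1.symm
    obtain ⟨b, hb, hs⟩ := common 0 hk (Nat.zero_le _) e
    exact ⟨Nat.zero_le _, agree_of_starts e (h.2.2.1 0 hk) (h'.2.2.1 0 (Nat.zero_le _)) hb hs
      (by rw [h.1]; exact h.2.2.2.1) (by rw [h.1]; exact h'.2.2.2.1)⟩
  | succ k ih =>
    obtain ⟨hk', hag⟩ := ih (Nat.le_of_succ_le hk)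
    have hkW : k < W.K := hk
    obtain ⟨hkW', hle⟩ := h.end_le h' hkW hk' hag
    obtain ⟨-, hle'⟩ := h'.end_le h hkW' hkW.le hag.symm
    have e : W.T (k + 1) = W'.T (k + 1) := le_antisymm hle' hle
    refine ⟨hkW', ?_⟩
    obtain ⟨b, hb, hs⟩ := common (k + 1) hk hkW' e
    refine agree_of_starts e (h.2.2.1 _ hk) (h'.2.2.1 _ hkW') hb hs (h.2.2.2.2 k hkW).2 ?_
    have hmem : W.T (k + 1) ∈ W.times k ∩ W'.times k := by
      rw [times_of_lt hkW, times_of_lt hkW', ← e, ← hag.1]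
      exact ⟨⟨(h.2.1 k hkW).le, le_rfl⟩, (h.2.1 k hkW).le, le_rfl⟩
    have := (h'.2.2.2.2 k hkW').2
    rw [← e] at this
    convert this using 1
    · exact funext fun x => hag.2.base hmem x
    · exact funext fun x => hag.2.massAt hmem x
    · exact funext fun x => hag.2.momAt hmem x

/-- Uniqueness of admissible solutions. -/
theorem IsSolution.unique (h : W.IsSolution U₀) (h' : W'.IsSolution U₀) :
    W.K = W'.K ∧ ∀ k ≤ W.K, W.T k = W'.T k ∧ W.times k = W'.times k ∧
      (W.slab k).Agree (W'.slab k) (W.times k) := by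
  have hK : W.K = W'.K :=
    le_antisymm (h.agreeAt h' W.K le_rfl).1 (h'.agreeAt h W'.K le_rfl).1
  refine ⟨hK, fun k hk => ?_⟩
  have hag := (h.agreeAt h' k hk).2
  have ht : W.times k = W'.times k := by
    rcases hk.lt_or_eq with h1 | rfl
    · rw [times_of_lt h1, times_of_lt (hK ▸ h1), hag.1, (h.agreeAt h' (k + 1) h1).2.1]
    · conv_rhs => rw [hK]
      rw [times_last, times_last, hag.1, hK]
  refine ⟨hag.1, ht, ?_⟩
  have := hag.2
  rwa [← ht, Set.inter_self] at this

end WaveTracking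

end Chaplygin

namespace Chaplygin

/-! ### Functions of the state that grow linearly in the density -/

/-- `g = ρ α(u) + β(u)/ρ + γ(u)` with continuous coefficients. -/
def IsFlux (g : State → ℝ) (α : ℝ → ℝ) : Prop :=
  Continuous α ∧ ∃ β γ : ℝ → ℝ, Continuous β ∧ Continuous γ ∧
    ∀ U, g U = U.rho * α U.vel + β U.vel / U.rho + γ U.vel

theorem isFlux_rho : IsFlux State.rho (fun _ => 1) :=
  ⟨by fun_prop, fun _ => 0, fun _ => 0, by fun_prop, by fun_prop, fun U => by simp⟩

theorem isFlux_vel : IsFlux State.vel (fun _ => 0) :=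
  ⟨by fun_prop, fun _ => 0, fun v => v, by fun_prop, by fun_prop, fun U => by simp⟩

theorem isFlux_mom : IsFlux State.mom (fun v => v) :=
  ⟨by fun_prop, fun _ => 0, fun _ => 0, by fun_prop, by fun_prop, fun U => by simp [State.mom]⟩

theorem isFlux_momFlux : IsFlux State.momFlux (fun v => v * v) :=
  ⟨by fun_prop, fun _ => -1, fun _ => 0, by fun_prop, by fun_prop,
    fun U => by simp only [State.momFlux]; ring⟩

theorem isFlux_energy : IsFlux State.energy (fun v => v ^ 2) :=
  ⟨by fun_prop, fun _ => 1, fun _ => 0, by fun_prop, by fun_prop,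
    fun U => by simp only [State.energy]; ring⟩

theorem isFlux_energyFlux : IsFlux State.energyFlux (fun v => v * v ^ 2) :=
  ⟨by fun_prop, fun v => -v, fun _ => 0, by fun_prop, by fun_prop,
    fun U => by simp only [State.energyFlux]; ring⟩

namespace Pattern

variable {P : Pattern} {g : State → ℝ} {α : ℝ → ℝ}

/-- The state inside the strip of the `i`-th front. -/
noncomputable def stripState (P : Pattern) (ε t : ℝ) (i : ℕ) : State :=
  ⟨P.str i t / (ε * (t - P.org i)), P.speed i t⟩

/-- The `i`-th strip is the first one that contains `(x, t)`. -/
def IsFirst (P : Pattern) (ε x t : ℝ) (i : ℕ) : Prop :=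
  P.InStrip ε x t i ∧ ∀ j < i, ¬ P.InStrip ε x t j

open Classical in
-- At most one summand is nonzero, the one of the first strip containing the point. This form is
-- linear enough to integrate and to check measurability.
theorem apply_net (P : Pattern) (g : State → ℝ) (ε x t : ℝ) :
    g (P.net ε x t) = g (P.base x t) + ∑ i ∈ Finset.range P.n,
      if P.IsFirst ε x t i then g (P.stripState ε t i) - g (P.base x t) else 0 := by
  by_cases h : ∃ i, P.InStrip ε x t i
  · have hf : P.IsFirst ε x t (Nat.find h) := ⟨Nat.find_spec h, fun j hj => Nat.find_min h hj⟩
    rw [net, dif_pos h, Finset.sum_eq_single (Nat.find h), if_pos hf]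
    · rw [stripState]; ring
    · intro i _ hi
      refine if_neg fun hi' => hi ?_
      rcases lt_trichotomy i (Nat.find h) with h1 | h1 | h1
      · exact absurd hi'.1 (hf.2 i h1)
      · exact h1
      · exact absurd hf.1 (hi'.2 _ h1)
    · intro hn
      exact absurd (Finset.mem_range.2 (Nat.find_spec h).1) hn
  · rw [net, dif_neg h, Finset.sum_eq_zero, add_zero]
    exact fun i _ => if_neg fun hi => h ⟨i, hi.1⟩

open Classical in
theorem abs_apply_net_le (P : Pattern) (g : State → ℝ) (ε x t : ℝ) :
    |g (P.net ε x t)| ≤ |g (P.base x t)| + ∑ i ∈ Finset.range P.n,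
      if P.InStrip ε x t i then |g (P.stripState ε t i)| else 0 := by
  by_cases h : ∃ i, P.InStrip ε x t i
  · have hs := Nat.find_spec h
    have h1 : (if P.InStrip ε x t (Nat.find h) then |g (P.stripState ε t (Nat.find h))| else 0) ≤
        ∑ i ∈ Finset.range P.n, if P.InStrip ε x t i then |g (P.stripState ε t i)| else 0 :=
      Finset.single_le_sum (f := fun i =>
          if P.InStrip ε x t i then |g (P.stripState ε t i)| else 0)
        (fun i _ => by split_ifs <;> positivity) (Finset.mem_range.2 hs.1)
    rw [if_pos hs] at h1
    rw [net, dif_pos h]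
    exact h1.trans (le_add_of_nonneg_left (abs_nonneg _))
  · rw [net, dif_neg h]
    exact le_add_of_nonneg_right (Finset.sum_nonneg fun i _ => by split_ifs <;> positivity)

/-- A bound of `g` on the states of the pattern. -/
noncomputable def maxAbs (P : Pattern) (g : State → ℝ) : ℝ :=
  ∑ i ∈ Finset.range (P.n + 1), |g (P.state i)|

theorem abs_apply_base_le (P : Pattern) (g : State → ℝ) (x t : ℝ) :
    |g (P.base x t)| ≤ P.maxAbs g := by
  rw [base_eq]
  exact Finset.single_le_sum (f := fun i => |g (P.state i)|) (fun i _ => abs_nonneg _)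
    (Finset.mem_range.2 (Nat.lt_succ_of_le (P.lo_le t x)))

theorem maxAbs_nonneg (P : Pattern) (g : State → ℝ) : 0 ≤ P.maxAbs g :=
  (abs_nonneg _).trans (P.abs_apply_base_le g 0 0)

/-- The net and the base are measurable on every set of times where the fronts are continuous. -/
theorem exists_measurable (hg : IsFlux g α) (P : Pattern) {J : Set ℝ} (hJ : MeasurableSet J)
    (hc : ∀ i < P.n, ContinuousOn (P.pos i) J ∧ ContinuousOn (P.speed i) J ∧
      ContinuousOn (P.str i) J) (ε : ℝ) :
    (∃ F : ℝ × ℝ → ℝ, Measurable F ∧ ∀ x, ∀ t ∈ J, F (x, t) = g (P.net ε x t)) ∧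
    ∃ F : ℝ × ℝ → ℝ, Measurable F ∧ ∀ x, ∀ t ∈ J, F (x, t) = g (P.base x t) := by
  classical
  -- The fronts are only known to be continuous on `J`; extended by zero they are measurable
  -- everywhere and nothing changes for times in `J`.
  let Q : Pattern := { P with
    pos := fun i => J.piecewise (P.pos i) 0
    speed := fun i => J.piecewise (P.speed i) 0
    str := fun i => J.piecewise (P.str i) 0 }
  have mpos : ∀ i < P.n, Measurable (Q.pos i) := fun i hi =>
    (hc i hi).1.measurable_piecewise continuousOn_const hJ
  have mspeed : ∀ i < P.n, Measurable (Q.speed i) := fun i hi =>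
    (hc i hi).2.1.measurable_piecewise continuousOn_const hJ
  have mstr : ∀ i < P.n, Measurable (Q.str i) := fun i hi =>
    (hc i hi).2.2.measurable_piecewise continuousOn_const hJ
  have e1 : ∀ t ∈ J, ∀ i, Q.pos i t = P.pos i t := fun t ht i => Set.piecewise_eq_of_mem _ _ _ ht
  have e2 : ∀ t ∈ J, ∀ i, Q.speed i t = P.speed i t :=
    fun t ht i => Set.piecewise_eq_of_mem _ _ _ ht
  have e3 : ∀ t ∈ J, ∀ i, Q.str i t = P.str i t := fun t ht i => Set.piecewise_eq_of_mem _ _ _ ht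
  have ebase : ∀ x, ∀ t ∈ J, Q.base x t = P.base x t := by
    intro x t ht
    simp only [base, e1 t ht]
    rfl
  have estrip : ∀ x, ∀ t ∈ J, ∀ i, Q.InStrip ε x t i ↔ P.InStrip ε x t i := by
    intro x t ht i
    simp only [InStrip, e1 t ht, e3 t ht]
    rfl
  have mbase : Measurable fun p : ℝ × ℝ => g (Q.base p.1 p.2) := by
    have h1 : Measurable fun p : ℝ × ℝ => Q.lo p.2 p.1 := by
      simp only [lo, Finset.card_filter]
      refine Finset.measurable_sum _ fun i hi => Measurable.ite ?_ measurable_const measurable_const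
      exact measurableSet_lt ((mpos i (Finset.mem_range.1 hi)).comp measurable_snd) measurable_fst
    exact (measurable_of_countable fun k => g (Q.state k)).comp h1
  refine ⟨⟨fun p => g (Q.net ε p.1 p.2), ?_, fun x t ht => ?_⟩,
    ⟨fun p => g (Q.base p.1 p.2), mbase, fun x t ht => by simp only [ebase x t ht]⟩⟩
  · simp only [apply_net]
    refine mbase.add (Finset.measurable_sum _ fun i hi => ?_)
    have hi := Finset.mem_range.1 hi
    have mS : ∀ j ≤ i, MeasurableSet {p : ℝ × ℝ | Q.InStrip ε p.1 p.2 j} := by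
      intro j hj
      have hj : j < P.n := hj.trans_lt hi
      refine MeasurableSet.inter (MeasurableSet.const _) (MeasurableSet.inter ?_ ?_)
      · exact measurableSet_lt measurable_const ((mstr j hj).comp measurable_snd)
      · refine measurableSet_lt ?_ (measurable_const.mul (measurable_snd.sub_const _))
        exact continuous_abs.measurable.comp
          (measurable_fst.sub ((mpos j hj).comp measurable_snd))
    refine Measurable.ite ?_ (Measurable.sub ?_ mbase) measurable_const
    · refine MeasurableSet.inter (mS i le_rfl) ?_
      have : {p : ℝ × ℝ | ∀ j < i, ¬ Q.InStrip ε p.1 p.2 j}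
          = ⋂ j ∈ Finset.range i, {p : ℝ × ℝ | Q.InStrip ε p.1 p.2 j}ᶜ := by
        ext p; simp
      change MeasurableSet {p : ℝ × ℝ | ∀ j < i, ¬ Q.InStrip ε p.1 p.2 j}
      rw [this]
      exact Finset.measurableSet_biInter _ fun j hj => (mS j (Finset.mem_range.1 hj).le).compl
    · obtain ⟨hα, β, γ, hβ, hγ, hgf⟩ := hg
      simp only [hgf, stripState]
      have s1 : Measurable fun p : ℝ × ℝ => Q.speed i p.2 := (mspeed i hi).comp measurable_snd
      have s2 : Measurable fun p : ℝ × ℝ => Q.str i p.2 / (ε * (p.2 - Q.org i)) :=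
        ((mstr i hi).comp measurable_snd).div (by fun_prop)
      exact ((s2.mul (hα.measurable.comp s1)).add ((hβ.measurable.comp s1).div s2)).add
        (hγ.measurable.comp s1)
  · simp only [apply_net, ebase x t ht, IsFirst, estrip x t ht, stripState, e2 t ht, e3 t ht]
    exact congrArg _ (Finset.sum_congr rfl fun i _ => by congr)

/-! ### The limit `ε → 0+` at a fixed time -/

section FixedTime

variable {t ε : ℝ} {ψ : ℝ → ℝ}

theorem measurable_net (hg : IsFlux g α) (P : Pattern) (ε t : ℝ) :
    Measurable fun x => g (P.net ε x t) := by
  obtain ⟨⟨F, hF, h⟩, -⟩ := P.exists_measurable hg (MeasurableSet.singleton t)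
    (fun i _ => ⟨continuousOn_singleton _ _, continuousOn_singleton _ _,
      continuousOn_singleton _ _⟩) ε
  have : (fun x => g (P.net ε x t)) = fun x => F (x, t) := funext fun x => (h x t rfl).symm
  rw [this]
  exact hF.comp (by fun_prop)

theorem measurable_base (hg : IsFlux g α) (P : Pattern) (t : ℝ) :
    Measurable fun x => g (P.base x t) := by
  obtain ⟨-, F, hF, h⟩ := P.exists_measurable hg (MeasurableSet.singleton t)
    (fun i _ => ⟨continuousOn_singleton _ _, continuousOn_singleton _ _,
      continuousOn_singleton _ _⟩) 0
  have : (fun x => g (P.base x t)) = fun x => F (x, t) := funext fun x => (h x t rfl).symm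
  rw [this]
  exact hF.comp (by fun_prop)

theorem integrable_base_mul (hg : IsFlux g α) (P : Pattern) (t : ℝ) (hψ : Integrable ψ) :
    Integrable fun x => g (P.base x t) * ψ x :=
  hψ.bdd_mul (P.measurable_base hg t).aestronglyMeasurable
    (ae_of_all _ fun x => P.abs_apply_base_le g x t)

theorem integrable_net_mul (hg : IsFlux g α) (P : Pattern) (ε t : ℝ) (hψ : Integrable ψ) :
    Integrable fun x => g (P.net ε x t) * ψ x := by
  classical
  refine hψ.bdd_mul (c := P.maxAbs g + ∑ i ∈ Finset.range P.n, |g (P.stripState ε t i)|)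
    (P.measurable_net hg ε t).aestronglyMeasurable (ae_of_all _ fun x => ?_)
  refine (P.abs_apply_net_le g ε x t).trans (add_le_add (P.abs_apply_base_le g x t) ?_)
  refine Finset.sum_le_sum fun i _ => ?_
  split_ifs
  · exact le_rfl
  · exact abs_nonneg _

theorem setOf_inStrip {i : ℕ} (hi : i < P.n) (hs : 0 < P.str i t) :
    {x | P.InStrip ε x t i} = Metric.ball (P.pos i t) (ε / 2 * (t - P.org i)) := by
  ext x
  simp [InStrip, hi, hs, Real.dist_eq]

theorem volume_inStrip (hε : 0 < ε) {i : ℕ} (hi : i < P.n) (hs : 0 < P.str i t)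
    (ho : P.org i < t) : volume.real {x | P.InStrip ε x t i} = ε * (t - P.org i) := by
  have : 0 < t - P.org i := sub_pos.2 ho
  rw [setOf_inStrip hi hs, Measure.real, Real.volume_ball, ENNReal.toReal_ofReal (by positivity)]
  ring

theorem measurableSet_inStrip {i : ℕ} (hi : i < P.n) (hs : 0 < P.str i t) :
    MeasurableSet {x | P.InStrip ε x t i} := by
  rw [setOf_inStrip hi hs]; exact measurableSet_ball

/-- Density times width is the strength, so the term linear in the density survives as the delta
weight, while the other two terms carry positive powers of the width. -/
theorem apply_stripState_mul {β γ : ℝ → ℝ}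
    (hgf : ∀ U : State, g U = U.rho * α U.vel + β U.vel / U.rho + γ U.vel) (hε : 0 < ε) {i : ℕ}
    (hs : 0 < P.str i t) (ho : P.org i < t) :
    g (P.stripState ε t i) * (ε * (t - P.org i)) = P.str i t * α (P.speed i t)
      + β (P.speed i t) * ((ε * (t - P.org i)) ^ 2 / P.str i t)
      + γ (P.speed i t) * (ε * (t - P.org i)) := by
  have : t - P.org i ≠ 0 := (sub_pos.2 ho).ne'
  rw [hgf, stripState]
  simp only [div_div_eq_mul_div]
  field_simp

/-- The total of `g` over the strip tends to `str * α speed`, the mean of `ψ` over the shrinking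
strip tends to its value on the front, and the removed part of the bounded step function is of the
order of the width. -/
theorem tendsto_strip (hg : IsFlux g α) {i : ℕ} (hi : i < P.n) (hψ : Integrable ψ) {C : ℝ}
    (hC : ∀ x, |ψ x| ≤ C) (hs : 0 < P.str i t) (ho : P.org i < t)
    (hcont : ContinuousAt ψ (P.pos i t)) :
    Tendsto (fun ε => ∫ x in {x | P.InStrip ε x t i},
        (g (P.stripState ε t i) - g (P.base x t)) * ψ x) (𝓝[>] 0)
      (𝓝 (P.str i t * α (P.speed i t) * ψ (P.pos i t))) := by
  obtain ⟨hα, β, γ, hβ, hγ, hgf⟩ := id hg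
  have hd : 0 < t - P.org i := sub_pos.2 ho
  have hw : Tendsto (fun ε : ℝ => ε * (t - P.org i)) (𝓝[>] 0) (𝓝 0) := by
    have : Tendsto (fun ε : ℝ => ε * (t - P.org i)) (𝓝 0) (𝓝 (0 * (t - P.org i))) :=
      Continuous.tendsto (by fun_prop) 0
    rw [zero_mul] at this
    exact this.mono_left nhdsWithin_le_nhds
  have hsmall : Tendsto (fun ε => {x | P.InStrip ε x t i}) (𝓝[>] 0) (𝓝 (P.pos i t)).smallSets := by
    rw [tendsto_smallSets_iff]
    intro s hs'
    obtain ⟨r, hr, hball⟩ := Metric.mem_nhds_iff.1 hs'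
    filter_upwards [hw.eventually (gt_mem_nhds hr), self_mem_nhdsWithin] with ε h1 h2
    rw [setOf_inStrip hi hs]
    refine (Metric.ball_subset_ball ?_).trans hball
    have : 0 < ε := h2
    nlinarith [mul_pos this hd]
  have hlo := hcont.integral_sub_linear_isLittleO_ae (μ := volume)
    (hψ.aestronglyMeasurable.stronglyMeasurableAtFilter) hsmall (fun ε => ε * (t - P.org i))
    (by filter_upwards [self_mem_nhdsWithin] with ε hε using volume_inStrip hε hi hs ho)
  have havg : Tendsto (fun ε => (∫ x in {x | P.InStrip ε x t i}, ψ x) / (ε * (t - P.org i)))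
      (𝓝[>] 0) (𝓝 (ψ (P.pos i t))) := by
    have h1 := (hlo.tendsto_div_nhds_zero).add_const (ψ (P.pos i t))
    rw [zero_add] at h1
    refine h1.congr' ?_
    filter_upwards [self_mem_nhdsWithin] with ε hε
    have : 0 < ε := hε
    rw [smul_eq_mul]
    field_simp
    ring
  have hstrip : Tendsto (fun ε => g (P.stripState ε t i) * (ε * (t - P.org i))) (𝓝[>] 0)
      (𝓝 (P.str i t * α (P.speed i t))) := by
    have h1 : Tendsto (fun ε => P.str i t * α (P.speed i t)
        + β (P.speed i t) * ((ε * (t - P.org i)) ^ 2 / P.str i t)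
        + γ (P.speed i t) * (ε * (t - P.org i))) (𝓝[>] 0)
        (𝓝 (P.str i t * α (P.speed i t) + β (P.speed i t) * (0 ^ 2 / P.str i t)
          + γ (P.speed i t) * 0)) :=
      (tendsto_const_nhds.add (((hw.pow 2).div_const _).const_mul _)).add (hw.const_mul _)
    have e : P.str i t * α (P.speed i t) + β (P.speed i t) * (0 ^ 2 / P.str i t)
          + γ (P.speed i t) * 0 = P.str i t * α (P.speed i t) := by simp
    rw [e] at h1
    refine h1.congr' ?_
    filter_upwards [self_mem_nhdsWithin] with ε hε
    exact (apply_stripState_mul hgf hε hs ho).symm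
  have hbase : Tendsto (fun ε => ∫ x in {x | P.InStrip ε x t i}, g (P.base x t) * ψ x) (𝓝[>] 0)
      (𝓝 0) := by
    have h1 : Tendsto (fun ε => P.maxAbs g * C * (ε * (t - P.org i))) (𝓝[>] 0) (𝓝 0) := by
      simpa using hw.const_mul (P.maxAbs g * C)
    refine squeeze_zero_norm' ?_ h1
    filter_upwards [self_mem_nhdsWithin] with ε hε
    rw [← volume_inStrip hε hi hs ho]
    refine norm_setIntegral_le_of_norm_le_const ?_ fun x _ => ?_
    · rw [setOf_inStrip hi hs]; exact measure_ball_lt_top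
    · rw [norm_mul]
      exact mul_le_mul (P.abs_apply_base_le g x t) (hC x) (norm_nonneg _) (P.maxAbs_nonneg g)
  have hfin := (hstrip.mul havg).sub hbase
  rw [sub_zero] at hfin
  refine hfin.congr' ?_
  filter_upwards [self_mem_nhdsWithin] with ε hε
  have : 0 < ε := hε
  simp only [sub_mul]
  rw [integral_sub (hψ.const_mul _).integrableOn (P.integrable_base_mul hg t hψ).integrableOn,
    integral_const_mul]
  field_simp

/-- The limit, as `ε → 0`, of `∫ g(U^ε) ψ dx` at a fixed time. -/
theorem tendsto_integral_net (hg : IsFlux g α) (P : Pattern) (hψ : Integrable ψ) {C : ℝ}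
    (hC : ∀ x, |ψ x| ≤ C) (hcont : ∀ i < P.n, 0 < P.str i t → ContinuousAt ψ (P.pos i t))
    (hstr : ∀ i < P.n, 0 ≤ P.str i t) (horg : ∀ i < P.n, 0 < P.str i t → P.org i < t)
    (hdisj : ∀ i < P.n, ∀ j < P.n, i ≠ j → 0 < P.str i t → 0 < P.str j t →
      P.pos i t ≠ P.pos j t) :
    Tendsto (fun ε => ∫ x, g (P.net ε x t) * ψ x) (𝓝[>] 0)
      (𝓝 ((∫ x, g (P.base x t) * ψ x)
        + ∑ i ∈ Finset.range P.n, P.str i t * α (P.speed i t) * ψ (P.pos i t))) := by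
  classical
  -- For small ε the strips around distinct positions are disjoint, so the rule that the first strip
  -- counts is irrelevant in the limit.
  have hdis : ∀ᶠ ε in 𝓝[>] (0 : ℝ), ∀ i ∈ Finset.range P.n, ∀ j ∈ Finset.range P.n, i ≠ j →
      ∀ x, ¬ (P.InStrip ε x t i ∧ P.InStrip ε x t j) := by
    rw [Filter.eventually_all_finset]
    intro i hi
    rw [Filter.eventually_all_finset]
    intro j hj
    by_cases hij : i = j
    · exact Eventually.of_forall fun ε h => absurd hij h
    by_cases hsi : 0 < P.str i t
    swap
    · exact Eventually.of_forall fun ε _ x h => hsi h.1.2.1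
    by_cases hsj : 0 < P.str j t
    swap
    · exact Eventually.of_forall fun ε _ x h => hsj h.2.2.1
    have hne := hdisj i (Finset.mem_range.1 hi) j (Finset.mem_range.1 hj) hij hsi hsj
    have hpos : 0 < |P.pos i t - P.pos j t| := abs_pos.2 (sub_ne_zero.2 hne)
    have hlim : Tendsto (fun ε : ℝ => ε / 2 * (t - P.org i) + ε / 2 * (t - P.org j)) (𝓝[>] 0)
        (𝓝 (0 / 2 * (t - P.org i) + 0 / 2 * (t - P.org j))) :=
      (Continuous.tendsto (by fun_prop) 0).mono_left nhdsWithin_le_nhds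
    simp only [zero_div, zero_mul, add_zero] at hlim
    filter_upwards [hlim.eventually (gt_mem_nhds hpos)] with ε hε _ x hx
    have h1 := hx.1.2.2
    have h2 := hx.2.2.2
    have h3 := abs_sub_le (P.pos i t) x (P.pos j t)
    rw [abs_sub_comm (P.pos i t) x] at h3
    linarith
  have hterm : ∀ i ∈ Finset.range P.n, Tendsto (fun ε => ∫ x, (if P.InStrip ε x t i then
      g (P.stripState ε t i) - g (P.base x t) else 0) * ψ x) (𝓝[>] 0)
      (𝓝 (P.str i t * α (P.speed i t) * ψ (P.pos i t))) := by
    intro i hi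
    have hi := Finset.mem_range.1 hi
    rcases (hstr i hi).eq_or_lt with h0 | h0
    · rw [← h0, zero_mul, zero_mul]
      refine tendsto_const_nhds.congr fun ε => ?_
      simp [InStrip, ← h0]
    · refine (tendsto_strip hg hi hψ hC h0 (horg i hi h0) (hcont i hi h0)).congr fun ε => ?_
      rw [← integral_indicator (measurableSet_inStrip hi h0)]
      refine integral_congr_ae (ae_of_all _ fun x => ?_)
      simp only [Set.indicator_apply, Set.mem_ofPred_eq, ite_mul, zero_mul]
  refine ((tendsto_const_nhds (x := ∫ x, g (P.base x t) * ψ x)).add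
    (tendsto_finsetSum _ hterm)).congr' ?_
  filter_upwards [hdis, self_mem_nhdsWithin] with ε hε _
  have hint : ∀ i ∈ Finset.range P.n, Integrable fun x => (if P.InStrip ε x t i then
      g (P.stripState ε t i) - g (P.base x t) else 0) * ψ x := by
    intro i hi
    have hi := Finset.mem_range.1 hi
    rcases (hstr i hi).eq_or_lt with h0 | h0
    · simp [InStrip, ← h0]
    · refine hψ.bdd_mul (c := |g (P.stripState ε t i)| + P.maxAbs g) ?_ (ae_of_all _ fun x => ?_)
      · exact (Measurable.ite (measurableSet_inStrip hi h0)
          (measurable_const.sub (P.measurable_base hg t)) measurable_const).aestronglyMeasurable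
      · split_ifs
        · exact (abs_sub _ _).trans (add_le_add le_rfl (P.abs_apply_base_le g x t))
        · rw [norm_zero]
          exact add_nonneg (abs_nonneg _) (P.maxAbs_nonneg g)
  rw [← integral_finsetSum _ hint,
    ← integral_add (P.integrable_base_mul hg t hψ) (integrable_finsetSum _ hint)]
  refine integral_congr_ae (ae_of_all _ fun x => ?_)
  simp only []
  rw [P.apply_net g, add_mul, Finset.sum_mul]
  congr 1
  refine Finset.sum_congr rfl fun i hi => ?_
  have : P.IsFirst ε x t i ↔ P.InStrip ε x t i :=
    ⟨fun h => h.1, fun h => ⟨h, fun j hj hj' => hε i hi j (Finset.mem_range.2 hj'.1) hj.ne' x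
      ⟨h, hj'⟩⟩⟩
  simp only [this]

/-- A bound of `∫ g(U^ε) ψ dx` at a fixed time. -/
theorem abs_integral_net_le (hg : IsFlux g α) (P : Pattern) (hψ : Integrable ψ) {C : ℝ}
    (hC : ∀ x, |ψ x| ≤ C) (hε : 0 < ε) (horg : ∀ i < P.n, 0 < P.str i t → P.org i < t) :
    |∫ x, g (P.net ε x t) * ψ x| ≤ (P.maxAbs g * ∫ x, |ψ x|)
      + ∑ i ∈ Finset.range P.n, if 0 < P.str i t then
        |g (P.stripState ε t i) * (ε * (t - P.org i))| * C else 0 := by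
  classical
  have hC0 : 0 ≤ C := (abs_nonneg _).trans (hC 0)
  have hind : ∀ i, 0 < P.str i t →
      (fun x => if P.InStrip ε x t i then |g (P.stripState ε t i)| else 0)
        = {x | P.InStrip ε x t i}.indicator fun _ => |g (P.stripState ε t i)| := by
    intro i _
    funext x
    simp only [Set.indicator_apply, Set.mem_ofPred_eq]
  have hint : ∀ i ∈ Finset.range P.n, Integrable fun x =>
      (if P.InStrip ε x t i then |g (P.stripState ε t i)| else 0) * C := by
    intro i hi
    have hi := Finset.mem_range.1 hi
    by_cases h0 : 0 < P.str i t
    · refine Integrable.mul_const ?_ C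
      rw [hind i h0]
      refine (integrable_indicator_iff (measurableSet_inStrip hi h0)).2 (integrableOn_const ?_)
      rw [setOf_inStrip hi h0]
      exact measure_ball_lt_top.ne
    · simp [InStrip, h0]
  have hint0 : Integrable fun x => P.maxAbs g * |ψ x| := hψ.abs.const_mul _
  calc |∫ x, g (P.net ε x t) * ψ x|
      ≤ ∫ x, |g (P.net ε x t) * ψ x| := abs_integral_le_integral_abs
    _ ≤ ∫ x, (P.maxAbs g * |ψ x| + ∑ i ∈ Finset.range P.n,
          (if P.InStrip ε x t i then |g (P.stripState ε t i)| else 0) * C) := by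
        refine integral_mono (P.integrable_net_mul hg ε t hψ).abs
          (hint0.add (integrable_finsetSum _ hint)) fun x => ?_
        simp only []
        rw [abs_mul, ← Finset.sum_mul]
        calc |g (P.net ε x t)| * |ψ x| ≤ (|g (P.base x t)| + ∑ i ∈ Finset.range P.n,
              if P.InStrip ε x t i then |g (P.stripState ε t i)| else 0) * |ψ x| :=
              mul_le_mul_of_nonneg_right (P.abs_apply_net_le g ε x t) (abs_nonneg _)
          _ ≤ _ := by
              rw [add_mul]
              refine add_le_add (mul_le_mul_of_nonneg_right (P.abs_apply_base_le g x t)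
                (abs_nonneg _)) (mul_le_mul_of_nonneg_left (hC x) ?_)
              exact Finset.sum_nonneg fun i _ => by split_ifs <;> positivity
    _ = _ := by
        rw [integral_add hint0 (integrable_finsetSum _ hint), integral_const_mul,
          integral_finsetSum _ hint]
        congr 1
        refine Finset.sum_congr rfl fun i hi => ?_
        have hi := Finset.mem_range.1 hi
        split_ifs with h0
        · have hpos : 0 < ε * (t - P.org i) := mul_pos hε (sub_pos.2 (horg i hi h0))
          rw [integral_mul_const, hind i h0, integral_indicator (measurableSet_inStrip hi h0),
            setIntegral_const, volume_inStrip hε hi h0 (horg i hi h0), smul_eq_mul, abs_mul,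
            abs_of_pos hpos]
          ring
        · simp [InStrip, h0]

end FixedTime

end Pattern

end Chaplygin

namespace Chaplygin

/-! ### Continuous functions with compact support in the plane -/

section CompactSupport

variable {ψ : ℝ × ℝ → ℝ}

theorem exists_bounds (hψ : Continuous ψ) (hc : HasCompactSupport ψ) :
    ∃ R C : ℝ, 0 < R ∧ 0 ≤ C ∧ (∀ p, |ψ p| ≤ C) ∧ ∀ x t, R ≤ |x| ∨ R ≤ |t| → ψ (x, t) = 0 := by
  obtain ⟨C, hC⟩ := hc.exists_bound_of_continuous hψ
  obtain ⟨r, hr⟩ := hc.isCompact.isBounded.subset_closedBall 0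
  refine ⟨max r 0 + 1, C, by positivity, (abs_nonneg _).trans (hC 0), hC, fun x t h => ?_⟩
  by_contra h0
  have h1 := hr (subset_tsupport _ (Function.mem_support.2 h0))
  rw [mem_closedBall_zero_iff, Prod.norm_def, max_le_iff, Real.norm_eq_abs, Real.norm_eq_abs] at h1
  have := le_max_left r 0
  dsimp only at h1
  rcases h with h | h <;> linarith

theorem integrable_section (hψ : Continuous ψ) (hc : HasCompactSupport ψ) (t : ℝ) :
    Integrable fun x => ψ (x, t) := by
  obtain ⟨R, C, hR, -, -, h⟩ := exists_bounds hψ hc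
  refine Continuous.integrable_of_hasCompactSupport (by fun_prop)
    (HasCompactSupport.of_support_subset_isCompact (isCompact_Icc (a := -R) (b := R)) ?_)
  intro x hx
  rw [Set.mem_Icc, ← abs_le]
  by_contra! hlt
  exact hx (h x t (.inl hlt.le))

theorem exists_integral_abs_le (hψ : Continuous ψ) (hc : HasCompactSupport ψ) :
    ∃ D, 0 ≤ D ∧ ∀ t, ∫ x, |ψ (x, t)| ≤ D := by
  obtain ⟨R, C, hR, hC0, hC, h⟩ := exists_bounds hψ hc
  refine ⟨C * (2 * R), by positivity, fun t => ?_⟩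
  have hint : IntegrableOn (fun _ : ℝ => C) (Set.Icc (-R) R) := by
    simp
  calc ∫ x, |ψ (x, t)| ≤ ∫ x, (Set.Icc (-R) R).indicator (fun _ => C) x := by
        refine integral_mono (integrable_section hψ hc t).abs
          ((integrable_indicator_iff measurableSet_Icc).2 hint) fun x => ?_
        by_cases hx : x ∈ Set.Icc (-R) R
        · simp only [Set.indicator_of_mem hx, hC]
        · rw [Set.mem_Icc, ← abs_le, not_le] at hx
          simp only [h x t (.inl hx.le), abs_zero]
          exact Set.indicator_nonneg (fun _ _ => hC0) _
    _ = C * (2 * R) := by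
        rw [integral_indicator measurableSet_Icc, setIntegral_const, Real.volume_real_Icc_of_le
          (by linarith), smul_eq_mul]
        ring

end CompactSupport

namespace Pattern

variable {P P' : Pattern} {g : State → ℝ} {α : ℝ → ℝ} {ψ : ℝ × ℝ → ℝ} {a b t : ℝ}

/-- The action of the limit of `g(U^ε)` on `ψ` at time `t`. -/
noncomputable def slice (P : Pattern) (g : State → ℝ) (α : ℝ → ℝ) (ψ : ℝ × ℝ → ℝ) (t : ℝ) : ℝ :=
  (∫ x, g (P.base x t) * ψ (x, t))
    + ∑ i ∈ Finset.range P.n, P.str i t * α (P.speed i t) * ψ (P.pos i t, t)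

theorem Agree.slice {J : Set ℝ} (h : P.Agree P' J) (ht : t ∈ J) :
    P.slice g α ψ t = P'.slice g α ψ t := by
  rw [Pattern.slice, Pattern.slice, ← h.n_eq]
  congr 1
  · simp only [h.base ht]
  · refine Finset.sum_congr rfl fun i hi => ?_
    obtain ⟨h1, h2, h3⟩ := h.front_eq i (Finset.mem_range.1 hi) t ht
    rw [h1, h2, h3]

theorem IsAdmissibleOn.continuousOn {J : Set ℝ} (h : P.IsAdmissibleOn a J) {i : ℕ} (hi : i < P.n) :
    ContinuousOn (P.pos i) J ∧ ContinuousOn (P.speed i) J ∧ ContinuousOn (P.str i) J := by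
  refine ⟨(h.2.2 i hi).1.1, (h.2.2 i hi).1.2.1, ?_⟩
  rcases (h.2.2 i hi).2 with h' | h'
  · exact continuousOn_const.congr fun t ht => h'.2.1 t ht
  · exact h'.1.1

theorem IsAdmissibleOn.str_nonneg (h : P.IsAdmissibleOn a (Set.Icc a b)) (ht : t ∈ Set.Icc a b)
    {i : ℕ} (hi : i < P.n) : 0 ≤ P.str i t := by
  rcases (h.2.2 i hi).2 with h' | ⟨h', h''⟩
  · exact (h'.2.1 t ht).ge
  · have h0 : 0 ≤ P.str i a := by
      rcases h'' with k | k
      · exact k.1.ge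
      · exact k.1.le
    have := h'.le_str (h.1 i hi.le) (h.1 (i + 1) hi) ht
    have := ht.1
    linarith

theorem IsAdmissibleOn.org_lt (h : P.IsAdmissibleOn a (Set.Icc a b)) (ht : t ∈ Set.Ioc a b)
    {i : ℕ} (hi : i < P.n) (hs : 0 < P.str i t) : P.org i < t := by
  rcases (h.2.2 i hi).2 with h' | ⟨-, h' | h'⟩
  · exact absurd (h'.2.1 t ⟨ht.1.le, ht.2⟩) hs.ne'
  · rw [h'.2]; exact ht.1
  · exact h'.2.trans ht.1

/-- This provides the dominating function for the limit in time. The only delicate term is width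
squared over strength, near a time at which a wave starts with zero strength. -/
theorem IsAdmissibleOn.exists_strip_bound (h : P.IsAdmissibleOn a (Set.Icc a b)) (hab : a < b)
    (hg : IsFlux g α) {i : ℕ} (hi : i < P.n) : ∃ D, 0 ≤ D ∧ ∀ t ∈ Set.Ioo a b, ∀ ε ∈ Set.Ioc 0 1,
      0 < P.str i t → |g (P.stripState ε t i) * (ε * (t - P.org i))| ≤ D := by
  rcases (h.2.2 i hi).2 with h' | ⟨h', h''⟩
  · refine ⟨0, le_rfl, fun t ht ε _ hs => ?_⟩
    exact absurd (h'.2.1 t ⟨ht.1.le, ht.2.le⟩) hs.ne'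
  obtain ⟨hα, β, γ, hβ, hγ, hgf⟩ := hg
  obtain ⟨-, cs, cm⟩ := h.continuousOn hi
  obtain ⟨A, hA⟩ := isCompact_Icc.exists_bound_of_continuousOn (cm.mul (hα.comp_continuousOn cs))
  obtain ⟨B, hB⟩ := isCompact_Icc.exists_bound_of_continuousOn (hβ.comp_continuousOn cs)
  obtain ⟨G, hG⟩ := isCompact_Icc.exists_bound_of_continuousOn (hγ.comp_continuousOn cs)
  have hae : a ∈ Set.Icc a b := ⟨le_rfl, hab.le⟩
  have hA0 := (norm_nonneg _).trans (hA a hae)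
  have hB0 := (norm_nonneg _).trans (hB a hae)
  have hG0 := (norm_nonneg _).trans (hG a hae)
  have horg : P.org i ≤ a := by
    rcases h'' with k | k
    · exact k.2.le
    · exact k.2.le
  obtain ⟨E, hE0, hE⟩ : ∃ E, 0 ≤ E ∧ ∀ t ∈ Set.Ioo a b, ∀ ε ∈ Set.Ioc (0 : ℝ) 1,
      (ε * (t - P.org i)) ^ 2 / P.str i t ≤ E := by
    rcases h'' with k | k
    -- Here the width is at most `t - a` and the strength at least `2 * (t - a)`, so the quotient
    -- stays bounded up to the start.
    · refine ⟨b - a, by linarith, fun t ht ε hε => ?_⟩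
      have h1 := h'.le_str (h.1 i hi.le) (h.1 (i + 1) hi) ⟨ht.1.le, ht.2.le⟩
      rw [k.1, zero_add] at h1
      have h2 : 0 < t - a := sub_pos.2 ht.1
      rw [k.2, div_le_iff₀ (by linarith)]
      calc (ε * (t - a)) ^ 2 ≤ (1 * (t - a)) ^ 2 := by
            have := hε.1; have := hε.2; gcongr
        _ ≤ (b - a) * P.str i t := by nlinarith [ht.2]
    · refine ⟨(b - P.org i) ^ 2 / P.str i a, div_nonneg (sq_nonneg _) k.1.le,
        fun t ht ε hε => ?_⟩
      have h1 := h'.le_str (h.1 i hi.le) (h.1 (i + 1) hi) ⟨ht.1.le, ht.2.le⟩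
      have h2 : 0 < t - P.org i := by linarith [ht.1, k.2]
      have h3 : ε * (t - P.org i) ≤ b - P.org i := by nlinarith [hε.1, hε.2, ht.2]
      have h4 : 0 ≤ ε * (t - P.org i) := mul_nonneg hε.1.le h2.le
      have h5 := k.1
      have h6 : P.str i a ≤ P.str i t := by linarith [ht.1]
      gcongr
  refine ⟨A + B * E + G * (b - P.org i), ?_, fun t ht ε hε hs => ?_⟩
  · have : 0 ≤ b - P.org i := by linarith
    positivity
  have htc : t ∈ Set.Icc a b := ⟨ht.1.le, ht.2.le⟩
  have ho : P.org i < t := horg.trans_lt ht.1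
  have h2 : 0 < t - P.org i := sub_pos.2 ho
  have h4 : 0 ≤ ε * (t - P.org i) := mul_nonneg hε.1.le h2.le
  have h3 : ε * (t - P.org i) ≤ b - P.org i := by nlinarith [hε.1, hε.2, ht.2]
  have h5 : 0 ≤ (ε * (t - P.org i)) ^ 2 / P.str i t := div_nonneg (sq_nonneg _) hs.le
  rw [apply_stripState_mul hgf hε.1 hs ho]
  refine (abs_add_three _ _ _).trans (add_le_add (add_le_add (hA t htc) ?_) ?_)
  · rw [abs_mul, abs_of_nonneg h5]
    exact mul_le_mul (hB t htc) (hE t ht ε hε) h5 hB0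
  · rw [abs_mul, abs_of_nonneg h4]
    exact mul_le_mul (hG t htc) h3 h4 hG0

theorem IsAdmissibleOn.exists_integral_net_bound (h : P.IsAdmissibleOn a (Set.Icc a b))
    (hab : a < b) (hg : IsFlux g α) (hψ : Continuous ψ) (hc : HasCompactSupport ψ) :
    ∃ D, ∀ t ∈ Set.Ioo a b, ∀ ε ∈ Set.Ioc 0 1, |∫ x, g (P.net ε x t) * ψ (x, t)| ≤ D := by
  have : ∀ i, ∃ D, 0 ≤ D ∧ (i < P.n → ∀ t ∈ Set.Ioo a b, ∀ ε ∈ Set.Ioc 0 1,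
      0 < P.str i t → |g (P.stripState ε t i) * (ε * (t - P.org i))| ≤ D) := by
    intro i
    by_cases hi : i < P.n
    · obtain ⟨D, h0, hD⟩ := h.exists_strip_bound hab hg hi
      exact ⟨D, h0, fun _ => hD⟩
    · exact ⟨0, le_rfl, fun h => absurd h hi⟩
  choose D hD0 hD using this
  obtain ⟨R, C, -, hC0, hC, -⟩ := exists_bounds hψ hc
  obtain ⟨I, hI0, hI⟩ := exists_integral_abs_le hψ hc
  refine ⟨P.maxAbs g * I + ∑ i ∈ Finset.range P.n, D i * C, fun t ht ε hε => ?_⟩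
  refine (P.abs_integral_net_le hg (integrable_section hψ hc t) (fun x => hC _) hε.1
    (fun i hi => h.org_lt ⟨ht.1, ht.2.le⟩ hi)).trans (add_le_add ?_ (Finset.sum_le_sum ?_))
  · exact mul_le_mul_of_nonneg_left (hI t) (P.maxAbs_nonneg g)
  · intro i hi
    split_ifs with hs
    · exact mul_le_mul_of_nonneg_right (hD i (Finset.mem_range.1 hi) t ht ε hε hs) hC0
    · exact mul_nonneg (hD0 i) hC0

theorem IsAdmissibleOn.tendsto_slice (h : P.IsAdmissibleOn a (Set.Icc a b))
    (hg : IsFlux g α) (hψ : Continuous ψ) (hc : HasCompactSupport ψ) (ht : t ∈ Set.Ioo a b) :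
    Tendsto (fun ε => ∫ x, g (P.net ε x t) * ψ (x, t)) (𝓝[>] 0) (𝓝 (P.slice g α ψ t)) := by
  obtain ⟨R, C, -, -, hC, -⟩ := exists_bounds hψ hc
  have hti : t ∈ interior (Set.Icc a b) := by rwa [interior_Icc]
  refine P.tendsto_integral_net (ψ := fun x => ψ (x, t)) hg (integrable_section hψ hc t)
    (fun x => hC _) (fun i _ _ => by fun_prop)
    (fun i hi => h.str_nonneg ⟨ht.1.le, ht.2.le⟩ hi) (fun i hi => h.org_lt ⟨ht.1, ht.2.le⟩ hi)
    (fun i hi j hj hij _ _ => ?_)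
  rcases lt_or_gt_of_ne hij with hlt | hlt
  · exact (h.pos_lt hti hlt hj).ne
  · exact (h.pos_lt hti hlt hi).ne'

theorem IsAdmissibleOn.aestronglyMeasurable_integral_net (h : P.IsAdmissibleOn a (Set.Icc a b))
    (hab : a < b) (hg : IsFlux g α) (hψ : Continuous ψ) (ε : ℝ) :
    AEStronglyMeasurable (fun t => ∫ x, g (P.net ε x t) * ψ (x, t))
      (volume.restrict (Set.uIoc a b)) := by
  obtain ⟨⟨F, hF, hFe⟩, -⟩ := P.exists_measurable hg measurableSet_Icc
    (fun i hi => h.continuousOn hi) ε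
  have hm : StronglyMeasurable fun t => ∫ x, F (x, t) * ψ (x, t) :=
    StronglyMeasurable.integral_prod_left (f := fun x t => F (x, t) * ψ (x, t))
      (hF.mul hψ.measurable).stronglyMeasurable
  refine hm.aestronglyMeasurable.congr (ae_restrict_of_forall_mem measurableSet_uIoc ?_)
  intro t ht
  rw [Set.uIoc_of_le hab.le] at ht
  simp only [hFe _ t ⟨ht.1.le, ht.2⟩]

theorem IsAdmissibleOn.intervalIntegrable_net (h : P.IsAdmissibleOn a (Set.Icc a b))
    (hab : a < b) (hg : IsFlux g α) (hψ : Continuous ψ) (hc : HasCompactSupport ψ) {ε : ℝ}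
    (hε : ε ∈ Set.Ioc (0 : ℝ) 1) :
    IntervalIntegrable (fun t => ∫ x, g (P.net ε x t) * ψ (x, t)) volume a b := by
  obtain ⟨D, hD⟩ := h.exists_integral_net_bound hab hg hψ hc
  refine (intervalIntegrable_const (c := D)).mono_fun
    (h.aestronglyMeasurable_integral_net hab hg hψ ε) ?_
  rw [Set.uIoc_of_le hab.le]
  refine (ae_restrict_iff' measurableSet_Ioc).2 ?_
  filter_upwards [Measure.ae_ne volume b] with t htb ht
  exact (hD t ⟨ht.1, lt_of_le_of_ne ht.2 htb⟩ ε hε).trans (le_abs_self D)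

theorem IsAdmissibleOn.tendsto_integral_slice (h : P.IsAdmissibleOn a (Set.Icc a b))
    (hab : a < b) (hg : IsFlux g α) (hψ : Continuous ψ) (hc : HasCompactSupport ψ) :
    Tendsto (fun ε => ∫ t in a..b, ∫ x, g (P.net ε x t) * ψ (x, t)) (𝓝[>] 0)
      (𝓝 (∫ t in a..b, P.slice g α ψ t)) := by
  obtain ⟨D, hD⟩ := h.exists_integral_net_bound hab hg hψ hc
  refine intervalIntegral.tendsto_integral_filter_of_dominated_convergence (fun _ => D)
    (Eventually.of_forall fun ε => h.aestronglyMeasurable_integral_net hab hg hψ ε) ?_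
    intervalIntegrable_const ?_
  · filter_upwards [Ioc_mem_nhdsGT one_pos] with ε hε
    rw [Set.uIoc_of_le hab.le]
    filter_upwards [Measure.ae_ne volume b] with t htb ht
    exact hD t ⟨ht.1, lt_of_le_of_ne ht.2 htb⟩ ε hε
  · rw [Set.uIoc_of_le hab.le]
    filter_upwards [Measure.ae_ne volume b] with t htb ht
    exact h.tendsto_slice hg hψ hc ⟨ht.1, lt_of_le_of_ne ht.2 htb⟩

/-! ### The slices in terms of the single fronts -/

/-- Telescoping over the fronts left of `x`; each front contributes a Heaviside function, so that
slices become sums over single moving fronts. -/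
theorem Sorted.apply_base (h : P.Sorted t) (g : State → ℝ) (x : ℝ) :
    g (P.base x t) = g (P.state 0) + ∑ i ∈ Finset.range P.n,
      if P.pos i t < x then g (P.state (i + 1)) - g (P.state i) else 0 := by
  classical
  have hf : (Finset.range P.n).filter (fun i => P.pos i t < x) = Finset.range (P.lo t x) := by
    ext i
    rw [Finset.mem_filter, Finset.mem_range, h.lt_iff, Finset.mem_range]
  rw [← Finset.sum_filter, hf, Finset.sum_range_sub (fun i => g (P.state i)), base_eq]
  ring

theorem integral_ite_lt_mul (c p : ℝ) (f : ℝ → ℝ) :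
    ∫ x, (if p < x then c else 0) * f x = c * ∫ y in Set.Ioi 0, f (p + y) := by
  rw [← integral_add_left_eq_self _ p, ← integral_const_mul, ← integral_indicator measurableSet_Ioi]
  refine integral_congr_ae (ae_of_all _ fun y => ?_)
  by_cases hy : 0 < y <;> simp [hy]

/-- Shifting the variable by the front position fixes the domain of integration, so each term can be
differentiated in time. -/
theorem Sorted.slice_eq (h : P.Sorted t) (g : State → ℝ) (α : ℝ → ℝ) (hψ : Continuous ψ)
    (hc : HasCompactSupport ψ) :
    P.slice g α ψ t = g (P.state 0) * (∫ x, ψ (x, t)) + ∑ i ∈ Finset.range P.n,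
      ((g (P.state (i + 1)) - g (P.state i)) * (∫ y in Set.Ioi 0, ψ (P.pos i t + y, t))
        + P.str i t * α (P.speed i t) * ψ (P.pos i t, t)) := by
  have hi := integrable_section hψ hc t
  have hint : ∀ i ∈ Finset.range P.n, Integrable fun x =>
      (if P.pos i t < x then g (P.state (i + 1)) - g (P.state i) else 0) * ψ (x, t) := by
    intro i _
    refine hi.bdd_mul (c := |g (P.state (i + 1)) - g (P.state i)|)
      (Measurable.ite measurableSet_Ioi measurable_const measurable_const).aestronglyMeasurable
      (ae_of_all _ fun x => ?_)
    split_ifs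
    · exact le_rfl
    · simp
  rw [slice, Finset.sum_add_distrib, ← add_assoc]
  congr 1
  simp only [h.apply_base g, add_mul, Finset.sum_mul]
  rw [integral_add (hi.const_mul _) (integrable_finsetSum _ hint), integral_const_mul,
    integral_finsetSum _ hint]
  simp only [integral_ite_lt_mul]

end Pattern

/-! ### Integrals along moving points -/

section Moving

variable {φ ψ : ℝ × ℝ → ℝ} {pos speed : ℝ → ℝ} {t : ℝ} {J S : Set ℝ}

theorem continuousOn_integral_moving (hψ : Continuous ψ) (hc : HasCompactSupport ψ)
    (hJ : IsCompact J) (hpos : ContinuousOn pos J) (S : Set ℝ) :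
    ContinuousOn (fun t => ∫ y in S, ψ (pos t + y, t)) J := by
  obtain ⟨R, C, hR, -, -, hz⟩ := exists_bounds hψ hc
  obtain ⟨B, hB⟩ := hJ.exists_bound_of_continuousOn hpos
  refine continuousOn_integral_of_compact_support (isCompact_Icc (a := -(R + B)) (b := R + B))
    (f := fun t y => ψ (pos t + y, t)) ?_ ?_
  · refine hψ.comp_continuousOn (ContinuousOn.prodMk (ContinuousOn.add ?_ continuousOn_snd)
      continuousOn_fst)
    exact hpos.comp continuousOn_fst fun p hp => hp.1
  · intro t y ht hy
    refine hz _ _ (.inl ?_)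
    rw [Set.mem_Icc, ← abs_le, not_le] at hy
    have h1 := hB t ht
    rw [Real.norm_eq_abs] at h1
    have := abs_sub_abs_le_abs_sub y (-pos t)
    rw [abs_neg, sub_neg_eq_add, add_comm y] at this
    linarith

theorem IsTest.continuous_dx (h : IsTest φ) : Continuous fun p : ℝ × ℝ => dx φ p.1 p.2 :=
  (h.1.continuous_fderiv (by simp)).clm_apply continuous_const

theorem IsTest.continuous_dt (h : IsTest φ) : Continuous fun p : ℝ × ℝ => dt φ p.1 p.2 :=
  (h.1.continuous_fderiv (by simp)).clm_apply continuous_const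

theorem IsTest.hasCompactSupport_dx (h : IsTest φ) :
    HasCompactSupport fun p : ℝ × ℝ => dx φ p.1 p.2 :=
  h.2.fderiv_apply (𝕜 := ℝ) (1, 0)

theorem IsTest.hasCompactSupport_dt (h : IsTest φ) :
    HasCompactSupport fun p : ℝ × ℝ => dt φ p.1 p.2 :=
  h.2.fderiv_apply (𝕜 := ℝ) (0, 1)

theorem IsTest.hasDerivAt_moving (h : IsTest φ) {s : ℝ} (hp : HasDerivAt pos s t) (y : ℝ) :
    HasDerivAt (fun τ => φ (pos τ + y, τ)) (s * dx φ (pos t + y) t + dt φ (pos t + y) t) t := by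
  have h1 : HasFDerivAt φ (fderiv ℝ φ (pos t + y, t)) (pos t + y, t) :=
    (h.1.differentiable (by simp) _).hasFDerivAt
  have h2 : HasDerivAt (fun τ => (pos τ + y, τ)) (s, 1) t :=
    (hp.add_const y).prodMk (hasDerivAt_id t)
  refine (h1.comp_hasDerivAt (f := fun τ => (pos τ + y, τ)) t h2).congr_deriv ?_
  have : ((s, 1) : ℝ × ℝ) = s • (1, 0) + (0, 1) := by simp
  rw [this, map_add, map_smul, smul_eq_mul, dx, dt]

/-- Differentiation under the integral sign; the bound holds for times near `t` because the support,
shifted by the positions, stays in one compact interval. -/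
theorem IsTest.hasDerivAt_integral_moving (h : IsTest φ) (hJ : J ∈ 𝓝 t)
    (hpos : ∀ τ ∈ J, HasDerivAt pos (speed τ) τ) (hspeed : ContinuousOn speed J)
    (S : Set ℝ) :
    HasDerivAt (fun τ => ∫ y in S, φ (pos τ + y, τ))
      (∫ y in S, (speed t * dx φ (pos t + y) t + dt φ (pos t + y) t)) t := by
  obtain ⟨R₁, C₁, -, hC₁, hb₁, hz₁⟩ := exists_bounds h.continuous_dx h.hasCompactSupport_dx
  obtain ⟨R₂, C₂, -, hC₂, hb₂, hz₂⟩ := exists_bounds h.continuous_dt h.hasCompactSupport_dt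
  have htJ := mem_of_mem_nhds hJ
  have e1 : ∀ᶠ τ in 𝓝 t, |speed τ| < |speed t| + 1 :=
    (hspeed.continuousAt hJ).abs.eventually (gt_mem_nhds (lt_add_one _))
  have e2 : ∀ᶠ τ in 𝓝 t, |pos τ| < |pos t| + 1 :=
    (hpos t htJ).continuousAt.abs.eventually (gt_mem_nhds (lt_add_one _))
  set M := max R₁ R₂ + |pos t| + 1
  refine (hasDerivAt_integral_of_dominated_loc_of_deriv_le
    (bound := (Set.Icc (-M) M).indicator fun _ => (|speed t| + 1) * C₁ + C₂)
    (F' := fun τ y => speed τ * dx φ (pos τ + y) τ + dt φ (pos τ + y) τ)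
    (inter_mem hJ (e1.and e2)) ?_ ?_ ?_ (ae_of_all _ ?_) ?_ (ae_of_all _ ?_)).2
  · have := h.1.continuous
    exact Eventually.of_forall fun τ => Continuous.aestronglyMeasurable (by fun_prop)
  · have := (integrable_section h.1.continuous h.2 t).comp_add_left (pos t)
    exact this.integrableOn
  · have h1 := h.continuous_dx.comp (f := fun y : ℝ => (pos t + y, t)) (by fun_prop)
    have h2 := h.continuous_dt.comp (f := fun y : ℝ => (pos t + y, t)) (by fun_prop)
    exact ((h1.const_mul (speed t)).add h2).aestronglyMeasurable
  · intro y τ hτ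
    by_cases hy : y ∈ Set.Icc (-M) M
    · rw [Set.indicator_of_mem hy]
      refine (norm_add_le _ _).trans (add_le_add ?_ (hb₂ (pos τ + y, τ)))
      rw [norm_mul]
      exact mul_le_mul hτ.2.1.le (hb₁ (pos τ + y, τ)) (norm_nonneg _) (by positivity)
    · rw [Set.indicator_of_notMem hy]
      rw [Set.mem_Icc, ← abs_le, not_le] at hy
      have h1 := hτ.2.2
      have h2 := abs_sub_abs_le_abs_sub y (-pos τ)
      rw [abs_neg, sub_neg_eq_add, add_comm y] at h2
      have h3 := le_max_left R₁ R₂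
      have h4 := le_max_right R₁ R₂
      have z1 := hz₁ (pos τ + y) τ (.inl (by simp only [M] at hy; linarith))
      have z2 := hz₂ (pos τ + y) τ (.inl (by simp only [M] at hy; linarith))
      dsimp only at z1 z2
      rw [z1, z2, mul_zero, add_zero, norm_zero]
  · exact ((integrable_indicator_iff measurableSet_Icc).2 (by simp)).integrableOn
  · intro y τ hτ
    exact h.hasDerivAt_moving (hpos τ hτ.1) y

theorem IsTest.integral_dx_Ioi (h : IsTest φ) (p t : ℝ) :
    ∫ y in Set.Ioi 0, dx φ (p + y) t = -φ (p, t) := by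
  obtain ⟨R, C, hR, -, -, hz⟩ := exists_bounds h.1.continuous h.2
  have hd : ∀ y, HasDerivAt (fun y => φ (p + y, t)) (dx φ (p + y) t) y := by
    intro y
    have h1 : HasFDerivAt φ (fderiv ℝ φ (p + y, t)) (p + y, t) :=
      (h.1.differentiable (by simp) _).hasFDerivAt
    exact h1.comp_hasDerivAt y (((hasDerivAt_id y).const_add p).prodMk (hasDerivAt_const y t))
  have hlim : Tendsto (fun y => φ (p + y, t)) atTop (𝓝 0) := by
    refine tendsto_const_nhds.congr' ?_
    filter_upwards [eventually_ge_atTop (R - p)] with y hy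
    exact (hz _ _ (.inl ((by linarith : R ≤ p + y).trans (le_abs_self _)))).symm
  rw [integral_Ioi_of_hasDerivAt_of_tendsto (hd 0).continuousAt.continuousWithinAt
    (fun y _ => hd y) ?_ hlim, add_zero, zero_sub]
  exact ((integrable_section h.continuous_dx h.hasCompactSupport_dx t).comp_add_left
    p).integrableOn

theorem IsTest.integral_dx (h : IsTest φ) (t : ℝ) : ∫ x, dx φ x t = 0 := by
  refine integral_eq_zero_of_hasDerivAt_of_integrable (f := fun x => φ (x, t)) (fun x => ?_)
    (integrable_section h.continuous_dx h.hasCompactSupport_dx t)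
    (integrable_section h.1.continuous h.2 t)
  have h1 : HasFDerivAt φ (fderiv ℝ φ (x, t)) (x, t) :=
    (h.1.differentiable (by simp) _).hasFDerivAt
  exact h1.comp_hasDerivAt x ((hasDerivAt_id x).prodMk (hasDerivAt_const x t))

end Moving

end Chaplygin

namespace Chaplygin

/-! ### Conservation laws across a contact discontinuity and a shadow wave -/

namespace State

variable {U : State}

/-- The three fluxes relative to a frame of speed λ₁ depend on λ₁ alone. Hence they are continuous
across a 1-contact, which conserves mass, momentum and energy; the λ₂ identities do the same for
2-contacts. -/
theorem mom_sub_lam1 (h : 0 < U.rho) : U.mom - U.lam1 * U.rho = 1 := by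
  simp only [mom, lam1]; field_simp; ring

theorem momFlux_sub_lam1 (h : 0 < U.rho) : U.momFlux - U.lam1 * U.mom = U.lam1 := by
  simp only [mom, momFlux, lam1]; field_simp; ring

theorem energyFlux_sub_lam1 (h : 0 < U.rho) : U.energyFlux - U.lam1 * U.energy = U.lam1 ^ 2 := by
  simp only [energy, energyFlux, lam1]; field_simp; ring

theorem mom_sub_lam2 (h : 0 < U.rho) : U.mom - U.lam2 * U.rho = -1 := by
  simp only [mom, lam2]; field_simp; ring

theorem momFlux_sub_lam2 (h : 0 < U.rho) : U.momFlux - U.lam2 * U.mom = -U.lam2 := by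
  simp only [mom, momFlux, lam2]; field_simp; ring

theorem energyFlux_sub_lam2 (h : 0 < U.rho) : U.energyFlux - U.lam2 * U.energy = -U.lam2 ^ 2 := by
  simp only [energy, energyFlux, lam2]; field_simp; ring

end State

section Contact

variable {L R : State} {J : Set ℝ} {speed str : ℝ → ℝ} {t : ℝ}

theorem IsContact.laws (h : IsContact L R J speed str) (hL : 0 < L.rho) (hR : 0 < R.rho)
    (ht : t ∈ J) : speed t * (R.rho - L.rho) - (R.mom - L.mom) = 0 ∧
      speed t * (R.mom - L.mom) - (R.momFlux - L.momFlux) = 0 ∧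
      speed t * (R.energy - L.energy) - (R.energyFlux - L.energyFlux) = 0 := by
  rcases h.2.2 with ⟨e, hs⟩ | ⟨e, hs⟩
  · have l1 := State.mom_sub_lam1 hL
    have l2 := State.momFlux_sub_lam1 hL
    have l3 := State.energyFlux_sub_lam1 hL
    have r1 := State.mom_sub_lam1 hR
    have r2 := State.momFlux_sub_lam1 hR
    have r3 := State.energyFlux_sub_lam1 hR
    rw [← e] at r1 r2 r3
    rw [hs t ht]
    exact ⟨by linarith, by linarith, by linarith⟩
  · have l1 := State.mom_sub_lam2 hL
    have l2 := State.momFlux_sub_lam2 hL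
    have l3 := State.energyFlux_sub_lam2 hL
    have r1 := State.mom_sub_lam2 hR
    have r2 := State.momFlux_sub_lam2 hR
    have r3 := State.energyFlux_sub_lam2 hR
    rw [← e] at r1 r2 r3
    rw [hs t ht]
    exact ⟨by linarith, by linarith, by linarith⟩

theorem IsContact.hasDerivAt_zero (h : IsContact L R J speed str) (ht : t ∈ interior J)
    (f : ℝ → ℝ) : HasDerivAt (fun τ => str τ * f (speed τ)) 0 t := by
  refine (hasDerivAt_const t (0 : ℝ)).congr_of_eventuallyEq ?_
  filter_upwards [mem_interior_iff_mem_nhds.1 ht] with τ hτ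
  rw [h.2.1 τ hτ, zero_mul]

/-- Differentiate `(str * speed)² / str` by the two jump conditions. The result is a cubic in the
speed, which `State.excess_eq` identifies with the energy flux jump up to the jump of `excess`. -/
theorem IsShadow.hasDerivAt_energy (h : IsShadow L R J speed str) (hL : 0 < L.rho)
    (hR : 0 < R.rho) (ht : t ∈ interior J) :
    HasDerivAt (fun τ => str τ * speed τ ^ 2) (speed t * (R.energy - L.energy)
      - (R.energyFlux - L.energyFlux) - (R.excess (speed t) - L.excess (speed t))) t := by
  obtain ⟨h0, -, -, h1, h2⟩ := h.2 t ht
  have h3 := (h2.mul h2).div h1 h0.ne'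
  refine (h3.congr_deriv ?_).congr_of_eventuallyEq ?_
  · rw [State.excess_eq hR, State.excess_eq hL]
    simp only [Pi.mul_apply]
    field_simp
    ring
  · filter_upwards [isOpen_interior.mem_nhds ht] with τ hτ
    have := (h.2 τ hτ).1
    simp only [Pi.div_apply, Pi.mul_apply]
    field_simp

end Contact

namespace Pattern

variable {P P' : Pattern} {g q f : State → ℝ} {α αq αf : ℝ → ℝ} {φ ψ : ℝ × ℝ → ℝ} {a b t : ℝ}

theorem IsAdmissibleOn.continuousOn_slice (h : P.IsAdmissibleOn a (Set.Icc a b)) (hab : a < b)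
    (hα : Continuous α) (hψ : Continuous ψ) (hc : HasCompactSupport ψ) :
    ContinuousOn (P.slice g α ψ) (Set.Icc a b) := by
  refine ContinuousOn.congr ?_ fun t ht => (h.sorted hab ht).slice_eq g α hψ hc
  refine ContinuousOn.add (ContinuousOn.mul continuousOn_const ?_)
    (continuousOn_finsetSum _ fun i hi => ?_)
  · simpa using continuousOn_integral_moving hψ hc isCompact_Icc (pos := fun _ => 0)
      continuousOn_const Set.univ
  · obtain ⟨c1, c2, c3⟩ := h.continuousOn (Finset.mem_range.1 hi)
    refine ContinuousOn.add (continuousOn_const.mul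
      (continuousOn_integral_moving hψ hc isCompact_Icc c1 _)) ?_
    exact (c3.mul (hα.comp_continuousOn c2)).mul
      (hψ.comp_continuousOn (c1.prodMk continuousOn_id))

/-- The balance law `∂ₜ q + ∂ₓ f = 0` for one pattern. -/
theorem IsAdmissibleOn.integral_slice (h : P.IsAdmissibleOn a (Set.Icc a b)) (hab : a < b)
    (hq : Continuous αq) (hf : Continuous αf) (hαf : ∀ s, αf s = s * αq s)
    (hw : ∀ i < P.n, ∀ t ∈ Set.Ioo a b, HasDerivAt (fun τ => P.str i τ * αq (P.speed i τ))
      (P.speed i t * (q (P.state (i + 1)) - q (P.state i))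
        - (f (P.state (i + 1)) - f (P.state i))) t) (hφ : IsTest φ) :
    (∫ t in a..b, P.slice q αq (fun p => dt φ p.1 p.2) t)
      + ∫ t in a..b, P.slice f αf (fun p => dx φ p.1 p.2) t
      = P.slice q αq φ b - P.slice q αq φ a := by
  have ct := h.continuousOn_slice (g := q) hab hq hφ.continuous_dt hφ.hasCompactSupport_dt
  have cx := h.continuousOn_slice (g := f) hab hf hφ.continuous_dx hφ.hasCompactSupport_dx
  have it := ct.intervalIntegrable_of_Icc (μ := volume) hab.le
  have ix := cx.intervalIntegrable_of_Icc (μ := volume) hab.le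
  rw [← intervalIntegral.integral_add it ix]
  refine intervalIntegral.integral_eq_sub_of_hasDerivAt_of_le hab.le
    (h.continuousOn_slice hab hq hφ.1.continuous hφ.2) (fun t ht => ?_) (it.add ix)
  have hIoo : Set.Ioo a b ∈ 𝓝 t := Ioo_mem_nhds ht.1 ht.2
  have htc : t ∈ Set.Icc a b := ⟨ht.1.le, ht.2.le⟩
  have hs := h.sorted hab htc
  have key : HasDerivAt (fun τ => q (P.state 0) * (∫ x in Set.univ, φ (0 + x, τ))
      + ∑ i ∈ Finset.range P.n,
        ((q (P.state (i + 1)) - q (P.state i)) * (∫ y in Set.Ioi 0, φ (P.pos i τ + y, τ))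
        + P.str i τ * αq (P.speed i τ) * φ (P.pos i τ, τ)))
      (q (P.state 0) * (∫ x in Set.univ, ((0 : ℝ) * dx φ (0 + x) t + dt φ (0 + x) t))
      + ∑ i ∈ Finset.range P.n,
        ((q (P.state (i + 1)) - q (P.state i)) *
          (∫ y in Set.Ioi 0, (P.speed i t * dx φ (P.pos i t + y) t + dt φ (P.pos i t + y) t))
        + ((P.speed i t * (q (P.state (i + 1)) - q (P.state i))
            - (f (P.state (i + 1)) - f (P.state i))) * φ (P.pos i t, t)
          + P.str i t * αq (P.speed i t) *
            (P.speed i t * dx φ (P.pos i t) t + dt φ (P.pos i t) t)))) t := by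
    refine HasDerivAt.add ?_ (HasDerivAt.fun_sum fun i hi => ?_)
    · exact (hφ.hasDerivAt_integral_moving (pos := fun _ => 0) (speed := fun _ => 0) univ_mem
        (fun τ _ => hasDerivAt_const τ 0) continuousOn_const Set.univ).const_mul _
    · have hi := Finset.mem_range.1 hi
      have hp : ∀ τ ∈ Set.Ioo a b, HasDerivAt (P.pos i) (P.speed i τ) τ := fun τ hτ =>
        (h.2.2 i hi).1.2.2 τ (by rwa [interior_Icc])
      refine HasDerivAt.add ((hφ.hasDerivAt_integral_moving hIoo hp
        ((h.continuousOn hi).2.1.mono Set.Ioo_subset_Icc_self) _).const_mul _) ?_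
      have h1 := hφ.hasDerivAt_moving (hp t ht) 0
      simp only [add_zero] at h1
      exact (hw i hi t ht).mul h1
  refine (key.congr_of_eventuallyEq ?_).congr_deriv ?_
  · filter_upwards [hIoo] with τ hτ
    rw [(h.sorted hab ⟨hτ.1.le, hτ.2.le⟩).slice_eq q αq hφ.1.continuous hφ.2]
    simp
  · rw [hs.slice_eq q αq hφ.continuous_dt hφ.hasCompactSupport_dt,
      hs.slice_eq f αf hφ.continuous_dx hφ.hasCompactSupport_dx, hφ.integral_dx]
    simp only [zero_add, zero_mul, setIntegral_univ, mul_zero]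
    rw [add_assoc, ← Finset.sum_add_distrib]
    congr 1
    refine Finset.sum_congr rfl fun i _ => ?_
    have i1 := ((integrable_section hφ.continuous_dx hφ.hasCompactSupport_dx t).comp_add_left
      (P.pos i t)).integrableOn (s := Set.Ioi 0)
    have i2 := ((integrable_section hφ.continuous_dt hφ.hasCompactSupport_dt t).comp_add_left
      (P.pos i t)).integrableOn (s := Set.Ioi 0)
    have e := integral_add (i1.const_mul (P.speed i t)) i2
    simp only [integral_const_mul] at e
    simp only [hφ.integral_dx_Ioi] at e ⊢
    -- The weight of the flux is the speed times the weight of the density, so the delta terms with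
    -- the `x`-derivative cancel those from the motion of the front.
    rw [e, hαf]
    ring

/-! ### Initial values -/

/-- Grouping the fronts by position turns a sum over fronts into one that depends only on the point
sums, the data conserved at a collision. -/
theorem sum_mul_comp_pos {w : ℕ → ℝ} (S : Finset ℝ) (hS : ∀ i < P.n, P.pos i t ∈ S) (c : ℝ → ℝ)
    [∀ x, DecidablePred fun i => P.pos i t = x] :
    ∑ i ∈ Finset.range P.n, w i * c (P.pos i t)
      = ∑ x ∈ S, (∑ i ∈ (Finset.range P.n).filter (fun i => P.pos i t = x), w i) * c x := by
  classical
  rw [← Finset.sum_fiberwise_of_maps_to (t := S) (g := fun i => P.pos i t)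
    (fun i hi => hS i (Finset.mem_range.1 hi))]
  refine Finset.sum_congr rfl fun x _ => ?_
  rw [Finset.sum_mul]
  refine Finset.sum_congr (by congr) fun i hi => ?_
  rw [(Finset.mem_filter.1 hi).2]

theorem ae_of_cofinite {p : ℝ → Prop} (h : ∀ᶠ x in cofinite, p x) : ∀ᵐ x, p x :=
  (Set.Finite.measure_zero (show {x | ¬ p x}.Finite from h) volume)

/-- A collision preserves the point sums of strength and of strength times speed. So slices with the
weights 1 and `v` do not jump; a quadratic weight, as for the energy, has no such protection. -/
theorem StartsFrom.slice_eq_mass (h : P'.StartsFrom t (fun x => P.base x t)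
      (fun x => P.massAt x t) (fun x => P.momAt x t)) :
    P.slice g (fun _ => 1) ψ t = P'.slice g (fun _ => 1) ψ t := by
  classical
  rw [slice, slice]
  congr 1
  · refine integral_congr_ae ?_
    filter_upwards [ae_of_cofinite h.1] with x hx
    rw [hx]
  · let S := (Finset.range P.n).image (fun i => P.pos i t) ∪
      (Finset.range P'.n).image (fun i => P'.pos i t)
    simp only [mul_one]
    rw [sum_mul_comp_pos (P := P) S (fun i hi => Finset.mem_union_left _
        (Finset.mem_image_of_mem (fun i => P.pos i t) (Finset.mem_range.2 hi)))
        (fun x => ψ (x, t)),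
      sum_mul_comp_pos (P := P') S (fun i hi => Finset.mem_union_right _
        (Finset.mem_image_of_mem (fun i => P'.pos i t) (Finset.mem_range.2 hi)))
        (fun x => ψ (x, t))]
    refine Finset.sum_congr rfl fun x _ => ?_
    have := h.2.1 x
    simp only [massAt] at this
    rw [this]

theorem StartsFrom.slice_eq_mom (h : P'.StartsFrom t (fun x => P.base x t)
      (fun x => P.massAt x t) (fun x => P.momAt x t)) :
    P.slice g (fun v => v) ψ t = P'.slice g (fun v => v) ψ t := by
  classical
  rw [slice, slice]
  congr 1
  · refine integral_congr_ae ?_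
    filter_upwards [ae_of_cofinite h.1] with x hx
    rw [hx]
  · let S := (Finset.range P.n).image (fun i => P.pos i t) ∪
      (Finset.range P'.n).image (fun i => P'.pos i t)
    rw [sum_mul_comp_pos (P := P) S (fun i hi => Finset.mem_union_left _
        (Finset.mem_image_of_mem (fun i => P.pos i t) (Finset.mem_range.2 hi)))
        (fun x => ψ (x, t)),
      sum_mul_comp_pos (P := P') S (fun i hi => Finset.mem_union_right _
        (Finset.mem_image_of_mem (fun i => P'.pos i t) (Finset.mem_range.2 hi)))
        (fun x => ψ (x, t))]
    refine Finset.sum_congr rfl fun x _ => ?_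
    have := h.2.2 x
    simp only [momAt] at this
    rw [this]

/-- Strengths are nonnegative, so a vanishing point mass forces each of them to vanish. -/
theorem StartsFrom.str_eq_zero {U : ℝ → State} {m p : ℝ → ℝ} (h : P.StartsFrom a U m p)
    (ha : P.IsAdmissibleOn a (Set.Icc a b)) (hab : a < b) (hm : ∀ x, m x = 0) {i : ℕ}
    (hi : i < P.n) : P.str i a = 0 := by
  classical
  have h1 : P.massAt (P.pos i a) a = 0 := (h.2.1 _).trans (hm _)
  rw [massAt, Finset.sum_eq_zero_iff_of_nonneg (fun j hj => ha.str_nonneg ⟨le_rfl, hab.le⟩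
    (Finset.mem_range.1 (Finset.mem_filter.1 hj).1))] at h1
  exact h1 i (Finset.mem_filter.2 ⟨Finset.mem_range.2 hi, rfl⟩)

theorem slice_eq_of_str_eq_zero {U : ℝ → State} (hU : ∀ᶠ x in cofinite, P.base x t = U x)
    (h : ∀ i < P.n, P.str i t = 0) : P.slice g α ψ t = ∫ x, g (U x) * ψ (x, t) := by
  rw [slice, Finset.sum_eq_zero, add_zero]
  · refine integral_congr_ae ?_
    filter_upwards [ae_of_cofinite hU] with x hx
    rw [hx]
  · intro i hi
    rw [h i (Finset.mem_range.1 hi), zero_mul, zero_mul]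

end Pattern

/-! ### Admissible solutions are weak solutions -/

namespace WaveTracking

variable {W W' : WaveTracking} {U₀ : ℝ → State} {g q f : State → ℝ} {α αq αf : ℝ → ℝ}
  {φ ψ : ℝ × ℝ → ℝ} {B : ℝ} {k : ℕ}

/-- The left ends of the slabs, followed by `B`. -/
noncomputable def ends (W : WaveTracking) (B : ℝ) (k : ℕ) : ℝ := if k ≤ W.K then W.T k else B

/-- The action of the limit of `g(U^ε)` on `ψ`, if `ψ` vanishes for `t ≥ B`. -/
noncomputable def limInt (W : WaveTracking) (B : ℝ) (g : State → ℝ) (α : ℝ → ℝ)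
    (ψ : ℝ × ℝ → ℝ) : ℝ :=
  ∑ k ∈ Finset.range (W.K + 1), ∫ t in W.ends B k..W.ends B (k + 1), (W.slab k).slice g α ψ t

theorem ends_of_le (hk : k ≤ W.K) : W.ends B k = W.T k := if_pos hk

theorem ends_last : W.ends B (W.K + 1) = B := if_neg (by omega)

theorem IsSolution.ends_lt (h : W.IsSolution U₀) (hB : W.T W.K < B) (hk : k ≤ W.K) :
    W.ends B k < W.ends B (k + 1) := by
  rw [ends_of_le hk]
  rcases hk.lt_or_eq with h1 | rfl
  · rw [ends_of_le h1]; exact h.2.1 k h1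
  · rwa [ends_last]

theorem IsSolution.Icc_ends_subset (hk : k ≤ W.K) :
    Set.Icc (W.ends B k) (W.ends B (k + 1)) ⊆ W.times k := by
  rw [ends_of_le hk]
  rcases hk.lt_or_eq with h1 | rfl
  · rw [ends_of_le h1, times_of_lt h1]
  · rw [ends_last, times_last]; exact Set.Icc_subset_Ici_self

theorem IsSolution.admissible (h : W.IsSolution U₀) (hk : k ≤ W.K) :
    (W.slab k).IsAdmissibleOn (W.ends B k) (Set.Icc (W.ends B k) (W.ends B (k + 1))) := by
  have := (h.2.2.1 k hk).mono (IsSolution.Icc_ends_subset (B := B) hk)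
  rwa [ends_of_le hk] at this ⊢

theorem IsSolution.T_le (h : W.IsSolution U₀) {j k : ℕ} (hjk : j ≤ k) (hk : k ≤ W.K) :
    W.T j ≤ W.T k := by
  induction k, hjk using Nat.le_induction with
  | base => exact le_rfl
  | succ k hk' ih => exact (ih (Nat.le_of_succ_le hk)).trans (h.2.1 k hk).le

/-- The net counts the collision times up to `t`, so on half-open intervals it uses exactly one
slab. -/
theorem IsSolution.net_eq (h : W.IsSolution U₀) (hk : k ≤ W.K) {t : ℝ}
    (ht : t ∈ Set.Ico (W.ends B k) (W.ends B (k + 1))) (ε x : ℝ) :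
    W.net ε x t = (W.slab k).net ε x t := by
  classical
  rw [ends_of_le hk] at ht
  have : (Finset.Icc 1 W.K).filter (fun k => W.T k ≤ t) = Finset.Icc 1 k := by
    ext j
    rw [Finset.mem_filter, Finset.mem_Icc, Finset.mem_Icc]
    constructor
    · rintro ⟨⟨h1, h2⟩, h3⟩
      refine ⟨h1, ?_⟩
      by_contra! hlt
      have hk1 : k + 1 ≤ W.K := (Nat.succ_le_of_lt hlt).trans h2
      have := h.T_le (Nat.succ_le_of_lt hlt) h2
      have h4 := ht.2
      rw [ends_of_le hk1] at h4
      exact absurd (h4.trans_le this) (not_lt.2 h3)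
    · rintro ⟨h1, h2⟩
      exact ⟨⟨h1, h2.trans hk⟩, (h.T_le h2 hk).trans ht.1⟩
  have hcard := congrArg Finset.card this
  rw [Nat.card_Icc, Nat.add_sub_cancel] at hcard
  rw [net]
  convert rfl using 3
  exact hcard.symm

theorem IsSolution.intervalIntegral_net (h : W.IsSolution U₀) (hB : W.T W.K < B) (hk : k ≤ W.K)
    (ε : ℝ) : (fun t => ∫ x, g ((W.slab k).net ε x t) * ψ (x, t)) =ᵐ[volume.restrict
      (Set.uIoc (W.ends B k) (W.ends B (k + 1)))] fun t => ∫ x, g (W.net ε x t) * ψ (x, t) := by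
  rw [Set.uIoc_of_le (h.ends_lt hB hk).le]
  refine (ae_restrict_iff' measurableSet_Ioc).2 ?_
  filter_upwards [Measure.ae_ne volume (W.ends B (k + 1))] with t htb ht
  simp only [h.net_eq hk ⟨ht.1.le, lt_of_le_of_ne ht.2 htb⟩]

theorem IsSolution.intervalIntegrable (h : W.IsSolution U₀) (hB : W.T W.K < B)
    (hg : IsFlux g α) (hψ : Continuous ψ) (hc : HasCompactSupport ψ) {ε : ℝ}
    (hε : ε ∈ Set.Ioc (0 : ℝ) 1) (k : ℕ) (hk : k < W.K + 1) :
    IntervalIntegrable (fun t => ∫ x, g (W.net ε x t) * ψ (x, t)) volume (W.ends B k)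
      (W.ends B (k + 1)) :=
  ((h.admissible (Nat.lt_succ_iff.1 hk)).intervalIntegrable_net
    (h.ends_lt hB (Nat.lt_succ_iff.1 hk)) hg hψ hc hε).congr_ae
    (h.intervalIntegral_net hB (Nat.lt_succ_iff.1 hk) ε)

theorem IsSolution.zero_lt (h : W.IsSolution U₀) (hB : W.T W.K < B) : 0 < B := by
  have := h.T_le (Nat.zero_le W.K) le_rfl
  rw [h.1] at this
  exact this.trans_lt hB

theorem IsSolution.integrableOn_net (h : W.IsSolution U₀) (hB : W.T W.K < B)
    (hg : IsFlux g α) (hψ : Continuous ψ) (hc : HasCompactSupport ψ)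
    (hz : ∀ x t, B ≤ t → ψ (x, t) = 0) {ε : ℝ} (hε : ε ∈ Set.Ioc (0 : ℝ) 1) :
    IntegrableOn (fun t => ∫ x, g (W.net ε x t) * ψ (x, t)) (Set.Ioi 0) ∧
      ∫ t in Set.Ioi 0, ∫ x, g (W.net ε x t) * ψ (x, t) = ∑ k ∈ Finset.range (W.K + 1),
        ∫ t in W.ends B k..W.ends B (k + 1), ∫ x, g ((W.slab k).net ε x t) * ψ (x, t) := by
  have hint := IntervalIntegrable.trans_iterate (h.intervalIntegrable hB hg hψ hc hε)
  have e0 : W.ends B 0 = 0 := by rw [ends_of_le (Nat.zero_le _), h.1]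
  rw [e0, ends_last] at hint
  have hB0 := h.zero_lt hB
  have hvan : ∀ t ∈ Set.Ioi (0 : ℝ) \ Set.Ioc 0 B, ∫ x, g (W.net ε x t) * ψ (x, t) = 0 := by
    intro t ht
    have : B ≤ t := by
      by_contra! hlt
      exact ht.2 ⟨ht.1, hlt.le⟩
    simp only [hz _ _ this, mul_zero, integral_zero]
  refine ⟨?_, ?_⟩
  · exact ((intervalIntegrable_iff_integrableOn_Ioc_of_le hB0.le).1
      hint).of_forall_sdiff_eq_zero measurableSet_Ioi hvan
  · rw [setIntegral_eq_of_subset_of_forall_sdiff_eq_zero measurableSet_Ioi Set.Ioc_subset_Ioi_self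
      hvan, ← intervalIntegral.integral_of_le hB0.le]
    have e := intervalIntegral.sum_integral_adjacent_intervals
      (h.intervalIntegrable hB hg hψ hc hε)
    rw [e0, ends_last] at e
    rw [← e]
    refine Finset.sum_congr rfl fun k hk => ?_
    exact (intervalIntegral.integral_congr_ae_restrict
      (h.intervalIntegral_net hB (Nat.lt_succ_iff.1 (Finset.mem_range.1 hk)) ε)).symm

/-- The limit of `∫∫ g(U^ε) ψ` as `ε → 0`. -/
theorem IsSolution.tendsto_limInt (h : W.IsSolution U₀) (hB : W.T W.K < B)
    (hg : IsFlux g α) (hψ : Continuous ψ) (hc : HasCompactSupport ψ)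
    (hz : ∀ x t, B ≤ t → ψ (x, t) = 0) :
    Tendsto (fun ε => ∫ t in Set.Ioi 0, ∫ x, g (W.net ε x t) * ψ (x, t)) (𝓝[>] 0)
      (𝓝 (W.limInt B g α ψ)) := by
  refine Tendsto.congr' ?_ (tendsto_finsetSum (Finset.range (W.K + 1)) fun k hk =>
    (h.admissible (B := B) (Nat.lt_succ_iff.1 (Finset.mem_range.1 hk))).tendsto_integral_slice
      (h.ends_lt hB (Nat.lt_succ_iff.1 (Finset.mem_range.1 hk))) hg hψ hc)
  filter_upwards [Ioc_mem_nhdsGT one_pos] with ε hε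
  exact (h.integrableOn_net hB hg hψ hc hz hε).2.symm

/-- By uniqueness the limit functional can be computed from any one explicit solution and then used
for all others. -/
theorem IsSolution.limInt_eq (h : W.IsSolution U₀) (h' : W'.IsSolution U₀) (hB : W.T W.K < B) :
    W'.T W'.K < B ∧ W'.limInt B g α ψ = W.limInt B g α ψ := by
  obtain ⟨hK, hu⟩ := h.unique h'
  refine ⟨by rw [← hK, ← (hu W.K le_rfl).1]; exact hB, ?_⟩
  rw [limInt, limInt, ← hK]
  refine Finset.sum_congr rfl fun k hk => ?_
  have hk := Nat.lt_succ_iff.1 (Finset.mem_range.1 hk)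
  have he : ∀ j, W'.ends B j = W.ends B j := by
    intro j
    rw [ends, ends, ← hK]
    split_ifs with hj
    · exact (hu j hj).1.symm
    · rfl
  rw [he, he]
  refine intervalIntegral.integral_congr fun t ht => ?_
  rw [Set.uIcc_of_le (h.ends_lt hB hk).le] at ht
  exact ((hu k hk).2.2.slice (IsSolution.Icc_ends_subset hk ht)).symm

/-- Summing the balance laws of the slabs, the boundary terms at collision times cancel by `hjump`.
What remains is the initial slice, which carries no delta, and the final one, where the test
function vanishes. -/
theorem IsSolution.satisfiesLaw (h : W.IsSolution U₀) (hq : IsFlux q αq) (hf : IsFlux f αf)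
    (hαf : ∀ s, αf s = s * αq s)
    (hw : ∀ k ≤ W.K, ∀ i < (W.slab k).n, ∀ t ∈ interior (W.times k),
      HasDerivAt (fun τ => (W.slab k).str i τ * αq ((W.slab k).speed i τ))
      ((W.slab k).speed i t * (q ((W.slab k).state (i + 1)) - q ((W.slab k).state i))
        - (f ((W.slab k).state (i + 1)) - f ((W.slab k).state i))) t)
    (hjump : ∀ k < W.K, ∀ φ, (W.slab k).slice q αq φ (W.T (k + 1))
      = (W.slab (k + 1)).slice q αq φ (W.T (k + 1))) :
    SatisfiesLaw W.net U₀ q f := by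
  intro φ hφ
  obtain ⟨R₀, -, -, -, -, hz₀⟩ := exists_bounds hφ.1.continuous hφ.2
  obtain ⟨R₁, -, -, -, -, hz₁⟩ := exists_bounds hφ.continuous_dx hφ.hasCompactSupport_dx
  obtain ⟨R₂, -, -, -, -, hz₂⟩ := exists_bounds hφ.continuous_dt hφ.hasCompactSupport_dt
  -- `B` lies beyond the support in time of the test function and of its two derivatives, and after
  -- the last collision.
  set B := max (max R₀ R₁) (max R₂ (W.T W.K + 1)) with hBdef
  have b0 : R₀ ≤ B := (le_max_left _ _).trans (le_max_left _ _)
  have b1 : R₁ ≤ B := (le_max_right _ _).trans (le_max_left _ _)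
  have b2 : R₂ ≤ B := (le_max_left _ _).trans (le_max_right _ _)
  have hB : W.T W.K < B :=
    (lt_add_one _).trans_le ((le_max_right _ _).trans (le_max_right _ _))
  have z0 : ∀ x t, B ≤ t → φ (x, t) = 0 := fun x t ht =>
    hz₀ x t (.inr ((b0.trans ht).trans (le_abs_self t)))
  have z1 : ∀ x t, B ≤ t → dx φ x t = 0 := fun x t ht =>
    hz₁ x t (.inr ((b1.trans ht).trans (le_abs_self t)))
  have z2 : ∀ x t, B ≤ t → dt φ x t = 0 := fun x t ht =>
    hz₂ x t (.inr ((b2.trans ht).trans (le_abs_self t)))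
  have lt := h.tendsto_limInt hB hq hφ.continuous_dt hφ.hasCompactSupport_dt z2
  have lx := h.tendsto_limInt hB hf hφ.continuous_dx hφ.hasCompactSupport_dx z1
  have hinit : (W.slab 0).slice q αq φ (W.T 0) = ∫ x, q (U₀ x) * φ (x, 0) := by
    rw [h.1]
    refine Pattern.slice_eq_of_str_eq_zero h.2.2.2.1.1 fun i hi => ?_
    have ha := h.admissible (B := B) (Nat.zero_le W.K)
    have hl := h.ends_lt hB (Nat.zero_le W.K)
    rw [ends_of_le (Nat.zero_le _), h.1] at ha hl
    exact h.2.2.2.1.str_eq_zero ha hl (fun _ => rfl) hi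
  have hval : W.limInt B q αq (fun p => dt φ p.1 p.2) + W.limInt B f αf (fun p => dx φ p.1 p.2)
      = -∫ x, q (U₀ x) * φ (x, 0) := by
    rw [limInt, limInt, ← Finset.sum_add_distrib, ← hinit]
    -- The value 0 after the last slab stands for the slice at time `B`, so that the whole sum
    -- telescopes.
    set u : ℕ → ℝ := fun k => if k ≤ W.K then (W.slab k).slice q αq φ (W.T k) else 0 with hu
    have hstep : ∀ k ∈ Finset.range (W.K + 1),
        (∫ t in W.ends B k..W.ends B (k + 1), (W.slab k).slice q αq (fun p => dt φ p.1 p.2) t)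
        + (∫ t in W.ends B k..W.ends B (k + 1), (W.slab k).slice f αf (fun p => dx φ p.1 p.2) t)
        = u (k + 1) - u k := by
      intro k hk
      have hk := Nat.lt_succ_iff.1 (Finset.mem_range.1 hk)
      have hl := h.ends_lt hB hk
      rw [(h.admissible hk).integral_slice hl hq.1 hf.1 hαf (fun i hi t ht => hw k hk i hi t
        (interior_mono (IsSolution.Icc_ends_subset (B := B) hk) (by rwa [interior_Icc]))) hφ]
      simp only [hu, if_pos hk, ends_of_le hk]
      congr 1
      rcases hk.lt_or_eq with h1 | rfl
      · rw [if_pos (Nat.succ_le_of_lt h1), ends_of_le h1]; exact hjump k h1 φ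
      · rw [if_neg (by omega), ends_last, Pattern.slice]
        simp [z0 _ B le_rfl]
    rw [Finset.sum_congr rfl hstep, Finset.sum_range_sub]
    simp [hu]
  have hfin := (lt.add lx).add_const (∫ x, q (U₀ x) * φ (x, 0))
  rw [hval, neg_add_cancel] at hfin
  refine hfin.congr' ?_
  filter_upwards [Ioc_mem_nhdsGT one_pos] with ε hε
  rw [residual, ← integral_add
    (h.integrableOn_net hB hq hφ.continuous_dt hφ.hasCompactSupport_dt z2 hε).1
    (h.integrableOn_net hB hf hφ.continuous_dx hφ.hasCompactSupport_dx z1 hε).1]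
  congr 1
  refine integral_congr_ae (ae_of_all _ fun t => ?_)
  refine (integral_add ?_ ?_).symm
  · exact Pattern.integrable_net_mul hq _ ε t
      (integrable_section hφ.continuous_dt hφ.hasCompactSupport_dt t)
  · exact Pattern.integrable_net_mul hf _ ε t
      (integrable_section hφ.continuous_dx hφ.hasCompactSupport_dx t)

theorem IsSolution.isWeakSolution (h : W.IsSolution U₀) : IsWeakSolution W.net U₀ := by
  constructor
  · refine h.satisfiesLaw isFlux_rho isFlux_mom (fun s => by simp) (fun k hk i hi t ht => ?_)
      (fun k hk φ => (h.2.2.2.2 k hk).2.slice_eq_mass)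
    have ha := h.2.2.1 k hk
    rcases (ha.2.2 i hi).2 with h' | h'
    · rw [(h'.laws (ha.1 i hi.le) (ha.1 (i + 1) hi) (interior_subset ht)).1]
      exact h'.hasDerivAt_zero ht fun _ => 1
    · simpa using (h'.1.2 t ht).2.2.2.1
  · refine h.satisfiesLaw isFlux_mom isFlux_momFlux (fun s => rfl) (fun k hk i hi t ht => ?_)
      (fun k hk φ => (h.2.2.2.2 k hk).2.slice_eq_mom)
    have ha := h.2.2.1 k hk
    rcases (ha.2.2 i hi).2 with h' | h'
    · rw [(h'.laws (ha.1 i hi.le) (ha.1 (i + 1) hi) (interior_subset ht)).2.1]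
      exact h'.hasDerivAt_zero ht fun v => v
    · exact (h'.1.2 t ht).2.2.2.2

/-- Energy is conserved if the shadow waves do not dissipate it and do not collide. -/
theorem IsSolution.conservesEnergy (h : W.IsSolution U₀)
    (hz : ∀ k < W.K, ∀ i < (W.slab k).n, (W.slab k).str i (W.T (k + 1)) = 0)
    (hex : ∀ k ≤ W.K, ∀ i < (W.slab k).n, ∀ t ∈ interior (W.times k), 0 < (W.slab k).str i t →
      ((W.slab k).state (i + 1)).excess ((W.slab k).speed i t)
        = ((W.slab k).state i).excess ((W.slab k).speed i t)) :
    ConservesEnergy W.net U₀ := by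
  refine h.satisfiesLaw isFlux_energy isFlux_energyFlux (fun s => rfl) (fun k hk i hi t ht => ?_)
    (fun k hk φ => ?_)
  · have ha := h.2.2.1 k hk
    rcases (ha.2.2 i hi).2 with h' | h'
    · rw [(h'.laws (ha.1 i hi.le) (ha.1 (i + 1) hi) (interior_subset ht)).2.2]
      exact h'.hasDerivAt_zero ht fun v => v ^ 2
    · have := h'.1.hasDerivAt_energy (ha.1 i hi.le) (ha.1 (i + 1) hi) ht
      rwa [hex k hk i hi t ht (h'.1.2 t ht).1, sub_self, sub_zero] at this
  · have hs := (h.2.2.2.2 k hk).2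
    rw [Pattern.slice_eq_of_str_eq_zero (Eventually.of_forall fun x => rfl) (hz k hk),
      Pattern.slice_eq_of_str_eq_zero hs.1 fun i hi => ?_]
    have hB : W.T W.K < W.T W.K + 1 := lt_add_one _
    have ha := h.admissible (B := W.T W.K + 1) (Nat.succ_le_of_lt hk)
    have hl := h.ends_lt hB (Nat.succ_le_of_lt hk)
    rw [ends_of_le (Nat.succ_le_of_lt hk)] at ha hl
    refine hs.str_eq_zero ha hl (fun x => ?_) hi
    exact Finset.sum_eq_zero fun i hi => hz k hk i (Finset.mem_range.1 (Finset.mem_filter.1 hi).1)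

end WaveTracking

end Chaplygin

namespace Chaplygin

/-! ### Explicit shadow waves with positive initial strength -/

namespace State

theorem pull_lam1 {U : State} (h : 0 < U.rho) : U.pull U.lam1 = 0 := by
  rw [pull_eq h]; ring

theorem pull_lam2 {U : State} (h : 0 < U.rho) : U.pull U.lam2 = 0 := by
  rw [pull_eq h]; ring

theorem two_le_flux {L R : State} (hL : 0 < L.rho) (hR : 0 < R.rho) {s : ℝ} (h₁ : R.lam2 ≤ s)
    (h₂ : s ≤ L.lam1) : 2 ≤ s * (R.rho - L.rho) - (R.mom - L.mom) := by
  have := mass_flux_right hR h₁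
  have := mass_flux_left hL h₂
  linarith

end State

namespace DeltaShock

/-- The flux of mass into a front of speed `λ₂(R)`. -/
noncomputable def inflow (L R : State) : ℝ := R.lam2 * (R.rho - L.rho) - (R.mom - L.mom)

/-- The strength at time `τ` of the shadow wave with initial strength `m` and speed `s`. -/
noncomputable def str (L R : State) (m s τ : ℝ) : ℝ :=
  √(m ^ 2 + 2 * m * (s * (R.rho - L.rho) - (R.mom - L.mom)) * τ
    + ((R.mom - L.mom) ^ 2 - (R.rho - L.rho) * (R.momFlux - L.momFlux)) * τ ^ 2)

/-- The displacement relative to the speed `λ₂(R)`. -/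
noncomputable def rel (L R : State) (m s τ : ℝ) : ℝ :=
  (2 * (m * (s - R.lam2)) * τ + (L.pull R.lam2 - R.pull R.lam2) * τ ^ 2)
    / (str L R m s τ + m + inflow L R * τ)

/-- The displacement at time `τ` of the shadow wave with initial strength `m` and speed `s`. -/
noncomputable def pos (L R : State) (m s τ : ℝ) : ℝ := R.lam2 * τ + rel L R m s τ

/-- The speed at time `τ` of the shadow wave with initial strength `m` and speed `s`. -/
noncomputable def speed (L R : State) (m s τ : ℝ) : ℝ :=
  (m * s + (R.mom - L.mom) * pos L R m s τ - (R.momFlux - L.momFlux) * τ) / str L R m s τ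

variable {L R : State} {m s τ : ℝ}

/-- The leading coefficient of the radicand factors through the jumps of λ₁ and λ₂, both of which
are positive in the overcompressive case. -/
theorem discr_nonneg (hL : 0 < L.rho) (hR : 0 < R.rho) (h : R.lam2 ≤ L.lam1) :
    0 ≤ (R.mom - L.mom) ^ 2 - (R.rho - L.rho) * (R.momFlux - L.momFlux) := by
  have e : (R.mom - L.mom) ^ 2 - (R.rho - L.rho) * (R.momFlux - L.momFlux)
      = L.rho * R.rho * ((L.lam1 - R.lam1) * (L.lam2 - R.lam2)) := by
    simp only [State.mom, State.momFlux, State.lam1, State.lam2]; field_simp; ring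
  have := State.lam1_lt_lam2 hL
  have := State.lam1_lt_lam2 hR
  rw [e]
  exact mul_nonneg (by positivity) (mul_nonneg (by linarith) (by linarith))

theorem inflow_pos (hL : 0 < L.rho) (hR : 0 < R.rho) (h : R.lam2 ≤ L.lam1) :
    0 < inflow L R := by
  have := State.two_le_flux hL hR le_rfl h
  rw [inflow]; linarith

theorem radicand_pos (hL : 0 < L.rho) (hR : 0 < R.rho) (hs : R.lam2 ≤ s ∧ s ≤ L.lam1)
    (hm : 0 < m) (hτ : 0 ≤ τ) :
    0 < m ^ 2 + 2 * m * (s * (R.rho - L.rho) - (R.mom - L.mom)) * τ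
      + ((R.mom - L.mom) ^ 2 - (R.rho - L.rho) * (R.momFlux - L.momFlux)) * τ ^ 2 := by
  have h1 := State.two_le_flux hL hR hs.1 hs.2
  have h2 := discr_nonneg hL hR (hs.1.trans hs.2)
  have : 0 ≤ 2 * m * (s * (R.rho - L.rho) - (R.mom - L.mom)) * τ :=
    mul_nonneg (mul_nonneg (by positivity) (by linarith)) hτ
  positivity

theorem str_pos (hL : 0 < L.rho) (hR : 0 < R.rho) (hs : R.lam2 ≤ s ∧ s ≤ L.lam1)
    (hm : 0 < m) (hτ : 0 ≤ τ) : 0 < str L R m s τ :=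
  Real.sqrt_pos.2 (radicand_pos hL hR hs hm hτ)

theorem denom_pos (hL : 0 < L.rho) (hR : 0 < R.rho) (hs : R.lam2 ≤ s ∧ s ≤ L.lam1)
    (hm : 0 < m) (hτ : 0 ≤ τ) : 0 < str L R m s τ + m + inflow L R * τ := by
  have := str_pos hL hR hs hm hτ
  have := inflow_pos hL hR (hs.1.trans hs.2)
  positivity

/-- The conic is quadratic in the displacement with leading coefficient `[ρ] / 2`, which may vanish.
The root is therefore written in rationalized form, with a denominator kept positive by the inflow
in the frame of speed λ₂(R); this identity recovers the usual form of the root. -/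
theorem rho_mul_rel (hL : 0 < L.rho) (hR : 0 < R.rho) (hs : R.lam2 ≤ s ∧ s ≤ L.lam1)
    (hm : 0 < m) (hτ : 0 ≤ τ) :
    (R.rho - L.rho) * rel L R m s τ = str L R m s τ - (m + inflow L R * τ) := by
  have hD := denom_pos hL hR hs hm hτ
  have hS : str L R m s τ ^ 2 = _ := Real.sq_sqrt (radicand_pos hL hR hs hm hτ).le
  rw [rel, ← mul_div_assoc, div_eq_iff hD.ne']
  have : (str L R m s τ - (m + inflow L R * τ)) * (str L R m s τ + m + inflow L R * τ)
      = str L R m s τ ^ 2 - (m + inflow L R * τ) ^ 2 := by ring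
  rw [this, hS]
  simp only [inflow, State.pull]
  ring

theorem str_eq (hL : 0 < L.rho) (hR : 0 < R.rho) (hs : R.lam2 ≤ s ∧ s ≤ L.lam1)
    (hm : 0 < m) (hτ : 0 ≤ τ) :
    str L R m s τ = m + (R.rho - L.rho) * pos L R m s τ - (R.mom - L.mom) * τ := by
  have := rho_mul_rel hL hR hs hm hτ
  simp only [pos, inflow] at *
  linarith

theorem rel_conic (hL : 0 < L.rho) (hR : 0 < R.rho) (hs : R.lam2 ≤ s ∧ s ≤ L.lam1)
    (hm : 0 < m) (hτ : 0 ≤ τ) :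
    (R.rho - L.rho) * rel L R m s τ * rel L R m s τ / 2 + (m + inflow L R * τ) * rel L R m s τ
      = m * (s - R.lam2) * τ + (L.pull R.lam2 - R.pull R.lam2) * τ ^ 2 / 2 := by
  have hD := denom_pos hL hR hs hm hτ
  have h2 : rel L R m s τ * (str L R m s τ + m + inflow L R * τ)
      = 2 * (m * (s - R.lam2)) * τ + (L.pull R.lam2 - R.pull R.lam2) * τ ^ 2 :=
    div_mul_cancel₀ _ hD.ne'
  rw [rho_mul_rel hL hR hs hm hτ]
  linarith

theorem str_mul_speed (hL : 0 < L.rho) (hR : 0 < R.rho) (hs : R.lam2 ≤ s ∧ s ≤ L.lam1)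
    (hm : 0 < m) (hτ : 0 ≤ τ) : str L R m s τ * speed L R m s τ
      = m * s + (R.mom - L.mom) * pos L R m s τ - (R.momFlux - L.momFlux) * τ :=
  mul_div_cancel₀ _ (str_pos hL hR hs hm hτ).ne'

/-- Implicit differentiation of the conic: the factor of the derivative is the strength, which is
positive. -/
theorem hasDerivAt_pos (hL : 0 < L.rho) (hR : 0 < R.rho) (hs : R.lam2 ≤ s ∧ s ≤ L.lam1)
    (hm : 0 < m) (hτ : 0 < τ) : HasDerivAt (pos L R m s) (speed L R m s τ) τ := by
  have hD := denom_pos hL hR hs hm hτ.le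
  have hid : HasDerivAt (fun τ : ℝ => τ) 1 τ := hasDerivAt_id τ
  have hS : DifferentiableAt ℝ (str L R m s) τ := by
    have := (radicand_pos hL hR hs hm hτ.le).ne'
    unfold str
    exact DifferentiableAt.sqrt (by fun_prop) this
  have hY : DifferentiableAt ℝ (rel L R m s) τ := by
    unfold rel
    exact DifferentiableAt.div (by fun_prop) (by fun_prop) hD.ne'
  have dY := hY.hasDerivAt
  have d1 := ((((dY.const_mul (R.rho - L.rho)).mul dY).div_const 2).add
    (((hid.const_mul (inflow L R)).const_add m).mul dY))
  have d2 := (hid.const_mul (m * (s - R.lam2))).add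
    (((hid.pow 2).const_mul (L.pull R.lam2 - R.pull R.lam2)).div_const 2)
  have hev : (fun τ => (R.rho - L.rho) * rel L R m s τ * rel L R m s τ / 2
      + (m + inflow L R * τ) * rel L R m s τ) =ᶠ[𝓝 τ]
      fun τ => m * (s - R.lam2) * τ + (L.pull R.lam2 - R.pull R.lam2) * τ ^ 2 / 2 := by
    filter_upwards [lt_mem_nhds hτ] with x hx
    exact rel_conic hL hR hs hm hx.le
  have hu := d1.unique (d2.congr_of_eventuallyEq hev)
  have hpos : HasDerivAt (pos L R m s) (R.lam2 * 1 + deriv (rel L R m s) τ) τ :=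
    (hid.const_mul R.lam2).add dY
  refine hpos.congr_deriv ?_
  have hsp := str_pos hL hR hs hm hτ.le
  rw [speed, eq_div_iff hsp.ne']
  have e := rho_mul_rel hL hR hs hm hτ.le
  have e' : str L R m s τ = (R.rho - L.rho) * rel L R m s τ + (m + inflow L R * τ) := by linarith
  rw [e', pos]
  simp only [State.pull, inflow, Nat.cast_ofNat, Nat.add_one_sub_one, pow_one] at hu ⊢
  linarith

theorem pos_zero : pos L R m s 0 = 0 := by simp [pos, rel]

theorem str_zero (hm : 0 < m) : str L R m s 0 = m := by simp [str, Real.sqrt_sq hm.le]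

theorem speed_zero (hm : 0 < m) : speed L R m s 0 = s := by
  rw [speed, pos_zero, str_zero hm]; field_simp; ring

theorem continuousAt_str (L R : State) (p : ℝ × ℝ × ℝ) :
    ContinuousAt (fun p : ℝ × ℝ × ℝ => str L R p.1 p.2.1 p.2.2) p := by
  unfold str; fun_prop

theorem continuousAt_pos (hL : 0 < L.rho) (hR : 0 < R.rho) {p : ℝ × ℝ × ℝ}
    (hs : R.lam2 ≤ p.2.1 ∧ p.2.1 ≤ L.lam1) (hm : 0 < p.1) (hτ : 0 ≤ p.2.2) :
    ContinuousAt (fun p : ℝ × ℝ × ℝ => pos L R p.1 p.2.1 p.2.2) p := by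
  have h := denom_pos hL hR hs hm hτ
  have := continuousAt_str L R p
  unfold pos rel
  refine ContinuousAt.add (by fun_prop) (ContinuousAt.div (by fun_prop) (by fun_prop) h.ne')

theorem continuousAt_speed (hL : 0 < L.rho) (hR : 0 < R.rho) {p : ℝ × ℝ × ℝ}
    (hs : R.lam2 ≤ p.2.1 ∧ p.2.1 ≤ L.lam1) (hm : 0 < p.1) (hτ : 0 ≤ p.2.2) :
    ContinuousAt (fun p : ℝ × ℝ × ℝ => speed L R p.1 p.2.1 p.2.2) p := by
  have h := str_pos hL hR hs hm hτ
  have := continuousAt_str L R p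
  have := continuousAt_pos hL hR hs hm hτ
  unfold speed
  exact ContinuousAt.div (by fun_prop) (by fun_prop) h.ne'

theorem isFront (hL : 0 < L.rho) (hR : 0 < R.rho) (hs : R.lam2 ≤ s ∧ s ≤ L.lam1)
    (hm : 0 < m) (a p : ℝ) :
    IsFront (Set.Ici a) (fun t => p + pos L R m s (t - a)) (fun t => speed L R m s (t - a)) := by
  refine ⟨fun t ht => ?_, fun t ht => ?_, fun t ht => ?_⟩
  · have := (continuousAt_pos hL hR (p := (m, s, t - a)) hs hm (sub_nonneg.2 ht)).comp
      (f := fun t : ℝ => (m, s, t - a)) (x := t) (by fun_prop)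
    exact (continuousAt_const.add this).continuousWithinAt
  · exact ((continuousAt_speed hL hR (p := (m, s, t - a)) hs hm (sub_nonneg.2 ht)).comp
      (f := fun t : ℝ => (m, s, t - a)) (x := t) (by fun_prop)).continuousWithinAt
  · rw [interior_Ici] at ht
    exact ((hasDerivAt_pos hL hR hs hm (sub_pos.2 ht)).comp_sub_const t a).const_add p

theorem rankineHugoniot (hL : 0 < L.rho) (hR : 0 < R.rho) (hs : R.lam2 ≤ s ∧ s ≤ L.lam1)
    (hm : 0 < m) (a p : ℝ) :
    RankineHugoniot L R (Set.Ici a) (fun t => p + pos L R m s (t - a))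
      (fun t => speed L R m s (t - a)) (fun t => str L R m s (t - a)) := by
  have hid : ∀ t, HasDerivAt (fun t : ℝ => t - a) 1 t := fun t => (hasDerivAt_id t).sub_const a
  have hev : ∀ t ∈ interior (Set.Ici a), ∀ᶠ x in 𝓝 t, 0 ≤ x - a := by
    intro t ht
    rw [interior_Ici] at ht
    filter_upwards [lt_mem_nhds ht] with x hx
    exact sub_nonneg.2 (le_of_lt hx)
  have hp : ∀ t ∈ interior (Set.Ici a), HasDerivAt (fun t => pos L R m s (t - a))
      (speed L R m s (t - a)) t := by
    intro t ht
    rw [interior_Ici] at ht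
    exact (hasDerivAt_pos hL hR hs hm (sub_pos.2 ht)).comp_sub_const t a
  refine ⟨isFront hL hR hs hm a p, fun t ht => ?_, fun t ht => ?_, fun t ht => ?_⟩
  · exact ((continuousAt_str L R (m, s, t - a)).comp
      (f := fun t : ℝ => (m, s, t - a)) (x := t) (by fun_prop)).continuousWithinAt
  · refine ((((hp t ht).const_mul (R.rho - L.rho)).const_add m).sub
      ((hid t).const_mul (R.mom - L.mom))).congr_of_eventuallyEq ?_ |>.congr_deriv (by ring)
    filter_upwards [hev t ht] with x hx
    exact str_eq hL hR hs hm hx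
  · refine ((((hp t ht).const_mul (R.mom - L.mom)).const_add (m * s)).sub
      ((hid t).const_mul (R.momFlux - L.momFlux))).congr_of_eventuallyEq ?_
      |>.congr_deriv (by ring)
    filter_upwards [hev t ht] with x hx
    exact str_mul_speed hL hR hs hm hx

theorem _root_.Chaplygin.RankineHugoniot.mono {J J' : Set ℝ} {pos speed str : ℝ → ℝ}
    (h : RankineHugoniot L R J pos speed str) (hJ : J' ⊆ J) :
    RankineHugoniot L R J' pos speed str :=
  ⟨h.front.mono hJ, h.cont.mono hJ, fun t ht => h.mass t (interior_mono hJ ht),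
    fun t ht => h.mom t (interior_mono hJ ht)⟩

/-- The overcompressive condition persists because λ₂(R) and λ₁(L) are barriers for the speed: at
each of them the pull of one side vanishes and that of the other is nonnegative. -/
theorem isShadow (hL : 0 < L.rho) (hR : 0 < R.rho) (hs : R.lam2 ≤ s ∧ s ≤ L.lam1)
    (hm : 0 < m) (a : ℝ) :
    IsShadow L R (Set.Ici a) (fun t => speed L R m s (t - a)) (fun t => str L R m s (t - a)) := by
  have h := rankineHugoniot hL hR hs hm a 0
  refine ⟨h.cont, fun t ht => ⟨str_pos hL hR hs hm (sub_nonneg.2 (interior_subset ht)), ?_, ?_,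
    h.mass t ht, h.mom t ht⟩⟩
  · have h' := h.mono (Set.Icc_subset_Ici_self : Set.Icc a t ⊆ Set.Ici a)
    refine h'.le_speed (fun x hx => str_pos hL hR hs hm (sub_nonneg.2 hx.1)) ?_ ?_ ?_
      ⟨interior_subset ht, le_rfl⟩
    · rw [State.pull_lam2 hR]; exact State.pull_nonneg_left hL (hs.1.trans hs.2)
    · have := State.two_le_flux hL hR le_rfl (hs.1.trans hs.2); linarith
    · rw [sub_self, speed_zero hm]; exact hs.1
  · have h' := h.mono (Set.Icc_subset_Ici_self : Set.Icc a t ⊆ Set.Ici a)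
    refine h'.speed_le (fun x hx => str_pos hL hR hs hm (sub_nonneg.2 hx.1)) ?_ ?_ ?_
      ⟨interior_subset ht, le_rfl⟩
    · rw [State.pull_lam1 hL]; exact State.pull_nonneg_right hR (hs.1.trans hs.2)
    · have := State.two_le_flux hL hR (hs.1.trans hs.2) le_rfl; linarith
    · rw [sub_self, speed_zero hm]; exact hs.2

end DeltaShock

/-- A weighted delta shock that starts with positive strength. -/
theorem isWeightedDeltaShock {U₀ U₁ : State} {ξ v : ℝ} (h₀ : 0 < U₀.rho) (h₁ : 0 < U₁.rho)
    (hξ : 0 < ξ) (hv : U₁.lam2 ≤ v ∧ v ≤ U₀.lam1) :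
    IsWeightedDeltaShock U₀ U₁ ξ v (DeltaShock.pos U₀ U₁ ξ v) (DeltaShock.speed U₀ U₁ ξ v)
      (DeltaShock.str U₀ U₁ ξ v) := by
  have hf := DeltaShock.isFront h₀ h₁ hv hξ 0 0
  have hs := DeltaShock.isShadow h₀ h₁ hv hξ 0
  simp only [sub_zero, zero_add] at hf hs
  exact ⟨hf, hs, DeltaShock.pos_zero, DeltaShock.speed_zero hξ, DeltaShock.str_zero hξ⟩

end Chaplygin

namespace Chaplygin

/-! ### Patterns of straight waves -/

/-- A straight wave with speed `s` whose strength grows with rate `κ`. -/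
def IsRay (L R : State) (s κ : ℝ) : Prop :=
  (L ≠ R ∧ κ = 0 ∧ ((L.lam1 = R.lam1 ∧ s = L.lam1) ∨ (L.lam2 = R.lam2 ∧ s = L.lam2))) ∨
    (R.lam2 ≤ s ∧ s ≤ L.lam1 ∧ κ = s * (R.rho - L.rho) - (R.mom - L.mom) ∧ R.pull s = L.pull s)

namespace IsRay

variable {L R : State} {s κ a : ℝ} {J : Set ℝ}

theorem admissible (h : IsRay L R s κ) (hL : 0 < L.rho) (hR : 0 < R.rho) (hJ : J ⊆ Set.Ici a) :
    IsContact L R J (fun _ => s) (fun t => κ * (t - a)) ∨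
      (IsShadow L R J (fun _ => s) (fun t => κ * (t - a)) ∧ κ * (a - a) = 0) := by
  rcases h with ⟨hne, h0, h'⟩ | ⟨h1, h2, h3, h4⟩
  · refine .inl ⟨hne, fun t _ => by simp [h0], ?_⟩
    exact h'.imp (fun k => ⟨k.1, fun _ _ => k.2⟩) (fun k => ⟨k.1, fun _ _ => k.2⟩)
  · refine .inr ⟨⟨by fun_prop, fun t ht => ⟨?_, h1, h2, ?_, ?_⟩⟩, by rw [sub_self, mul_zero]⟩
    · have := State.two_le_flux hL hR h1 h2
      have ht' := interior_mono hJ ht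
      rw [interior_Ici] at ht'
      exact mul_pos (by linarith) (sub_pos.2 ht')
    · rw [← h3]
      simpa using ((hasDerivAt_id t).sub_const a).const_mul κ
    · refine ((((hasDerivAt_id t).sub_const a).const_mul κ).mul_const s).congr_deriv ?_
      simp only [State.pull] at h4
      rw [h3]
      linarith

theorem nonneg (h : IsRay L R s κ) (hL : 0 < L.rho) (hR : 0 < R.rho) : 0 ≤ κ := by
  rcases h with ⟨-, h0, -⟩ | ⟨h1, h2, h3, -⟩
  · exact h0.ge
  · have := State.two_le_flux hL hR h1 h2
    linarith

/-- Up to the jump of `excess`, the energy balance of a straight wave is the difference of the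
fluxes of its end states. Summed over a fan, the fluxes telescope, and only shadow waves contribute
a loss. -/
theorem energy (h : IsRay L R s κ) (hL : 0 < L.rho) (hR : 0 < R.rho) :
    -((R.energy - L.energy) * s) + κ * s ^ 2
      = L.energyFlux - R.energyFlux - (R.excess s - L.excess s) := by
  rcases h with ⟨-, h0, ⟨h1, h2⟩ | ⟨h1, h2⟩⟩ | ⟨-, -, h3, h4⟩
  · have l := State.energyFlux_sub_lam1 hL
    have r := State.energyFlux_sub_lam1 hR
    have e : R.excess s = 0 := by rw [State.excess, h2, h1, State.pull_lam1 hR, mul_zero]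
    have e' : L.excess s = 0 := by rw [State.excess, h2, State.pull_lam1 hL, mul_zero]
    rw [← h1] at r
    rw [h0, e, e', h2]
    linarith
  · have l := State.energyFlux_sub_lam2 hL
    have r := State.energyFlux_sub_lam2 hR
    have e : R.excess s = 0 := by rw [State.excess, h2, h1, State.pull_lam2 hR, mul_zero]
    have e' : L.excess s = 0 := by rw [State.excess, h2, State.pull_lam2 hL, mul_zero]
    rw [← h1] at r
    rw [h0, e, e', h2]
    linarith
  · rw [State.excess_eq hL, State.excess_eq hR, h3]
    simp only [State.pull] at h4
    linear_combination 2 * s * h4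

end IsRay

namespace Pattern

/-- A pattern of straight waves that start at time `a`. -/
@[simps]
noncomputable def affine (n : ℕ) (st : ℕ → State) (p s κ : ℕ → ℝ) (a : ℝ) : Pattern where
  n := n
  state := st
  pos i t := p i + s i * (t - a)
  speed i _ := s i
  str i t := κ i * (t - a)
  org _ := a

variable {n : ℕ} {st : ℕ → State} {p s κ : ℕ → ℝ} {a : ℝ} {J : Set ℝ}

theorem isFront_affine (p s a : ℝ) (J : Set ℝ) :
    IsFront J (fun t => p + s * (t - a)) (fun _ => s) := by
  refine ⟨by fun_prop, by fun_prop, fun t _ => ?_⟩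
  simpa using (((hasDerivAt_id t).sub_const a).const_mul s).const_add p

theorem affine_admissible (hJ : J ⊆ Set.Ici a) (hst : ∀ i ≤ n, 0 < (st i).rho)
    (hlt : ∀ t ∈ interior J, ∀ i, i + 1 < n → p i + s i * (t - a) < p (i + 1) + s (i + 1) * (t - a))
    (hray : ∀ i < n, IsRay (st i) (st (i + 1)) (s i) (κ i)) :
    (affine n st p s κ a).IsAdmissibleOn a J := by
  refine ⟨hst, hlt, fun i hi => ⟨isFront_affine _ _ _ _, ?_⟩⟩
  rcases (hray i hi).admissible (hst i (le_of_lt hi)) (hst (i + 1) hi) hJ with h | h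
  · exact .inl h
  · exact .inr ⟨h.1, .inl ⟨h.2, rfl⟩⟩

theorem affine_massAt (x : ℝ) : (affine n st p s κ a).massAt x a = 0 :=
  Finset.sum_eq_zero fun i _ => by simp

theorem affine_momAt (x : ℝ) : (affine n st p s κ a).momAt x a = 0 :=
  Finset.sum_eq_zero fun i _ => by simp

theorem integral_indicator_energy {ℓ q : ℝ} (hq : q ∈ Set.Ioo (-ℓ) ℓ) (c : ℝ) :
    ∫ x, (if q < x then c else 0) * (Set.Ioc (-ℓ) ℓ).indicator (fun _ => (1 : ℝ)) x
      = c * (ℓ - q) := by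
  have : ∀ x, (if q < x then c else 0) * (Set.Ioc (-ℓ) ℓ).indicator (fun _ => (1 : ℝ)) x
      = (Set.Ioc q ℓ).indicator (fun _ => c) x := by
    intro x
    simp only [Set.indicator_apply, Set.mem_Ioc]
    by_cases h1 : q < x
    · have : -ℓ < x := hq.1.trans h1
      simp [h1, this]
    · simp [h1]
  simp only [this]
  rw [integral_indicator measurableSet_Ioc, setIntegral_const, Real.volume_real_Ioc_of_le hq.2.le,
    smul_eq_mul, mul_comm]

theorem tendsto_totalEnergy {P : Pattern} {ℓ t : ℝ} (hℓ : 0 < ℓ) (hs : P.Sorted t)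
    (hstr : ∀ i < P.n, 0 ≤ P.str i t) (horg : ∀ i < P.n, 0 < P.str i t → P.org i < t)
    (hdisj : ∀ i < P.n, ∀ j < P.n, i ≠ j → 0 < P.str i t → 0 < P.str j t →
      P.pos i t ≠ P.pos j t) (hpos : ∀ i < P.n, P.pos i t ∈ Set.Ioo (-ℓ) ℓ) :
    Tendsto (fun ε => totalEnergy ℓ (fun x => P.net ε x t)) (𝓝[>] 0)
      (𝓝 ((P.state 0).energy * (2 * ℓ) + ∑ i ∈ Finset.range P.n,
        (((P.state (i + 1)).energy - (P.state i).energy) * (ℓ - P.pos i t)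
          + P.str i t * P.speed i t ^ 2))) := by
  set ψ : ℝ → ℝ := (Set.Ioc (-ℓ) ℓ).indicator fun _ => 1 with hψdef
  have hψ : Integrable ψ := (integrable_indicator_iff measurableSet_Ioc).2 (by simp)
  have hC : ∀ x, |ψ x| ≤ 1 := by
    intro x
    simp only [hψdef, Set.indicator_apply]
    split_ifs <;> simp
  have h1 : ∀ x ∈ Set.Ioo (-ℓ) ℓ, ψ x = 1 := fun x hx =>
    Set.indicator_of_mem (show x ∈ Set.Ioc (-ℓ) ℓ from ⟨hx.1, hx.2.le⟩) _
  have hcont : ∀ i < P.n, 0 < P.str i t → ContinuousAt ψ (P.pos i t) := by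
    intro i hi _
    refine (continuousAt_const (y := (1 : ℝ))).congr ?_
    filter_upwards [Ioo_mem_nhds (hpos i hi).1 (hpos i hi).2] with x hx
    exact (h1 x hx).symm
  have hmain := P.tendsto_integral_net isFlux_energy hψ hC hcont hstr horg hdisj
  have hint : ∀ i ∈ Finset.range P.n, Integrable fun x =>
      (if P.pos i t < x then (P.state (i + 1)).energy - (P.state i).energy else 0) * ψ x := by
    intro i _
    refine hψ.bdd_mul (c := |(P.state (i + 1)).energy - (P.state i).energy|)
      (Measurable.ite measurableSet_Ioi measurable_const measurable_const).aestronglyMeasurable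
      (ae_of_all _ fun x => ?_)
    split_ifs
    · exact le_rfl
    · simp
  have hbase : ∫ x, (P.base x t).energy * ψ x = (P.state 0).energy * (2 * ℓ)
      + ∑ i ∈ Finset.range P.n,
        ((P.state (i + 1)).energy - (P.state i).energy) * (ℓ - P.pos i t) := by
    simp only [hs.apply_base State.energy, add_mul, Finset.sum_mul]
    rw [integral_add (hψ.const_mul _) (integrable_finsetSum _ hint), integral_finsetSum _ hint,
      integral_const_mul]
    congr 1
    · rw [hψdef, integral_indicator measurableSet_Ioc, setIntegral_const,
        Real.volume_real_Ioc_of_le (by linarith)]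
      rw [smul_eq_mul]; ring
    · exact Finset.sum_congr rfl fun i hi =>
        integral_indicator_energy (hpos i (Finset.mem_range.1 hi)) _
  rw [hbase, add_assoc, ← Finset.sum_add_distrib] at hmain
  have e : ∀ ε, totalEnergy ℓ (fun x => P.net ε x t) = ∫ x, (P.net ε x t).energy * ψ x := by
    intro ε
    rw [totalEnergy, intervalIntegral.integral_of_le (by linarith),
      ← integral_indicator measurableSet_Ioc]
    refine integral_congr_ae (ae_of_all _ fun x => ?_)
    simp only [hψdef, Set.indicator_apply, mul_ite, mul_one, mul_zero]
  simp only [e]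
  refine hmain.trans_eq ?_
  congr 2
  refine Finset.sum_congr rfl fun i hi => ?_
  rw [h1 _ (hpos i (Finset.mem_range.1 hi)), mul_one]

end Pattern

end Chaplygin

namespace Chaplygin

/-! ### Initial energy rates -/

namespace Pattern

variable {n : ℕ} {st : ℕ → State} {p s κ : ℕ → ℝ} {a : ℝ} {J : Set ℝ}

theorem eventually_affine_lt
    (hord : ∀ i, i + 1 < n → p i < p (i + 1) ∨ (p i = p (i + 1) ∧ s i < s (i + 1))) :
    ∀ᶠ t in 𝓝[>] (0 : ℝ), ∀ i, i + 1 < n → p i + s i * t < p (i + 1) + s (i + 1) * t := by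
  have : ∀ᶠ t in 𝓝[>] (0 : ℝ), ∀ i ∈ Finset.range n,
      i + 1 < n → p i + s i * t < p (i + 1) + s (i + 1) * t := by
    rw [Finset.eventually_all]
    intro i _
    by_cases hi : i + 1 < n
    swap
    · exact Eventually.of_forall fun t h => absurd h hi
    rcases hord i hi with h | ⟨h, h'⟩
    · have c : Tendsto (fun t : ℝ => p (i + 1) + s (i + 1) * t - (p i + s i * t)) (𝓝[>] 0)
          (𝓝 (p (i + 1) + s (i + 1) * 0 - (p i + s i * 0))) :=
        Tendsto.mono_left (Continuous.tendsto (by fun_prop) 0) nhdsWithin_le_nhds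
      filter_upwards [c.eventually (lt_mem_nhds (a := 0) (by simpa using h))] with t ht _
      linarith
    · filter_upwards [self_mem_nhdsWithin] with t ht _
      have := mul_lt_mul_of_pos_right h' ht
      linarith
  filter_upwards [this] with t ht i hi
  exact ht i (Finset.mem_range.2 (by omega)) hi

/-- For straight waves with linearly growing strength the limit energy is an affine function of time
as long as all fronts remain inside the interval, so its derivative is read off. -/
theorem affine_rate {U : ℝ → State} {ℓ : ℝ} (hℓ : 0 < ℓ) (hst : ∀ i ≤ n, 0 < (st i).rho)
    (hp : ∀ i < n, p i ∈ Set.Ioo (-ℓ) ℓ)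
    (hord : ∀ i, i + 1 < n → p i < p (i + 1) ∨ (p i = p (i + 1) ∧ s i < s (i + 1)))
    (hray : ∀ i < n, IsRay (st i) (st (i + 1)) (s i) (κ i))
    (hS : (affine n st p s κ 0).StartsFrom 0 U (fun _ => 0) (fun _ => 0)) :
    HasInitialEnergyRate U ℓ (∑ i ∈ Finset.range n,
      (-(((st (i + 1)).energy - (st i).energy) * s i) + κ i * s i ^ 2)) := by
  have hin : ∀ᶠ t in 𝓝[>] (0 : ℝ), ∀ i ∈ Finset.range n, p i + s i * t ∈ Set.Ioo (-ℓ) ℓ := by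
    rw [Finset.eventually_all]
    intro i hi
    have c : Tendsto (fun t : ℝ => p i + s i * t) (𝓝[>] 0) (𝓝 (p i + s i * 0)) :=
      Tendsto.mono_left (Continuous.tendsto (by fun_prop) 0) nhdsWithin_le_nhds
    have := hp i (Finset.mem_range.1 hi)
    exact c.eventually (Ioo_mem_nhds (by simpa using this.1) (by simpa using this.2))
  obtain ⟨b, hb, hsub⟩ := mem_nhdsGT_iff_exists_Ioo_subset.1
    ((eventually_affine_lt hord).and hin)
  have hb0 : 0 < b := hb
  have hadm : (affine n st p s κ 0).IsAdmissibleOn 0 (Set.Icc 0 (b / 2)) := by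
    refine affine_admissible Set.Icc_subset_Ici_self hst (fun t ht => ?_) hray
    rw [interior_Icc] at ht
    simpa using (hsub ⟨ht.1, by linarith [ht.2]⟩).1
  refine ⟨affine n st p s κ 0, b / 2, fun t => (st 0).energy * (2 * ℓ) + ∑ i ∈ Finset.range n,
    (((st (i + 1)).energy - (st i).energy) * (ℓ - (p i + s i * (t - 0)))
      + κ i * (t - 0) * s i ^ 2), by linarith, hadm, hS, fun t ht => ?_, ?_⟩
  · refine tendsto_totalEnergy (P := affine n st p s κ 0) hℓ
      (hadm.sorted (by linarith) (Set.Ico_subset_Icc_self ht)) (fun i hi => ?_) (fun i _ h => ?_)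
      (fun i hi j hj hij h _ => ?_) (fun i hi => ?_)
    · exact mul_nonneg ((hray i hi).nonneg (hst i (le_of_lt hi)) (hst _ hi)) (by linarith [ht.1])
    · refine lt_of_le_of_ne ht.1 fun e => ?_
      simp [← e] at h
    · have h0 : 0 < t := lt_of_le_of_ne ht.1 fun e => by simp [← e] at h
      have ht' : t ∈ interior (Set.Icc 0 (b / 2)) := by
        rw [interior_Icc]; exact ⟨h0, ht.2⟩
      rcases hij.lt_or_gt with hij | hij
      · exact (hadm.pos_lt ht' hij hj).ne
      · exact (hadm.pos_lt ht' hij hi).ne'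
    · rcases ht.1.eq_or_lt with h0 | h0
      · simpa [← h0] using hp i hi
      · simpa using (hsub ⟨h0, by linarith [ht.2]⟩).2 i (Finset.mem_range.2 hi)
  · refine HasDerivAt.hasDerivWithinAt ?_
    have : HasDerivAt (fun t : ℝ => ∑ i ∈ Finset.range n,
        (((st (i + 1)).energy - (st i).energy) * (ℓ - (p i + s i * (t - 0)))
          + κ i * (t - 0) * s i ^ 2)) (∑ i ∈ Finset.range n,
        (-(((st (i + 1)).energy - (st i).energy) * s i) + κ i * s i ^ 2)) 0 := by
      refine HasDerivAt.fun_sum fun i _ => ?_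
      have h1 : HasDerivAt (fun t : ℝ => t - 0) 1 0 := (hasDerivAt_id _).sub_const 0
      refine (((((h1.const_mul (s i)).const_add (p i)).const_sub ℓ).const_mul _).add
        ((h1.const_mul (κ i)).mul_const (s i ^ 2))).congr_deriv ?_
      ring
    exact this.const_add _

theorem Agree.net {P P' : Pattern} {J : Set ℝ} {t : ℝ} (h : P.Agree P' J) (ht : t ∈ J)
    (horg : ∀ i < P.n, 0 < P.str i t → P.org i = P'.org i) (ε x : ℝ) :
    P.net ε x t = P'.net ε x t := by
  classical
  have hiff : ∀ {i}, P.InStrip ε x t i ↔ P'.InStrip ε x t i := by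
    intro i
    rw [InStrip, InStrip, ← h.n_eq]
    refine and_congr_right fun hi => ?_
    obtain ⟨h1, -, h3⟩ := h.front_eq i hi t ht
    rw [← h1, ← h3]
    exact and_congr_right fun hw => by rw [horg i hi hw]
  by_cases hE : ∃ i, P.InStrip ε x t i
  · have hE' : ∃ i, P'.InStrip ε x t i := hE.imp fun i => hiff.1
    have e : Nat.find hE' = Nat.find hE := Nat.find_congr' hiff.symm
    have hs := Nat.find_spec hE
    obtain ⟨-, h2, h3⟩ := h.front_eq _ hs.1 t ht
    rw [Pattern.net, Pattern.net, dif_pos hE, dif_pos hE', e, ← h2, ← h3, horg _ hs.1 hs.2.1]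
  · have hE' : ¬ ∃ i, P'.InStrip ε x t i := fun k => hE (k.imp fun i => hiff.2)
    rw [Pattern.net, Pattern.net, dif_neg hE, dif_neg hE', h.base ht]

theorem IsAdmissibleOn.org_eq {P : Pattern} {b t : ℝ} (h : P.IsAdmissibleOn a (Set.Icc a b))
    (ht : t ∈ Set.Icc a b) (h0 : ∀ i < P.n, P.str i a = 0) {i : ℕ} (hi : i < P.n)
    (hw : 0 < P.str i t) : P.org i = a := by
  rcases (h.2.2 i hi).2 with hc | ⟨-, ⟨-, h1⟩ | ⟨h1, -⟩⟩
  · exact absurd (hc.2.1 t ht) hw.ne'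
  · exact h1
  · exact absurd (h0 i hi) h1.ne'

end Pattern

/-- Two patterns from the same data agree, and zero initial strength also fixes the origins of the
strips. So the nets coincide, and with them the limit energies on a common interval. -/
theorem HasInitialEnergyRate.unique {U : ℝ → State} {ℓ d d' : ℝ}
    (h : HasInitialEnergyRate U ℓ d) (h' : HasInitialEnergyRate U ℓ d') : d = d' := by
  obtain ⟨P, b, H, hb, hP, hS, hH, hd⟩ := h
  obtain ⟨P', b', H', hb', hP', hS', hH', hd'⟩ := h'
  have hc : 0 < min b b' := lt_min hb hb'
  replace hP := hP.mono (Set.Icc_subset_Icc_right (min_le_left b b'))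
  replace hP' := hP'.mono (Set.Icc_subset_Icc_right (min_le_right b b'))
  have hA := hP.agree hP' hc hS hS'
  have hz : ∀ i < P.n, P.str i 0 = 0 := fun i hi => hS.str_eq_zero hP hc (fun _ => rfl) hi
  have hz' : ∀ i < P'.n, P'.str i 0 = 0 := fun i hi => hS'.str_eq_zero hP' hc (fun _ => rfl) hi
  have key : ∀ t ∈ Set.Ico 0 (min b b'), H t = H' t := by
    intro t ht
    have ht' := Set.Ico_subset_Icc_self ht
    have hnet : ∀ ε x, P.net ε x t = P'.net ε x t := hA.net ht' fun i hi hw => by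
      rw [hP.org_eq ht' hz hi hw, hP'.org_eq ht' hz' (hi.trans_eq hA.n_eq)
        (by rwa [← (hA.front_eq i hi t ht').2.2])]
    have h1 := hH t ⟨ht.1, ht.2.trans_le (min_le_left _ _)⟩
    have h2 := hH' t ⟨ht.1, ht.2.trans_le (min_le_right _ _)⟩
    simp only [hnet] at h1
    exact tendsto_nhds_unique h1 h2
  have hd2 : HasDerivWithinAt H d' (Set.Ici 0) 0 := by
    refine hd'.congr_of_eventuallyEq ?_ (key 0 ⟨le_rfl, hc⟩)
    filter_upwards [Ico_mem_nhdsGE hc] with t ht using key t ht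
  exact (uniqueDiffOn_Ici (0 : ℝ) 0 Set.self_mem_Ici).eq_deriv _ hd hd2

/-! ### Fans -/

/-- A fan of `k` straight waves that joins `A` to `B`. -/
structure IsFan (A B : State) (k : ℕ) (st : ℕ → State) (s κ : ℕ → ℝ) : Prop where
  first : st 0 = A
  last : st k = B
  rho_pos : ∀ i ≤ k, 0 < (st i).rho
  mono : ∀ i, i + 1 < k → s i < s (i + 1)
  ray : ∀ i < k, IsRay (st i) (st (i + 1)) (s i) (κ i)

/-- The sum of the energy rates of the waves of a fan. -/
noncomputable def fanRate (k : ℕ) (st : ℕ → State) (s κ : ℕ → ℝ) : ℝ :=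
  ∑ i ∈ Finset.range k, (-(((st (i + 1)).energy - (st i).energy) * s i) + κ i * s i ^ 2)

theorem isFan_one {A B : State} {s κ : ℝ} (hA : 0 < A.rho) (hB : 0 < B.rho)
    (h : IsRay A B s κ) : IsFan A B 1 (fun i => if i = 0 then A else B) (fun _ => s)
      (fun _ => κ) where
  first := rfl
  last := rfl
  rho_pos i _ := by split_ifs <;> assumption
  mono i hi := by omega
  ray i hi := by
    obtain rfl : i = 0 := by omega
    simpa using h

theorem fanRate_one {A B : State} {s κ : ℝ} (hA : 0 < A.rho) (hB : 0 < B.rho)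
    (h : IsRay A B s κ) : fanRate 1 (fun i => if i = 0 then A else B) (fun _ => s) (fun _ => κ)
      = A.energyFlux - B.energyFlux - (B.excess s - A.excess s) := by
  simpa [fanRate] using h.energy hA hB

/-- The state between the contact discontinuities that join `A` to `B`. -/
noncomputable def State.between (A B : State) : State := State.ofLam A.lam1 B.lam2

@[simp] theorem State.lam1_between (A B : State) : (A.between B).lam1 = A.lam1 :=
  State.lam1_ofLam _ _

@[simp] theorem State.lam2_between (A B : State) : (A.between B).lam2 = B.lam2 :=
  State.lam2_ofLam _ _

theorem State.rho_between_pos {A B : State} (h : A.lam1 < B.lam2) : 0 < (A.between B).rho :=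
  State.rho_ofLam_pos h

theorem isRay_between_left {A B : State} (h : A.lam2 ≠ B.lam2) :
    IsRay A (A.between B) A.lam1 0 :=
  .inl ⟨fun e => h (by rw [← State.lam2_between A B, ← e]), rfl,
    .inl ⟨(State.lam1_between A B).symm, rfl⟩⟩

theorem isRay_between_right {A B : State} (h : A.lam1 ≠ B.lam1) :
    IsRay (A.between B) B B.lam2 0 :=
  .inl ⟨fun e => h (by rw [← State.lam1_between A B, e]), rfl,
    .inr ⟨State.lam2_between A B, (State.lam2_between A B).symm⟩⟩

theorem isFan_contacts {A B : State} (hA : 0 < A.rho) (hB : 0 < B.rho) (h : A.lam1 < B.lam2)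
    (h1 : A.lam1 ≠ B.lam1) (h2 : A.lam2 ≠ B.lam2) :
    IsFan A B 2 (fun i => if i = 0 then A else if i = 1 then A.between B else B)
      (fun i => if i = 0 then A.lam1 else B.lam2) (fun _ => 0) where
  first := rfl
  last := rfl
  rho_pos i _ := by
    have := State.rho_between_pos h
    split_ifs <;> assumption
  mono i hi := by
    obtain rfl : i = 0 := by omega
    simpa using h
  ray i hi := by
    interval_cases i
    · simpa using isRay_between_left h2
    · simpa using isRay_between_right h1

theorem excess_lam1 {U : State} (h : 0 < U.rho) : U.excess U.lam1 = 0 := by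
  rw [State.excess, State.pull_lam1 h, mul_zero]

theorem excess_lam2 {U : State} (h : 0 < U.rho) : U.excess U.lam2 = 0 := by
  rw [State.excess, State.pull_lam2 h, mul_zero]

theorem fanRate_contacts {A B : State} (hA : 0 < A.rho) (hB : 0 < B.rho) (h : A.lam1 < B.lam2)
    (h1 : A.lam1 ≠ B.lam1) (h2 : A.lam2 ≠ B.lam2) :
    fanRate 2 (fun i => if i = 0 then A else if i = 1 then A.between B else B)
      (fun i => if i = 0 then A.lam1 else B.lam2) (fun _ => 0)
      = A.energyFlux - B.energyFlux := by
  have hM := State.rho_between_pos h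
  have l := (isRay_between_left h2).energy hA hM
  have r := (isRay_between_right h1).energy hM hB
  rw [excess_lam1 hA, show (A.between B).excess A.lam1 = 0 by
    rw [← State.lam1_between A B, excess_lam1 hM]] at l
  rw [excess_lam2 hB, show (A.between B).excess B.lam2 = 0 by
    rw [← State.lam2_between A B, excess_lam2 hM]] at r
  simp only [fanRate, Finset.sum_range_succ, Finset.sum_range_zero, one_ne_zero, if_true,
    if_false, Nat.add_eq_zero_iff, and_false, zero_add, OfNat.ofNat_ne_one,
    Nat.reduceAdd]
  linarith

/-- Intermediate value theorem: the difference of the pulls changes sign between λ₂(B) and λ₁(A),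
where one of them vanishes. Equal pulls mean that momentum grows at `s` times the rate of the mass,
so the wave keeps the speed `s`. -/
theorem exists_isRay_shadow {A B : State} (hA : 0 < A.rho) (hB : 0 < B.rho)
    (h : B.lam2 ≤ A.lam1) : ∃ s κ, B.lam2 ≤ s ∧ s ≤ A.lam1 ∧ B.pull s = A.pull s ∧
      IsRay A B s κ := by
  have hc : ContinuousOn (fun s => B.pull s - A.pull s) (Set.Icc B.lam2 A.lam1) := by
    simp only [State.pull]; fun_prop
  have h0 : (0 : ℝ) ∈ Set.Icc (B.pull B.lam2 - A.pull B.lam2) (B.pull A.lam1 - A.pull A.lam1) := by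
    rw [State.pull_lam2 hB, State.pull_lam1 hA]
    exact ⟨by linarith [State.pull_nonneg_left hA h], by linarith [State.pull_nonneg_right hB h]⟩
  obtain ⟨s, ⟨h1, h2⟩, h3⟩ := intermediate_value_Icc h hc h0
  exact ⟨s, _, h1, h2, sub_eq_zero.1 h3, .inr ⟨h1, h2, rfl, sub_eq_zero.1 h3⟩⟩

/-! ### Two fans -/

/-- The waves of two fans, the first one with `k` waves. -/
def glue {α : Type*} (k : ℕ) (f g : ℕ → α) (i : ℕ) : α := if i < k then f i else g (i - k)

theorem glue_of_lt {α : Type*} {k i : ℕ} {f g : ℕ → α} (h : i < k) : glue k f g i = f i := if_pos h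

theorem glue_add {α : Type*} {k i : ℕ} {f g : ℕ → α} : glue k f g (k + i) = g i := by
  simp [glue]

theorem glue_of_le {α : Type*} {k i : ℕ} {f g : ℕ → α} (h : i ≤ k) (hfg : f k = g 0) :
    glue k f g i = f i := by
  rcases h.lt_or_eq with h | rfl
  · exact glue_of_lt h
  · simp [glue, hfg]

theorem sum_range_glue {k k' : ℕ} {F G H : ℕ → ℝ} (h1 : ∀ i < k, H i = F i)
    (h2 : ∀ i < k', H (k + i) = G i) :
    ∑ i ∈ Finset.range (k + k'), H i = ∑ i ∈ Finset.range k, F i + ∑ i ∈ Finset.range k', G i := by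
  rw [Finset.sum_range_add]
  exact congr_arg₂ _ (Finset.sum_congr rfl fun i hi => h1 i (Finset.mem_range.1 hi))
    (Finset.sum_congr rfl fun i hi => h2 i (Finset.mem_range.1 hi))

section Glue

variable {A M B : State} {k k' : ℕ} {st st' : ℕ → State} {s κ s' κ' : ℕ → ℝ}

theorem IsFan.glue_rho_pos (h : IsFan A M k st s κ) (h' : IsFan M B k' st' s' κ') :
    ∀ i ≤ k + k', 0 < (glue k st st' i).rho := by
  intro i hi
  by_cases hik : i < k
  · rw [glue_of_lt hik]; exact h.rho_pos i hik.le
  · obtain ⟨j, rfl⟩ := Nat.exists_eq_add_of_le (not_lt.1 hik)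
    rw [glue_add]; exact h'.rho_pos j (by omega)

theorem IsFan.glue_left (h : IsFan A M k st s κ) (h' : IsFan M B k' st' s' κ') {i : ℕ}
    (hi : i ≤ k) : glue k st st' i = st i :=
  glue_of_le hi (h.last.trans h'.first.symm)

theorem IsFan.glue_ray (h : IsFan A M k st s κ) (h' : IsFan M B k' st' s' κ') :
    ∀ i < k + k', IsRay (glue k st st' i) (glue k st st' (i + 1)) (glue k s s' i)
      (glue k κ κ' i) := by
  intro i hi
  by_cases hik : i < k
  · rw [h.glue_left h' (i := i + 1) hik, glue_of_lt hik, glue_of_lt hik, glue_of_lt hik]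
    exact h.ray i hik
  · obtain ⟨j, rfl⟩ := Nat.exists_eq_add_of_le (not_lt.1 hik)
    rw [glue_add, glue_add, add_assoc, glue_add, glue_add]
    exact h'.ray j (by omega)

/-- The pattern of two fans that start at `-(μ / 2)` and `μ / 2`. -/
noncomputable def twoFans (μ : ℝ) (k k' : ℕ) (st st' : ℕ → State) (s κ s' κ' : ℕ → ℝ) : Pattern :=
  Pattern.affine (k + k') (glue k st st') (glue k (fun _ => -(μ / 2)) (fun _ => μ / 2))
    (glue k s s') (glue k κ κ') 0

theorem IsFan.startsFrom {U₀ U₁ : State} {ξ μ v : ℝ} (hμ : 0 < μ)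
    (h : IsFan U₀ ⟨ξ / μ, v⟩ k st s κ) (h' : IsFan ⟨ξ / μ, v⟩ U₁ k' st' s' κ') :
    (twoFans μ k k' st st' s κ s' κ').StartsFrom 0 (deltaData U₀ U₁ ξ μ v)
      (fun _ => 0) (fun _ => 0) := by
  refine ⟨?_, Pattern.affine_massAt, Pattern.affine_momAt⟩
  filter_upwards [(Set.finite_singleton (-(μ / 2))).compl_mem_cofinite,
    (Set.finite_singleton (μ / 2)).compl_mem_cofinite] with x hx hx'
  simp only [Set.mem_compl_iff, Set.mem_singleton_iff] at hx hx'
  simp only [twoFans, Pattern.base, Pattern.affine_n, Pattern.affine_pos, sub_zero, mul_zero,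
    add_zero, Pattern.affine_state, deltaData]
  by_cases h1 : x < -(μ / 2)
  · rw [if_pos h1, Finset.filter_false_of_mem, Finset.card_empty, h.glue_left h' (Nat.zero_le _),
      h.first]
    intro i _
    rw [glue]
    split_ifs <;> linarith
  have h1' : -(μ / 2) < x := lt_of_le_of_ne (not_lt.1 h1) (Ne.symm hx)
  by_cases h2 : x < μ / 2
  · have : (Finset.range (k + k')).filter
        (fun i => glue k (fun _ => -(μ / 2)) (fun _ => μ / 2) i < x) = Finset.range k := by
      ext i
      simp only [Finset.mem_filter, Finset.mem_range, glue]
      by_cases hi : i < k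
      · simp only [hi, if_true, h1', and_true, iff_true]; omega
      · simp only [hi, if_false, iff_false, not_and, not_lt, h2.le, implies_true]
    rw [if_neg h1, if_pos h2, this, Finset.card_range, h.glue_left h' le_rfl, h.last]
  · have h2' : μ / 2 < x := lt_of_le_of_ne (not_lt.1 h2) (Ne.symm hx')
    rw [if_neg h1, if_neg h2, Finset.filter_true_of_mem, Finset.card_range, glue_add, h'.last]
    intro i _
    rw [glue]
    split_ifs <;> linarith

theorem IsFan.hasInitialEnergyRate {U₀ U₁ : State} {ξ μ v ℓ : ℝ} (hμ : 0 < μ) (hℓ : μ / 2 < ℓ)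
    (h : IsFan U₀ ⟨ξ / μ, v⟩ k st s κ) (h' : IsFan ⟨ξ / μ, v⟩ U₁ k' st' s' κ') :
    HasInitialEnergyRate (deltaData U₀ U₁ ξ μ v) ℓ (fanRate k st s κ + fanRate k' st' s' κ') := by
  rw [fanRate, fanRate, ← sum_range_glue (H := fun i =>
    -(((glue k st st' (i + 1)).energy - (glue k st st' i).energy) * glue k s s' i)
      + glue k κ κ' i * glue k s s' i ^ 2)]
  · refine Pattern.affine_rate (by linarith) (h.glue_rho_pos h') (fun i _ => ?_) (fun i hi => ?_)
      (h.glue_ray h') (h.startsFrom hμ h')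
    · rw [glue]
      split_ifs <;> constructor <;> linarith
    · rcases lt_trichotomy (i + 1) k with hk | hk | hk
      · rw [glue_of_lt hk, glue_of_lt (by omega), glue_of_lt (by omega), glue_of_lt hk]
        exact .inr ⟨rfl, h.mono i hk⟩
      · left
        rw [glue, glue, if_pos (by omega), if_neg (by omega)]
        linarith
      · obtain ⟨j, rfl⟩ := Nat.exists_eq_add_of_le (Nat.le_of_lt_succ hk)
        rw [glue_add, add_assoc, glue_add, glue_add, glue_add]
        exact .inr ⟨rfl, h'.mono j (by omega)⟩
  · intro i hi
    rw [h.glue_left h' (i := i + 1) hi, glue_of_lt hi, glue_of_lt hi, glue_of_lt hi]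
  · intro i _
    rw [glue_add, glue_add, add_assoc, glue_add, glue_add]

end Glue

end Chaplygin

namespace Chaplygin

/-! ### The concentrated middle state -/

section Mid

variable {ξ μ v s : ℝ} {U : State}

theorem rho_mid_pos (hξ : 0 < ξ) (hμ : 0 < μ) : 0 < (State.mk (ξ / μ) v).rho := div_pos hξ hμ

theorem lam1_mid (ξ μ v : ℝ) : (State.mk (ξ / μ) v).lam1 = v - μ / ξ := by
  simp [State.lam1]

theorem lam2_mid (ξ μ v : ℝ) : (State.mk (ξ / μ) v).lam2 = v + μ / ξ := by
  simp [State.lam2]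

/-- The pull of the concentrated state is `(ξ / μ) * ((s - v)² - (μ / ξ)²)`. The huge density forces
the speed towards `v`, at a distance of order `√μ` if the other pull does not vanish. -/
theorem sq_sub_eq_of_pull_eq (hξ : 0 < ξ) (hμ : 0 < μ)
    (h : (State.mk (ξ / μ) v).pull s = U.pull s) :
    (s - v) ^ 2 = (μ / ξ) ^ 2 + μ / ξ * U.pull s := by
  rw [← h, State.pull_eq (rho_mid_pos hξ hμ), lam1_mid, lam2_mid]
  field_simp
  ring

theorem tendsto_div_const_nhdsGT (hξ : 0 < ξ) :
    Tendsto (fun μ : ℝ => μ / ξ) (𝓝[>] 0) (𝓝[>] 0) := by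
  refine tendsto_nhdsWithin_iff.2 ⟨?_, ?_⟩
  · have : Tendsto (fun μ : ℝ => μ / ξ) (𝓝 0) (𝓝 (0 / ξ)) := tendsto_id.div_const ξ
    rw [zero_div] at this
    exact this.mono_left nhdsWithin_le_nhds
  · filter_upwards [self_mem_nhdsWithin] with μ hμ using div_pos hμ hξ

/-- Small `μ` avoid the finitely many values at which a contact would join equal states, which the
definition of a contact forbids. -/
theorem eventually_div_ne (hξ : 0 < ξ) (c : ℝ) : ∀ᶠ μ in 𝓝[>] (0 : ℝ), μ / ξ ≠ c := by
  suffices h : ∀ᶠ x in 𝓝[>] (0 : ℝ), x ≠ c from (tendsto_div_const_nhdsGT hξ).eventually h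
  rcases le_or_gt c 0 with hc | hc
  · filter_upwards [self_mem_nhdsWithin] with x hx
    exact (lt_of_le_of_lt hc hx).ne'
  · filter_upwards [nhdsWithin_le_nhds (gt_mem_nhds hc)] with x hx using ne_of_lt hx

theorem eventually_div_lt (hξ : 0 < ξ) {c : ℝ} (hc : 0 < c) : ∀ᶠ μ in 𝓝[>] (0 : ℝ), μ / ξ < c :=
  (tendsto_div_const_nhdsGT hξ).eventually (nhdsWithin_le_nhds (gt_mem_nhds hc))

/-- The speed of a shadow wave between `U` and the concentrated state is close to `v`. -/
theorem tendsto_shadow_speed (hξ : 0 < ξ) {σ : ℝ → ℝ} {c : ℝ}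
    (h : ∀ᶠ μ in 𝓝[>] (0 : ℝ), (State.mk (ξ / μ) v).pull (σ μ) = U.pull (σ μ) ∧ |σ μ| ≤ c) :
    Tendsto σ (𝓝[>] 0) (𝓝 v) := by
  obtain ⟨C, hC⟩ := (isCompact_Icc (a := -c) (b := c)).exists_bound_of_continuousOn
    (f := fun s => U.pull s) (by simp only [State.pull]; fun_prop)
  have hlim : Tendsto (fun μ : ℝ => Real.sqrt ((μ / ξ) ^ 2 + μ / ξ * C)) (𝓝[>] 0) (𝓝 0) := by
    have : Tendsto (fun x : ℝ => Real.sqrt (x ^ 2 + x * C)) (𝓝 0) (𝓝 (Real.sqrt (0 ^ 2 + 0 * C))) :=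
      Continuous.tendsto (by fun_prop) 0
    simp only [ne_eq, OfNat.ofNat_ne_zero, not_false_eq_true, zero_pow, zero_mul, add_zero,
      Real.sqrt_zero] at this
    exact this.comp ((tendsto_div_const_nhdsGT hξ).mono_right nhdsWithin_le_nhds)
  refine tendsto_iff_dist_tendsto_zero.2 (squeeze_zero' (Eventually.of_forall fun _ => dist_nonneg)
    ?_ hlim)
  filter_upwards [h, self_mem_nhdsWithin] with μ hμ h0
  have h0' : 0 < μ / ξ := div_pos h0 hξ
  refine Real.le_sqrt_of_sq_le ?_
  rw [Real.dist_eq, sq_abs, sq_sub_eq_of_pull_eq hξ h0 hμ.1]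
  have := (le_abs_self _).trans (hC (σ μ) (abs_le.1 hμ.2))
  gcongr

end Mid

/-! ### Initial dissipation -/

/-- The states `A μ` and `B μ` are joined by fans whose energy loss tends to `d`. -/
def FanLoss (A B : ℝ → State) (d : ℝ) : Prop :=
  ∃ D : ℝ → ℝ, Tendsto D (𝓝[>] 0) (𝓝 d) ∧ (d = 0 → ∀ᶠ μ in 𝓝[>] (0 : ℝ), D μ = 0) ∧
    ∀ᶠ μ in 𝓝[>] (0 : ℝ), ∃ k st s κ, IsFan (A μ) (B μ) k st s κ ∧
      fanRate k st s κ = (A μ).energyFlux - (B μ).energyFlux - D μ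

/-- The limit of the energy loss of the waves between `U` and a concentrated state to the right. -/
noncomputable def lossLeft (U : State) (v : ℝ) : ℝ := if v < U.lam1 then -U.excess v else 0

/-- The limit of the energy loss of the waves between a concentrated state and `U` to the right. -/
noncomputable def lossRight (U : State) (v : ℝ) : ℝ := if U.lam2 < v then U.excess v else 0

theorem lossLeft_pos {U : State} (hU : 0 < U.rho) {v : ℝ} (h : v < U.lam1) : 0 < lossLeft U v := by
  rw [lossLeft, if_pos h, State.excess, State.pull_eq hU, U.vel_eq]
  have h2 := State.lam1_lt_lam2 hU
  have := mul_pos (mul_pos (mul_pos hU (sub_pos.2 h)) (sub_pos.2 (h.trans h2)))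
    (show 0 < (U.lam1 + U.lam2) / 2 - v by linarith)
  linarith

theorem lossRight_pos {U : State} (hU : 0 < U.rho) {v : ℝ} (h : U.lam2 < v) :
    0 < lossRight U v := by
  rw [lossRight, if_pos h, State.excess, State.pull_eq hU, U.vel_eq]
  have h2 := State.lam1_lt_lam2 hU
  have := mul_pos (mul_pos (mul_pos hU (sub_pos.2 h)) (sub_pos.2 (h2.trans h)))
    (show 0 < v - (U.lam1 + U.lam2) / 2 by linarith)
  linarith

theorem lossLeft_of_le {U : State} {v : ℝ} (h : U.lam1 ≤ v) : lossLeft U v = 0 :=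
  if_neg (not_lt.2 h)

theorem lossRight_of_le {U : State} {v : ℝ} (h : v ≤ U.lam2) : lossRight U v = 0 :=
  if_neg (not_lt.2 h)

theorem lossLeft_nonneg {U : State} (hU : 0 < U.rho) (v : ℝ) : 0 ≤ lossLeft U v := by
  rcases lt_or_ge v U.lam1 with h | h
  · exact (lossLeft_pos hU h).le
  · exact (lossLeft_of_le h).ge

theorem lossRight_nonneg {U : State} (hU : 0 < U.rho) (v : ℝ) : 0 ≤ lossRight U v := by
  rcases lt_or_ge U.lam2 v with h | h
  · exact (lossRight_pos hU h).le
  · exact (lossRight_of_le h).ge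

/-- If `v < U.lam1`, a shadow wave with equal pulls loses `(U.vel - v) * U.pull s`, and `s` tends to
`v`. Otherwise the fan consists of two contacts and the loss is exactly zero for small `μ`. -/
theorem fanLoss_left {U : State} (hU : 0 < U.rho) {ξ : ℝ} (hξ : 0 < ξ) (v : ℝ) :
    FanLoss (fun _ => U) (fun μ => ⟨ξ / μ, v⟩) (lossLeft U v) := by
  rcases lt_or_ge v U.lam1 with h | h
  · have hpos := lossLeft_pos hU h
    have hev : ∀ᶠ μ in 𝓝[>] (0 : ℝ), ∃ p : ℝ × ℝ, v + μ / ξ ≤ p.1 ∧ p.1 ≤ U.lam1 ∧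
        (State.mk (ξ / μ) v).pull p.1 = U.pull p.1 ∧ IsRay U ⟨ξ / μ, v⟩ p.1 p.2 := by
      filter_upwards [eventually_div_lt hξ (sub_pos.2 h), self_mem_nhdsWithin] with μ h1 h0
      obtain ⟨s, κ, h2, h3, h4, h5⟩ := exists_isRay_shadow hU (rho_mid_pos (v := v) hξ h0)
        (by rw [lam2_mid]; linarith)
      rw [lam2_mid] at h2
      exact ⟨(s, κ), h2, h3, h4, h5⟩
    obtain ⟨p, hp⟩ := hev.choice
    have hlim : Tendsto (fun μ => (p μ).1) (𝓝[>] 0) (𝓝 v) := by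
      refine tendsto_shadow_speed (U := U) (c := max |v| |U.lam1|) hξ ?_
      filter_upwards [hp, self_mem_nhdsWithin] with μ hμ h0
      refine ⟨hμ.2.2.1, abs_le_max_abs_abs ?_ hμ.2.1⟩
      have : 0 < μ / ξ := div_pos h0 hξ
      linarith [hμ.1]
    refine ⟨fun μ => (U.vel - v) * U.pull (p μ).1, ?_, fun h0 => absurd h0 hpos.ne', ?_⟩
    · rw [lossLeft, if_pos h, State.excess, ← neg_mul, neg_sub]
      refine Tendsto.const_mul _ ?_
      have : Continuous U.pull := by unfold State.pull; fun_prop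
      exact (this.tendsto v).comp hlim
    · filter_upwards [hp, self_mem_nhdsWithin] with μ hμ h0
      refine ⟨1, _, _, _, isFan_one hU (rho_mid_pos hξ h0) hμ.2.2.2, ?_⟩
      rw [fanRate_one hU (rho_mid_pos hξ h0) hμ.2.2.2, State.excess, State.excess, hμ.2.2.1]
      ring
  · rw [lossLeft_of_le h]
    refine ⟨fun _ => 0, tendsto_const_nhds, fun _ => Eventually.of_forall fun _ => rfl, ?_⟩
    filter_upwards [eventually_div_ne hξ (v - U.lam1), eventually_div_ne hξ (U.lam2 - v),
      self_mem_nhdsWithin] with μ h1 h2 h0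
    have h0' : 0 < μ / ξ := div_pos h0 hξ
    have hM := rho_mid_pos (v := v) hξ h0
    have l : U.lam1 < (State.mk (ξ / μ) v).lam2 := by rw [lam2_mid]; linarith
    have l1 : U.lam1 ≠ (State.mk (ξ / μ) v).lam1 := by
      rw [lam1_mid]; intro e; exact h1 (by linarith)
    have l2 : U.lam2 ≠ (State.mk (ξ / μ) v).lam2 := by
      rw [lam2_mid]; intro e; exact h2 (by linarith)
    exact ⟨2, _, _, _, isFan_contacts hU hM l l1 l2, by
      rw [fanRate_contacts hU hM l l1 l2, sub_zero]⟩

/-- The counterpart of `fanLoss_left`, with λ₂ in the place of λ₁. -/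
theorem fanLoss_right {U : State} (hU : 0 < U.rho) {ξ : ℝ} (hξ : 0 < ξ) (v : ℝ) :
    FanLoss (fun μ => ⟨ξ / μ, v⟩) (fun _ => U) (lossRight U v) := by
  rcases lt_or_ge U.lam2 v with h | h
  · have hpos := lossRight_pos hU h
    have hev : ∀ᶠ μ in 𝓝[>] (0 : ℝ), ∃ p : ℝ × ℝ, U.lam2 ≤ p.1 ∧ p.1 ≤ v - μ / ξ ∧
        (State.mk (ξ / μ) v).pull p.1 = U.pull p.1 ∧ IsRay ⟨ξ / μ, v⟩ U p.1 p.2 := by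
      filter_upwards [eventually_div_lt hξ (sub_pos.2 h), self_mem_nhdsWithin] with μ h1 h0
      obtain ⟨s, κ, h2, h3, h4, h5⟩ := exists_isRay_shadow (rho_mid_pos (v := v) hξ h0) hU
        (by rw [lam1_mid]; linarith)
      rw [lam1_mid] at h3
      exact ⟨(s, κ), h2, h3, h4.symm, h5⟩
    obtain ⟨p, hp⟩ := hev.choice
    have hlim : Tendsto (fun μ => (p μ).1) (𝓝[>] 0) (𝓝 v) := by
      refine tendsto_shadow_speed (U := U) (c := max |U.lam2| |v|) hξ ?_
      filter_upwards [hp, self_mem_nhdsWithin] with μ hμ h0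
      refine ⟨hμ.2.2.1, abs_le_max_abs_abs hμ.1 ?_⟩
      have : 0 < μ / ξ := div_pos h0 hξ
      linarith [hμ.2.1]
    refine ⟨fun μ => (v - U.vel) * U.pull (p μ).1, ?_, fun h0 => absurd h0 hpos.ne', ?_⟩
    · rw [lossRight, if_pos h, State.excess]
      refine Tendsto.const_mul _ ?_
      have : Continuous U.pull := by unfold State.pull; fun_prop
      exact (this.tendsto v).comp hlim
    · filter_upwards [hp, self_mem_nhdsWithin] with μ hμ h0
      refine ⟨1, _, _, _, isFan_one (rho_mid_pos hξ h0) hU hμ.2.2.2, ?_⟩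
      rw [fanRate_one (rho_mid_pos hξ h0) hU hμ.2.2.2, State.excess, State.excess, hμ.2.2.1]
      ring
  · rw [lossRight_of_le h]
    refine ⟨fun _ => 0, tendsto_const_nhds, fun _ => Eventually.of_forall fun _ => rfl, ?_⟩
    filter_upwards [eventually_div_ne hξ (U.lam2 - v), eventually_div_ne hξ (v - U.lam1),
      self_mem_nhdsWithin] with μ h1 h2 h0
    have h0' : 0 < μ / ξ := div_pos h0 hξ
    have hM := rho_mid_pos (v := v) hξ h0
    have l : (State.mk (ξ / μ) v).lam1 < U.lam2 := by rw [lam1_mid]; linarith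
    have l1 : (State.mk (ξ / μ) v).lam1 ≠ U.lam1 := by
      rw [lam1_mid]; intro e; exact h2 (by linarith)
    have l2 : (State.mk (ξ / μ) v).lam2 ≠ U.lam2 := by
      rw [lam2_mid]; intro e; exact h1 (by linarith)
    exact ⟨2, _, _, _, isFan_contacts hM hU l l1 l2, by
      rw [fanRate_contacts hM hU l l1 l2, sub_zero]⟩

/-- The limit of the initial dissipation for the value `v`, as `μ → 0+`. -/
noncomputable def loss (U₀ U₁ : State) (v : ℝ) : ℝ := lossLeft U₀ v + lossRight U₁ v

/-! ### Comparison of the values of the velocity: dissipation and initial energy -/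

section Data

variable {U₀ U₁ : State} {ξ : ℝ}

theorem loss_nonneg (hU₀ : 0 < U₀.rho) (hU₁ : 0 < U₁.rho) (v : ℝ) : 0 ≤ loss U₀ U₁ v :=
  add_nonneg (lossLeft_nonneg hU₀ v) (lossRight_nonneg hU₁ v)

theorem exists_rate (hU₀ : 0 < U₀.rho) (hU₁ : 0 < U₁.rho) (hξ : 0 < ξ) (v : ℝ) :
    ∃ D : ℝ → ℝ, Tendsto D (𝓝[>] 0) (𝓝 (loss U₀ U₁ v)) ∧
      (loss U₀ U₁ v = 0 → ∀ᶠ μ in 𝓝[>] (0 : ℝ), D μ = 0) ∧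
      ∀ ℓ > 0, ∀ᶠ μ in 𝓝[>] (0 : ℝ), HasInitialEnergyRate (deltaData U₀ U₁ ξ μ v) ℓ
        (U₀.energyFlux - U₁.energyFlux - D μ) := by
  obtain ⟨D, hD, hz, hfan⟩ := fanLoss_left hU₀ hξ v
  obtain ⟨D', hD', hz', hfan'⟩ := fanLoss_right hU₁ hξ v
  refine ⟨fun μ => D μ + D' μ, hD.add hD', fun h0 => ?_, fun ℓ hℓ => ?_⟩
  · have h1 := lossLeft_nonneg hU₀ v
    have h2 := lossRight_nonneg hU₁ v
    rw [loss] at h0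
    filter_upwards [hz (by linarith), hz' (by linarith)] with μ e e'
    rw [e, e', add_zero]
  · filter_upwards [hfan, hfan', self_mem_nhdsWithin,
      nhdsWithin_le_nhds (gt_mem_nhds (show 0 < 2 * ℓ by linarith))] with μ h h' h0 hμ
    obtain ⟨k, st, s, κ, hF, hr⟩ := h
    obtain ⟨k', st', s', κ', hF', hr'⟩ := h'
    have := hF.hasInitialEnergyRate h0 (show μ / 2 < ℓ by linarith) hF'
    rw [hr, hr'] at this
    convert this using 1
    ring

/-- Comparison of limits would not settle a tie between two values without limit loss. There the
exact vanishing of both losses for small `μ` is needed. -/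
theorem hasLeastDissipation_of_loss_eq_zero (hU₀ : 0 < U₀.rho) (hU₁ : 0 < U₁.rho) (hξ : 0 < ξ)
    {v : ℝ} (h : loss U₀ U₁ v = 0) : HasLeastDissipation U₀ U₁ ξ v := by
  intro ℓ hℓ v'
  obtain ⟨D, hD, hz, hr⟩ := exists_rate hU₀ hU₁ hξ v
  obtain ⟨D', hD', hz', hr'⟩ := exists_rate hU₀ hU₁ hξ v'
  have hle : ∀ᶠ μ in 𝓝[>] (0 : ℝ), D μ ≤ D' μ := by
    rcases (loss_nonneg hU₀ hU₁ v').eq_or_lt with h0 | h0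
    · filter_upwards [hz h, hz' h0.symm] with μ e e'
      rw [e, e']
    · filter_upwards [hz h, hD'.eventually (lt_mem_nhds h0)] with μ e e'
      rw [e]
      exact e'.le
  filter_upwards [hr ℓ hℓ, hr' ℓ hℓ, hle] with μ h1 h2 h3
  exact ⟨_, _, h1, h2, by linarith⟩

theorem hasLeastDissipation_of_lt (hU₀ : 0 < U₀.rho) (hU₁ : 0 < U₁.rho) (hξ : 0 < ξ)
    {v : ℝ} (h : ∀ v' ≠ v, loss U₀ U₁ v < loss U₀ U₁ v') : HasLeastDissipation U₀ U₁ ξ v := by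
  intro ℓ hℓ v'
  obtain ⟨D, hD, -, hr⟩ := exists_rate hU₀ hU₁ hξ v
  rcases eq_or_ne v' v with rfl | hne
  · filter_upwards [hr ℓ hℓ] with μ h1
    exact ⟨_, _, h1, h1, le_rfl⟩
  obtain ⟨D', hD', -, hr'⟩ := exists_rate hU₀ hU₁ hξ v'
  filter_upwards [hr ℓ hℓ, hr' ℓ hℓ, hD.eventually_lt hD' (h v' hne)] with μ h1 h2 h3
  exact ⟨_, _, h1, h2, by linarith⟩

/-- The rates in the definition are existential; their uniqueness identifies them with the computed
ones, and the inequality passes to the limit. -/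
theorem HasLeastDissipation.loss_le (hU₀ : 0 < U₀.rho) (hU₁ : 0 < U₁.rho) (hξ : 0 < ξ)
    {v : ℝ} (h : HasLeastDissipation U₀ U₁ ξ v) (v' : ℝ) : loss U₀ U₁ v ≤ loss U₀ U₁ v' := by
  obtain ⟨D, hD, -, hr⟩ := exists_rate hU₀ hU₁ hξ v
  obtain ⟨D', hD', -, hr'⟩ := exists_rate hU₀ hU₁ hξ v'
  refine le_of_tendsto_of_tendsto hD hD' ?_
  filter_upwards [h 1 one_pos v', hr 1 one_pos, hr' 1 one_pos] with μ ⟨d, d', h1, h2, h3⟩ h4 h5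
  have e1 := h1.unique h4
  have e2 := h2.unique h5
  linarith

theorem loss_eq_zero_iff (hU₀ : 0 < U₀.rho) (hU₁ : 0 < U₁.rho) {v : ℝ} :
    loss U₀ U₁ v = 0 ↔ U₀.lam1 ≤ v ∧ v ≤ U₁.lam2 := by
  refine ⟨fun h => ⟨?_, ?_⟩, fun h => ?_⟩
  · by_contra! h1
    have := lossLeft_pos hU₀ h1
    have := lossRight_nonneg hU₁ v
    rw [loss] at h
    linarith
  · by_contra! h1
    have := lossRight_pos hU₁ h1
    have := lossLeft_nonneg hU₀ v
    rw [loss] at h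
    linarith
  · rw [loss, lossLeft_of_le h.1, lossRight_of_le h.2, add_zero]

theorem hasLeastDissipation_iff (hU₀ : 0 < U₀.rho) (hU₁ : 0 < U₁.rho) (hξ : 0 < ξ)
    (h : U₀.lam1 ≤ U₁.lam2) {v : ℝ} :
    HasLeastDissipation U₀ U₁ ξ v ↔ U₀.lam1 ≤ v ∧ v ≤ U₁.lam2 := by
  rw [← loss_eq_zero_iff hU₀ hU₁]
  refine ⟨fun hv => ?_, hasLeastDissipation_of_loss_eq_zero hU₀ hU₁ hξ⟩
  have h1 := hv.loss_le hU₀ hU₁ hξ U₀.lam1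
  rw [(loss_eq_zero_iff hU₀ hU₁).2 ⟨le_rfl, h⟩] at h1
  exact le_antisymm h1 (loss_nonneg hU₀ hU₁ v)

/-- Only the term `ξ * v ^ 2` depends on `v`, so comparing total energies means comparing squares.
-/
theorem totalEnergy_deltaData {ℓ μ : ℝ} (hξ : 0 < ξ) (hμ : 0 < μ) (hℓ : μ / 2 < ℓ) (v : ℝ) :
    totalEnergy ℓ (deltaData U₀ U₁ ξ μ v)
      = (ℓ - μ / 2) * (U₀.energy + U₁.energy) + ξ * v ^ 2 + μ * (μ / ξ) := by
  have e1 : ∫ x in (-ℓ)..(-(μ / 2)), (deltaData U₀ U₁ ξ μ v x).energy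
      = ∫ x in (-ℓ)..(-(μ / 2)), U₀.energy := by
    refine intervalIntegral.integral_congr_ae ?_
    have : ∀ᵐ x : ℝ, x ≠ -(μ / 2) := by simp [ae_iff, measure_singleton]
    filter_upwards [this] with x hx hx'
    rw [Set.uIoc_of_le (by linarith)] at hx'
    rw [deltaData, if_pos (lt_of_le_of_ne hx'.2 hx)]
  have e2 : ∫ x in (-(μ / 2))..(μ / 2), (deltaData U₀ U₁ ξ μ v x).energy
      = ∫ x in (-(μ / 2))..(μ / 2), (State.mk (ξ / μ) v).energy := by
    refine intervalIntegral.integral_congr_ae ?_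
    have : ∀ᵐ x : ℝ, x ≠ μ / 2 := by simp [ae_iff, measure_singleton]
    filter_upwards [this] with x hx hx'
    rw [Set.uIoc_of_le (by linarith)] at hx'
    rw [deltaData, if_neg (not_lt.2 hx'.1.le), if_pos (lt_of_le_of_ne hx'.2 hx)]
  have e3 : ∫ x in (μ / 2)..ℓ, (deltaData U₀ U₁ ξ μ v x).energy
      = ∫ x in (μ / 2)..ℓ, U₁.energy := by
    refine intervalIntegral.integral_congr fun x hx => ?_
    rw [Set.uIcc_of_le hℓ.le] at hx
    show (deltaData U₀ U₁ ξ μ v x).energy = _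
    rw [deltaData, if_neg (not_lt.2 (by linarith [hx.1])), if_neg (not_lt.2 hx.1)]
  have hint : ∀ a b : ℝ, IntervalIntegrable (fun x => (deltaData U₀ U₁ ξ μ v x).energy)
      volume a b := by
    intro a b
    have : (fun x => (deltaData U₀ U₁ ξ μ v x).energy) = fun x =>
        if x < -(μ / 2) then U₀.energy else if x < μ / 2 then (State.mk (ξ / μ) v).energy
          else U₁.energy := by
      funext x
      rw [deltaData]
      split_ifs <;> rfl
    rw [this]
    have hm : Measurable fun x : ℝ => if x < -(μ / 2) then U₀.energy else
        if x < μ / 2 then (State.mk (ξ / μ) v).energy else U₁.energy :=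
      Measurable.ite measurableSet_Iio measurable_const
        (Measurable.ite measurableSet_Iio measurable_const measurable_const)
    refine (intervalIntegrable_const (c := |U₀.energy| + |(State.mk (ξ / μ) v).energy|
      + |U₁.energy|)).mono_fun' hm.aestronglyMeasurable (ae_of_all _ fun x => ?_)
    have a1 := abs_nonneg U₀.energy
    have a2 := abs_nonneg (State.mk (ξ / μ) v).energy
    have a3 := abs_nonneg U₁.energy
    simp only [Real.norm_eq_abs]
    split_ifs <;> linarith
  rw [totalEnergy, ← intervalIntegral.integral_add_adjacent_intervals (hint _ (-(μ / 2))) (hint _ _),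
    ← intervalIntegral.integral_add_adjacent_intervals (hint (-(μ / 2)) (μ / 2)) (hint _ _),
    e1, e2, e3]
  simp only [intervalIntegral.integral_const, smul_eq_mul, State.energy]
  field_simp
  ring

theorem eventually_totalEnergy_le_iff (hξ : 0 < ξ) {v v' : ℝ} :
    (∀ ℓ > 0, ∀ᶠ μ in 𝓝[>] (0 : ℝ),
      totalEnergy ℓ (deltaData U₀ U₁ ξ μ v) ≤ totalEnergy ℓ (deltaData U₀ U₁ ξ μ v'))
      ↔ v ^ 2 ≤ v' ^ 2 := by
  have key : ∀ ℓ > 0, ∀ᶠ μ in 𝓝[>] (0 : ℝ), (totalEnergy ℓ (deltaData U₀ U₁ ξ μ v)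
      ≤ totalEnergy ℓ (deltaData U₀ U₁ ξ μ v') ↔ v ^ 2 ≤ v' ^ 2) := by
    intro ℓ hℓ
    filter_upwards [self_mem_nhdsWithin,
      nhdsWithin_le_nhds (gt_mem_nhds (show 0 < 2 * ℓ by linarith))] with μ h0 hμ
    rw [totalEnergy_deltaData hξ h0 (by linarith), totalEnergy_deltaData hξ h0 (by linarith),
      add_le_add_iff_right, add_le_add_iff_left, mul_le_mul_iff_right₀ hξ]
  refine ⟨fun h => ?_, fun h ℓ hℓ => ?_⟩
  · obtain ⟨μ, h1, h2⟩ := ((h 1 one_pos).and (key 1 one_pos)).exists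
    exact h2.1 h1
  · filter_upwards [key ℓ hℓ] with μ hμ using hμ.2 h

/-- The values of least dissipation form the interval from λ₁(U₀) to λ₂(U₁), and the energy
criterion projects 0 onto it. -/
theorem backwardEnergy_iff_of_le (hU₀ : 0 < U₀.rho) (hU₁ : 0 < U₁.rho) (hξ : 0 < ξ)
    (h : U₀.lam1 ≤ U₁.lam2) {v : ℝ} :
    BackwardEnergy U₀ U₁ ξ v ↔
      v = if U₁.lam2 < 0 then U₁.lam2 else if 0 < U₀.lam1 then U₀.lam1 else 0 := by
  simp only [BackwardEnergy, hasLeastDissipation_iff hU₀ hU₁ hξ h,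
    eventually_totalEnergy_le_iff hξ]
  split_ifs with h1 h2
  · refine ⟨fun ⟨hv, hmin⟩ => ?_, ?_⟩
    · have := hmin U₁.lam2 ⟨h, le_rfl⟩
      nlinarith
    · rintro rfl
      exact ⟨⟨h, le_rfl⟩, fun v' hv' => by nlinarith⟩
  · refine ⟨fun ⟨hv, hmin⟩ => ?_, ?_⟩
    · have := hmin U₀.lam1 ⟨le_rfl, h⟩
      nlinarith
    · rintro rfl
      exact ⟨⟨le_rfl, h⟩, fun v' hv' => by nlinarith⟩
  · refine ⟨fun ⟨hv, hmin⟩ => ?_, ?_⟩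
    · have := hmin 0 ⟨not_lt.1 h2, not_lt.1 h1⟩
      nlinarith
    · rintro rfl
      exact ⟨⟨not_lt.1 h2, not_lt.1 h1⟩, fun v' hv' => by nlinarith⟩

/-- The midpoint defect of the cubic has the sign of the mass flux relative to the midpoint, so
`excess` is strictly convex for speeds above the velocity and strictly concave below. -/
theorem excess_midpoint {U : State} (hU : 0 < U.rho) (x y : ℝ) :
    U.excess x + U.excess y - 2 * U.excess ((x + y) / 2)
      = 3 / 2 * (U.rho * ((x + y) / 2 - U.vel)) * (x - y) ^ 2 := by
  rw [State.excess_eq hU, State.excess_eq hU, State.excess_eq hU]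
  simp only [State.mom]
  ring

theorem loss_eq (v : ℝ) (h : U₀.lam1 ≥ v) (h' : U₁.lam2 ≤ v) (hU₀ : 0 < U₀.rho)
    (hU₁ : 0 < U₁.rho) : loss U₀ U₁ v = U₁.excess v - U₀.excess v := by
  have e1 : lossLeft U₀ v = -U₀.excess v := by
    rcases h.lt_or_eq with h | h
    · exact if_pos h
    · rw [h, lossLeft_of_le le_rfl, excess_lam1 hU₀, neg_zero]
  have e2 : lossRight U₁ v = U₁.excess v := by
    rcases h'.lt_or_eq with h | h
    · exact if_pos h
    · rw [← h, lossRight_of_le le_rfl, excess_lam2 hU₁]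
  rw [loss, e1, e2]
  ring

/-- Below λ₁ the loss is a product of the positive decreasing factors `U.vel - v` and `U.pull v`. -/
theorem lossLeft_anti {U : State} (hU : 0 < U.rho) {x y : ℝ} (hxy : x < y) (h : x < U.lam1) :
    lossLeft U y < lossLeft U x := by
  rcases le_or_gt U.lam1 y with hy | hy
  · rw [lossLeft_of_le hy]
    exact lossLeft_pos hU h
  · rw [lossLeft, lossLeft, if_pos h, if_pos hy, State.excess, State.excess, State.pull_eq hU,
      State.pull_eq hU, U.vel_eq]
    have h2 := State.lam1_lt_lam2 hU
    have p1 : U.rho * (y - U.lam1) * (y - U.lam2) < U.rho * (x - U.lam1) * (x - U.lam2) := by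
      rw [mul_assoc, mul_assoc]
      refine mul_lt_mul_of_pos_left ?_ hU
      nlinarith
    have p2 : 0 < U.rho * (y - U.lam1) * (y - U.lam2) := by
      rw [mul_assoc]; exact mul_pos hU (mul_pos_of_neg_of_neg (by linarith) (by linarith))
    nlinarith

theorem lossRight_mono {U : State} (hU : 0 < U.rho) {x y : ℝ} (hxy : x < y) (h : U.lam2 < y) :
    lossRight U x < lossRight U y := by
  rcases le_or_gt x U.lam2 with hy | hy
  · rw [lossRight_of_le hy]
    exact lossRight_pos hU h
  · rw [lossRight, lossRight, if_pos h, if_pos hy, State.excess, State.excess, State.pull_eq hU,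
      State.pull_eq hU, U.vel_eq]
    have h2 := State.lam1_lt_lam2 hU
    have p1 : U.rho * (x - U.lam1) * (x - U.lam2) < U.rho * (y - U.lam1) * (y - U.lam2) := by
      rw [mul_assoc, mul_assoc]
      refine mul_lt_mul_of_pos_left ?_ hU
      nlinarith
    have p2 : 0 < U.rho * (x - U.lam1) * (x - U.lam2) := by
      rw [mul_assoc]; exact mul_pos hU (mul_pos (by linarith) (by linarith))
    nlinarith

/-- In the overcompressive case the limit of the dissipation has exactly one minimizer. -/
theorem exists_loss_lt (hU₀ : 0 < U₀.rho) (hU₁ : 0 < U₁.rho) (h : U₁.lam2 < U₀.lam1) :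
    ∃ v, U₁.lam2 ≤ v ∧ v ≤ U₀.lam1 ∧ ∀ v' ≠ v, loss U₀ U₁ v < loss U₀ U₁ v' := by
  have hc : ContinuousOn (fun v => U₁.excess v - U₀.excess v) (Set.Icc U₁.lam2 U₀.lam1) := by
    simp only [State.excess, State.pull]; fun_prop
  obtain ⟨v, hv, hmin⟩ := isCompact_Icc.exists_isMinOn (Set.nonempty_Icc.2 h.le) hc
  -- Inside the interval the loss is strictly convex, since both midpoint defects have the right
  -- sign; a second point as good as the minimizer would be beaten by the midpoint.
  have inner : ∀ v' ∈ Set.Icc U₁.lam2 U₀.lam1, v' ≠ v → loss U₀ U₁ v < loss U₀ U₁ v' := by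
    intro v' hv' hne
    rw [loss_eq v hv.2 hv.1 hU₀ hU₁, loss_eq v' hv'.2 hv'.1 hU₀ hU₁]
    have h1 : U₁.excess v - U₀.excess v
        ≤ U₁.excess ((v + v') / 2) - U₀.excess ((v + v') / 2) :=
      hmin ⟨by linarith [hv.1, hv'.1], by linarith [hv.2, hv'.2]⟩
    have m0 := excess_midpoint hU₀ v v'
    have m1 := excess_midpoint hU₁ v v'
    have hsq : 0 < (v - v') ^ 2 := by
      have := sub_ne_zero.2 hne.symm
      positivity
    have l0 := State.mass_flux_left hU₀ (s := (v + v') / 2) (by linarith [hv.2, hv'.2])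
    have l1 := State.mass_flux_right hU₁ (s := (v + v') / 2) (by linarith [hv.1, hv'.1])
    simp only [State.mom] at l0 l1
    nlinarith
  refine ⟨v, hv.1, hv.2, fun v' hne => ?_⟩
  have le_of : ∀ y ∈ Set.Icc U₁.lam2 U₀.lam1, loss U₀ U₁ v ≤ loss U₀ U₁ y := by
    intro y hy
    rcases eq_or_ne y v with rfl | h'
    · exact le_rfl
    · exact (inner y hy h').le
  -- Outside the interval one of the two losses vanishes and the other is strictly larger than at
  -- the nearer endpoint.
  rcases lt_or_ge v' U₁.lam2 with h1 | h1
  · refine (le_of U₁.lam2 ⟨le_rfl, h.le⟩).trans_lt ?_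
    have := lossLeft_anti hU₀ h1 (h1.trans h)
    rw [loss, loss, lossRight_of_le h1.le, lossRight_of_le le_rfl]
    linarith
  rcases le_or_gt v' U₀.lam1 with h2 | h2
  · exact inner v' ⟨h1, h2⟩ hne
  · refine (le_of U₀.lam1 ⟨h.le, le_rfl⟩).trans_lt ?_
    have := lossRight_mono hU₁ h2 (h.trans h2)
    rw [loss, loss, lossLeft_of_le h2.le, lossLeft_of_le le_rfl]
    linarith

theorem exists_backwardEnergy_iff (hU₀ : 0 < U₀.rho) (hU₁ : 0 < U₁.rho) (hξ : 0 < ξ)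
    (h : U₁.lam2 < U₀.lam1) :
    ∃ v, U₁.lam2 ≤ v ∧ v ≤ U₀.lam1 ∧ ∀ v', BackwardEnergy U₀ U₁ ξ v' ↔ v' = v := by
  obtain ⟨v, h1, h2, hmin⟩ := exists_loss_lt hU₀ hU₁ h
  have hiff : ∀ v', HasLeastDissipation U₀ U₁ ξ v' ↔ v' = v := by
    intro v'
    constructor
    · intro hv'
      by_contra hne
      exact absurd (hv'.loss_le hU₀ hU₁ hξ v) (not_le.2 (hmin v' hne))
    · rintro rfl
      exact hasLeastDissipation_of_lt hU₀ hU₁ hξ hmin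
  refine ⟨v, h1, h2, fun v' => ?_⟩
  rw [BackwardEnergy, hiff]
  refine ⟨fun k => k.1, fun k => ⟨k, fun w hw => ?_⟩⟩
  rw [(hiff w).1 hw, ← k]
  exact fun ℓ _ => Eventually.of_forall fun μ => le_rfl

end Data

end Chaplygin

namespace Chaplygin

/-! ### Slices in terms of the regions between the fronts -/

/-- The integral of `ψ` over the half line to the right of `p` at time `t`. -/
noncomputable def tail (ψ : ℝ × ℝ → ℝ) (p t : ℝ) : ℝ := ∫ y in Set.Ioi 0, ψ (p + y, t)

/-- The mean value of `ψ` between `p` and `q` at time `t`. -/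
noncomputable def mean (ψ : ℝ × ℝ → ℝ) (p q t : ℝ) : ℝ := ∫ θ in (0 : ℝ)..1, ψ (p + (q - p) * θ, t)

section Mean

variable {ψ : ℝ × ℝ → ℝ} {p q r t : ℝ}

theorem tail_eq (ψ : ℝ × ℝ → ℝ) (p t : ℝ) : tail ψ p t = ∫ x in Set.Ioi p, ψ (x, t) := by
  have := Pattern.integral_ite_lt_mul 1 p fun x => ψ (x, t)
  rw [one_mul] at this
  rw [tail, ← this, ← integral_indicator measurableSet_Ioi]
  refine integral_congr_ae (ae_of_all _ fun x => ?_)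
  by_cases hx : p < x <;> simp [hx]

/-- Writing integrals between fronts as width times mean separates the factor that may vanish, and
the mean itself is continuous even where the endpoints coincide. -/
theorem sub_mul_mean (ψ : ℝ × ℝ → ℝ) (p q t : ℝ) :
    (q - p) * mean ψ p q t = ∫ x in p..q, ψ (x, t) := by
  have := intervalIntegral.smul_integral_comp_add_mul (a := 0) (b := 1)
    (fun x => ψ (x, t)) (q - p) p
  rw [smul_eq_mul, mul_zero, mul_one, add_zero, add_sub_cancel] at this
  exact this

theorem tail_sub_tail (hψ : Continuous ψ) (hc : HasCompactSupport ψ) (p q t : ℝ) :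
    tail ψ p t - tail ψ q t = (q - p) * mean ψ p q t := by
  have hi := integrable_section hψ hc t
  rw [sub_mul_mean, tail_eq, tail_eq,
    intervalIntegral.integral_Ioi_sub_Ioi' hi.integrableOn hi.integrableOn]

theorem tail_of_le (hz : ∀ x t, r ≤ |x| ∨ r ≤ |t| → ψ (x, t) = 0) (hr : 0 ≤ r) (t : ℝ) :
    tail ψ r t = 0 := by
  rw [tail, setIntegral_eq_zero_of_forall_eq_zero]
  intro y hy
  have hy : 0 < y := hy
  exact hz _ _ (.inl (by rw [abs_of_nonneg (by linarith)]; linarith))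

theorem integral_eq_tail (hz : ∀ x t, r ≤ |x| ∨ r ≤ |t| → ψ (x, t) = 0) (hr : 0 ≤ r) (t : ℝ) :
    ∫ x, ψ (x, t) = tail ψ (-r) t := by
  rw [tail_eq, setIntegral_eq_integral_of_forall_compl_eq_zero]
  intro x hx
  have hx : x ≤ -r := not_lt.1 hx
  exact hz _ _ (.inl (by rw [abs_of_nonpos (by linarith)]; linarith))

theorem continuous_mean (hψ : Continuous ψ) :
    Continuous fun z : ℝ × ℝ × ℝ => mean ψ z.1 z.2.1 z.2.2 := by
  unfold mean
  exact intervalIntegral.continuous_parametric_intervalIntegral_of_continuous' (by fun_prop) _ _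

theorem mean_self (ψ : ℝ × ℝ → ℝ) (p t : ℝ) : mean ψ p p t = ψ (p, t) := by simp [mean]

theorem abs_mean_le {C : ℝ} (hC : ∀ z, |ψ z| ≤ C) (p q t : ℝ) : |mean ψ p q t| ≤ C := by
  have := intervalIntegral.norm_integral_le_of_norm_le_const (a := 0) (b := 1)
    (f := fun θ => ψ (p + (q - p) * θ, t)) (C := C) fun x _ => hC _
  simpa [mean] using this

end Mean

namespace Pattern

variable {P : Pattern} {ψ : ℝ × ℝ → ℝ} {t r : ℝ}

/-- Summation by parts in the formula by fronts; each bounded region appears as state value times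
width times mean, the form in which thin dense regions can be controlled. -/
theorem Sorted.slice_eq_regions (h : P.Sorted t) {m : ℕ} (hm : P.n = m + 1) (g : State → ℝ)
    (α : ℝ → ℝ) (hψ : Continuous ψ) (hc : HasCompactSupport ψ)
    (hz : ∀ x t, r ≤ |x| ∨ r ≤ |t| → ψ (x, t) = 0) (hr : 0 ≤ r) :
    P.slice g α ψ t = g (P.state 0) * ((P.pos 0 t - -r) * mean ψ (-r) (P.pos 0 t) t)
      + ∑ i ∈ Finset.range m, g (P.state (i + 1))
        * ((P.pos (i + 1) t - P.pos i t) * mean ψ (P.pos i t) (P.pos (i + 1) t) t)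
      + g (P.state (m + 1)) * ((r - P.pos m t) * mean ψ (P.pos m t) r t)
      + ∑ i ∈ Finset.range (m + 1), P.str i t * α (P.speed i t) * ψ (P.pos i t, t) := by
  have e : ∑ i ∈ Finset.range (m + 1),
      (g (P.state (i + 1)) - g (P.state i)) * tail ψ (P.pos i t) t
      = g (P.state (m + 1)) * tail ψ (P.pos m t) t - g (P.state 0) * tail ψ (P.pos 0 t) t
        + ∑ i ∈ Finset.range m, g (P.state (i + 1))
          * (tail ψ (P.pos i t) t - tail ψ (P.pos (i + 1) t) t) := by
    simp only [sub_mul, mul_sub, Finset.sum_sub_distrib]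
    rw [Finset.sum_range_succ, Finset.sum_range_succ' _ m]
    ring
  rw [h.slice_eq g α hψ hc, hm, Finset.sum_add_distrib]
  change _ + (∑ i ∈ Finset.range (m + 1),
      (g (P.state (i + 1)) - g (P.state i)) * tail ψ (P.pos i t) t + _) = _
  rw [e, integral_eq_tail hz hr]
  simp only [← tail_sub_tail hψ hc, tail_of_le hz hr]
  ring

theorem base_eq_sum (P : Pattern) (x t : ℝ) :
    P.base x t = P.state (∑ i ∈ Finset.range P.n, if P.pos i t < x then 1 else 0) := by
  rw [base, Finset.card_filter]

end Pattern

/-- The amount of the quantity `g` between the fronts of speeds `a` and `b` of a fan that is one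
unit of time old; for `a = b` it is carried by a shadow wave. -/
structure IsContent (g : State → ℝ) (α : ℝ → ℝ) (G : ℝ → ℝ → ℝ) : Prop where
  flux : IsFlux g α
  cont : Continuous fun p : ℝ × ℝ => G p.1 p.2
  eq : ∀ a b, a < b → (b - a) * g (State.ofLam a b) = G a b
  diag : ∀ a, 2 * α a = G a a

/-- The mass between the fronts of a fan of age one is 2 whatever the speeds are, and this is also
the growth rate of the delta for coinciding speeds. -/
theorem isContent_rho : IsContent State.rho (fun _ => 1) (fun _ _ => 2) where
  flux := isFlux_rho
  cont := by fun_prop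
  eq a b h := by
    have := sub_pos.2 h
    simp only [State.ofLam]; field_simp
  diag _ := by norm_num

theorem isContent_vel :
    IsContent State.vel (fun _ => 0) (fun a b => (b - a) * ((a + b) / 2)) where
  flux := isFlux_vel
  cont := by fun_prop
  eq a b h := rfl
  diag _ := by ring

theorem isContent_mom : IsContent State.mom (fun v => v) (fun a b => a + b) where
  flux := isFlux_mom
  cont := by fun_prop
  eq a b h := by
    have := sub_pos.2 h
    simp only [State.ofLam, State.mom]; field_simp
  diag _ := by ring

end Chaplygin

namespace Chaplygin

/-! ### Contact discontinuities that meet -/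

namespace Meeting

variable {U₀ U₁ : State} {ξ μ v : ℝ}

/-- The pattern up to the time `ξ / 2`. -/
noncomputable def first (U₀ U₁ : State) (ξ μ v : ℝ) : Pattern :=
  twoFans μ 2 2
    (fun i => if i = 0 then U₀ else if i = 1 then U₀.between ⟨ξ / μ, v⟩ else ⟨ξ / μ, v⟩)
    (fun i => if i = 0 then ⟨ξ / μ, v⟩ else if i = 1 then State.between ⟨ξ / μ, v⟩ U₁ else U₁)
    (fun i => if i = 0 then U₀.lam1 else (State.mk (ξ / μ) v).lam2) (fun _ => 0)
    (fun i => if i = 0 then (State.mk (ξ / μ) v).lam1 else U₁.lam2) (fun _ => 0)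

/-- The pattern after the time `ξ / 2`, with two contact discontinuities in the middle. -/
noncomputable def split (U₀ U₁ : State) (ξ μ v : ℝ) : Pattern :=
  Pattern.affine 4
    (fun
      | 0 => U₀
      | 1 => U₀.between ⟨ξ / μ, v⟩
      | 2 => U₀.between U₁
      | 3 => State.between ⟨ξ / μ, v⟩ U₁
      | _ => U₁)
    (fun
      | 0 => -(μ / 2) + U₀.lam1 * (ξ / 2)
      | 1 => v * (ξ / 2)
      | 2 => v * (ξ / 2)
      | _ => μ / 2 + U₁.lam2 * (ξ / 2))
    (fun
      | 0 => U₀.lam1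
      | 1 => U₀.lam1
      | _ => U₁.lam2)
    (fun _ => 0) (ξ / 2)

/-- The pattern after the time `ξ / 2`, with a shadow wave in the middle. -/
noncomputable def merge (U₀ U₁ : State) (ξ μ v : ℝ) : Pattern :=
  Pattern.affine 3
    (fun
      | 0 => U₀
      | 1 => U₀.between ⟨ξ / μ, v⟩
      | 2 => State.between ⟨ξ / μ, v⟩ U₁
      | _ => U₁)
    (fun
      | 0 => -(μ / 2) + v * (ξ / 2)
      | 1 => v * (ξ / 2)
      | _ => μ / 2 + v * (ξ / 2))
    (fun _ => v) (fun i => if i = 1 then 2 else 0) (ξ / 2)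

/-- The solution, with `P` the pattern after the time `ξ / 2`. -/
noncomputable def tracking (U₀ U₁ : State) (ξ μ v : ℝ) (P : Pattern) : WaveTracking where
  K := 1
  T k := if k = 0 then 0 else ξ / 2
  slab k := if k = 0 then first U₀ U₁ ξ μ v else P

/-- The waves next to the concentrated state `(ξ / μ, v)` are contact discontinuities. -/
structure Generic (U₀ U₁ : State) (ξ μ v : ℝ) : Prop where
  rho₀ : 0 < U₀.rho
  rho₁ : 0 < U₁.rho
  mass : 0 < ξ
  le_v : U₀.lam1 ≤ v
  v_le : v ≤ U₁.lam2
  pos : 0 < μ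
  left1 : U₀.lam1 ≠ v - μ / ξ
  left2 : U₀.lam2 ≠ v + μ / ξ
  right1 : U₁.lam1 ≠ v - μ / ξ
  right2 : U₁.lam2 ≠ v + μ / ξ

theorem eventually_generic (hU₀ : 0 < U₀.rho) (hU₁ : 0 < U₁.rho) (hξ : 0 < ξ) (h₀ : U₀.lam1 ≤ v)
    (h₁ : v ≤ U₁.lam2) : ∀ᶠ μ in 𝓝[>] (0 : ℝ), Generic U₀ U₁ ξ μ v := by
  filter_upwards [eventually_div_ne hξ (v - U₀.lam1), eventually_div_ne hξ (U₀.lam2 - v),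
    eventually_div_ne hξ (v - U₁.lam1), eventually_div_ne hξ (U₁.lam2 - v),
    self_mem_nhdsWithin] with μ e1 e2 e3 e4 e5
  exact ⟨hU₀, hU₁, hξ, h₀, h₁, e5, fun e => e1 (by linarith), fun e => e2 (by linarith),
    fun e => e3 (by linarith), fun e => e4 (by linarith)⟩

namespace Generic

theorem half_eq (h : Generic U₀ U₁ ξ μ v) : μ / 2 = μ / ξ * (ξ / 2) := by
  have := h.mass
  field_simp

theorem div_pos (h : Generic U₀ U₁ ξ μ v) : 0 < μ / ξ := _root_.div_pos h.pos h.mass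

theorem half_pos (h : Generic U₀ U₁ ξ μ v) : 0 < ξ / 2 := _root_.half_pos h.mass

theorem rho_mid (h : Generic U₀ U₁ ξ μ v) : 0 < (State.mk (ξ / μ) v).rho :=
  rho_mid_pos h.mass h.pos

theorem left_lt (h : Generic U₀ U₁ ξ μ v) : U₀.lam1 < (State.mk (ξ / μ) v).lam2 := by
  rw [lam2_mid]; linarith [h.div_pos, h.le_v]

theorem right_lt (h : Generic U₀ U₁ ξ μ v) : (State.mk (ξ / μ) v).lam1 < U₁.lam2 := by
  rw [lam1_mid]; linarith [h.div_pos, h.v_le]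

theorem fan_left (h : Generic U₀ U₁ ξ μ v) : IsFan U₀ ⟨ξ / μ, v⟩ 2
    (fun i => if i = 0 then U₀ else if i = 1 then U₀.between ⟨ξ / μ, v⟩ else ⟨ξ / μ, v⟩)
    (fun i => if i = 0 then U₀.lam1 else (State.mk (ξ / μ) v).lam2) (fun _ => 0) :=
  isFan_contacts h.rho₀ h.rho_mid h.left_lt (by rw [lam1_mid]; exact h.left1)
    (by rw [lam2_mid]; exact h.left2)

theorem fan_right (h : Generic U₀ U₁ ξ μ v) : IsFan ⟨ξ / μ, v⟩ U₁ 2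
    (fun i => if i = 0 then ⟨ξ / μ, v⟩ else if i = 1 then State.between ⟨ξ / μ, v⟩ U₁ else U₁)
    (fun i => if i = 0 then (State.mk (ξ / μ) v).lam1 else U₁.lam2) (fun _ => 0) :=
  isFan_contacts h.rho_mid h.rho₁ h.right_lt (by rw [lam1_mid]; exact h.right1.symm)
    (by rw [lam2_mid]; exact h.right2.symm)

theorem first_admissible (h : Generic U₀ U₁ ξ μ v) :
    (first U₀ U₁ ξ μ v).IsAdmissibleOn 0 (Set.Icc 0 (ξ / 2)) := by
  refine Pattern.affine_admissible Set.Icc_subset_Ici_self (h.fan_left.glue_rho_pos h.fan_right)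
    (fun t ht i hi => ?_) (h.fan_left.glue_ray h.fan_right)
  rw [interior_Icc] at ht
  have hlt := h.left_lt
  have hlt' := h.right_lt
  have h0 := h.div_pos
  rw [sub_zero]
  rw [lam2_mid] at hlt
  rw [lam1_mid] at hlt'
  have hi : i < 3 := by omega
  interval_cases i
  · have := mul_lt_mul_of_pos_right hlt ht.1
    simpa [glue, lam2_mid] using this
  · have := mul_lt_mul_of_pos_left ht.2 h0
    have e := h.half_eq
    simp only [glue, lam2_mid, lam1_mid, Nat.lt_irrefl, Nat.one_lt_two, if_true, if_false,
      Nat.reduceAdd, Nat.sub_self, one_ne_zero]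
    linarith
  · have := mul_lt_mul_of_pos_right hlt' ht.1
    simpa [glue, lam1_mid] using this

theorem startsFrom (h : Generic U₀ U₁ ξ μ v) :
    (first U₀ U₁ ξ μ v).StartsFrom 0 (deltaData U₀ U₁ ξ μ v) (fun _ => 0) (fun _ => 0) :=
  h.fan_left.startsFrom h.pos h.fan_right

theorem rays (h : Generic U₀ U₁ ξ μ v) :
    IsRay U₀ (U₀.between ⟨ξ / μ, v⟩) U₀.lam1 0 ∧ IsRay (State.between ⟨ξ / μ, v⟩ U₁) U₁ U₁.lam2 0 :=
  ⟨isRay_between_left (by rw [lam2_mid]; exact h.left2),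
    isRay_between_right (by rw [lam1_mid]; exact h.right1.symm)⟩

theorem split_admissible (h : Generic U₀ U₁ ξ μ v) (hlt : U₀.lam1 < U₁.lam2) :
    (split U₀ U₁ ξ μ v).IsAdmissibleOn (ξ / 2) (Set.Ici (ξ / 2)) := by
  have hL := State.rho_between_pos h.left_lt
  have hR := State.rho_between_pos h.right_lt
  have hM := State.rho_between_pos hlt
  refine Pattern.affine_admissible le_rfl (fun i hi => ?_) (fun t ht i hi => ?_) (fun i hi => ?_)
  · interval_cases i
    exacts [h.rho₀, hL, hM, hR, h.rho₁]
  · rw [interior_Ici] at ht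
    have ht0 : 0 < t - ξ / 2 := sub_pos.2 ht
    have hμ := h.pos
    have hξ := h.half_pos
    have hi : i < 3 := by omega
    interval_cases i
    · change -(μ / 2) + U₀.lam1 * (ξ / 2) + U₀.lam1 * (t - ξ / 2)
        < v * (ξ / 2) + U₀.lam1 * (t - ξ / 2)
      have := mul_le_mul_of_nonneg_right h.le_v hξ.le
      linarith
    · change v * (ξ / 2) + U₀.lam1 * (t - ξ / 2) < v * (ξ / 2) + U₁.lam2 * (t - ξ / 2)
      have := mul_lt_mul_of_pos_right hlt ht0
      linarith
    · change v * (ξ / 2) + U₁.lam2 * (t - ξ / 2)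
        < μ / 2 + U₁.lam2 * (ξ / 2) + U₁.lam2 * (t - ξ / 2)
      have := mul_le_mul_of_nonneg_right h.v_le hξ.le
      linarith
  · interval_cases i
    · exact h.rays.1
    -- The neighbouring states share λ₁; their λ₂ are `v + μ / ξ` and `U₁.lam2`, which differ by
    -- genericity.
    · refine .inl ⟨fun e => h.right2 ?_, rfl, .inl ⟨?_, ?_⟩⟩
      · have := congrArg State.lam2 e
        simpa [lam2_mid] using this.symm
      · simp
      · simp
    · refine .inl ⟨fun e => h.left1 ?_, rfl, .inr ⟨?_, ?_⟩⟩
      · have := congrArg State.lam1 e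
        simpa [lam1_mid] using this
      · simp
      · simp
    · exact h.rays.2

theorem merge_admissible (h : Generic U₀ U₁ ξ μ v) (h0 : U₀.lam1 = v) (h1 : U₁.lam2 = v) :
    (merge U₀ U₁ ξ μ v).IsAdmissibleOn (ξ / 2) (Set.Ici (ξ / 2)) := by
  have hL := State.rho_between_pos h.left_lt
  have hR := State.rho_between_pos h.right_lt
  refine Pattern.affine_admissible le_rfl (fun i hi => ?_) (fun t ht i hi => ?_) (fun i hi => ?_)
  · interval_cases i
    exacts [h.rho₀, hL, hR, h.rho₁]
  · have hμ := h.pos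
    have hi : i < 2 := by omega
    interval_cases i
    · change -(μ / 2) + v * (ξ / 2) + v * (t - ξ / 2) < v * (ξ / 2) + v * (t - ξ / 2)
      linarith
    · change v * (ξ / 2) + v * (t - ξ / 2) < μ / 2 + v * (ξ / 2) + v * (t - ξ / 2)
      linarith
  · interval_cases i
    · have := h.rays.1
      rw [h0] at this
      exact this
    · have e1 : (U₀.between ⟨ξ / μ, v⟩).lam1 = v := by rw [State.lam1_between, h0]
      have e2 : (State.between ⟨ξ / μ, v⟩ U₁).lam2 = v := by rw [State.lam2_between, h1]
      -- The front moves with λ₁ of its left and λ₂ of its right state, so each side supplies mass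
      -- at rate exactly 1 and both pulls vanish.
      have m1 := State.mom_sub_lam1 hL
      have m2 := State.mom_sub_lam2 hR
      have p1 := State.pull_lam1 hL
      have p2 := State.pull_lam2 hR
      rw [e1] at m1 p1
      rw [e2] at m2 p2
      refine .inr ⟨e2.le, e1.ge, ?_, p2.trans p1.symm⟩
      change (2 : ℝ) = v * ((State.between ⟨ξ / μ, v⟩ U₁).rho - (U₀.between ⟨ξ / μ, v⟩).rho)
        - ((State.between ⟨ξ / μ, v⟩ U₁).mom - (U₀.between ⟨ξ / μ, v⟩).mom)
      linarith
    · have := h.rays.2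
      rw [h1] at this
      exact this

end Generic

end Meeting

end Chaplygin

/-! ### Continuation through the meeting of the inner contacts, and its limit -/

namespace Chaplygin

theorem Pattern.IsAdmissibleOn.sorted_of_le {P : Pattern} {a t : ℝ}
    (h : P.IsAdmissibleOn a (Set.Ici a)) (ht : a ≤ t) : P.Sorted t := by
  have hs : Set.Icc a (t + 1) ⊆ Set.Ici a := Set.Icc_subset_Ici_self
  exact (h.mono hs).sorted (by linarith) ⟨ht, by linarith⟩

namespace Meeting

variable {U₀ U₁ : State} {ξ μ v : ℝ}

theorem first_pos (t : ℝ) :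
    (first U₀ U₁ ξ μ v).pos 0 t = -(μ / 2) + U₀.lam1 * t ∧
    (first U₀ U₁ ξ μ v).pos 1 t = -(μ / 2) + (v + μ / ξ) * t ∧
    (first U₀ U₁ ξ μ v).pos 2 t = μ / 2 + (v - μ / ξ) * t ∧
    (first U₀ U₁ ξ μ v).pos 3 t = μ / 2 + U₁.lam2 * t := by
  simp [first, twoFans, glue, lam1_mid, lam2_mid]

theorem first_str (i : ℕ) (t : ℝ) : (first U₀ U₁ ξ μ v).str i t = 0 := by
  simp [first, twoFans, glue]

namespace Generic

/-- A pattern with the same outer fronts that starts in the meeting point continues the first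
pattern. -/
theorem startsFrom_of_base (h : Generic U₀ U₁ ξ μ v) {P : Pattern}
    (hm : ∀ x, P.massAt x (ξ / 2) = 0) (hq : ∀ x, P.momAt x (ξ / 2) = 0)
    (h0 : ∀ x < -(μ / 2) + U₀.lam1 * (ξ / 2), P.base x (ξ / 2) = U₀)
    (h1 : ∀ x, -(μ / 2) + U₀.lam1 * (ξ / 2) < x → x < v * (ξ / 2) →
      P.base x (ξ / 2) = U₀.between ⟨ξ / μ, v⟩)
    (h2 : ∀ x, v * (ξ / 2) < x → x < μ / 2 + U₁.lam2 * (ξ / 2) →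
      P.base x (ξ / 2) = State.between ⟨ξ / μ, v⟩ U₁)
    (h3 : ∀ x, μ / 2 + U₁.lam2 * (ξ / 2) < x → P.base x (ξ / 2) = U₁) :
    P.StartsFrom (ξ / 2) (fun x => (first U₀ U₁ ξ μ v).base x (ξ / 2))
      (fun x => (first U₀ U₁ ξ μ v).massAt x (ξ / 2))
      (fun x => (first U₀ U₁ ξ μ v).momAt x (ξ / 2)) := by
  refine ⟨?_, fun x => ?_, fun x => ?_⟩
  · filter_upwards [(Set.finite_singleton (-(μ / 2) + U₀.lam1 * (ξ / 2))).compl_mem_cofinite,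
      (Set.finite_singleton (v * (ξ / 2))).compl_mem_cofinite,
      (Set.finite_singleton (μ / 2 + U₁.lam2 * (ξ / 2))).compl_mem_cofinite] with x x0 x1 x2
    simp only [Set.mem_compl_iff, Set.mem_singleton_iff] at x0 x1 x2
    obtain ⟨p0, p1, p2, p3⟩ := first_pos (U₀ := U₀) (U₁ := U₁) (ξ := ξ) (μ := μ) (v := v) (ξ / 2)
    have e := h.half_eq
    rw [show -(μ / 2) + (v + μ / ξ) * (ξ / 2) = v * (ξ / 2) by linarith] at p1
    rw [show μ / 2 + (v - μ / ξ) * (ξ / 2) = v * (ξ / 2) by linarith] at p2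
    have l0 : -(μ / 2) + U₀.lam1 * (ξ / 2) < v * (ξ / 2) := by
      linarith [mul_le_mul_of_nonneg_right h.le_v h.half_pos.le, h.pos]
    have l1 : v * (ξ / 2) < μ / 2 + U₁.lam2 * (ξ / 2) := by
      linarith [mul_le_mul_of_nonneg_right h.v_le h.half_pos.le, h.pos]
    have hn : (first U₀ U₁ ξ μ v).n = 4 := rfl
    rw [(first U₀ U₁ ξ μ v).base_eq_sum, hn]
    simp only [Finset.sum_range_succ, Finset.sum_range_zero, p0, p1, p2, p3]
    rcases lt_or_gt_of_ne x0 with x0 | x0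
    · rw [h0 x x0, if_neg (by linarith), if_neg (by linarith), if_neg (by linarith)]
      rfl
    rcases lt_or_gt_of_ne x1 with x1 | x1
    · rw [h1 x x0 x1, if_pos x0, if_neg (by linarith), if_neg (by linarith)]
      rfl
    rcases lt_or_gt_of_ne x2 with x2 | x2
    · rw [h2 x x1 x2, if_pos x0, if_pos x1, if_neg (by linarith)]
      rfl
    · rw [h3 x x2, if_pos x0, if_pos x1, if_pos x2]
      rfl
  · exact (hm x).trans (Finset.sum_eq_zero fun i _ => first_str i _).symm
  · exact (hq x).trans (Finset.sum_eq_zero fun i _ => by rw [first_str, zero_mul]).symm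

theorem isSolution (h : Generic U₀ U₁ ξ μ v) {P : Pattern}
    (hP : P.IsAdmissibleOn (ξ / 2) (Set.Ici (ξ / 2)))
    (hS : P.StartsFrom (ξ / 2) (fun x => (first U₀ U₁ ξ μ v).base x (ξ / 2))
      (fun x => (first U₀ U₁ ξ μ v).massAt x (ξ / 2))
      (fun x => (first U₀ U₁ ξ μ v).momAt x (ξ / 2))) :
    (tracking U₀ U₁ ξ μ v P).IsSolution (deltaData U₀ U₁ ξ μ v) := by
  refine ⟨rfl, fun k hk => ?_, fun k hk => ?_, h.startsFrom, fun k hk => ?_⟩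
  · obtain rfl : k = 0 := Nat.lt_one_iff.1 hk
    exact h.half_pos
  · rcases hk.lt_or_eq with hk | rfl
    · obtain rfl : k = 0 := Nat.lt_one_iff.1 hk
      exact h.first_admissible
    · exact hP
  · obtain rfl : k = 0 := Nat.lt_one_iff.1 hk
    refine ⟨⟨1, show 1 + 1 < 2 + 2 by norm_num, ?_⟩, hS⟩
    obtain ⟨-, p1, p2, -⟩ := first_pos (U₀ := U₀) (U₁ := U₁) (ξ := ξ) (μ := μ) (v := v) (ξ / 2)
    change (first U₀ U₁ ξ μ v).pos 1 (ξ / 2) = (first U₀ U₁ ξ μ v).pos 2 (ξ / 2)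
    rw [p1, p2]
    linarith [h.half_eq]

/-- No front carries mass before the meeting, so the collision cannot change the energy. By
uniqueness this knowledge of the explicit solution transfers to any other. -/
theorem conservesEnergy (h : Generic U₀ U₁ ξ μ v) {P : Pattern}
    (hW : (tracking U₀ U₁ ξ μ v P).IsSolution (deltaData U₀ U₁ ξ μ v))
    (hex : ∀ i < P.n, ∀ t, ξ / 2 < t → 0 < P.str i t →
      (P.state (i + 1)).excess (P.speed i t) = (P.state i).excess (P.speed i t))
    {W : WaveTracking} (hW' : W.IsSolution (deltaData U₀ U₁ ξ μ v)) :
    ConservesEnergy W.net (deltaData U₀ U₁ ξ μ v) := by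
  obtain ⟨hK, hu⟩ := hW.unique hW'
  refine hW'.conservesEnergy (fun k hk i hi => ?_) (fun k hk i hi t ht hw => ?_)
  · rw [← hK] at hk
    obtain rfl : k = 0 := Nat.lt_one_iff.1 hk
    obtain ⟨-, -, ha⟩ := hu 0 zero_le_one
    obtain ⟨e, -, -⟩ := hu 1 le_rfl
    have hm : W.T (0 + 1) ∈ (tracking U₀ U₁ ξ μ v P).times 0 := by
      rw [← e]
      exact ⟨h.half_pos.le, le_rfl⟩
    rw [← (ha.front_eq i (by rwa [ha.n_eq]) _ hm).2.2]
    exact first_str i _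
  · rw [← hK] at hk
    obtain ⟨-, et, ha⟩ := hu k hk
    rw [← et] at ht
    rw [← ha.n_eq] at hi
    obtain ⟨-, e2, e3⟩ := ha.front_eq i hi t (interior_subset ht)
    rw [← e3] at hw
    rw [← ha.state_eq i hi.le, ← ha.state_eq (i + 1) hi, ← e2]
    rcases hk.lt_or_eq with hk | rfl
    · obtain rfl : k = 0 := Nat.lt_one_iff.1 hk
      exact absurd (first_str i t) hw.ne'
    · refine hex i hi t ?_ hw
      have : t ∈ interior (Set.Ici (ξ / 2)) := ht
      rwa [interior_Ici] at this

end Generic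

/-! ### The limit -/

section Limit

variable {g : State → ℝ} {α : ℝ → ℝ} {G : ℝ → ℝ → ℝ} {ψ : ℝ × ℝ → ℝ} {r : ℝ}

/-- The slice before the time `T`; `η` is the inverse of the density in the middle. -/
noncomputable def before (U₀ U₁ : State) (T v : ℝ) (g : State → ℝ) (G : ℝ → ℝ → ℝ)
    (ψ : ℝ × ℝ → ℝ) (r η t : ℝ) : ℝ :=
  g U₀ * ((-(η * T) + U₀.lam1 * t - -r) * mean ψ (-r) (-(η * T) + U₀.lam1 * t) t)
    + G U₀.lam1 (v + η) * t * mean ψ (-(η * T) + U₀.lam1 * t) (-(η * T) + (v + η) * t) t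
    + G (v - η) (v + η) * (T - t) * mean ψ (-(η * T) + (v + η) * t) (η * T + (v - η) * t) t
    + G (v - η) U₁.lam2 * t * mean ψ (η * T + (v - η) * t) (η * T + U₁.lam2 * t) t
    + g U₁ * ((r - (η * T + U₁.lam2 * t)) * mean ψ (η * T + U₁.lam2 * t) r t)

/-- The slice after the time `T`. -/
noncomputable def after (U₀ U₁ : State) (T v : ℝ) (g : State → ℝ) (G : ℝ → ℝ → ℝ)
    (ψ : ℝ × ℝ → ℝ) (r η t : ℝ) : ℝ :=
  g U₀ * ((-(η * T) + U₀.lam1 * t - -r) * mean ψ (-r) (-(η * T) + U₀.lam1 * t) t)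
    + G U₀.lam1 (v + η) * T * mean ψ (-(η * T) + U₀.lam1 * t) (v * T + U₀.lam1 * (t - T)) t
    + G U₀.lam1 U₁.lam2 * (t - T)
      * mean ψ (v * T + U₀.lam1 * (t - T)) (v * T + U₁.lam2 * (t - T)) t
    + G (v - η) U₁.lam2 * T * mean ψ (v * T + U₁.lam2 * (t - T)) (η * T + U₁.lam2 * t) t
    + g U₁ * ((r - (η * T + U₁.lam2 * t)) * mean ψ (η * T + U₁.lam2 * t) r t)

theorem continuous_before (hG : Continuous fun p : ℝ × ℝ => G p.1 p.2) (hψ : Continuous ψ)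
    (T : ℝ) : Continuous fun p : ℝ × ℝ => before U₀ U₁ T v g G ψ r p.1 p.2 := by
  have hm : ∀ {f₁ f₂ : ℝ × ℝ → ℝ}, Continuous f₁ → Continuous f₂ →
      Continuous fun p : ℝ × ℝ => mean ψ (f₁ p) (f₂ p) p.2 := fun h₁ h₂ =>
    (continuous_mean hψ).comp (h₁.prodMk (h₂.prodMk continuous_snd))
  have hG' : ∀ {f₁ f₂ : ℝ × ℝ → ℝ}, Continuous f₁ → Continuous f₂ →
      Continuous fun p : ℝ × ℝ => G (f₁ p) (f₂ p) := fun h₁ h₂ => hG.comp (h₁.prodMk h₂)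
  unfold before
  refine ((((continuous_const.mul (.mul ?_ (hm ?_ ?_))).add ((hG' ?_ ?_).mul ?_ |>.mul
    (hm ?_ ?_))).add ((hG' ?_ ?_).mul ?_ |>.mul (hm ?_ ?_))).add ((hG' ?_ ?_).mul ?_ |>.mul
    (hm ?_ ?_))).add (continuous_const.mul (.mul ?_ (hm ?_ ?_))) <;> fun_prop

theorem continuous_after (hG : Continuous fun p : ℝ × ℝ => G p.1 p.2) (hψ : Continuous ψ)
    (T : ℝ) : Continuous fun p : ℝ × ℝ => after U₀ U₁ T v g G ψ r p.1 p.2 := by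
  have hm : ∀ {f₁ f₂ : ℝ × ℝ → ℝ}, Continuous f₁ → Continuous f₂ →
      Continuous fun p : ℝ × ℝ => mean ψ (f₁ p) (f₂ p) p.2 := fun h₁ h₂ =>
    (continuous_mean hψ).comp (h₁.prodMk (h₂.prodMk continuous_snd))
  have hG' : ∀ {f₁ f₂ : ℝ × ℝ → ℝ}, Continuous f₁ → Continuous f₂ →
      Continuous fun p : ℝ × ℝ => G (f₁ p) (f₂ p) := fun h₁ h₂ => hG.comp (h₁.prodMk h₂)
  unfold after
  refine ((((continuous_const.mul (.mul ?_ (hm ?_ ?_))).add ((hG' ?_ ?_).mul ?_ |>.mul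
    (hm ?_ ?_))).add ((hG' ?_ ?_).mul ?_ |>.mul (hm ?_ ?_))).add ((hG' ?_ ?_).mul ?_ |>.mul
    (hm ?_ ?_))).add (continuous_const.mul (.mul ?_ (hm ?_ ?_))) <;> fun_prop

theorem mid_eq_ofLam (ξ μ v : ℝ) : State.mk (ξ / μ) v = State.ofLam (v - μ / ξ) (v + μ / ξ) := by
  refine State.ext_lam ?_ ?_
  · rw [lam1_mid, State.lam1_ofLam]
  · rw [lam2_mid, State.lam2_ofLam]

namespace Generic

theorem content (h : Generic U₀ U₁ ξ μ v) (hG : IsContent g α G) :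
    (v + μ / ξ - U₀.lam1) * g (U₀.between ⟨ξ / μ, v⟩) = G U₀.lam1 (v + μ / ξ) ∧
    2 * (μ / ξ) * g ⟨ξ / μ, v⟩ = G (v - μ / ξ) (v + μ / ξ) ∧
    (U₁.lam2 - (v - μ / ξ)) * g (State.between ⟨ξ / μ, v⟩ U₁) = G (v - μ / ξ) U₁.lam2 := by
  have h1 := h.left_lt
  have h2 := h.right_lt
  have h3 := h.div_pos
  rw [lam2_mid] at h1
  rw [lam1_mid] at h2
  rw [← hG.eq _ _ h1, ← hG.eq _ _ h2, ← hG.eq (v - μ / ξ) (v + μ / ξ) (by linarith), mid_eq_ofLam,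
    State.between, State.between, State.lam1_ofLam, State.lam2_ofLam]
  refine ⟨rfl, ?_, rfl⟩
  ring

/-- The widths of the inner regions are linear in time, with the middle one equal to `2 * (μ / ξ) *
(ξ / 2 - t)`. Each width times its state value is a content `G` times an elapsed or remaining time,
and no negative power of `μ` is left. -/
theorem slice_first (h : Generic U₀ U₁ ξ μ v) (hG : IsContent g α G) (hψ : Continuous ψ)
    (hc : HasCompactSupport ψ) (hz : ∀ x t, r ≤ |x| ∨ r ≤ |t| → ψ (x, t) = 0) (hr : 0 ≤ r) {t : ℝ}
    (ht : t ∈ Set.Icc 0 (ξ / 2)) :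
    (first U₀ U₁ ξ μ v).slice g α ψ t = before U₀ U₁ (ξ / 2) v g G ψ r (μ / ξ) t := by
  obtain ⟨p0, p1, p2, p3⟩ := first_pos (U₀ := U₀) (U₁ := U₁) (ξ := ξ) (μ := μ) (v := v) t
  obtain ⟨c1, c2, c3⟩ := h.content hG
  have hs := h.first_admissible.sorted h.half_pos ht
  have s0 : (first U₀ U₁ ξ μ v).state 0 = U₀ := rfl
  have s1 : (first U₀ U₁ ξ μ v).state 1 = U₀.between ⟨ξ / μ, v⟩ := rfl
  have s2 : (first U₀ U₁ ξ μ v).state 2 = ⟨ξ / μ, v⟩ := rfl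
  have s3 : (first U₀ U₁ ξ μ v).state 3 = State.between ⟨ξ / μ, v⟩ U₁ := rfl
  have s4 : (first U₀ U₁ ξ μ v).state 4 = U₁ := rfl
  rw [hs.slice_eq_regions (m := 3) rfl g α hψ hc hz hr]
  simp only [first_str, zero_mul, Finset.sum_const_zero, add_zero, Finset.sum_range_succ,
    Finset.sum_range_zero, zero_add, Nat.reduceAdd, p0, p1, p2, p3, s0, s1, s2, s3, s4, h.half_eq,
    before, ← c1, ← c2, ← c3]
  ring

theorem slice_split (h : Generic U₀ U₁ ξ μ v) (hlt : U₀.lam1 < U₁.lam2) (hG : IsContent g α G)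
    (hψ : Continuous ψ) (hc : HasCompactSupport ψ)
    (hz : ∀ x t, r ≤ |x| ∨ r ≤ |t| → ψ (x, t) = 0) (hr : 0 ≤ r) {t : ℝ} (ht : ξ / 2 ≤ t) :
    (split U₀ U₁ ξ μ v).slice g α ψ t = after U₀ U₁ (ξ / 2) v g G ψ r (μ / ξ) t := by
  obtain ⟨c1, c2, c3⟩ := h.content hG
  have hs := (h.split_admissible hlt).sorted_of_le ht
  have p0 : (split U₀ U₁ ξ μ v).pos 0 t = -(μ / ξ * (ξ / 2)) + U₀.lam1 * t := by
    rw [← h.half_eq]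
    change -(μ / 2) + U₀.lam1 * (ξ / 2) + U₀.lam1 * (t - ξ / 2) = _
    ring
  have p1 : (split U₀ U₁ ξ μ v).pos 1 t = v * (ξ / 2) + U₀.lam1 * (t - ξ / 2) := rfl
  have p2 : (split U₀ U₁ ξ μ v).pos 2 t = v * (ξ / 2) + U₁.lam2 * (t - ξ / 2) := rfl
  have p3 : (split U₀ U₁ ξ μ v).pos 3 t = μ / ξ * (ξ / 2) + U₁.lam2 * t := by
    rw [← h.half_eq]
    change μ / 2 + U₁.lam2 * (ξ / 2) + U₁.lam2 * (t - ξ / 2) = _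
    ring
  have s0 : (split U₀ U₁ ξ μ v).state 0 = U₀ := rfl
  have s1 : (split U₀ U₁ ξ μ v).state 1 = U₀.between ⟨ξ / μ, v⟩ := rfl
  have s2 : (split U₀ U₁ ξ μ v).state 2 = State.ofLam U₀.lam1 U₁.lam2 := rfl
  have s3 : (split U₀ U₁ ξ μ v).state 3 = State.between ⟨ξ / μ, v⟩ U₁ := rfl
  have s4 : (split U₀ U₁ ξ μ v).state 4 = U₁ := rfl
  have hstr : ∀ i, (split U₀ U₁ ξ μ v).str i t = 0 := fun i => zero_mul _
  rw [hs.slice_eq_regions (m := 3) rfl g α hψ hc hz hr]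
  simp only [hstr, zero_mul, Finset.sum_const_zero, add_zero, Finset.sum_range_succ,
    Finset.sum_range_zero, zero_add, Nat.reduceAdd, p0, p1, p2, p3, s0, s1, s2, s3, s4,
    after, ← c1, ← c3, ← hG.eq _ _ hlt]
  ring

/-- The delta weight `2 * (t - ξ / 2) * α v` is the diagonal content times the elapsed time, and the
mean over a degenerate interval is the point value. So the same function `after` covers the shadow
wave. -/
theorem slice_merge (h : Generic U₀ U₁ ξ μ v) (h0 : U₀.lam1 = v) (h1 : U₁.lam2 = v)
    (hG : IsContent g α G) (hψ : Continuous ψ) (hc : HasCompactSupport ψ)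
    (hz : ∀ x t, r ≤ |x| ∨ r ≤ |t| → ψ (x, t) = 0) (hr : 0 ≤ r) {t : ℝ} (ht : ξ / 2 ≤ t) :
    (merge U₀ U₁ ξ μ v).slice g α ψ t = after U₀ U₁ (ξ / 2) v g G ψ r (μ / ξ) t := by
  obtain ⟨c1, c2, c3⟩ := h.content hG
  have hs := (h.merge_admissible h0 h1).sorted_of_le ht
  have p0 : (merge U₀ U₁ ξ μ v).pos 0 t = -(μ / ξ * (ξ / 2)) + v * t := by
    rw [← h.half_eq]
    change -(μ / 2) + v * (ξ / 2) + v * (t - ξ / 2) = _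
    ring
  have p1 : (merge U₀ U₁ ξ μ v).pos 1 t = v * (ξ / 2) + v * (t - ξ / 2) := rfl
  have p2 : (merge U₀ U₁ ξ μ v).pos 2 t = μ / ξ * (ξ / 2) + v * t := by
    rw [← h.half_eq]
    change μ / 2 + v * (ξ / 2) + v * (t - ξ / 2) = _
    ring
  have s0 : (merge U₀ U₁ ξ μ v).state 0 = U₀ := rfl
  have s1 : (merge U₀ U₁ ξ μ v).state 1 = U₀.between ⟨ξ / μ, v⟩ := rfl
  have s2 : (merge U₀ U₁ ξ μ v).state 2 = State.between ⟨ξ / μ, v⟩ U₁ := rfl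
  have s3 : (merge U₀ U₁ ξ μ v).state 3 = U₁ := rfl
  have k0 : (merge U₀ U₁ ξ μ v).str 0 t = 0 := zero_mul _
  have k1 : (merge U₀ U₁ ξ μ v).str 1 t = 2 * (t - ξ / 2) := rfl
  have k2 : (merge U₀ U₁ ξ μ v).str 2 t = 0 := zero_mul _
  have hsp : (merge U₀ U₁ ξ μ v).speed 1 t = v := rfl
  rw [hs.slice_eq_regions (m := 2) rfl g α hψ hc hz hr]
  simp only [zero_mul, add_zero, Finset.sum_range_succ, Finset.sum_range_zero, zero_add,
    Nat.reduceAdd, p0, p1, p2, s0, s1, s2, s3, k0, k1, k2, hsp, after, h0, h1, mean_self]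
  rw [h0] at c1
  rw [h1] at c3
  rw [← c1, ← c3, ← hG.diag]
  ring

theorem split_startsFrom (h : Generic U₀ U₁ ξ μ v) :
    (split U₀ U₁ ξ μ v).StartsFrom (ξ / 2) (fun x => (first U₀ U₁ ξ μ v).base x (ξ / 2))
      (fun x => (first U₀ U₁ ξ μ v).massAt x (ξ / 2))
      (fun x => (first U₀ U₁ ξ μ v).momAt x (ξ / 2)) := by
  have l0 : -(μ / 2) + U₀.lam1 * (ξ / 2) < v * (ξ / 2) := by
    linarith [mul_le_mul_of_nonneg_right h.le_v h.half_pos.le, h.pos]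
  have l1 : v * (ξ / 2) < μ / 2 + U₁.lam2 * (ξ / 2) := by
    linarith [mul_le_mul_of_nonneg_right h.v_le h.half_pos.le, h.pos]
  have hb : ∀ x, (split U₀ U₁ ξ μ v).base x (ξ / 2) = (split U₀ U₁ ξ μ v).state
      ((if -(μ / 2) + U₀.lam1 * (ξ / 2) < x then 1 else 0) + (if v * (ξ / 2) < x then 1 else 0)
        + (if v * (ξ / 2) < x then 1 else 0)
        + (if μ / 2 + U₁.lam2 * (ξ / 2) < x then 1 else 0)) := by
    intro x
    have hn : (split U₀ U₁ ξ μ v).n = 4 := rfl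
    rw [Pattern.base_eq_sum, hn]
    simp only [split, Pattern.affine_pos, sub_self, mul_zero, add_zero, Finset.sum_range_succ,
      Finset.sum_range_zero, zero_add]
  refine h.startsFrom_of_base Pattern.affine_massAt Pattern.affine_momAt (fun x h0 => ?_)
    (fun x h0 h1 => ?_) (fun x h0 h1 => ?_) (fun x h0 => ?_)
  · rw [hb, if_neg (by linarith), if_neg (by linarith), if_neg (by linarith)]; rfl
  · rw [hb, if_pos h0, if_neg (by linarith), if_neg (by linarith)]; rfl
  · rw [hb, if_pos (by linarith), if_pos h0, if_neg (by linarith)]; rfl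
  · rw [hb, if_pos (by linarith), if_pos (by linarith), if_pos h0]; rfl

theorem merge_startsFrom (h : Generic U₀ U₁ ξ μ v) (e0 : U₀.lam1 = v) (e1 : U₁.lam2 = v) :
    (merge U₀ U₁ ξ μ v).StartsFrom (ξ / 2) (fun x => (first U₀ U₁ ξ μ v).base x (ξ / 2))
      (fun x => (first U₀ U₁ ξ μ v).massAt x (ξ / 2))
      (fun x => (first U₀ U₁ ξ μ v).momAt x (ξ / 2)) := by
  have hμ := h.pos
  have hb : ∀ x, (merge U₀ U₁ ξ μ v).base x (ξ / 2) = (merge U₀ U₁ ξ μ v).state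
      ((if -(μ / 2) + v * (ξ / 2) < x then 1 else 0) + (if v * (ξ / 2) < x then 1 else 0)
        + (if μ / 2 + v * (ξ / 2) < x then 1 else 0)) := by
    intro x
    have hn : (merge U₀ U₁ ξ μ v).n = 3 := rfl
    rw [Pattern.base_eq_sum, hn]
    simp only [merge, Pattern.affine_pos, sub_self, mul_zero, add_zero, Finset.sum_range_succ,
      Finset.sum_range_zero, zero_add]
  refine h.startsFrom_of_base Pattern.affine_massAt Pattern.affine_momAt (fun x h0 => ?_)
    (fun x h0 h1 => ?_) (fun x h0 h1 => ?_) (fun x h0 => ?_)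
  · rw [e0] at h0
    rw [hb, if_neg (by linarith), if_neg (by linarith), if_neg (by linarith)]; rfl
  · rw [e0] at h0
    rw [hb, if_pos h0, if_neg (by linarith), if_neg (by linarith)]; rfl
  · rw [e1] at h1
    rw [hb, if_pos (by linarith), if_pos h0, if_neg (by linarith)]; rfl
  · rw [e1] at h0
    rw [hb, if_pos (by linarith), if_pos (by linarith), if_pos h0]; rfl

/-- The solution exists for all times; it does not dissipate energy. -/
theorem exists_solution (h : Generic U₀ U₁ ξ μ v) : ∃ P : Pattern,
    (tracking U₀ U₁ ξ μ v P).IsSolution (deltaData U₀ U₁ ξ μ v) ∧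
    (∀ i < P.n, ∀ t, ξ / 2 < t → 0 < P.str i t →
      (P.state (i + 1)).excess (P.speed i t) = (P.state i).excess (P.speed i t)) ∧
    ∀ (g : State → ℝ) (α : ℝ → ℝ) (G : ℝ → ℝ → ℝ) (ψ : ℝ × ℝ → ℝ) (r t : ℝ), IsContent g α G →
      Continuous ψ → HasCompactSupport ψ → (∀ x t, r ≤ |x| ∨ r ≤ |t| → ψ (x, t) = 0) → 0 ≤ r →
      ξ / 2 ≤ t → P.slice g α ψ t = after U₀ U₁ (ξ / 2) v g G ψ r (μ / ξ) t := by
  rcases (h.le_v.trans h.v_le).lt_or_eq with hlt | heq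
  · refine ⟨split U₀ U₁ ξ μ v, h.isSolution (h.split_admissible hlt) h.split_startsFrom,
      fun i _ t _ hw => ?_, fun g α G ψ r t hG hψ hc hz hr ht =>
      h.slice_split hlt hG hψ hc hz hr ht⟩
    have : (split U₀ U₁ ξ μ v).str i t = 0 := zero_mul _
    exact absurd this hw.ne'
  · have e0 : U₀.lam1 = v := le_antisymm h.le_v (h.v_le.trans heq.ge)
    have e1 : U₁.lam2 = v := heq.symm.trans e0
    refine ⟨merge U₀ U₁ ξ μ v, h.isSolution (h.merge_admissible e0 e1)
      (h.merge_startsFrom e0 e1), fun i hi t _ hw => ?_, fun g α G ψ r t hG hψ hc hz hr ht =>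
      h.slice_merge e0 e1 hG hψ hc hz hr ht⟩
    -- Only the middle front carries mass, and it moves at a zero of the excess of both neighbours.
    by_cases h1 : i = 1
    · subst h1
      have l := excess_lam1 (State.rho_between_pos h.left_lt)
      have r := excess_lam2 (State.rho_between_pos h.right_lt)
      rw [State.lam1_between, e0] at l
      rw [State.lam2_between, e1] at r
      exact r.trans l.symm
    · have : (merge U₀ U₁ ξ μ v).str i t = 0 := by
        simp [merge, h1]
      exact absurd this hw.ne'

theorem limInt_eq (h : Generic U₀ U₁ ξ μ v) {W : WaveTracking}
    (hW : W.IsSolution (deltaData U₀ U₁ ξ μ v)) (hG : IsContent g α G) (hψ : Continuous ψ)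
    (hc : HasCompactSupport ψ) (hz : ∀ x t, r ≤ |x| ∨ r ≤ |t| → ψ (x, t) = 0) (hr : 0 ≤ r)
    {B : ℝ} (hB : ξ / 2 < B) :
    W.T W.K < B ∧ W.limInt B g α ψ
      = (∫ t in (0 : ℝ)..(ξ / 2), before U₀ U₁ (ξ / 2) v g G ψ r (μ / ξ) t)
        + ∫ t in (ξ / 2)..B, after U₀ U₁ (ξ / 2) v g G ψ r (μ / ξ) t := by
  obtain ⟨P, hP, -, hs⟩ := h.exists_solution
  have hB' : (tracking U₀ U₁ ξ μ v P).T (tracking U₀ U₁ ξ μ v P).K < B := hB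
  obtain ⟨h1, h2⟩ := hP.limInt_eq (g := g) (α := α) (ψ := ψ) hW hB'
  refine ⟨h1, h2.trans ?_⟩
  have hK : (tracking U₀ U₁ ξ μ v P).K + 1 = 2 := rfl
  have e0 : (tracking U₀ U₁ ξ μ v P).ends B 0 = 0 := rfl
  have e1 : (tracking U₀ U₁ ξ μ v P).ends B 1 = ξ / 2 := rfl
  have e2 : (tracking U₀ U₁ ξ μ v P).ends B 2 = B := rfl
  rw [WaveTracking.limInt, hK, Finset.sum_range_succ, Finset.sum_range_one, zero_add, e0, e1, e2]
  congr 1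
  · refine intervalIntegral.integral_congr fun t ht => ?_
    rw [Set.uIcc_of_le h.half_pos.le] at ht
    exact h.slice_first hG hψ hc hz hr ht
  · refine intervalIntegral.integral_congr fun t ht => ?_
    rw [Set.uIcc_of_le hB.le] at ht
    exact hs g α G ψ r t hG hψ hc hz hr ht.1

end Generic

/-- The limit as ε → 0 is `J (μ / ξ)` with a function `J` that is continuous at 0 and does not
involve the chosen solution. -/
theorem exists_tendstoDistrib (hU₀ : 0 < U₀.rho) (hU₁ : 0 < U₁.rho) (hξ : 0 < ξ)
    (h₀ : U₀.lam1 ≤ v) (h₁ : v ≤ U₁.lam2) (hG : IsContent g α G) :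
    ∃ Λ : (ℝ × ℝ → ℝ) → ℝ, ∀ W, IsApproximatingFamily U₀ U₁ ξ v W → TendstoDistrib W g Λ := by
  -- The number `l` is chosen before the family `W`, which makes the limit distribution independent
  -- of `W`.
  have key : ∀ φ, ∃ l : ℝ, IsTest φ → ∀ W, IsApproximatingFamily U₀ U₁ ξ v W → ∃ I : ℝ → ℝ,
      (∀ᶠ μ in 𝓝[>] (0 : ℝ),
        Tendsto (fun ε => ∫ t in Set.Ioi (0 : ℝ), ∫ x, g ((W μ).net ε x t) * φ (x, t))
          (𝓝[>] 0) (𝓝 (I μ))) ∧ Tendsto I (𝓝[>] 0) (𝓝 l) := by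
    intro φ
    by_cases hφ : IsTest φ
    swap
    · exact ⟨0, fun h => absurd h hφ⟩
    have hψ := hφ.1.continuous
    obtain ⟨r, -, hr, -, -, hz⟩ := exists_bounds hψ hφ.2
    set B := max r (ξ / 2 + 1)
    have hB : ξ / 2 < B := (lt_add_one _).trans_le (le_max_right _ _)
    set J : ℝ → ℝ := fun η => (∫ t in (0 : ℝ)..(ξ / 2), before U₀ U₁ (ξ / 2) v g G φ r η t)
        + ∫ t in (ξ / 2)..B, after U₀ U₁ (ξ / 2) v g G φ r η t
    have hJ : Continuous J :=
      (intervalIntegral.continuous_parametric_intervalIntegral_of_continuous'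
        (continuous_before hG.cont hψ (ξ / 2)) _ _).add
      (intervalIntegral.continuous_parametric_intervalIntegral_of_continuous'
        (continuous_after hG.cont hψ (ξ / 2)) _ _)
    refine ⟨J 0, fun _ W hW => ⟨fun μ => J (μ / ξ), ?_, ?_⟩⟩
    · filter_upwards [hW, eventually_generic hU₀ hU₁ hξ h₀ h₁] with μ hμ hgen
      obtain ⟨hB', e⟩ := hgen.limInt_eq hμ hG hψ hφ.2 hz hr.le hB
      have := hμ.tendsto_limInt hB' hG.flux hψ hφ.2 fun x t ht =>
        hz x t (.inr (((le_max_left _ _).trans ht).trans (le_abs_self t)))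
      rwa [e] at this
    · exact (hJ.tendsto 0).comp ((tendsto_div_const_nhdsGT hξ).mono_right nhdsWithin_le_nhds)
  choose Λ hΛ using key
  exact ⟨Λ, fun W hW φ hφ => hΛ φ hφ W hW⟩

theorem exists_approximatingFamily (hU₀ : 0 < U₀.rho) (hU₁ : 0 < U₁.rho) (hξ : 0 < ξ)
    (h₀ : U₀.lam1 ≤ v) (h₁ : v ≤ U₁.lam2) : ∃ W, IsApproximatingFamily U₀ U₁ ξ v W := by
  have : ∀ᶠ μ in 𝓝[>] (0 : ℝ), ∃ W : WaveTracking, W.IsSolution (deltaData U₀ U₁ ξ μ v) := by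
    filter_upwards [eventually_generic hU₀ hU₁ hξ h₀ h₁] with μ h
    obtain ⟨P, hP, -⟩ := h.exists_solution
    exact ⟨_, hP⟩
  exact this.choice

theorem eventually_conservesEnergy (hU₀ : 0 < U₀.rho) (hU₁ : 0 < U₁.rho) (hξ : 0 < ξ)
    (h₀ : U₀.lam1 ≤ v) (h₁ : v ≤ U₁.lam2) {W : ℝ → WaveTracking}
    (hW : IsApproximatingFamily U₀ U₁ ξ v W) :
    ∀ᶠ μ in 𝓝[>] (0 : ℝ), IsWeakSolution (W μ).net (deltaData U₀ U₁ ξ μ v) ∧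
      ConservesEnergy (W μ).net (deltaData U₀ U₁ ξ μ v) := by
  filter_upwards [hW, eventually_generic hU₀ hU₁ hξ h₀ h₁] with μ hμ h
  obtain ⟨P, hP, hex, -⟩ := h.exists_solution
  exact ⟨hμ.isWeakSolution, h.conservesEnergy hP hex hμ⟩

end Limit

end Meeting

end Chaplygin

namespace Chaplygin

/-! ### Families of solutions that become a single shadow wave -/

/-- The outer regions may be large but have fixed states, so they are bounded by the integral of
`|ψ|`; the inner regions are bounded by their content and the deltas by their weight. -/
theorem Pattern.Sorted.abs_slice_le {P : Pattern} {ψ : ℝ × ℝ → ℝ} {t C D : ℝ} (h : P.Sorted t)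
    {m : ℕ} (hm : P.n = m + 1) (g : State → ℝ) (α : ℝ → ℝ) (hψ : Continuous ψ)
    (hc : HasCompactSupport ψ) (hC : ∀ z, |ψ z| ≤ C) (hD : ∀ t, ∫ x, |ψ (x, t)| ≤ D) :
    |P.slice g α ψ t| ≤ (|g (P.state 0)| + |g (P.state (m + 1))|) * D
      + C * ∑ i ∈ Finset.range m, |g (P.state (i + 1))| * (P.pos (i + 1) t - P.pos i t)
      + C * ∑ i ∈ Finset.range (m + 1), |P.str i t| * |α (P.speed i t)| := by
  obtain ⟨r, -, hr, -, -, hz⟩ := exists_bounds hψ hc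
  have hi := integrable_section hψ hc t
  have hmean : ∀ p q, |(q - p) * mean ψ p q t| ≤ D := by
    intro p q
    rw [sub_mul_mean]
    refine (intervalIntegral.norm_integral_le_integral_norm_uIoc).trans ((setIntegral_le_integral
      hi.norm (ae_of_all _ fun x => norm_nonneg _)).trans (hD t))
  rw [h.slice_eq_regions hm g α hψ hc hz hr.le]
  refine (abs_add_le _ _).trans (add_le_add ((abs_add_le _ _).trans ?_) ?_)
  · have e1 : |∑ i ∈ Finset.range m, g (P.state (i + 1))
        * ((P.pos (i + 1) t - P.pos i t) * mean ψ (P.pos i t) (P.pos (i + 1) t) t)|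
        ≤ C * ∑ i ∈ Finset.range m, |g (P.state (i + 1))| * (P.pos (i + 1) t - P.pos i t) := by
      rw [Finset.mul_sum]
      refine (Finset.abs_sum_le_sum_abs _ _).trans (Finset.sum_le_sum fun i hi => ?_)
      have hw : 0 ≤ P.pos (i + 1) t - P.pos i t :=
        sub_nonneg.2 (h i (i + 1) (Nat.le_succ i) (by have := Finset.mem_range.1 hi; omega))
      rw [abs_mul, abs_mul, abs_of_nonneg hw]
      have := mul_le_mul_of_nonneg_left (abs_mean_le hC (P.pos i t) (P.pos (i + 1) t) t)
        (mul_nonneg (abs_nonneg (g (P.state (i + 1)))) hw)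
      linarith
    have e2 := (abs_add_le (g (P.state 0) * ((P.pos 0 t - -r) * mean ψ (-r) (P.pos 0 t) t))
      (∑ i ∈ Finset.range m, g (P.state (i + 1))
        * ((P.pos (i + 1) t - P.pos i t) * mean ψ (P.pos i t) (P.pos (i + 1) t) t)))
    have e3 : |g (P.state 0) * ((P.pos 0 t - -r) * mean ψ (-r) (P.pos 0 t) t)|
        ≤ |g (P.state 0)| * D := by
      rw [abs_mul]
      exact mul_le_mul_of_nonneg_left (hmean _ _) (abs_nonneg _)
    have e4 : |g (P.state (m + 1)) * ((r - P.pos m t) * mean ψ (P.pos m t) r t)|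
        ≤ |g (P.state (m + 1))| * D := by
      rw [abs_mul]
      exact mul_le_mul_of_nonneg_left (hmean _ _) (abs_nonneg _)
    linarith
  · rw [Finset.mul_sum]
    refine (Finset.abs_sum_le_sum_abs _ _).trans (Finset.sum_le_sum fun i _ => ?_)
    rw [abs_mul, abs_mul, mul_comm C]
    exact mul_le_mul_of_nonneg_left (hC _) (by positivity)

/-- A single shadow wave with strength `m`, speed `s` and position `p` at time `T`. -/
@[simps]
noncomputable def Pattern.single (L R : State) (m s p T : ℝ) : Pattern where
  n := 1
  state i := if i = 0 then L else R
  pos _ t := p + DeltaShock.pos L R m s (t - T)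
  speed _ t := DeltaShock.speed L R m s (t - T)
  str _ t := DeltaShock.str L R m s (t - T)
  org _ := T - 1

theorem Pattern.single_admissible {L R : State} {m s p T : ℝ} (hL : 0 < L.rho) (hR : 0 < R.rho)
    (hs : R.lam2 ≤ s ∧ s ≤ L.lam1) (hm : 0 < m) :
    (Pattern.single L R m s p T).IsAdmissibleOn T (Set.Ici T) := by
  refine ⟨fun i _ => ?_, fun t _ i hi => ?_, fun i hi => ?_⟩
  · rw [Pattern.single_state]
    split_ifs <;> assumption
  · rw [Pattern.single_n] at hi; omega
  · obtain rfl : i = 0 := Nat.lt_one_iff.1 hi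
    refine ⟨DeltaShock.isFront hL hR hs hm T p, .inr ⟨DeltaShock.isShadow hL hR hs hm T, .inr ⟨?_, ?_⟩⟩⟩
    · rw [Pattern.single_str, sub_self, DeltaShock.str_zero hm]; exact hm
    -- A wave with positive initial strength may use any earlier time as the origin of its strip.
    · exact sub_one_lt T

/-- The action at time `T + τ` of a shadow wave with strength `m`, speed `s` and position `p` at
time `T`. -/
noncomputable def shadowSlice (L R : State) (g : State → ℝ) (α : ℝ → ℝ) (ψ : ℝ × ℝ → ℝ)
    (r m s p T τ : ℝ) : ℝ :=
  g L * ((p + DeltaShock.pos L R m s τ - -r) * mean ψ (-r) (p + DeltaShock.pos L R m s τ) (T + τ))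
    + g R * ((r - (p + DeltaShock.pos L R m s τ))
      * mean ψ (p + DeltaShock.pos L R m s τ) r (T + τ))
    + DeltaShock.str L R m s τ * α (DeltaShock.speed L R m s τ)
      * ψ (p + DeltaShock.pos L R m s τ, T + τ)

section ShadowSlice

variable {L R : State} {g : State → ℝ} {α : ℝ → ℝ} {ψ : ℝ × ℝ → ℝ} {r m s p T t τ : ℝ}

theorem Pattern.single_slice (hψ : Continuous ψ)
    (hc : HasCompactSupport ψ) (hz : ∀ x t, r ≤ |x| ∨ r ≤ |t| → ψ (x, t) = 0) (hr : 0 ≤ r) :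
    (Pattern.single L R m s p T).slice g α ψ t = shadowSlice L R g α ψ r m s p T (t - T) := by
  have hs : (Pattern.single L R m s p T).Sorted t := fun i j hij hj => by
    rw [Pattern.single_n] at hj
    obtain rfl : i = j := by omega
    exact le_rfl
  rw [hs.slice_eq_regions (m := 0) rfl g α hψ hc hz hr]
  simp [shadowSlice]

theorem continuousAt_shadowSlice (hL : 0 < L.rho) (hR : 0 < R.rho) (hα : Continuous α)
    (hψ : Continuous ψ) (r : ℝ) {q : ℝ × ℝ × ℝ × ℝ × ℝ}
    (hs : R.lam2 ≤ q.2.1 ∧ q.2.1 ≤ L.lam1) (hm : 0 < q.1) (hτ : 0 ≤ q.2.2.2.2) :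
    ContinuousAt (fun q : ℝ × ℝ × ℝ × ℝ × ℝ =>
      shadowSlice L R g α ψ r q.1 q.2.1 q.2.2.1 q.2.2.2.1 q.2.2.2.2) q := by
  have hproj : Continuous fun q : ℝ × ℝ × ℝ × ℝ × ℝ => (q.1, q.2.1, q.2.2.2.2) := by fun_prop
  have h1 : ContinuousAt (fun q : ℝ × ℝ × ℝ × ℝ × ℝ => DeltaShock.str L R q.1 q.2.1 q.2.2.2.2) q :=
    (DeltaShock.continuousAt_str L R (q.1, q.2.1, q.2.2.2.2)).comp
      (f := fun q : ℝ × ℝ × ℝ × ℝ × ℝ => (q.1, q.2.1, q.2.2.2.2)) hproj.continuousAt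
  have h2 : ContinuousAt (fun q : ℝ × ℝ × ℝ × ℝ × ℝ => DeltaShock.pos L R q.1 q.2.1 q.2.2.2.2) q :=
    (DeltaShock.continuousAt_pos hL hR (p := (q.1, q.2.1, q.2.2.2.2)) hs hm hτ).comp
      (f := fun q : ℝ × ℝ × ℝ × ℝ × ℝ => (q.1, q.2.1, q.2.2.2.2)) hproj.continuousAt
  have h3 : ContinuousAt (fun q : ℝ × ℝ × ℝ × ℝ × ℝ => DeltaShock.speed L R q.1 q.2.1 q.2.2.2.2) q :=
    (DeltaShock.continuousAt_speed hL hR (p := (q.1, q.2.1, q.2.2.2.2)) hs hm hτ).comp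
      (f := fun q : ℝ × ℝ × ℝ × ℝ × ℝ => (q.1, q.2.1, q.2.2.2.2)) hproj.continuousAt
  have h4 : ContinuousAt (fun q : ℝ × ℝ × ℝ × ℝ × ℝ =>
      q.2.2.1 + DeltaShock.pos L R q.1 q.2.1 q.2.2.2.2) q := ContinuousAt.add (by fun_prop) h2
  have h5 : ContinuousAt (fun q : ℝ × ℝ × ℝ × ℝ × ℝ => q.2.2.2.1 + q.2.2.2.2) q := by fun_prop
  have hmean : ∀ {f₁ f₂ : ℝ × ℝ × ℝ × ℝ × ℝ → ℝ}, ContinuousAt f₁ q → ContinuousAt f₂ q →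
      ContinuousAt (fun q => mean ψ (f₁ q) (f₂ q) (q.2.2.2.1 + q.2.2.2.2)) q := fun {f₁ f₂} k₁ k₂ =>
    ContinuousAt.comp (g := fun z : ℝ × ℝ × ℝ => mean ψ z.1 z.2.1 z.2.2)
      (f := fun q => (f₁ q, f₂ q, q.2.2.2.1 + q.2.2.2.2)) (continuous_mean hψ).continuousAt
      (k₁.prodMk (k₂.prodMk h5))
  unfold shadowSlice
  refine ((continuousAt_const.mul ((h4.sub continuousAt_const).mul (hmean continuousAt_const h4))).add
    (continuousAt_const.mul ((continuousAt_const.sub h4).mul (hmean h4 continuousAt_const)))).add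
    ((h1.mul (hα.continuousAt.comp h3)).mul (hψ.continuousAt.comp (h4.prodMk h5)))

theorem shadowSlice_of_le (hz : ∀ x t, r ≤ |x| ∨ r ≤ |t| → ψ (x, t) = 0) (h : r ≤ T + τ) :
    shadowSlice L R g α ψ r m s p T τ = 0 := by
  have h0 : ∀ x, ψ (x, T + τ) = 0 := fun x => hz x _ (.inr (h.trans (le_abs_self _)))
  simp [shadowSlice, mean, h0]

end ShadowSlice

/-- Admissible solutions for the approximated data that consist, after a short time `T`, of a
single shadow wave that is close to the one with strength `ξ` and speed `v`. -/
structure Collapse (U₀ U₁ : State) (ξ v : ℝ) where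
  W : ℝ → WaveTracking
  m : ℝ → ℝ
  s : ℝ → ℝ
  p : ℝ → ℝ
  T : ℝ → ℝ
  sol : ∀ᶠ μ in 𝓝[>] (0 : ℝ), (W μ).IsSolution (deltaData U₀ U₁ ξ μ v)
  last : ∀ᶠ μ in 𝓝[>] (0 : ℝ), (W μ).T (W μ).K = T μ ∧
    (W μ).slab (W μ).K = Pattern.single U₀ U₁ (m μ) (s μ) (p μ) (T μ)
  speed : ∀ᶠ μ in 𝓝[>] (0 : ℝ), U₁.lam2 ≤ s μ ∧ s μ ≤ U₀.lam1
  tendsto_m : Tendsto m (𝓝[>] 0) (𝓝 ξ)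
  tendsto_s : Tendsto s (𝓝[>] 0) (𝓝 v)
  tendsto_p : Tendsto p (𝓝[>] 0) (𝓝 0)
  tendsto_T : Tendsto T (𝓝[>] 0) (𝓝 0)
  bound : ∀ g α G ψ, IsContent g α G → Continuous ψ → HasCompactSupport ψ → ∃ C : ℝ,
    ∀ᶠ μ in 𝓝[>] (0 : ℝ), ∀ k < (W μ).K, ∀ t ∈ Set.Icc ((W μ).T k) ((W μ).T (k + 1)),
      |((W μ).slab k).slice g α ψ t| ≤ C

/-- Dominated convergence: the parameters eventually lie in a compact set on which the slice is
jointly continuous, hence bounded. -/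
theorem tendsto_integral_shadowSlice {L R : State} {g : State → ℝ} {α : ℝ → ℝ} {ψ : ℝ × ℝ → ℝ}
    {ξ v : ℝ} {m s p T : ℝ → ℝ} (hL : 0 < L.rho) (hR : 0 < R.rho) (hα : Continuous α)
    (hψ : Continuous ψ) (r : ℝ) (hξ : 0 < ξ) (hv : R.lam2 ≤ v ∧ v ≤ L.lam1)
    (hs : ∀ᶠ μ in 𝓝[>] (0 : ℝ), R.lam2 ≤ s μ ∧ s μ ≤ L.lam1)
    (tm : Tendsto m (𝓝[>] 0) (𝓝 ξ)) (ts : Tendsto s (𝓝[>] 0) (𝓝 v))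
    (tp : Tendsto p (𝓝[>] 0) (𝓝 0)) (tT : Tendsto T (𝓝[>] 0) (𝓝 0)) {B : ℝ} (hB : 0 ≤ B) :
    Tendsto (fun μ => ∫ τ in (0 : ℝ)..B, shadowSlice L R g α ψ r (m μ) (s μ) (p μ) (T μ) τ)
      (𝓝[>] 0) (𝓝 (∫ τ in (0 : ℝ)..B, shadowSlice L R g α ψ r ξ v 0 0 τ)) := by
  set K : Set (ℝ × ℝ × ℝ × ℝ × ℝ) := Set.Icc (ξ / 2) (2 * ξ) ×ˢ Set.Icc R.lam2 L.lam1 ×ˢ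
    Set.Icc (-1) 1 ×ˢ Set.Icc (-1) 1 ×ˢ Set.Icc 0 B with hK
  have hKc : IsCompact K := isCompact_Icc.prod (isCompact_Icc.prod (isCompact_Icc.prod
    (isCompact_Icc.prod isCompact_Icc)))
  have hcont : ∀ q ∈ K, ContinuousAt (fun q : ℝ × ℝ × ℝ × ℝ × ℝ =>
      shadowSlice L R g α ψ r q.1 q.2.1 q.2.2.1 q.2.2.2.1 q.2.2.2.2) q := fun q hq =>
    continuousAt_shadowSlice hL hR hα hψ r hq.2.1 (by linarith [hq.1.1]) hq.2.2.2.2.1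
  obtain ⟨C, hC⟩ := hKc.exists_bound_of_continuousOn fun q hq => (hcont q hq).continuousWithinAt
  have hmem : ∀ᶠ μ in 𝓝[>] (0 : ℝ), ∀ τ ∈ Set.Icc 0 B, (m μ, s μ, p μ, T μ, τ) ∈ K := by
    filter_upwards [hs, tm.eventually (Icc_mem_nhds (show ξ / 2 < ξ by linarith)
      (show ξ < 2 * ξ by linarith)), tp.eventually (Icc_mem_nhds (show (-1 : ℝ) < 0 by norm_num)
      one_pos), tT.eventually (Icc_mem_nhds (show (-1 : ℝ) < 0 by norm_num) one_pos)]
      with μ h1 h2 h3 h4 τ hτ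
    exact ⟨h2, h1, h3, h4, hτ⟩
  have hsec : ∀ m s p T : ℝ, (∀ τ ∈ Set.Icc 0 B, (m, s, p, T, τ) ∈ K) →
      ContinuousOn (shadowSlice L R g α ψ r m s p T) (Set.Icc 0 B) := fun m s p T h τ hτ =>
    ((hcont _ (h τ hτ)).comp (f := fun τ : ℝ => (m, s, p, T, τ)) (x := τ)
      (by fun_prop)).continuousWithinAt
  refine intervalIntegral.tendsto_integral_filter_of_dominated_convergence (fun _ => C) ?_ ?_
    intervalIntegrable_const ?_
  · filter_upwards [hmem] with μ hμ
    rw [Set.uIoc_of_le hB]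
    exact ((hsec _ _ _ _ hμ).mono Set.Ioc_subset_Icc_self).aestronglyMeasurable measurableSet_Ioc
  · filter_upwards [hmem] with μ hμ
    refine ae_of_all _ fun τ hτ => ?_
    rw [Set.uIoc_of_le hB] at hτ
    exact hC _ (hμ τ (Set.Ioc_subset_Icc_self hτ))
  · refine ae_of_all _ fun τ hτ => ?_
    rw [Set.uIoc_of_le hB] at hτ
    have h0 : (ξ, v, (0 : ℝ), (0 : ℝ), τ) ∈ K :=
      ⟨⟨by linarith, by linarith⟩, hv, ⟨by norm_num, by norm_num⟩, ⟨by norm_num, by norm_num⟩,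
        Set.Ioc_subset_Icc_self hτ⟩
    have ht : Tendsto (fun μ => (m μ, s μ, p μ, T μ, τ)) (𝓝[>] 0) (𝓝 (ξ, v, 0, 0, τ)) :=
      tm.prodMk_nhds (ts.prodMk_nhds (tp.prodMk_nhds (tT.prodMk_nhds tendsto_const_nhds)))
    have hlim := (hcont _ h0).tendsto.comp ht
    simp only [Function.comp_def] at hlim
    exact hlim

theorem integral_jump_eq {a b c t r : ℝ} {ψ : ℝ × ℝ → ℝ} (hψ : Continuous ψ)
    (hc : HasCompactSupport ψ) (hz : ∀ x t, r ≤ |x| ∨ r ≤ |t| → ψ (x, t) = 0) (hr : 0 ≤ r) :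
    ∫ x, (if x < c then a else b) * ψ (x, t)
      = a * ((c - -r) * mean ψ (-r) c t) + b * ((r - c) * mean ψ c r t) := by
  have hi := integrable_section hψ hc t
  have e : ∀ᵐ x, (if x < c then a else b) * ψ (x, t)
      = a * ψ (x, t) + (if c < x then b - a else 0) * ψ (x, t) := by
    filter_upwards [Measure.ae_ne volume c] with x hx
    rcases lt_or_gt_of_ne hx with h | h
    · rw [if_pos h, if_neg h.not_gt]; ring
    · rw [if_neg h.not_gt, if_pos h]; ring
  have hi2 : Integrable fun x => (if c < x then b - a else 0) * ψ (x, t) := by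
    refine hi.bdd_mul (c := |b - a|)
      (Measurable.ite measurableSet_Ioi measurable_const measurable_const).aestronglyMeasurable
      (ae_of_all _ fun x => ?_)
    split_ifs
    · exact le_rfl
    · simp
  rw [integral_congr_ae e, integral_add (hi.const_mul a) hi2, integral_const_mul,
    Pattern.integral_ite_lt_mul (b - a) c fun x => ψ (x, t), integral_eq_tail hz hr]
  change a * tail ψ (-r) t + (b - a) * tail ψ c t = _
  rw [← tail_sub_tail hψ hc, ← tail_sub_tail hψ hc, tail_of_le hz hr]
  ring

namespace Collapse

variable {U₀ U₁ : State} {ξ v : ℝ}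

/-- The limit as a jump and a delta distribution. -/
theorem integral_limit_eq (hU₀ : 0 < U₀.rho) (hU₁ : 0 < U₁.rho) (hξ : 0 < ξ)
    (hv : U₁.lam2 ≤ v ∧ v ≤ U₀.lam1) {g : State → ℝ} {α : ℝ → ℝ} (hα : Continuous α)
    {ψ : ℝ × ℝ → ℝ} {r B : ℝ} (hψ : Continuous ψ) (hc : HasCompactSupport ψ)
    (hz : ∀ x t, r ≤ |x| ∨ r ≤ |t| → ψ (x, t) = 0) (hr : 0 ≤ r) (hB : r ≤ B) :
    ∫ τ in (0 : ℝ)..B, shadowSlice U₀ U₁ g α ψ r ξ v 0 0 τ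
      = jumpPlusDelta (g U₀) (g U₁) (DeltaShock.pos U₀ U₁ ξ v)
        (fun t => DeltaShock.str U₀ U₁ ξ v t * α (DeltaShock.speed U₀ U₁ ξ v t)) ψ := by
  have h0 : 0 ≤ B := hr.trans hB
  have hvan : ∀ t ∈ Set.Ioi (0 : ℝ) \ Set.Ioc 0 B, ∀ x, ψ (x, t) = 0 := by
    intro t ht x
    have : B ≤ t := by
      by_contra! hlt
      exact ht.2 ⟨ht.1, hlt.le⟩
    exact hz x t (.inr ((hB.trans this).trans (le_abs_self t)))
  have hpos : ContinuousOn (DeltaShock.pos U₀ U₁ ξ v) (Set.Icc 0 B) := fun t ht =>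
    ((DeltaShock.continuousAt_pos hU₀ hU₁ (p := (ξ, v, t)) hv hξ ht.1).comp
      (f := fun t : ℝ => (ξ, v, t)) (x := t) (by fun_prop)).continuousWithinAt
  have hspeed : ContinuousOn (DeltaShock.speed U₀ U₁ ξ v) (Set.Icc 0 B) := fun t ht =>
    ((DeltaShock.continuousAt_speed hU₀ hU₁ (p := (ξ, v, t)) hv hξ ht.1).comp
      (f := fun t : ℝ => (ξ, v, t)) (x := t) (by fun_prop)).continuousWithinAt
  have hstr : ContinuousOn (DeltaShock.str U₀ U₁ ξ v) (Set.Icc 0 B) := fun t _ =>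
    ((DeltaShock.continuousAt_str U₀ U₁ (ξ, v, t)).comp
      (f := fun t : ℝ => (ξ, v, t)) (x := t) (by fun_prop)).continuousWithinAt
  have hmean : ∀ {f₁ f₂ : ℝ → ℝ}, ContinuousOn f₁ (Set.Icc 0 B) → ContinuousOn f₂ (Set.Icc 0 B) →
      ContinuousOn (fun t => mean ψ (f₁ t) (f₂ t) t) (Set.Icc 0 B) := fun {f₁ f₂} k₁ k₂ =>
    (continuous_mean hψ).comp_continuousOn (k₁.prodMk (k₂.prodMk continuousOn_id))
  have c1 : ContinuousOn (fun t => g U₀ * ((DeltaShock.pos U₀ U₁ ξ v t - -r)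
      * mean ψ (-r) (DeltaShock.pos U₀ U₁ ξ v t) t) + g U₁ * ((r - DeltaShock.pos U₀ U₁ ξ v t)
      * mean ψ (DeltaShock.pos U₀ U₁ ξ v t) r t)) (Set.Icc 0 B) :=
    (continuousOn_const.mul ((hpos.sub continuousOn_const).mul
      (hmean continuousOn_const hpos))).add (continuousOn_const.mul
      ((continuousOn_const.sub hpos).mul (hmean hpos continuousOn_const)))
  have c2 : ContinuousOn (fun t => DeltaShock.str U₀ U₁ ξ v t * α (DeltaShock.speed U₀ U₁ ξ v t)
      * ψ (DeltaShock.pos U₀ U₁ ξ v t, t)) (Set.Icc 0 B) :=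
    (hstr.mul (hα.comp_continuousOn hspeed)).mul
      (hψ.comp_continuousOn (hpos.prodMk continuousOn_id))
  rw [jumpPlusDelta,
    setIntegral_eq_of_subset_of_forall_sdiff_eq_zero (s := Set.Ioc 0 B) measurableSet_Ioi
      Set.Ioc_subset_Ioi_self (fun t ht => by simp [hvan t ht]),
    setIntegral_eq_of_subset_of_forall_sdiff_eq_zero (s := Set.Ioc 0 B) measurableSet_Ioi
      Set.Ioc_subset_Ioi_self (fun t ht => by rw [hvan t ht, mul_zero]),
    ← intervalIntegral.integral_of_le h0, ← intervalIntegral.integral_of_le h0]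
  simp only [integral_jump_eq hψ hc hz hr]
  rw [← intervalIntegral.integral_add (c1.intervalIntegrable_of_Icc h0)
    (c2.intervalIntegrable_of_Icc h0)]
  simp only [shadowSlice, zero_add]

/-- The solutions converge to the weighted delta shock. -/
theorem tendstoDistrib (c : Collapse U₀ U₁ ξ v) (hU₀ : 0 < U₀.rho) (hU₁ : 0 < U₁.rho)
    (hξ : 0 < ξ) (hv : U₁.lam2 ≤ v ∧ v ≤ U₀.lam1) {g : State → ℝ} {α : ℝ → ℝ} {G : ℝ → ℝ → ℝ}
    (hG : IsContent g α G) {W : ℝ → WaveTracking} (hW : IsApproximatingFamily U₀ U₁ ξ v W) :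
    TendstoDistrib W g (jumpPlusDelta (g U₀) (g U₁) (DeltaShock.pos U₀ U₁ ξ v)
      (fun t => DeltaShock.str U₀ U₁ ξ v t * α (DeltaShock.speed U₀ U₁ ξ v t))) := by
  intro φ hφ
  have hψ := hφ.1.continuous
  obtain ⟨r, -, hr, -, -, hz⟩ := exists_bounds hψ hφ.2
  obtain ⟨C, hC⟩ := c.bound g α G φ hG hψ hφ.2
  set B := r + 1 with hBdef
  have hB0 : 0 < B := by linarith
  have hTB : ∀ᶠ μ in 𝓝[>] (0 : ℝ), c.T μ < B := c.tendsto_T.eventually (gt_mem_nhds hB0)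
  refine ⟨fun μ => (c.W μ).limInt B g α φ, ?_, ?_⟩
  · filter_upwards [hW, c.sol, c.last, hTB] with μ h1 h2 h3 h4
    obtain ⟨hB', e⟩ := h2.limInt_eq (g := g) (α := α) (ψ := φ) (B := B) h1 (by rw [h3.1]; exact h4)
    have := h1.tendsto_limInt hB' hG.flux hψ hφ.2 fun x t ht =>
      hz x t (.inr ((by linarith : r ≤ t).trans (le_abs_self t)))
    rwa [e] at this
  have hmain := tendsto_integral_shadowSlice (g := g) hU₀ hU₁ hG.flux.1 hψ r hξ hv c.speed
    c.tendsto_m c.tendsto_s c.tendsto_p c.tendsto_T hB0.le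
  rw [integral_limit_eq hU₀ hU₁ hξ hv hG.flux.1 hψ hφ.2 hz hr.le (by linarith)] at hmain
  -- The integral before the time `T μ` is at most `C * T μ`, by the uniform bound of the slices,
  -- and vanishes in the limit.
  refine hmain.congr_dist (squeeze_zero' (Eventually.of_forall fun _ => dist_nonneg) ?_
    (g := fun μ => C * c.T μ) (by simpa using c.tendsto_T.const_mul C))
  filter_upwards [c.sol, c.last, hTB, hC, c.speed,
    c.tendsto_m.eventually (lt_mem_nhds hξ)] with μ h1 h2 h3 h4 h5 h6
  obtain ⟨e1, e2⟩ := h2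
  have hT0 : 0 ≤ c.T μ := by
    have := h1.T_le (Nat.zero_le _) le_rfl
    rwa [h1.1, e1] at this
  have hlast : ∫ t in (c.W μ).ends B (c.W μ).K..(c.W μ).ends B ((c.W μ).K + 1),
      ((c.W μ).slab (c.W μ).K).slice g α φ t
      = ∫ τ in (0 : ℝ)..B, shadowSlice U₀ U₁ g α φ r (c.m μ) (c.s μ) (c.p μ) (c.T μ) τ := by
    rw [WaveTracking.ends_of_le le_rfl, WaveTracking.ends_last, e1, e2]
    simp only [Pattern.single_slice hψ hφ.2 hz hr.le]
    rw [intervalIntegral.integral_comp_sub_right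
      (fun τ => shadowSlice U₀ U₁ g α φ r (c.m μ) (c.s μ) (c.p μ) (c.T μ) τ) (c.T μ), sub_self]
    have hint : ∀ a b : ℝ, 0 ≤ a → 0 ≤ b → IntervalIntegrable
        (fun τ => shadowSlice U₀ U₁ g α φ r (c.m μ) (c.s μ) (c.p μ) (c.T μ) τ) volume a b := by
      intro a b ha hb
      refine ContinuousOn.intervalIntegrable fun τ hτ => ?_
      have hτ0 : 0 ≤ τ := (le_min ha hb).trans hτ.1
      exact ((continuousAt_shadowSlice hU₀ hU₁ hG.flux.1 hψ r
        (q := (c.m μ, c.s μ, c.p μ, c.T μ, τ)) h5 h6 hτ0).comp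
        (f := fun τ : ℝ => (c.m μ, c.s μ, c.p μ, c.T μ, τ)) (x := τ) (by fun_prop)).continuousWithinAt
    rw [← intervalIntegral.integral_add_adjacent_intervals
      (hint 0 (B - c.T μ) le_rfl (by linarith)) (hint _ B (by linarith) hB0.le)]
    -- Shifting time by `T μ` shortens the interval; the missing end lies after the support of the
    -- test function.
    have hzero : ∫ τ in (B - c.T μ)..B,
        shadowSlice U₀ U₁ g α φ r (c.m μ) (c.s μ) (c.p μ) (c.T μ) τ = 0 := by
      refine intervalIntegral.integral_zero_ae (ae_of_all _ fun τ hτ => ?_)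
      rw [Set.uIoc_of_le (by linarith)] at hτ
      exact shadowSlice_of_le hz (by linarith [hτ.1])
    rw [hzero, add_zero]
  rw [WaveTracking.limInt, Finset.sum_range_succ, hlast, Real.dist_eq, abs_sub_comm,
    add_sub_cancel_right]
  refine (Finset.abs_sum_le_sum_abs _ _).trans ?_
  have hk : ∀ k ∈ Finset.range (c.W μ).K,
      |∫ t in (c.W μ).ends B k..(c.W μ).ends B (k + 1), ((c.W μ).slab k).slice g α φ t|
        ≤ C * (c.W μ).T (k + 1) - C * (c.W μ).T k := by
    intro k hk
    have hk := Finset.mem_range.1 hk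
    rw [WaveTracking.ends_of_le hk.le, WaveTracking.ends_of_le hk]
    have hlt := h1.2.1 k hk
    have hle := intervalIntegral.norm_integral_le_of_norm_le_const (C := C)
      (a := (c.W μ).T k) (b := (c.W μ).T (k + 1))
      (f := fun t => ((c.W μ).slab k).slice g α φ t) fun t ht => by
        rw [Set.uIoc_of_le hlt.le] at ht
        exact h4 k hk t (Set.Ioc_subset_Icc_self ht)
    rw [abs_of_pos (sub_pos.2 hlt), mul_sub] at hle
    exact hle
  refine (Finset.sum_le_sum hk).trans ?_
  rw [Finset.sum_range_sub (fun k => C * (c.W μ).T k), h1.1, e1, mul_zero, sub_zero]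

theorem isApproximatingFamily (c : Collapse U₀ U₁ ξ v) : IsApproximatingFamily U₀ U₁ ξ v c.W :=
  c.sol

end Collapse

end Chaplygin

namespace Chaplygin

/-! ### Speeds of the shadow waves next to the concentrated state -/

/-- Since `x²` is at least `(μ / ξ) * c`, the square of the quotient is at most `(μ / ξ) / c`. -/
theorem tendsto_div_of_sq_eq {ξ k : ℝ} (hξ : 0 < ξ) (hk : 0 < k) {x c : ℝ → ℝ}
    (hx : ∀ᶠ μ in 𝓝[>] (0 : ℝ), 0 < x μ ∧ x μ ^ 2 = (μ / ξ) ^ 2 + μ / ξ * c μ)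
    (hc : Tendsto c (𝓝[>] 0) (𝓝 k)) : Tendsto (fun μ => μ / ξ / x μ) (𝓝[>] 0) (𝓝 0) := by
  have hlim : Tendsto (fun μ => Real.sqrt (μ / ξ / c μ)) (𝓝[>] 0) (𝓝 0) := by
    have h0 := ((tendsto_div_const_nhdsGT hξ).mono_right nhdsWithin_le_nhds).div hc hk.ne'
    rw [zero_div] at h0
    simpa using h0.sqrt
  refine squeeze_zero' ?_ ?_ hlim
  · filter_upwards [hx, self_mem_nhdsWithin] with μ h h0
    exact div_nonneg (div_pos h0 hξ).le h.1.le
  · filter_upwards [hx, self_mem_nhdsWithin, hc.eventually (lt_mem_nhds hk)] with μ h h0 h1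
    have h2 : 0 < μ / ξ := div_pos h0 hξ
    refine Real.le_sqrt_of_sq_le ?_
    rw [div_pow, div_le_div_iff₀ (pow_pos h.1 2) h1, h.2]
    nlinarith [pow_pos h2 2, pow_pos h2 3]

theorem continuous_pull (U : State) : Continuous U.pull := by unfold State.pull; fun_prop

theorem State.pull_pos_left {U : State} (hU : 0 < U.rho) {v : ℝ} (h : v < U.lam1) : 0 < U.pull v := by
  rw [State.pull_eq hU, mul_assoc]
  have := State.lam1_lt_lam2 hU
  exact mul_pos hU (mul_pos_of_neg_of_neg (by linarith) (by linarith))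

theorem State.pull_pos_right {U : State} (hU : 0 < U.rho) {v : ℝ} (h : U.lam2 < v) :
    0 < U.pull v := by
  rw [State.pull_eq hU, mul_assoc]
  have := State.lam1_lt_lam2 hU
  exact mul_pos hU (mul_pos (by linarith) (by linarith))

/-- The last limit is the quantitative point: the shadow wave leaves the speed `v` by much more than
`μ / ξ`, so it crosses a region of width `μ` in a time that tends to 0. -/
theorem exists_speed_left {U : State} (hU : 0 < U.rho) {ξ v : ℝ} (hξ : 0 < ξ) (h : v < U.lam1) :
    ∃ σ : ℝ → ℝ, (∀ᶠ μ in 𝓝[>] (0 : ℝ), v + μ / ξ ≤ σ μ ∧ σ μ ≤ U.lam1 ∧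
      (State.mk (ξ / μ) v).pull (σ μ) = U.pull (σ μ)) ∧ Tendsto σ (𝓝[>] 0) (𝓝 v) ∧
      Tendsto (fun μ => μ / ξ / (σ μ - v)) (𝓝[>] 0) (𝓝 0) := by
  have hev : ∀ᶠ μ in 𝓝[>] (0 : ℝ), ∃ s : ℝ, v + μ / ξ ≤ s ∧ s ≤ U.lam1 ∧
      (State.mk (ξ / μ) v).pull s = U.pull s := by
    filter_upwards [eventually_div_lt hξ (sub_pos.2 h), self_mem_nhdsWithin] with μ h1 h0
    obtain ⟨s, κ, h2, h3, h4, -⟩ := exists_isRay_shadow hU (rho_mid_pos (v := v) hξ h0)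
      (by rw [lam2_mid]; linarith)
    rw [lam2_mid] at h2
    exact ⟨s, h2, h3, h4⟩
  obtain ⟨σ, hσ⟩ := hev.choice
  have hlim : Tendsto σ (𝓝[>] 0) (𝓝 v) := by
    refine tendsto_shadow_speed (U := U) (c := max |v| |U.lam1|) hξ ?_
    filter_upwards [hσ, self_mem_nhdsWithin] with μ hμ h0
    have : 0 < μ / ξ := div_pos h0 hξ
    exact ⟨hμ.2.2, abs_le_max_abs_abs (by linarith [hμ.1]) hμ.2.1⟩
  refine ⟨σ, hσ, hlim, tendsto_div_of_sq_eq hξ (State.pull_pos_left hU h)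
    (c := fun μ => U.pull (σ μ)) ?_ ((continuous_pull U).tendsto v |>.comp hlim)⟩
  filter_upwards [hσ, self_mem_nhdsWithin] with μ hμ h0
  have : 0 < μ / ξ := div_pos h0 hξ
  exact ⟨by linarith [hμ.1], sq_sub_eq_of_pull_eq hξ h0 hμ.2.2⟩

theorem exists_speed_right {U : State} (hU : 0 < U.rho) {ξ v : ℝ} (hξ : 0 < ξ) (h : U.lam2 < v) :
    ∃ σ : ℝ → ℝ, (∀ᶠ μ in 𝓝[>] (0 : ℝ), U.lam2 ≤ σ μ ∧ σ μ ≤ v - μ / ξ ∧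
      (State.mk (ξ / μ) v).pull (σ μ) = U.pull (σ μ)) ∧ Tendsto σ (𝓝[>] 0) (𝓝 v) ∧
      Tendsto (fun μ => μ / ξ / (v - σ μ)) (𝓝[>] 0) (𝓝 0) := by
  have hev : ∀ᶠ μ in 𝓝[>] (0 : ℝ), ∃ s : ℝ, U.lam2 ≤ s ∧ s ≤ v - μ / ξ ∧
      (State.mk (ξ / μ) v).pull s = U.pull s := by
    filter_upwards [eventually_div_lt hξ (sub_pos.2 h), self_mem_nhdsWithin] with μ h1 h0
    obtain ⟨s, κ, h2, h3, h4, -⟩ := exists_isRay_shadow (rho_mid_pos (v := v) hξ h0) hU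
      (by rw [lam1_mid]; linarith)
    rw [lam1_mid] at h3
    exact ⟨s, h2, h3, h4.symm⟩
  obtain ⟨σ, hσ⟩ := hev.choice
  have hlim : Tendsto σ (𝓝[>] 0) (𝓝 v) := by
    refine tendsto_shadow_speed (U := U) (c := max |U.lam2| |v|) hξ ?_
    filter_upwards [hσ, self_mem_nhdsWithin] with μ hμ h0
    have : 0 < μ / ξ := div_pos h0 hξ
    exact ⟨hμ.2.2, abs_le_max_abs_abs hμ.1 (by linarith [hμ.2.1])⟩
  refine ⟨σ, hσ, hlim, tendsto_div_of_sq_eq hξ (State.pull_pos_right hU h)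
    (c := fun μ => U.pull (σ μ)) ?_ ((continuous_pull U).tendsto v |>.comp hlim)⟩
  filter_upwards [hσ, self_mem_nhdsWithin] with μ hμ h0
  have : 0 < μ / ξ := div_pos h0 hξ
  refine ⟨by linarith [hμ.2.1], ?_⟩
  rw [← sq_sub_eq_of_pull_eq hξ h0 hμ.2.2]
  ring

/-! ### Collisions -/

namespace Pattern

theorem massAt_eq_sum (P : Pattern) (x t : ℝ) : P.massAt x t
    = ∑ i ∈ Finset.range P.n, if P.pos i t = x then P.str i t else 0 := by
  rw [massAt, Finset.sum_filter]

theorem momAt_eq_sum (P : Pattern) (x t : ℝ) : P.momAt x t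
    = ∑ i ∈ Finset.range P.n, if P.pos i t = x then P.str i t * P.speed i t else 0 := by
  rw [momAt, Finset.sum_filter]

/-- Two fronts that collide are continued by a single shadow wave. -/
theorem single_startsFrom {Q : Pattern} {T p m s : ℝ} (hn : Q.n = 2) (h0 : Q.pos 0 T = p)
    (h1 : Q.pos 1 T = p) (hm : 0 < m) (hmass : Q.str 0 T + Q.str 1 T = m)
    (hmom : Q.str 0 T * Q.speed 0 T + Q.str 1 T * Q.speed 1 T = m * s) :
    (single (Q.state 0) (Q.state 2) m s p T).StartsFrom T (fun x => Q.base x T)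
      (fun x => Q.massAt x T) (fun x => Q.momAt x T) := by
  refine ⟨Eventually.of_forall fun x => ?_, fun x => ?_, fun x => ?_⟩
  · beta_reduce
    rw [base_eq_sum, base_eq_sum, hn, single_n]
    simp only [Finset.sum_range_succ, Finset.sum_range_zero, zero_add, h0, h1, single_pos, sub_self,
      DeltaShock.pos_zero, add_zero]
    by_cases hx : p < x <;> simp [hx]
  · beta_reduce
    rw [massAt_eq_sum, massAt_eq_sum, hn, single_n]
    simp only [Finset.sum_range_succ, Finset.sum_range_zero, zero_add, h0, h1, single_pos, sub_self,
      DeltaShock.pos_zero, add_zero, single_str, DeltaShock.str_zero hm]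
    by_cases hx : p = x <;> simp [hx, hmass]
  · beta_reduce
    rw [momAt_eq_sum, momAt_eq_sum, hn, single_n]
    simp only [Finset.sum_range_succ, Finset.sum_range_zero, zero_add, h0, h1, single_pos, sub_self,
      DeltaShock.pos_zero, add_zero, single_str, single_speed, DeltaShock.str_zero hm,
      DeltaShock.speed_zero hm, ← hmom]
    by_cases hx : p = x <;> simp [hx]

end Pattern

/-- A solution with one interaction time. -/
noncomputable def WaveTracking.two (T : ℝ) (P Q : Pattern) : WaveTracking where
  K := 1
  T k := if k = 0 then 0 else T
  slab k := if k = 0 then P else Q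

theorem WaveTracking.two_isSolution {T : ℝ} {P Q : Pattern} {U : ℝ → State} (hT : 0 < T)
    (hP : P.IsAdmissibleOn 0 (Set.Icc 0 T)) (hQ : Q.IsAdmissibleOn T (Set.Ici T))
    (hS : P.StartsFrom 0 U (fun _ => 0) (fun _ => 0)) {i : ℕ} (hi : i + 1 < P.n)
    (hc : P.pos i T = P.pos (i + 1) T)
    (hS' : Q.StartsFrom T (fun x => P.base x T) (fun x => P.massAt x T) (fun x => P.momAt x T)) :
    (WaveTracking.two T P Q).IsSolution U := by
  refine ⟨rfl, fun k hk => ?_, fun k hk => ?_, hS, fun k hk => ?_⟩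
  · obtain rfl : k = 0 := Nat.lt_one_iff.1 hk
    exact hT
  · rcases hk.lt_or_eq with hk | rfl
    · obtain rfl : k = 0 := Nat.lt_one_iff.1 hk
      exact hP
    · exact hQ
  · obtain rfl : k = 0 := Nat.lt_one_iff.1 hk
    exact ⟨⟨i, hi, hc⟩, hS'⟩

/-- A solution with two interaction times. -/
noncomputable def WaveTracking.three (T T' : ℝ) (P Q R : Pattern) : WaveTracking where
  K := 2
  T k := if k = 0 then 0 else if k = 1 then T else T'
  slab k := if k = 0 then P else if k = 1 then Q else R

theorem WaveTracking.three_isSolution {T T' : ℝ} {P Q R : Pattern} {U : ℝ → State} (hT : 0 < T)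
    (hT' : T < T') (hP : P.IsAdmissibleOn 0 (Set.Icc 0 T)) (hQ : Q.IsAdmissibleOn T (Set.Icc T T'))
    (hR : R.IsAdmissibleOn T' (Set.Ici T'))
    (hS : P.StartsFrom 0 U (fun _ => 0) (fun _ => 0)) {i j : ℕ} (hi : i + 1 < P.n)
    (hc : P.pos i T = P.pos (i + 1) T)
    (hS' : Q.StartsFrom T (fun x => P.base x T) (fun x => P.massAt x T) (fun x => P.momAt x T))
    (hj : j + 1 < Q.n) (hc' : Q.pos j T' = Q.pos (j + 1) T')
    (hS'' : R.StartsFrom T' (fun x => Q.base x T') (fun x => Q.massAt x T')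
      (fun x => Q.momAt x T')) :
    (WaveTracking.three T T' P Q R).IsSolution U := by
  refine ⟨rfl, fun k hk => ?_, fun k hk => ?_, hS, fun k hk => ?_⟩
  · have hk : k < 2 := hk
    interval_cases k
    exacts [hT, hT']
  · have hk : k < 3 := Nat.lt_succ_of_le hk
    interval_cases k
    exacts [hP, hQ, hR]
  · have hk : k < 2 := hk
    interval_cases k
    exacts [⟨⟨i, hi, hc⟩, hS'⟩, ⟨⟨j, hj, hc'⟩, hS''⟩]

/-- Bounds for the contents of the middle states. -/
theorem IsContent.eventually_mid_le {g : State → ℝ} {α : ℝ → ℝ} {G : ℝ → ℝ → ℝ}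
    (hG : IsContent g α G) {ξ : ℝ} (hξ : 0 < ξ) (v : ℝ) :
    ∃ C : ℝ, 0 ≤ C ∧ ∀ᶠ μ in 𝓝[>] (0 : ℝ), |g ⟨ξ / μ, v⟩| * μ ≤ C := by
  have hc : Continuous fun η : ℝ => |G (v - η) (v + η)| * (ξ / 2) :=
    (hG.cont.comp (f := fun η : ℝ => (v - η, v + η)) (by fun_prop)).abs.mul continuous_const
  have hlim := (hc.tendsto 0).comp ((tendsto_div_const_nhdsGT hξ).mono_right nhdsWithin_le_nhds)
  refine ⟨|G (v - 0) (v + 0)| * (ξ / 2) + 1, by positivity, ?_⟩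
  filter_upwards [hlim.eventually (gt_mem_nhds (lt_add_one _)), self_mem_nhdsWithin] with μ h h0
  refine le_trans (le_of_eq ?_) h.le
  have h1 : 0 < μ / ξ := div_pos h0 hξ
  have h2 : μ = 2 * (μ / ξ) * (ξ / 2) := by field_simp
  simp only [Function.comp_def]
  rw [← hG.eq _ _ (show v - μ / ξ < v + μ / ξ by linarith), Meeting.mid_eq_ofLam, abs_mul,
    abs_of_pos (show 0 < v + μ / ξ - (v - μ / ξ) by linarith)]
  linear_combination |g (State.ofLam (v - μ / ξ) (v + μ / ξ))| * h2

/-! ### Two shadow waves that collide -/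

namespace TwoShadows

variable {U₀ U₁ : State} {ξ μ v s₀ s₁ : ℝ}

/-- The rate of growth of a shadow wave. -/
noncomputable def _root_.Chaplygin.growth (L R : State) (s : ℝ) : ℝ :=
  s * (R.rho - L.rho) - (R.mom - L.mom)

/-- The pattern before the collision. -/
noncomputable def first (U₀ U₁ : State) (ξ μ v s₀ s₁ : ℝ) : Pattern :=
  twoFans μ 1 1 (fun i => if i = 0 then U₀ else ⟨ξ / μ, v⟩)
    (fun i => if i = 0 then ⟨ξ / μ, v⟩ else U₁) (fun _ => s₀)
    (fun _ => growth U₀ ⟨ξ / μ, v⟩ s₀) (fun _ => s₁) (fun _ => growth ⟨ξ / μ, v⟩ U₁ s₁)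

/-- The waves next to the concentrated state are shadow waves with speeds `s₀` and `s₁`. -/
structure Data (U₀ U₁ : State) (ξ μ v s₀ s₁ : ℝ) : Prop where
  rho₀ : 0 < U₀.rho
  rho₁ : 0 < U₁.rho
  mass : 0 < ξ
  pos : 0 < μ
  left : v + μ / ξ ≤ s₀
  left' : s₀ ≤ U₀.lam1
  left_pull : (State.mk (ξ / μ) v).pull s₀ = U₀.pull s₀
  right : U₁.lam2 ≤ s₁
  right' : s₁ ≤ v - μ / ξ
  right_pull : (State.mk (ξ / μ) v).pull s₁ = U₁.pull s₁

/-- The time of the collision. -/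
noncomputable def time (μ s₀ s₁ : ℝ) : ℝ := μ / (s₀ - s₁)

/-- The sum of the rates of growth. -/
noncomputable def rate (U₀ U₁ : State) (ξ μ v s₀ s₁ : ℝ) : ℝ :=
  growth U₀ ⟨ξ / μ, v⟩ s₀ + growth ⟨ξ / μ, v⟩ U₁ s₁

/-- The speed after the collision. -/
noncomputable def speed (U₀ U₁ : State) (ξ μ v s₀ s₁ : ℝ) : ℝ :=
  (growth U₀ ⟨ξ / μ, v⟩ s₀ * s₀ + growth ⟨ξ / μ, v⟩ U₁ s₁ * s₁) / rate U₀ U₁ ξ μ v s₀ s₁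

/-- The solution. -/
noncomputable def tracking (U₀ U₁ : State) (ξ μ v s₀ s₁ : ℝ) : WaveTracking :=
  WaveTracking.two (time μ s₀ s₁) (first U₀ U₁ ξ μ v s₀ s₁)
    (Pattern.single U₀ U₁ (rate U₀ U₁ ξ μ v s₀ s₁ * time μ s₀ s₁)
      (speed U₀ U₁ ξ μ v s₀ s₁) (-(μ / 2) + s₀ * time μ s₀ s₁) (time μ s₀ s₁))

namespace Data

theorem div_pos (h : Data U₀ U₁ ξ μ v s₀ s₁) : 0 < μ / ξ := _root_.div_pos h.pos h.mass

theorem rho_mid (h : Data U₀ U₁ ξ μ v s₀ s₁) : 0 < (State.mk (ξ / μ) v).rho :=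
  rho_mid_pos h.mass h.pos

theorem lt (h : Data U₀ U₁ ξ μ v s₀ s₁) : s₁ < s₀ := by
  linarith [h.div_pos, h.left, h.right']

theorem time_pos (h : Data U₀ U₁ ξ μ v s₀ s₁) : 0 < time μ s₀ s₁ :=
  _root_.div_pos h.pos (sub_pos.2 h.lt)

theorem sub_mul_time (h : Data U₀ U₁ ξ μ v s₀ s₁) : (s₀ - s₁) * time μ s₀ s₁ = μ :=
  mul_div_cancel₀ _ (sub_pos.2 h.lt).ne'

theorem ray_left (h : Data U₀ U₁ ξ μ v s₀ s₁) :
    IsRay U₀ ⟨ξ / μ, v⟩ s₀ (growth U₀ ⟨ξ / μ, v⟩ s₀) :=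
  .inr ⟨by rw [lam2_mid]; exact h.left, h.left', rfl, h.left_pull⟩

theorem ray_right (h : Data U₀ U₁ ξ μ v s₀ s₁) :
    IsRay ⟨ξ / μ, v⟩ U₁ s₁ (growth ⟨ξ / μ, v⟩ U₁ s₁) :=
  .inr ⟨h.right, by rw [lam1_mid]; exact h.right', rfl, h.right_pull.symm⟩

theorem growth_left (h : Data U₀ U₁ ξ μ v s₀ s₁) : 2 ≤ growth U₀ ⟨ξ / μ, v⟩ s₀ :=
  State.two_le_flux h.rho₀ h.rho_mid (by rw [lam2_mid]; exact h.left) h.left'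

theorem growth_right (h : Data U₀ U₁ ξ μ v s₀ s₁) : 2 ≤ growth ⟨ξ / μ, v⟩ U₁ s₁ :=
  State.two_le_flux h.rho_mid h.rho₁ h.right (by rw [lam1_mid]; exact h.right')

theorem rate_pos (h : Data U₀ U₁ ξ μ v s₀ s₁) : 0 < rate U₀ U₁ ξ μ v s₀ s₁ := by
  have := h.growth_left
  have := h.growth_right
  rw [rate]
  linarith

theorem le_speed (h : Data U₀ U₁ ξ μ v s₀ s₁) : s₁ ≤ speed U₀ U₁ ξ μ v s₀ s₁ := by
  rw [speed, le_div_iff₀ h.rate_pos, rate]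
  nlinarith [h.growth_left, h.lt]

theorem speed_le (h : Data U₀ U₁ ξ μ v s₀ s₁) : speed U₀ U₁ ξ μ v s₀ s₁ ≤ s₀ := by
  rw [speed, div_le_iff₀ h.rate_pos, rate]
  nlinarith [h.growth_right, h.lt]

/-- At the collision the whole concentrated state has been swallowed: the terms with `ξ / μ` add up
to `(ξ / μ) * (s₀ - s₁) * time`, which is `ξ`. The rest is inflow from outside during a short time.
-/
theorem rate_mul_time (h : Data U₀ U₁ ξ μ v s₀ s₁) :
    rate U₀ U₁ ξ μ v s₀ s₁ * time μ s₀ s₁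
      = ξ + time μ s₀ s₁ * (s₁ * U₁.rho - s₀ * U₀.rho + U₀.mom - U₁.mom) := by
  have h1 := h.sub_mul_time
  have h2 : ξ / μ * μ = ξ := div_mul_cancel₀ _ h.pos.ne'
  simp only [rate, growth]
  linear_combination (ξ / μ) * h1 + h2

theorem first_pos (t : ℝ) : (first U₀ U₁ ξ μ v s₀ s₁).pos 0 t = -(μ / 2) + s₀ * t ∧
    (first U₀ U₁ ξ μ v s₀ s₁).pos 1 t = μ / 2 + s₁ * t := by
  simp [first, twoFans, glue]

theorem first_str (t : ℝ) :
    (first U₀ U₁ ξ μ v s₀ s₁).str 0 t = growth U₀ ⟨ξ / μ, v⟩ s₀ * t ∧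
    (first U₀ U₁ ξ μ v s₀ s₁).str 1 t = growth ⟨ξ / μ, v⟩ U₁ s₁ * t := by
  simp [first, twoFans, glue]

theorem fan_left (h : Data U₀ U₁ ξ μ v s₀ s₁) : IsFan U₀ ⟨ξ / μ, v⟩ 1
    (fun i => if i = 0 then U₀ else ⟨ξ / μ, v⟩) (fun _ => s₀)
    (fun _ => growth U₀ ⟨ξ / μ, v⟩ s₀) :=
  isFan_one h.rho₀ h.rho_mid h.ray_left

theorem fan_right (h : Data U₀ U₁ ξ μ v s₀ s₁) : IsFan ⟨ξ / μ, v⟩ U₁ 1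
    (fun i => if i = 0 then ⟨ξ / μ, v⟩ else U₁) (fun _ => s₁)
    (fun _ => growth ⟨ξ / μ, v⟩ U₁ s₁) :=
  isFan_one h.rho_mid h.rho₁ h.ray_right

theorem first_admissible (h : Data U₀ U₁ ξ μ v s₀ s₁) :
    (first U₀ U₁ ξ μ v s₀ s₁).IsAdmissibleOn 0 (Set.Icc 0 (time μ s₀ s₁)) := by
  refine Pattern.affine_admissible Set.Icc_subset_Ici_self (h.fan_left.glue_rho_pos h.fan_right)
    (fun t ht i hi => ?_) (h.fan_left.glue_ray h.fan_right)
  rw [interior_Icc] at ht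
  obtain rfl : i = 0 := by omega
  have := mul_lt_mul_of_pos_left ht.2 (sub_pos.2 h.lt)
  rw [h.sub_mul_time] at this
  simp only [glue, zero_lt_one, if_true, sub_zero, zero_add, lt_irrefl, if_false]
  linarith

theorem isSolution (h : Data U₀ U₁ ξ μ v s₀ s₁) :
    (tracking U₀ U₁ ξ μ v s₀ s₁).IsSolution (deltaData U₀ U₁ ξ μ v) := by
  obtain ⟨p0, p1⟩ := first_pos (U₀ := U₀) (U₁ := U₁) (ξ := ξ) (μ := μ) (v := v) (s₀ := s₀)
    (s₁ := s₁) (time μ s₀ s₁)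
  obtain ⟨k0, k1⟩ := first_str (U₀ := U₀) (U₁ := U₁) (ξ := ξ) (μ := μ) (v := v) (s₀ := s₀)
    (s₁ := s₁) (time μ s₀ s₁)
  have hm : 0 < rate U₀ U₁ ξ μ v s₀ s₁ * time μ s₀ s₁ := mul_pos h.rate_pos h.time_pos
  have he : μ / 2 + s₁ * time μ s₀ s₁ = -(μ / 2) + s₀ * time μ s₀ s₁ := by
    linarith [h.sub_mul_time]
  rw [he] at p1
  refine WaveTracking.two_isSolution h.time_pos h.first_admissible
    (Pattern.single_admissible h.rho₀ h.rho₁ ⟨h.right.trans h.le_speed, h.speed_le.trans h.left'⟩ hm)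
    (h.fan_left.startsFrom h.pos h.fan_right) (i := 0) (show 0 + 1 < 1 + 1 by norm_num)
    (p0.trans p1.symm) ?_
  refine Pattern.single_startsFrom (Q := first U₀ U₁ ξ μ v s₀ s₁) rfl p0 p1 hm ?_ ?_
  · rw [k0, k1, rate]
    ring
  · have e0 : (first U₀ U₁ ξ μ v s₀ s₁).speed 0 (time μ s₀ s₁) = s₀ := rfl
    have e1 : (first U₀ U₁ ξ μ v s₀ s₁).speed 1 (time μ s₀ s₁) = s₁ := rfl
    rw [k0, k1, e0, e1, speed]
    have := h.rate_pos.ne'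
    field_simp

end Data

end TwoShadows

end Chaplygin

/-! ### Collapse of two colliding shadow waves as `μ → 0+` -/

namespace Chaplygin

/-- A bound for the velocity weight of a quantity on a bounded set of speeds. -/
theorem IsFlux.exists_abs_le {g : State → ℝ} {α : ℝ → ℝ} (hg : IsFlux g α) (a b : ℝ) :
    ∃ A : ℝ, 0 ≤ A ∧ ∀ s, a ≤ s → s ≤ b → |α s| ≤ A := by
  obtain ⟨A, hA⟩ := isCompact_Icc.exists_bound_of_continuousOn (s := Set.Icc a b)
    hg.1.continuousOn
  exact ⟨max A 0, le_max_right _ _, fun s h1 h2 => (hA s ⟨h1, h2⟩).trans (le_max_left _ _)⟩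

namespace TwoShadows

variable {U₀ U₁ : State} {ξ v : ℝ}

/-- For `v` strictly between λ₂(U₁) and λ₁(U₀) both sides of the concentrated state are shadow
waves, which squeeze it. Their collision time is at most `μ / (σ₀ - v)` and tends to 0. -/
theorem nonempty_collapse (hU₀ : 0 < U₀.rho) (hU₁ : 0 < U₁.rho) (hξ : 0 < ξ) (h₀ : v < U₀.lam1)
    (h₁ : U₁.lam2 < v) : Nonempty (Collapse U₀ U₁ ξ v) := by
  obtain ⟨σ₀, hσ₀, lim₀, rat₀⟩ := exists_speed_left hU₀ hξ h₀
  obtain ⟨σ₁, hσ₁, lim₁, -⟩ := exists_speed_right hU₁ hξ h₁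
  have hdata : ∀ᶠ μ in 𝓝[>] (0 : ℝ), Data U₀ U₁ ξ μ v (σ₀ μ) (σ₁ μ) := by
    filter_upwards [hσ₀, hσ₁, self_mem_nhdsWithin] with μ k₀ k₁ hμ
    exact ⟨hU₀, hU₁, hξ, hμ, k₀.1, k₀.2.1, k₀.2.2, k₁.1, k₁.2.1, k₁.2.2⟩
  have limT : Tendsto (fun μ => time μ (σ₀ μ) (σ₁ μ)) (𝓝[>] 0) (𝓝 0) := by
    have hz : Tendsto (fun μ => ξ * (μ / ξ / (σ₀ μ - v))) (𝓝[>] 0) (𝓝 0) := by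
      simpa using rat₀.const_mul ξ
    refine squeeze_zero' ?_ ?_ hz
    · filter_upwards [hdata] with μ h using h.time_pos.le
    · filter_upwards [hdata] with μ h
      have l0 := h.left
      have l1 := h.right'
      have l2 := h.div_pos
      have e : ξ * (μ / ξ / (σ₀ μ - v)) = μ / (σ₀ μ - v) := by
        field_simp
      rw [e, time]
      exact div_le_div_of_nonneg_left h.pos.le (by linarith) (by linarith)
  have limm : Tendsto (fun μ => rate U₀ U₁ ξ μ v (σ₀ μ) (σ₁ μ) * time μ (σ₀ μ) (σ₁ μ))
      (𝓝[>] 0) (𝓝 ξ) := by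
    have : Tendsto (fun μ => ξ + time μ (σ₀ μ) (σ₁ μ)
        * (σ₁ μ * U₁.rho - σ₀ μ * U₀.rho + U₀.mom - U₁.mom)) (𝓝[>] 0)
        (𝓝 (ξ + 0 * (v * U₁.rho - v * U₀.rho + U₀.mom - U₁.mom))) :=
      (limT.mul ((((lim₁.mul_const _).sub (lim₀.mul_const _)).add_const _).sub_const _)).const_add _
    rw [zero_mul, add_zero] at this
    refine this.congr' ?_
    filter_upwards [hdata] with μ h using h.rate_mul_time.symm
  have limp : Tendsto (fun μ => -(μ / 2) + σ₀ μ * time μ (σ₀ μ) (σ₁ μ)) (𝓝[>] 0) (𝓝 0) := by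
    have h1 : Tendsto (fun μ : ℝ => -(μ / 2)) (𝓝[>] 0) (𝓝 0) := by
      have : Tendsto (fun μ : ℝ => -(μ / 2)) (𝓝 0) (𝓝 (-(0 / 2))) :=
        Continuous.tendsto (by fun_prop) 0
      rw [zero_div, neg_zero] at this
      exact this.mono_left nhdsWithin_le_nhds
    simpa using h1.add (lim₀.mul limT)
  refine ⟨⟨fun μ => tracking U₀ U₁ ξ μ v (σ₀ μ) (σ₁ μ),
    fun μ => rate U₀ U₁ ξ μ v (σ₀ μ) (σ₁ μ) * time μ (σ₀ μ) (σ₁ μ),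
    fun μ => speed U₀ U₁ ξ μ v (σ₀ μ) (σ₁ μ), fun μ => -(μ / 2) + σ₀ μ * time μ (σ₀ μ) (σ₁ μ),
    fun μ => time μ (σ₀ μ) (σ₁ μ), ?_, Eventually.of_forall fun μ => ⟨rfl, rfl⟩, ?_, limm, ?_, limp,
    limT, ?_⟩⟩
  · filter_upwards [hdata] with μ h using h.isSolution
  · filter_upwards [hdata] with μ h
    exact ⟨h.right.trans h.le_speed, h.speed_le.trans h.left'⟩
  -- The speed after the collision is a mean of the two incoming speeds with positive weights, and
  -- both tend to `v`.
  · refine tendsto_of_tendsto_of_tendsto_of_le_of_le' lim₁ lim₀ ?_ ?_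
    · filter_upwards [hdata] with μ h using h.le_speed
    · filter_upwards [hdata] with μ h using h.speed_le
  intro g α G ψ hG hψ hc
  obtain ⟨-, C₀, -, hC0, hC, -⟩ := exists_bounds hψ hc
  obtain ⟨D, -, hD⟩ := exists_integral_abs_le hψ hc
  obtain ⟨A, hA0, hA⟩ := hG.flux.exists_abs_le U₁.lam2 U₀.lam1
  obtain ⟨M, -, hM⟩ := hG.eventually_mid_le hξ v
  refine ⟨(|g U₀| + |g U₁|) * D + C₀ * M + C₀ * (2 * ξ * A), ?_⟩
  filter_upwards [hdata, hM, limm.eventually (gt_mem_nhds (show ξ < 2 * ξ by linarith))]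
    with μ h hMμ hm k hk t ht
  obtain rfl : k = 0 := Nat.lt_one_iff.1 hk
  change t ∈ Set.Icc 0 (time μ (σ₀ μ) (σ₁ μ)) at ht
  change |(first U₀ U₁ ξ μ v (σ₀ μ) (σ₁ μ)).slice g α ψ t| ≤ _
  have hs := h.first_admissible.sorted h.time_pos ht
  refine (hs.abs_slice_le (m := 1) rfl g α hψ hc hC hD).trans ?_
  obtain ⟨p0, p1⟩ := Data.first_pos (U₀ := U₀) (U₁ := U₁) (ξ := ξ) (μ := μ) (v := v) (s₀ := σ₀ μ)
    (s₁ := σ₁ μ) t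
  obtain ⟨k0, k1⟩ := Data.first_str (U₀ := U₀) (U₁ := U₁) (ξ := ξ) (μ := μ) (v := v) (s₀ := σ₀ μ)
    (s₁ := σ₁ μ) t
  have e0 : (first U₀ U₁ ξ μ v (σ₀ μ) (σ₁ μ)).speed 0 t = σ₀ μ := rfl
  have e1 : (first U₀ U₁ ξ μ v (σ₀ μ) (σ₁ μ)).speed 1 t = σ₁ μ := rfl
  have s0 : (first U₀ U₁ ξ μ v (σ₀ μ) (σ₁ μ)).state 0 = U₀ := rfl
  have s1 : (first U₀ U₁ ξ μ v (σ₀ μ) (σ₁ μ)).state 1 = ⟨ξ / μ, v⟩ := rfl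
  have s2 : (first U₀ U₁ ξ μ v (σ₀ μ) (σ₁ μ)).state 2 = U₁ := rfl
  have g0 := h.growth_left
  have g1 := h.growth_right
  simp only [Finset.sum_range_succ, Finset.sum_range_zero, zero_add, Nat.reduceAdd, p0, p1, k0, k1,
    e0, e1, s0, s1, s2]
  rw [abs_of_nonneg (mul_nonneg (by linarith) ht.1), abs_of_nonneg (mul_nonneg (by linarith) ht.1)]
  have a0 := hA (σ₀ μ) (h.right.trans h.lt.le) h.left'
  have a1 := hA (σ₁ μ) h.right (h.lt.le.trans h.left')
  have w : |g ⟨ξ / μ, v⟩| * (μ / 2 + σ₁ μ * t - (-(μ / 2) + σ₀ μ * t)) ≤ M := by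
    refine le_trans (mul_le_mul_of_nonneg_left ?_ (abs_nonneg _)) hMμ
    have := mul_nonneg (sub_pos.2 h.lt).le ht.1
    linarith
  have q : growth U₀ ⟨ξ / μ, v⟩ (σ₀ μ) * t * |α (σ₀ μ)| + growth ⟨ξ / μ, v⟩ U₁ (σ₁ μ) * t * |α (σ₁ μ)|
      ≤ 2 * ξ * A := by
    have b0 := mul_le_mul_of_nonneg_left a0 (mul_nonneg (by linarith : 0 ≤ growth U₀ ⟨ξ / μ, v⟩ (σ₀ μ))
      ht.1)
    have b1 := mul_le_mul_of_nonneg_left a1 (mul_nonneg (by linarith : 0 ≤ growth ⟨ξ / μ, v⟩ U₁ (σ₁ μ))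
      ht.1)
    have b2 := mul_le_mul_of_nonneg_left ht.2 h.rate_pos.le
    have b3 := mul_le_mul_of_nonneg_right (b2.trans hm.le) hA0
    rw [rate] at b3
    linarith
  have w' := mul_le_mul_of_nonneg_left w hC0
  have q' := mul_le_mul_of_nonneg_left q hC0
  linarith

end TwoShadows

end Chaplygin

/-! ### Estimates for explicit shadow waves, and patterns with two fronts -/

namespace Chaplygin

namespace DeltaShock

variable {L R : State} {m s τ r : ℝ}

/-- The barrier argument works at every intermediate speed at which the pulls are suitably ordered,
not only at the eigenvalues. This gives a definite gap to the speed of a contact that has to be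
overtaken. -/
theorem speed_le_of_pull (hL : 0 < L.rho) (hR : 0 < R.rho) (hs : R.lam2 ≤ s) (hm : 0 < m)
    (hτ : 0 ≤ τ) (hr : s ≤ r) (hr' : r ≤ L.lam1) (hp : L.pull r ≤ R.pull r) :
    speed L R m s τ ≤ r := by
  have hs' : R.lam2 ≤ s ∧ s ≤ L.lam1 := ⟨hs, hr.trans hr'⟩
  have h := (rankineHugoniot hL hR hs' hm 0 0).mono
    (Set.Icc_subset_Ici_self : Set.Icc 0 τ ⊆ Set.Ici 0)
  have := h.speed_le (fun x hx => str_pos hL hR hs' hm (sub_nonneg.2 hx.1)) hp ?_ ?_ ⟨hτ, le_rfl⟩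
  · simpa using this
  · have := State.two_le_flux hL hR (hs.trans hr) hr'; linarith
  · rwa [sub_self, speed_zero hm]

theorem le_speed_of_pull (hL : 0 < L.rho) (hR : 0 < R.rho) (hs : s ≤ L.lam1) (hm : 0 < m)
    (hτ : 0 ≤ τ) (hr : r ≤ s) (hr' : R.lam2 ≤ r) (hp : R.pull r ≤ L.pull r) :
    r ≤ speed L R m s τ := by
  have hs' : R.lam2 ≤ s ∧ s ≤ L.lam1 := ⟨hr'.trans hr, hs⟩
  have h := (rankineHugoniot hL hR hs' hm 0 0).mono
    (Set.Icc_subset_Ici_self : Set.Icc 0 τ ⊆ Set.Ici 0)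
  have := h.le_speed (fun x hx => str_pos hL hR hs' hm (sub_nonneg.2 hx.1)) hp ?_ ?_ ⟨hτ, le_rfl⟩
  · simpa using this
  · have := State.two_le_flux hL hR hr' (hr.trans hs); linarith
  · rwa [sub_self, speed_zero hm]

theorem speed_mem (hL : 0 < L.rho) (hR : 0 < R.rho) (hs : R.lam2 ≤ s ∧ s ≤ L.lam1) (hm : 0 < m)
    (hτ : 0 ≤ τ) : R.lam2 ≤ speed L R m s τ ∧ speed L R m s τ ≤ L.lam1 :=
  ⟨le_speed_of_pull hL hR hs.2 hm hτ hs.1 le_rfl (by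
      rw [State.pull_lam2 hR]; exact State.pull_nonneg_left hL (hs.1.trans hs.2)),
    speed_le_of_pull hL hR hs.1 hm hτ hs.2 le_rfl (by
      rw [State.pull_lam1 hL]; exact State.pull_nonneg_right hR (hs.1.trans hs.2))⟩

theorem str_le_str (hL : 0 < L.rho) (hR : 0 < R.rho) (hs : R.lam2 ≤ s ∧ s ≤ L.lam1) (hm : 0 < m)
    {τ' : ℝ} (hτ : 0 ≤ τ) (hτ' : τ ≤ τ') : str L R m s τ ≤ str L R m s τ' := by
  have hsub : Set.Icc τ τ' ⊆ Set.Ici 0 := fun x hx => hτ.trans hx.1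
  have := ((isShadow hL hR hs hm 0).mono hsub).le_str hL hR (t := τ') ⟨hτ', le_rfl⟩
  simp only [sub_zero] at this
  linarith

theorem continuousOn_pos (hL : 0 < L.rho) (hR : 0 < R.rho) (hs : R.lam2 ≤ s ∧ s ≤ L.lam1)
    (hm : 0 < m) : ContinuousOn (pos L R m s) (Set.Ici 0) := by
  have := (isFront hL hR hs hm 0 0).1
  simpa using this

theorem pos_sub_le (hL : 0 < L.rho) (hR : 0 < R.rho) (hs : R.lam2 ≤ s ∧ s ≤ L.lam1) (hm : 0 < m)
    {τ' c : ℝ} (hτ : 0 ≤ τ) (hτ' : τ ≤ τ') (hc : ∀ x, 0 ≤ x → speed L R m s x ≤ c) :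
    pos L R m s τ' ≤ pos L R m s τ + c * (τ' - τ) := by
  have hsub : Set.Icc τ τ' ⊆ Set.Ici 0 := fun x hx => hτ.trans hx.1
  have := ((isFront hL hR hs hm 0 0).mono hsub).pos_le
    (fun t ht => hc (t - 0) (by linarith [ht.1])) ⟨hτ', le_rfl⟩
  simpa using this

theorem le_pos_sub (hL : 0 < L.rho) (hR : 0 < R.rho) (hs : R.lam2 ≤ s ∧ s ≤ L.lam1) (hm : 0 < m)
    {τ' c : ℝ} (hτ : 0 ≤ τ) (hτ' : τ ≤ τ') (hc : ∀ x, 0 ≤ x → c ≤ speed L R m s x) :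
    pos L R m s τ + c * (τ' - τ) ≤ pos L R m s τ' := by
  have hsub : Set.Icc τ τ' ⊆ Set.Ici 0 := fun x hx => hτ.trans hx.1
  have := ((isFront hL hR hs hm 0 0).mono hsub).le_pos
    (fun t ht => hc (t - 0) (by linarith [ht.1])) ⟨hτ', le_rfl⟩
  simpa using this

end DeltaShock

/-- A function that decreases at least with rate `δ` has a zero. -/
theorem exists_zero_of_decay {f : ℝ → ℝ} {δ : ℝ} (hf : ContinuousOn f (Set.Ici 0)) (h0 : 0 < f 0)
    (hδ : 0 < δ) (hdec : ∀ x y, 0 ≤ x → x ≤ y → f y ≤ f x - δ * (y - x)) :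
    ∃ τ, 0 < τ ∧ τ ≤ f 0 / δ ∧ f τ = 0 ∧ ∀ t, 0 ≤ t → t < τ → 0 < f t := by
  have hd : 0 ≤ f 0 / δ := (div_pos h0 hδ).le
  have hend : f (f 0 / δ) ≤ 0 := by
    have := hdec 0 (f 0 / δ) le_rfl hd
    rw [sub_zero, mul_div_cancel₀ _ hδ.ne'] at this
    linarith
  obtain ⟨τ, hτ, hz⟩ := intermediate_value_Icc' hd (hf.mono Set.Icc_subset_Ici_self)
    (show (0 : ℝ) ∈ Set.Icc (f (f 0 / δ)) (f 0) from ⟨hend, h0.le⟩)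
  refine ⟨τ, lt_of_le_of_ne hτ.1 fun e => ?_, hτ.2, hz, fun t ht htτ => ?_⟩
  · rw [← e] at hz
    exact h0.ne' hz
  · have := hdec t τ ht htτ.le
    have := mul_pos hδ (sub_pos.2 htτ)
    linarith

namespace Pattern

/-- A pattern with two fronts. -/
@[simps]
noncomputable def pair (L M R : State) (x₀ s₀ w₀ x₁ s₁ w₁ : ℝ → ℝ) (o : ℝ) : Pattern where
  n := 2
  state i := if i = 0 then L else if i = 1 then M else R
  pos i := if i = 0 then x₀ else x₁
  speed i := if i = 0 then s₀ else s₁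
  str i := if i = 0 then w₀ else w₁
  org _ := o

variable {L M R : State} {x₀ s₀ w₀ x₁ s₁ w₁ : ℝ → ℝ} {o T : ℝ} {J : Set ℝ} {Q : Pattern}

/-- Two of three fronts collide, the two on the right. -/
theorem pair_startsFrom_right (hn : Q.n = 3) (q0 : Q.state 0 = L) (q1 : Q.state 1 = M)
    (q3 : Q.state 3 = R) (h0 : Q.pos 0 T = x₀ T) (h1 : Q.pos 1 T = x₁ T) (h2 : Q.pos 2 T = x₁ T)
    (hlt : x₀ T < x₁ T) (m0 : Q.str 0 T = w₀ T) (m1 : Q.str 1 T + Q.str 2 T = w₁ T)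
    (k0 : Q.str 0 T * Q.speed 0 T = w₀ T * s₀ T)
    (k1 : Q.str 1 T * Q.speed 1 T + Q.str 2 T * Q.speed 2 T = w₁ T * s₁ T) :
    (pair L M R x₀ s₀ w₀ x₁ s₁ w₁ o).StartsFrom T (fun x => Q.base x T)
      (fun x => Q.massAt x T) (fun x => Q.momAt x T) := by
  refine ⟨Eventually.of_forall fun x => ?_, fun x => ?_, fun x => ?_⟩
  · beta_reduce
    rw [base_eq_sum, base_eq_sum, hn, pair_n]
    simp only [Finset.sum_range_succ, Finset.sum_range_zero, zero_add, h0, h1, h2, pair_pos,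
      if_true, one_ne_zero, if_false]
    by_cases hx : x₁ T < x
    · simp [hx, hlt.trans hx, q3]
    · by_cases hx' : x₀ T < x
      · simp [hx, hx', q1]
      · simp [hx, hx', q0]
  · beta_reduce
    rw [massAt_eq_sum, massAt_eq_sum, hn, pair_n]
    simp only [Finset.sum_range_succ, Finset.sum_range_zero, zero_add, h0, h1, h2, pair_pos,
      pair_str, if_true, one_ne_zero, if_false, m0, ← m1]
    by_cases hx : x₁ T = x <;> simp [hx, add_assoc]
  · beta_reduce
    rw [momAt_eq_sum, momAt_eq_sum, hn, pair_n]
    simp only [Finset.sum_range_succ, Finset.sum_range_zero, zero_add, h0, h1, h2, pair_pos,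
      pair_str, pair_speed, if_true, one_ne_zero, if_false, k0, ← k1]
    by_cases hx : x₁ T = x <;> simp [hx, add_assoc]

/-- Two of three fronts collide, the two on the left. -/
theorem pair_startsFrom_left (hn : Q.n = 3) (q0 : Q.state 0 = L) (q2 : Q.state 2 = M)
    (q3 : Q.state 3 = R) (h0 : Q.pos 0 T = x₀ T) (h1 : Q.pos 1 T = x₀ T) (h2 : Q.pos 2 T = x₁ T)
    (hlt : x₀ T < x₁ T) (m0 : Q.str 0 T + Q.str 1 T = w₀ T) (m1 : Q.str 2 T = w₁ T)
    (k0 : Q.str 0 T * Q.speed 0 T + Q.str 1 T * Q.speed 1 T = w₀ T * s₀ T)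
    (k1 : Q.str 2 T * Q.speed 2 T = w₁ T * s₁ T) :
    (pair L M R x₀ s₀ w₀ x₁ s₁ w₁ o).StartsFrom T (fun x => Q.base x T)
      (fun x => Q.massAt x T) (fun x => Q.momAt x T) := by
  refine ⟨Eventually.of_forall fun x => ?_, fun x => ?_, fun x => ?_⟩
  · beta_reduce
    rw [base_eq_sum, base_eq_sum, hn, pair_n]
    simp only [Finset.sum_range_succ, Finset.sum_range_zero, zero_add, h0, h1, h2, pair_pos,
      if_true, one_ne_zero, if_false]
    by_cases hx : x₁ T < x
    · simp [hx, hlt.trans hx, q3]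
    · by_cases hx' : x₀ T < x
      · simp [hx, hx', q2]
      · simp [hx, hx', q0]
  · beta_reduce
    rw [massAt_eq_sum, massAt_eq_sum, hn, pair_n]
    simp only [Finset.sum_range_succ, Finset.sum_range_zero, zero_add, h0, h1, h2, pair_pos,
      pair_str, if_true, one_ne_zero, if_false, m1, ← m0]
    by_cases hx : x₀ T = x <;> simp [hx]
  · beta_reduce
    rw [momAt_eq_sum, momAt_eq_sum, hn, pair_n]
    simp only [Finset.sum_range_succ, Finset.sum_range_zero, zero_add, h0, h1, h2, pair_pos,
      pair_str, pair_speed, if_true, one_ne_zero, if_false, k1, ← k0]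
    by_cases hx : x₀ T = x <;> simp [hx]

end Pattern

/-- Bounds for the contents of the states next to the concentrated state. -/
theorem IsContent.eventually_side_le {g : State → ℝ} {α : ℝ → ℝ} {G : ℝ → ℝ → ℝ}
    (hG : IsContent g α G) {ξ : ℝ} (hξ : 0 < ξ) (v : ℝ) :
    ∃ C : ℝ, 0 ≤ C ∧ ∀ᶠ μ in 𝓝[>] (0 : ℝ), |g (State.ofLam v (v + μ / ξ))| * (μ / ξ) ≤ C ∧
      |g (State.ofLam (v - μ / ξ) v)| * (μ / ξ) ≤ C := by
  have hc : Continuous fun η : ℝ => |G v (v + η)| + |G (v - η) v| :=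
    (hG.cont.comp (f := fun η : ℝ => (v, v + η)) (by fun_prop)).abs.add
      (hG.cont.comp (f := fun η : ℝ => (v - η, v)) (by fun_prop)).abs
  have hlim := (hc.tendsto 0).comp ((tendsto_div_const_nhdsGT hξ).mono_right nhdsWithin_le_nhds)
  refine ⟨|G v (v + 0)| + |G (v - 0) v| + 1, by positivity, ?_⟩
  filter_upwards [hlim.eventually (gt_mem_nhds (lt_add_one _)), self_mem_nhdsWithin] with μ h h0
  have h1 : 0 < μ / ξ := div_pos h0 hξ
  simp only [Function.comp_def] at h
  have e1 := hG.eq v (v + μ / ξ) (by linarith)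
  have e2 := hG.eq (v - μ / ξ) v (by linarith)
  rw [add_sub_cancel_left] at e1
  rw [sub_sub_cancel] at e2
  rw [← e1, ← e2, abs_mul, abs_mul, abs_of_pos h1] at h
  have p1 := mul_nonneg h1.le (abs_nonneg (g (State.ofLam v (v + μ / ξ))))
  have p2 := mul_nonneg h1.le (abs_nonneg (g (State.ofLam (v - μ / ξ) v)))
  constructor <;> linarith

end Chaplygin

namespace Chaplygin

/-! ### A shadow wave that absorbs two contact discontinuities on its left -/

namespace ContactsShadow

variable {U₀ U₁ : State} {ξ μ v s τ : ℝ}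

/-- The state between the two contact discontinuities. -/
noncomputable def mid (ξ μ v : ℝ) : State := State.ofLam v (v + μ / ξ)

/-- The time of the first collision. -/
noncomputable def time (ξ μ v s : ℝ) : ℝ := μ / (v + μ / ξ - s)

/-- The strength of the shadow wave at the first collision. -/
noncomputable def mass (U₁ : State) (ξ μ v s : ℝ) : ℝ :=
  growth ⟨ξ / μ, v⟩ U₁ s * time ξ μ v s

/-- The pattern before the first collision. -/
noncomputable def first (U₀ U₁ : State) (ξ μ v s : ℝ) : Pattern :=
  twoFans μ 2 1 (fun i => if i = 0 then U₀ else if i = 1 then mid ξ μ v else ⟨ξ / μ, v⟩)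
    (fun i => if i = 0 then ⟨ξ / μ, v⟩ else U₁) (fun i => if i = 0 then v else v + μ / ξ)
    (fun _ => 0) (fun _ => s) (fun _ => growth ⟨ξ / μ, v⟩ U₁ s)

/-- The pattern between the two collisions. -/
noncomputable def second (U₀ U₁ : State) (ξ μ v s : ℝ) : Pattern :=
  Pattern.pair U₀ (mid ξ μ v) U₁ (fun t => -(μ / 2) + v * t) (fun _ => v) (fun _ => 0)
    (fun t => -(μ / 2) + (v + μ / ξ) * time ξ μ v s
      + DeltaShock.pos (mid ξ μ v) U₁ (mass U₁ ξ μ v s) s (t - time ξ μ v s))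
    (fun t => DeltaShock.speed (mid ξ μ v) U₁ (mass U₁ ξ μ v s) s (t - time ξ μ v s))
    (fun t => DeltaShock.str (mid ξ μ v) U₁ (mass U₁ ξ μ v s) s (t - time ξ μ v s))
    (time ξ μ v s - 1)

/-- The solution, the second collision takes place after the time `τ`. -/
noncomputable def tracking (U₀ U₁ : State) (ξ μ v s τ : ℝ) : WaveTracking :=
  WaveTracking.three (time ξ μ v s) (time ξ μ v s + τ) (first U₀ U₁ ξ μ v s)
    (second U₀ U₁ ξ μ v s)
    (Pattern.single U₀ U₁ (DeltaShock.str (mid ξ μ v) U₁ (mass U₁ ξ μ v s) s τ)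
      (DeltaShock.speed (mid ξ μ v) U₁ (mass U₁ ξ μ v s) s τ)
      (-(μ / 2) + v * (time ξ μ v s + τ)) (time ξ μ v s + τ))

/-- The waves on the left of the concentrated state are contact discontinuities, the one on the
right is a shadow wave with speed `s`. -/
structure Data (U₀ U₁ : State) (ξ μ v s : ℝ) : Prop where
  rho₀ : 0 < U₀.rho
  rho₁ : 0 < U₁.rho
  mass_pos : 0 < ξ
  pos : 0 < μ
  left : U₀.lam1 = v
  ne : U₀.lam2 ≠ v + μ / ξ
  right : U₁.lam2 ≤ s
  right' : s ≤ v - μ / ξ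
  right_pull : (State.mk (ξ / μ) v).pull s = U₁.pull s

/-- The left contact discontinuity meets the shadow wave after the time `τ`. -/
structure Meets (U₁ : State) (ξ μ v s τ : ℝ) : Prop where
  pos : 0 < τ
  eq : v * τ = μ / ξ * time ξ μ v s + DeltaShock.pos (mid ξ μ v) U₁ (mass U₁ ξ μ v s) s τ
  lt : ∀ t, 0 ≤ t → t < τ →
    v * t < μ / ξ * time ξ μ v s + DeltaShock.pos (mid ξ μ v) U₁ (mass U₁ ξ μ v s) s t

namespace Data

theorem div_pos (h : Data U₀ U₁ ξ μ v s) : 0 < μ / ξ := _root_.div_pos h.pos h.mass_pos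

theorem rho_conc (h : Data U₀ U₁ ξ μ v s) : 0 < (State.mk (ξ / μ) v).rho :=
  rho_mid_pos h.mass_pos h.pos

theorem rho_mid (h : Data U₀ U₁ ξ μ v s) : 0 < (mid ξ μ v).rho :=
  State.rho_ofLam_pos (by linarith [h.div_pos])

theorem lam1_mid (ξ μ v : ℝ) : (mid ξ μ v).lam1 = v := State.lam1_ofLam _ _

theorem lam2_mid (ξ μ v : ℝ) : (mid ξ μ v).lam2 = v + μ / ξ := State.lam2_ofLam _ _

theorem lt (h : Data U₀ U₁ ξ μ v s) : s < v := by linarith [h.div_pos, h.right']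

theorem mem (h : Data U₀ U₁ ξ μ v s) : U₁.lam2 ≤ s ∧ s ≤ (mid ξ μ v).lam1 :=
  ⟨h.right, by rw [lam1_mid]; exact h.lt.le⟩

theorem sub_pos (h : Data U₀ U₁ ξ μ v s) : 0 < v + μ / ξ - s := by linarith [h.div_pos, h.lt]

theorem time_pos (h : Data U₀ U₁ ξ μ v s) : 0 < time ξ μ v s := _root_.div_pos h.pos h.sub_pos

theorem sub_mul_time (h : Data U₀ U₁ ξ μ v s) : (v + μ / ξ - s) * time ξ μ v s = μ :=
  mul_div_cancel₀ _ h.sub_pos.ne'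

theorem time_le (h : Data U₀ U₁ ξ μ v s) : time ξ μ v s ≤ ξ * (μ / ξ / (v - s)) := by
  have e : ξ * (μ / ξ / (v - s)) = μ / (v - s) := by
    have := h.mass_pos.ne'
    field_simp
  rw [e, time]
  exact div_le_div_of_nonneg_left h.pos.le (by linarith [h.lt]) (by linarith [h.div_pos])

theorem two_le_growth (h : Data U₀ U₁ ξ μ v s) : 2 ≤ growth ⟨ξ / μ, v⟩ U₁ s :=
  State.two_le_flux h.rho_conc h.rho₁ h.right (by rw [Chaplygin.lam1_mid]; exact h.right')

theorem mass_pos' (h : Data U₀ U₁ ξ μ v s) : 0 < mass U₁ ξ μ v s :=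
  mul_pos (by linarith [h.two_le_growth]) h.time_pos

theorem mass_eq (h : Data U₀ U₁ ξ μ v s) :
    mass U₁ ξ μ v s = ξ + time ξ μ v s * (s * U₁.rho - U₁.mom - 1) := by
  have h1 := h.sub_mul_time
  have h2 : ξ / μ * μ = ξ := div_mul_cancel₀ _ h.pos.ne'
  have h3 : ξ / μ * (μ / ξ) = 1 := by
    have := h.mass_pos.ne'
    have := h.pos.ne'
    field_simp
  simp only [mass, growth, State.mom]
  linear_combination (ξ / μ) * h1 + h2 - time ξ μ v s * h3

theorem rho_mid_mul (h : Data U₀ U₁ ξ μ v s) : (mid ξ μ v).rho * (μ / ξ) = 2 := by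
  have := State.rho_mul (mid ξ μ v) h.rho_mid
  rwa [lam1_mid, lam2_mid, add_sub_cancel_left] at this

theorem mom_mid (h : Data U₀ U₁ ξ μ v s) : (mid ξ μ v).mom = 1 + v * (mid ξ μ v).rho := by
  have := State.mom_sub_lam1 h.rho_mid
  rw [lam1_mid] at this
  linarith

theorem momFlux_mid (h : Data U₀ U₁ ξ μ v s) :
    (mid ξ μ v).momFlux = v + v * (mid ξ μ v).mom := by
  have := State.momFlux_sub_lam1 h.rho_mid
  rw [lam1_mid] at this
  linarith

/-- The density of the middle state is of order `ξ / μ`, but it enters only through its product with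
`μ / ξ`, which is 2. All terms next to `mass` tend to 0 with the two elapsed times. -/
theorem str_eq (h : Data U₀ U₁ ξ μ v s) (hm : Meets U₁ ξ μ v s τ) :
    DeltaShock.str (mid ξ μ v) U₁ (mass U₁ ξ μ v s) s τ = mass U₁ ξ μ v s
      + U₁.rho * (v * τ - μ / ξ * time ξ μ v s) - U₁.mom * τ + 2 * time ξ μ v s + τ := by
  rw [DeltaShock.str_eq h.rho_mid h.rho₁ h.mem h.mass_pos' hm.pos.le, h.mom_mid]
  linear_combination (U₁.rho - (mid ξ μ v).rho) * -hm.eq + time ξ μ v s * h.rho_mid_mul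

/-- The same cancellation for the momentum: the limit speed is obtained from momentum over mass,
although the evolution between the collisions involves an unbounded density. -/
theorem str_mul_speed (h : Data U₀ U₁ ξ μ v s) (hm : Meets U₁ ξ μ v s τ) :
    DeltaShock.str (mid ξ μ v) U₁ (mass U₁ ξ μ v s) s τ
      * DeltaShock.speed (mid ξ μ v) U₁ (mass U₁ ξ μ v s) s τ = mass U₁ ξ μ v s * s
      + U₁.mom * (v * τ - μ / ξ * time ξ μ v s) - U₁.momFlux * τ
      + (μ / ξ + 2 * v) * time ξ μ v s + v * τ := by
  rw [DeltaShock.str_mul_speed h.rho_mid h.rho₁ h.mem h.mass_pos' hm.pos.le, h.momFlux_mid]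
  have e := h.mom_mid
  linear_combination (U₁.mom - (mid ξ μ v).mom) * -hm.eq + time ξ μ v s * v * h.rho_mid_mul
    + μ / ξ * time ξ μ v s * e

/-- The gap to the remaining contact starts as `μ / ξ * time` and closes at least with rate `δ`,
because `v - δ` is a barrier for the speed of the shadow wave. -/
theorem exists_meets (h : Data U₀ U₁ ξ μ v s) {δ : ℝ} (hδ : 0 < δ) (hs : s ≤ v - δ)
    (hp : (mid ξ μ v).pull (v - δ) ≤ U₁.pull (v - δ)) :
    ∃ τ, Meets U₁ ξ μ v s τ ∧ τ ≤ μ / ξ * time ξ μ v s / δ := by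
  have hT : 0 < μ / ξ * time ξ μ v s := mul_pos h.div_pos h.time_pos
  obtain ⟨τ, h0, h1, h2, h3⟩ := exists_zero_of_decay (δ := δ)
    (f := fun t => μ / ξ * time ξ μ v s
      + DeltaShock.pos (mid ξ μ v) U₁ (mass U₁ ξ μ v s) s t - v * t)
    ((continuousOn_const.add (DeltaShock.continuousOn_pos h.rho_mid h.rho₁ h.mem h.mass_pos')).sub
      (by fun_prop)) (by simpa [DeltaShock.pos_zero] using hT) hδ (fun x y hx hxy => by
        have := DeltaShock.pos_sub_le h.rho_mid h.rho₁ h.mem h.mass_pos' hx hxy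
          (c := v - δ) fun t ht => DeltaShock.speed_le_of_pull h.rho_mid h.rho₁ h.right h.mass_pos'
            ht hs (by rw [lam1_mid]; linarith) hp
        linarith)
  simp only [DeltaShock.pos_zero, mul_zero, sub_zero, add_zero] at h1
  exact ⟨τ, ⟨h0, by linarith, fun t ht ht' => by linarith [h3 t ht ht']⟩, h1⟩

theorem first_pos (t : ℝ) : (first U₀ U₁ ξ μ v s).pos 0 t = -(μ / 2) + v * t ∧
    (first U₀ U₁ ξ μ v s).pos 1 t = -(μ / 2) + (v + μ / ξ) * t ∧
    (first U₀ U₁ ξ μ v s).pos 2 t = μ / 2 + s * t := by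
  simp [first, twoFans, glue]

theorem first_str (t : ℝ) : (first U₀ U₁ ξ μ v s).str 0 t = 0 ∧
    (first U₀ U₁ ξ μ v s).str 1 t = 0 ∧
    (first U₀ U₁ ξ μ v s).str 2 t = growth ⟨ξ / μ, v⟩ U₁ s * t := by
  simp [first, twoFans, glue]

theorem first_speed (t : ℝ) : (first U₀ U₁ ξ μ v s).speed 2 t = s := by
  simp [first, twoFans, glue]

theorem first_state : (first U₀ U₁ ξ μ v s).state 0 = U₀ ∧
    (first U₀ U₁ ξ μ v s).state 1 = mid ξ μ v ∧ (first U₀ U₁ ξ μ v s).state 2 = ⟨ξ / μ, v⟩ ∧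
    (first U₀ U₁ ξ μ v s).state 3 = U₁ := by
  simp [first, twoFans, glue]

theorem fan_left (h : Data U₀ U₁ ξ μ v s) : IsFan U₀ ⟨ξ / μ, v⟩ 2
    (fun i => if i = 0 then U₀ else if i = 1 then mid ξ μ v else ⟨ξ / μ, v⟩)
    (fun i => if i = 0 then v else v + μ / ξ) (fun _ => 0) := by
  have hd := h.div_pos
  have := isFan_contacts h.rho₀ h.rho_conc (by rw [h.left, Chaplygin.lam2_mid]; linarith)
    (by rw [h.left, Chaplygin.lam1_mid]; linarith) (by rw [Chaplygin.lam2_mid]; exact h.ne)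
  rwa [State.between, h.left, Chaplygin.lam2_mid] at this

theorem fan_right (h : Data U₀ U₁ ξ μ v s) : IsFan ⟨ξ / μ, v⟩ U₁ 1
    (fun i => if i = 0 then ⟨ξ / μ, v⟩ else U₁) (fun _ => s)
    (fun _ => growth ⟨ξ / μ, v⟩ U₁ s) :=
  isFan_one h.rho_conc h.rho₁
    (.inr ⟨h.right, by rw [Chaplygin.lam1_mid]; exact h.right', rfl, h.right_pull.symm⟩)

theorem first_admissible (h : Data U₀ U₁ ξ μ v s) :
    (first U₀ U₁ ξ μ v s).IsAdmissibleOn 0 (Set.Icc 0 (time ξ μ v s)) := by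
  refine Pattern.affine_admissible Set.Icc_subset_Ici_self (h.fan_left.glue_rho_pos h.fan_right)
    (fun t ht i hi => ?_) (h.fan_left.glue_ray h.fan_right)
  rw [interior_Icc] at ht
  have h1 := mul_lt_mul_of_pos_left ht.2 h.sub_pos
  have h2 := mul_pos h.div_pos ht.1
  rw [h.sub_mul_time] at h1
  have hi : i < 2 := by omega
  interval_cases i <;> simp [glue] <;> linarith

theorem second_admissible (h : Data U₀ U₁ ξ μ v s) (hm : Meets U₁ ξ μ v s τ) :
    (second U₀ U₁ ξ μ v s).IsAdmissibleOn (time ξ μ v s)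
      (Set.Icc (time ξ μ v s) (time ξ μ v s + τ)) := by
  refine ⟨fun i _ => ?_, fun t ht i hi => ?_, fun i hi => ?_⟩
  · simp only [second, Pattern.pair_state]
    split_ifs
    exacts [h.rho₀, h.rho_mid, h.rho₁]
  · rw [interior_Icc] at ht
    obtain rfl : i = 0 := by
      simp only [second, Pattern.pair_n] at hi
      omega
    have := hm.lt (t - time ξ μ v s) (by linarith [ht.1]) (by linarith [ht.2])
    simp only [second, Pattern.pair_pos, if_true, zero_add, one_ne_zero, if_false]
    linarith
  · have hi : i < 2 := hi
    interval_cases i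
    · have hf : IsFront (Set.Icc (time ξ μ v s) (time ξ μ v s + τ)) (fun t => -(μ / 2) + v * t)
          (fun _ => v) := by
        simpa using Pattern.isFront_affine (-(μ / 2)) v 0 _
      refine ⟨hf, .inl ⟨fun e => h.ne ?_,
        fun _ _ => rfl, .inl ⟨?_, fun _ _ => h.left.symm⟩⟩⟩
      · change U₀ = mid ξ μ v at e
        rw [e, lam2_mid]
      · exact h.left.trans (lam1_mid ξ μ v).symm
    · refine ⟨(DeltaShock.isFront h.rho_mid h.rho₁ h.mem h.mass_pos' _ _).mono
        Set.Icc_subset_Ici_self, .inr ⟨(DeltaShock.isShadow h.rho_mid h.rho₁ h.mem h.mass_pos' _).mono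
          Set.Icc_subset_Ici_self, .inr ⟨?_, sub_one_lt _⟩⟩⟩
      simp only [second, Pattern.pair_str, one_ne_zero, if_false, sub_self,
        DeltaShock.str_zero h.mass_pos', h.mass_pos']

theorem speed_mem (h : Data U₀ U₁ ξ μ v s) {t : ℝ} (ht : 0 ≤ t) :
    U₁.lam2 ≤ DeltaShock.speed (mid ξ μ v) U₁ (mass U₁ ξ μ v s) s t ∧
      DeltaShock.speed (mid ξ μ v) U₁ (mass U₁ ξ μ v s) s t ≤ v := by
  have := DeltaShock.speed_mem h.rho_mid h.rho₁ h.mem h.mass_pos' ht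
  rwa [lam1_mid] at this

theorem isSolution (h : Data U₀ U₁ ξ μ v s) (hm : Meets U₁ ξ μ v s τ) :
    (tracking U₀ U₁ ξ μ v s τ).IsSolution (deltaData U₀ U₁ ξ μ v) := by
  obtain ⟨p0, p1, p2⟩ := first_pos (U₀ := U₀) (U₁ := U₁) (ξ := ξ) (μ := μ) (v := v) (s := s)
    (time ξ μ v s)
  obtain ⟨k0, k1, k2⟩ := first_str (U₀ := U₀) (U₁ := U₁) (ξ := ξ) (μ := μ) (v := v) (s := s)
    (time ξ μ v s)
  have hp : μ / 2 + s * time ξ μ v s = -(μ / 2) + (v + μ / ξ) * time ξ μ v s := by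
    linarith [h.sub_mul_time]
  rw [hp] at p2
  have hlt := mul_pos h.div_pos h.time_pos
  have hτ : time ξ μ v s + τ - time ξ μ v s = τ := add_sub_cancel_left _ _
  have hsp := h.speed_mem hm.pos.le
  have hw := DeltaShock.str_pos h.rho_mid h.rho₁ h.mem h.mass_pos' hm.pos.le
  have e1 : (second U₀ U₁ ξ μ v s).pos 1 (time ξ μ v s + τ)
      = -(μ / 2) + v * (time ξ μ v s + τ) := by
    simp only [second, Pattern.pair_pos, one_ne_zero, if_false, hτ]
    linarith [hm.eq]
  refine WaveTracking.three_isSolution h.time_pos (by linarith [hm.pos]) h.first_admissible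
    (h.second_admissible hm)
    (Pattern.single_admissible h.rho₀ h.rho₁ ⟨hsp.1, hsp.2.trans h.left.ge⟩ hw)
    (h.fan_left.startsFrom h.pos h.fan_right) (i := 1) (j := 0) (show 1 + 1 < 2 + 1 by norm_num)
    (p1.trans p2.symm) ?_ (show 0 + 1 < 2 by norm_num) e1.symm ?_
  · refine Pattern.pair_startsFrom_right (Q := first U₀ U₁ ξ μ v s) rfl first_state.1
      first_state.2.1 first_state.2.2.2 p0 ?_ ?_ ?_ k0 ?_ ?_ ?_
    · simp only [sub_self, DeltaShock.pos_zero, add_zero, p1]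
    · simp only [sub_self, DeltaShock.pos_zero, add_zero, p2]
    · simp only [sub_self, DeltaShock.pos_zero, add_zero]
      linarith
    · rw [k1, k2, sub_self, DeltaShock.str_zero h.mass_pos', zero_add, mass]
    · rw [k0, zero_mul, zero_mul]
    · rw [k1, k2, sub_self, DeltaShock.str_zero h.mass_pos', DeltaShock.speed_zero h.mass_pos',
        first_speed, zero_mul, zero_add, mass]
  · refine Pattern.single_startsFrom (Q := second U₀ U₁ ξ μ v s) rfl rfl e1 hw ?_ ?_
    · simp only [second, Pattern.pair_str, if_true, one_ne_zero, if_false, hτ, zero_add]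
    · simp only [second, Pattern.pair_str, Pattern.pair_speed, if_true, one_ne_zero, if_false, hτ,
        zero_mul, zero_add]

end Data

/-- Before the first collision the concentrated region is at most `μ` wide; at all times before the
second one the region next to it is at most `μ / ξ * time` wide. Both contents are bounded, and so
are the strengths. -/
theorem bound {g : State → ℝ} {α : ℝ → ℝ} {G : ℝ → ℝ → ℝ} {ψ : ℝ × ℝ → ℝ}
    (hG : IsContent g α G) (hψ : Continuous ψ) (hc : HasCompactSupport ψ) {σ τ : ℝ → ℝ}
    (hξ : 0 < ξ) (hdata : ∀ᶠ μ in 𝓝[>] (0 : ℝ), Data U₀ U₁ ξ μ v (σ μ))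
    (hmeet : ∀ᶠ μ in 𝓝[>] (0 : ℝ), Meets U₁ ξ μ v (σ μ) (τ μ))
    (limT : Tendsto (fun μ => time ξ μ v (σ μ)) (𝓝[>] 0) (𝓝 0))
    (limm : Tendsto (fun μ => mass U₁ ξ μ v (σ μ)) (𝓝[>] 0) (𝓝 ξ))
    (limw : Tendsto (fun μ => DeltaShock.str (mid ξ μ v) U₁ (mass U₁ ξ μ v (σ μ)) (σ μ) (τ μ))
      (𝓝[>] 0) (𝓝 ξ)) :
    ∃ C : ℝ, ∀ᶠ μ in 𝓝[>] (0 : ℝ), ∀ k < 2, ∀ t ∈ Set.Icc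
      ((tracking U₀ U₁ ξ μ v (σ μ) (τ μ)).T k) ((tracking U₀ U₁ ξ μ v (σ μ) (τ μ)).T (k + 1)),
      |((tracking U₀ U₁ ξ μ v (σ μ) (τ μ)).slab k).slice g α ψ t| ≤ C := by
  obtain ⟨-, C₀, -, hC0, hC, -⟩ := exists_bounds hψ hc
  obtain ⟨D, -, hD⟩ := exists_integral_abs_le hψ hc
  obtain ⟨A, hA0, hA⟩ := hG.flux.exists_abs_le U₁.lam2 v
  obtain ⟨M, hM0, hM⟩ := hG.eventually_mid_le hξ v
  obtain ⟨N, -, hN⟩ := hG.eventually_side_le hξ v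
  refine ⟨(|g U₀| + |g U₁|) * D + C₀ * (N + M) + C₀ * (2 * ξ * A), ?_⟩
  have h2 : ξ < 2 * ξ := by linarith
  filter_upwards [hdata, hmeet, hM, hN, limT.eventually (gt_mem_nhds one_pos),
    limm.eventually (gt_mem_nhds h2), limw.eventually (gt_mem_nhds h2)]
    with μ h hm hMμ hNμ hT hmass hstr k hk t ht
  replace hNμ : |g (mid ξ μ v)| * (μ / ξ) ≤ N := hNμ.1
  have hd := h.div_pos
  have hNT : ∀ y, y ≤ μ / ξ * time ξ μ v (σ μ) → |g (mid ξ μ v)| * y ≤ N := by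
    intro y hy
    refine le_trans (mul_le_mul_of_nonneg_left (hy.trans ?_) (abs_nonneg _)) hNμ
    exact mul_le_of_le_one_right hd.le hT.le
  interval_cases k
  · change t ∈ Set.Icc 0 (time ξ μ v (σ μ)) at ht
    change |(first U₀ U₁ ξ μ v (σ μ)).slice g α ψ t| ≤ _
    obtain ⟨p0, p1, p2⟩ := Data.first_pos (U₀ := U₀) (U₁ := U₁) (ξ := ξ) (μ := μ) (v := v)
      (s := σ μ) t
    obtain ⟨k0, k1, k2⟩ := Data.first_str (U₀ := U₀) (U₁ := U₁) (ξ := ξ) (μ := μ) (v := v)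
      (s := σ μ) t
    obtain ⟨s0, s1, s2, s3⟩ := Data.first_state (U₀ := U₀) (U₁ := U₁) (ξ := ξ) (μ := μ) (v := v)
      (s := σ μ)
    have e2 := Data.first_speed (U₀ := U₀) (U₁ := U₁) (ξ := ξ) (μ := μ) (v := v) (s := σ μ) t
    refine ((h.first_admissible.sorted h.time_pos ht).abs_slice_le (m := 2) rfl g α hψ hc hC
      hD).trans ?_
    have hκ := h.two_le_growth
    simp only [Finset.sum_range_succ, Finset.sum_range_zero, zero_add, Nat.reduceAdd, p0, p1, p2,
      k0, k1, k2, e2, s0, s1, s2, s3, abs_zero, zero_mul]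
    rw [abs_of_nonneg (mul_nonneg (by linarith) ht.1)]
    have w1 := mul_le_mul_of_nonneg_left (hNT (μ / ξ * t) (mul_le_mul_of_nonneg_left ht.2 hd.le)) hC0
    have w2 : |g ⟨ξ / μ, v⟩| * (μ / 2 + σ μ * t - (-(μ / 2) + (v + μ / ξ) * t)) ≤ M := by
      refine le_trans (mul_le_mul_of_nonneg_left ?_ (abs_nonneg _)) hMμ
      have := mul_nonneg h.sub_pos.le ht.1
      linarith
    have w3 : growth ⟨ξ / μ, v⟩ U₁ (σ μ) * t * |α (σ μ)| ≤ 2 * ξ * A := by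
      have b0 : growth ⟨ξ / μ, v⟩ U₁ (σ μ) * t ≤ mass U₁ ξ μ v (σ μ) :=
        mul_le_mul_of_nonneg_left ht.2 (by linarith)
      exact mul_le_mul (b0.trans hmass.le) (hA _ h.right h.lt.le) (abs_nonneg _) (by linarith)
    have w2' := mul_le_mul_of_nonneg_left w2 hC0
    have w3' := mul_le_mul_of_nonneg_left w3 hC0
    linarith
  · change t ∈ Set.Icc (time ξ μ v (σ μ)) (time ξ μ v (σ μ) + τ μ) at ht
    change |(second U₀ U₁ ξ μ v (σ μ)).slice g α ψ t| ≤ _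
    have ht0 : 0 ≤ t - time ξ μ v (σ μ) := by linarith [ht.1]
    have ht1 : t - time ξ μ v (σ μ) ≤ τ μ := by linarith [ht.2]
    refine (((h.second_admissible hm).sorted (by linarith [hm.pos]) ht).abs_slice_le (m := 1) rfl
      g α hψ hc hC hD).trans ?_
    simp only [second, Finset.sum_range_succ, Finset.sum_range_zero, zero_add, Nat.reduceAdd,
      Pattern.pair_state, Pattern.pair_pos, Pattern.pair_str, Pattern.pair_speed, if_true,
      one_ne_zero, if_false, OfNat.ofNat_ne_zero, OfNat.ofNat_ne_one, abs_zero, zero_mul]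
    rw [abs_of_pos (DeltaShock.str_pos h.rho_mid h.rho₁ h.mem h.mass_pos' ht0)]
    -- The shadow wave is not faster than the contact, so the region between them does not grow
    -- after the first collision.
    have hpos := DeltaShock.pos_sub_le h.rho_mid h.rho₁ h.mem h.mass_pos' le_rfl ht0
      (c := v) fun x hx => (h.speed_mem hx).2
    rw [DeltaShock.pos_zero] at hpos
    have w1 := mul_le_mul_of_nonneg_left (hNT (-(μ / 2) + (v + μ / ξ) * time ξ μ v (σ μ)
      + DeltaShock.pos (mid ξ μ v) U₁ (mass U₁ ξ μ v (σ μ)) (σ μ) (t - time ξ μ v (σ μ))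
      - (-(μ / 2) + v * t)) (by linarith)) hC0
    have hsp := h.speed_mem ht0
    have w3 := mul_le_mul_of_nonneg_left (mul_le_mul
      ((DeltaShock.str_le_str h.rho_mid h.rho₁ h.mem h.mass_pos' ht0 ht1).trans hstr.le)
      (hA _ hsp.1 hsp.2) (abs_nonneg _) (by linarith)) hC0
    have w4 := mul_nonneg hC0 hM0
    linarith

/-- With `δ = (v - σ) / 4` the pull of the middle state, by the equation for `(σ - v)²`, is an
eighth of `U₁.pull σ` plus terms that vanish in the limit. It is eventually below `U₁.pull (v - δ)`,
which tends to the full positive value `U₁.pull v`. -/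
theorem eventually_pull_le (hU₁ : 0 < U₁.rho) (hξ : 0 < ξ) (h₁ : U₁.lam2 < v) {σ : ℝ → ℝ}
    (hdata : ∀ᶠ μ in 𝓝[>] (0 : ℝ), Data U₀ U₁ ξ μ v (σ μ)) (lim : Tendsto σ (𝓝[>] 0) (𝓝 v)) :
    ∀ᶠ μ in 𝓝[>] (0 : ℝ),
      (mid ξ μ v).pull (v - (v - σ μ) / 4) ≤ U₁.pull (v - (v - σ μ) / 4) := by
  have hk := State.pull_pos_right hU₁ h₁
  have l1 : Tendsto (fun μ => μ / ξ / 8 + U₁.pull (σ μ) / 8 + (v - σ μ) / 2) (𝓝[>] 0)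
      (𝓝 (0 / 8 + U₁.pull v / 8 + (v - v) / 2)) :=
    ((((tendsto_div_const_nhdsGT hξ).mono_right nhdsWithin_le_nhds).div_const _).add
      ((((continuous_pull U₁).tendsto v).comp lim).div_const _)).add
      ((tendsto_const_nhds.sub lim).div_const _)
  have l2 : Tendsto (fun μ => U₁.pull (v - (v - σ μ) / 4)) (𝓝[>] 0)
      (𝓝 (U₁.pull (v - (v - v) / 4))) :=
    ((continuous_pull U₁).tendsto _).comp
      (tendsto_const_nhds.sub ((tendsto_const_nhds.sub lim).div_const _))
  rw [sub_self, zero_div, zero_div, add_zero, zero_add] at l1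
  rw [sub_self, zero_div, sub_zero] at l2
  filter_upwards [hdata, l1.eventually_lt l2 (by linarith)] with μ h hlt
  refine le_trans (le_of_eq ?_) hlt.le
  have hsq := sq_sub_eq_of_pull_eq h.mass_pos h.pos h.right_pull
  have hr := h.rho_mid_mul
  have hd := h.div_pos
  have hr' : (mid ξ μ v).rho = 2 / (μ / ξ) := by
    rw [eq_div_iff hd.ne', hr]
  rw [State.pull_eq h.rho_mid, Data.lam1_mid, Data.lam2_mid, hr']
  generalize μ / ξ = η at *
  field_simp
  linear_combination 32 * hsq

theorem nonempty_collapse (hU₀ : 0 < U₀.rho) (hU₁ : 0 < U₁.rho) (hξ : 0 < ξ) (h₀ : U₀.lam1 = v)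
    (h₁ : U₁.lam2 < v) : Nonempty (Collapse U₀ U₁ ξ v) := by
  obtain ⟨σ, hσ, lim, rat⟩ := exists_speed_right hU₁ hξ h₁
  have limη : Tendsto (fun μ : ℝ => μ / ξ) (𝓝[>] 0) (𝓝 0) :=
    (tendsto_div_const_nhdsGT hξ).mono_right nhdsWithin_le_nhds
  have hdata : ∀ᶠ μ in 𝓝[>] (0 : ℝ), Data U₀ U₁ ξ μ v (σ μ) := by
    filter_upwards [hσ, self_mem_nhdsWithin, eventually_div_ne hξ (U₀.lam2 - v)] with μ k hμ hne
    exact ⟨hU₀, hU₁, hξ, hμ, h₀, fun e => hne (by linarith), k.1, k.2.1, k.2.2⟩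
  have hex : ∀ᶠ μ in 𝓝[>] (0 : ℝ), ∃ τ, Meets U₁ ξ μ v (σ μ) τ ∧
      τ ≤ μ / ξ * time ξ μ v (σ μ) / ((v - σ μ) / 4) := by
    filter_upwards [hdata, eventually_pull_le hU₁ hξ h₁ hdata lim] with μ h hp
    exact h.exists_meets (by linarith [h.lt]) (by linarith [h.lt]) hp
  obtain ⟨τ, hτ⟩ := hex.choice
  have hmeet : ∀ᶠ μ in 𝓝[>] (0 : ℝ), Meets U₁ ξ μ v (σ μ) (τ μ) := hτ.mono fun _ h => h.1
  have limT : Tendsto (fun μ => time ξ μ v (σ μ)) (𝓝[>] 0) (𝓝 0) := by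
    have hz : Tendsto (fun μ => ξ * (μ / ξ / (v - σ μ))) (𝓝[>] 0) (𝓝 0) := by
      simpa using rat.const_mul ξ
    refine squeeze_zero' ?_ ?_ hz
    · filter_upwards [hdata] with μ h using h.time_pos.le
    · filter_upwards [hdata] with μ h using h.time_le
  have limτ : Tendsto τ (𝓝[>] 0) (𝓝 0) := by
    -- The closing rate `(v - σ) / 4` tends to 0 itself, but more slowly than `μ / ξ`, the factor in
    -- the initial gap.
    have hz : Tendsto (fun μ => 4 * (time ξ μ v (σ μ) * (μ / ξ / (v - σ μ)))) (𝓝[>] 0) (𝓝 0) := by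
      simpa using (limT.mul rat).const_mul 4
    refine squeeze_zero' ?_ ?_ hz
    · filter_upwards [hmeet] with μ h using h.pos.le
    · filter_upwards [hτ, hdata] with μ h h'
      refine h.2.trans (le_of_eq ?_)
      have := sub_pos.2 h'.lt
      field_simp
  have limm : Tendsto (fun μ => mass U₁ ξ μ v (σ μ)) (𝓝[>] 0) (𝓝 ξ) := by
    have : Tendsto (fun μ => ξ + time ξ μ v (σ μ) * (σ μ * U₁.rho - U₁.mom - 1)) (𝓝[>] 0)
        (𝓝 (ξ + 0 * (v * U₁.rho - U₁.mom - 1))) :=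
      (limT.mul (((lim.mul_const _).sub_const _).sub_const _)).const_add _
    rw [zero_mul, add_zero] at this
    refine this.congr' ?_
    filter_upwards [hdata] with μ h using h.mass_eq.symm
  have limx : Tendsto (fun μ => v * τ μ - μ / ξ * time ξ μ v (σ μ)) (𝓝[>] 0)
      (𝓝 (v * 0 - 0 * 0)) := (limτ.const_mul v).sub (limη.mul limT)
  have limw : Tendsto (fun μ => DeltaShock.str (mid ξ μ v) U₁ (mass U₁ ξ μ v (σ μ)) (σ μ) (τ μ))
      (𝓝[>] 0) (𝓝 ξ) := by
    have := (((limm.add (limx.const_mul U₁.rho)).sub (limτ.const_mul U₁.mom)).add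
      (limT.const_mul 2)).add limτ
    simp only [mul_zero, sub_zero, add_zero] at this
    refine this.congr' ?_
    filter_upwards [hdata, hmeet] with μ h hm using (h.str_eq hm).symm
  have limq : Tendsto (fun μ => DeltaShock.str (mid ξ μ v) U₁ (mass U₁ ξ μ v (σ μ)) (σ μ) (τ μ)
      * DeltaShock.speed (mid ξ μ v) U₁ (mass U₁ ξ μ v (σ μ)) (σ μ) (τ μ)) (𝓝[>] 0)
      (𝓝 (ξ * v)) := by
    have := (((((limm.mul lim).add (limx.const_mul U₁.mom)).sub (limτ.const_mul U₁.momFlux)).add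
      ((limη.add_const (2 * v)).mul limT))).add (limτ.const_mul v)
    simp only [mul_zero, sub_zero, add_zero] at this
    refine this.congr' ?_
    filter_upwards [hdata, hmeet] with μ h hm using (h.str_mul_speed hm).symm
  have lims : Tendsto
      (fun μ => DeltaShock.speed (mid ξ μ v) U₁ (mass U₁ ξ μ v (σ μ)) (σ μ) (τ μ)) (𝓝[>] 0)
      (𝓝 v) := by
    -- The limit of the speed is that of momentum over mass, as no direct estimate from below of the
    -- speed is at hand.
    have := limq.div limw hξ.ne'
    rw [mul_div_cancel_left₀ _ hξ.ne'] at this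
    refine this.congr' ?_
    filter_upwards [hdata, hmeet] with μ h hm
    exact mul_div_cancel_left₀ _
      (DeltaShock.str_pos h.rho_mid h.rho₁ h.mem h.mass_pos' hm.pos.le).ne'
  have limS : Tendsto (fun μ => time ξ μ v (σ μ) + τ μ) (𝓝[>] 0) (𝓝 0) := by
    simpa using limT.add limτ
  have limp : Tendsto (fun μ => -(μ / 2) + v * (time ξ μ v (σ μ) + τ μ)) (𝓝[>] 0) (𝓝 0) := by
    have := ((tendsto_div_const_nhdsGT (two_pos : (0 : ℝ) < 2)).mono_right
      nhdsWithin_le_nhds).neg.add (limS.const_mul v)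
    simpa using this
  refine ⟨⟨fun μ => tracking U₀ U₁ ξ μ v (σ μ) (τ μ), _, _, _, _, ?_,
    Eventually.of_forall fun μ => ⟨rfl, rfl⟩, ?_, limw, lims, limp, limS, ?_⟩⟩
  · filter_upwards [hdata, hmeet] with μ h hm using h.isSolution hm
  · filter_upwards [hdata, hmeet] with μ h hm
    exact ⟨(h.speed_mem hm.pos.le).1, (h.speed_mem hm.pos.le).2.trans h.left.ge⟩
  · intro g α G ψ hG hψ hc
    exact bound hG hψ hc hξ hdata hmeet limT limm limw

end ContactsShadow

end Chaplygin

namespace Chaplygin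

/-! ### A shadow wave that absorbs two contact discontinuities on its right -/

namespace ShadowContacts

variable {U₀ U₁ : State} {ξ μ v s τ : ℝ}

/-- The state between the two contact discontinuities. -/
noncomputable def mid (ξ μ v : ℝ) : State := State.ofLam (v - μ / ξ) v

/-- The time of the first collision. -/
noncomputable def time (ξ μ v s : ℝ) : ℝ := μ / (s - (v - μ / ξ))

/-- The strength of the shadow wave at the first collision. -/
noncomputable def mass (U₀ : State) (ξ μ v s : ℝ) : ℝ :=
  growth U₀ ⟨ξ / μ, v⟩ s * time ξ μ v s

/-- The pattern before the first collision. -/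
noncomputable def first (U₀ U₁ : State) (ξ μ v s : ℝ) : Pattern :=
  twoFans μ 1 2 (fun i => if i = 0 then U₀ else ⟨ξ / μ, v⟩)
    (fun i => if i = 0 then ⟨ξ / μ, v⟩ else if i = 1 then mid ξ μ v else U₁) (fun _ => s)
    (fun _ => growth U₀ ⟨ξ / μ, v⟩ s) (fun i => if i = 0 then v - μ / ξ else v) (fun _ => 0)

/-- The pattern between the two collisions. -/
noncomputable def second (U₀ U₁ : State) (ξ μ v s : ℝ) : Pattern :=
  Pattern.pair U₀ (mid ξ μ v) U₁
    (fun t => μ / 2 + (v - μ / ξ) * time ξ μ v s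
      + DeltaShock.pos U₀ (mid ξ μ v) (mass U₀ ξ μ v s) s (t - time ξ μ v s))
    (fun t => DeltaShock.speed U₀ (mid ξ μ v) (mass U₀ ξ μ v s) s (t - time ξ μ v s))
    (fun t => DeltaShock.str U₀ (mid ξ μ v) (mass U₀ ξ μ v s) s (t - time ξ μ v s))
    (fun t => μ / 2 + v * t) (fun _ => v) (fun _ => 0) (time ξ μ v s - 1)

/-- The solution, the second collision takes place after the time `τ`. -/
noncomputable def tracking (U₀ U₁ : State) (ξ μ v s τ : ℝ) : WaveTracking :=
  WaveTracking.three (time ξ μ v s) (time ξ μ v s + τ) (first U₀ U₁ ξ μ v s)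
    (second U₀ U₁ ξ μ v s)
    (Pattern.single U₀ U₁ (DeltaShock.str U₀ (mid ξ μ v) (mass U₀ ξ μ v s) s τ)
      (DeltaShock.speed U₀ (mid ξ μ v) (mass U₀ ξ μ v s) s τ)
      (μ / 2 + v * (time ξ μ v s + τ)) (time ξ μ v s + τ))

/-- The waves on the right of the concentrated state are contact discontinuities, the one on the
left is a shadow wave with speed `s`. -/
structure Data (U₀ U₁ : State) (ξ μ v s : ℝ) : Prop where
  rho₀ : 0 < U₀.rho
  rho₁ : 0 < U₁.rho
  mass_pos : 0 < ξ
  pos : 0 < μ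
  right : U₁.lam2 = v
  ne : U₁.lam1 ≠ v - μ / ξ
  left : v + μ / ξ ≤ s
  left' : s ≤ U₀.lam1
  left_pull : (State.mk (ξ / μ) v).pull s = U₀.pull s

/-- The right contact discontinuity meets the shadow wave after the time `τ`. -/
structure Meets (U₀ : State) (ξ μ v s τ : ℝ) : Prop where
  pos : 0 < τ
  eq : DeltaShock.pos U₀ (mid ξ μ v) (mass U₀ ξ μ v s) s τ = v * τ + μ / ξ * time ξ μ v s
  lt : ∀ t, 0 ≤ t → t < τ →
    DeltaShock.pos U₀ (mid ξ μ v) (mass U₀ ξ μ v s) s t < v * t + μ / ξ * time ξ μ v s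

namespace Data

theorem div_pos (h : Data U₀ U₁ ξ μ v s) : 0 < μ / ξ := _root_.div_pos h.pos h.mass_pos

theorem rho_conc (h : Data U₀ U₁ ξ μ v s) : 0 < (State.mk (ξ / μ) v).rho :=
  rho_mid_pos h.mass_pos h.pos

theorem rho_mid (h : Data U₀ U₁ ξ μ v s) : 0 < (mid ξ μ v).rho :=
  State.rho_ofLam_pos (by linarith [h.div_pos])

theorem lam1_mid (ξ μ v : ℝ) : (mid ξ μ v).lam1 = v - μ / ξ := State.lam1_ofLam _ _

theorem lam2_mid (ξ μ v : ℝ) : (mid ξ μ v).lam2 = v := State.lam2_ofLam _ _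

theorem lt (h : Data U₀ U₁ ξ μ v s) : v < s := by linarith [h.div_pos, h.left]

theorem mem (h : Data U₀ U₁ ξ μ v s) : (mid ξ μ v).lam2 ≤ s ∧ s ≤ U₀.lam1 :=
  ⟨by rw [lam2_mid]; exact h.lt.le, h.left'⟩

theorem sub_pos (h : Data U₀ U₁ ξ μ v s) : 0 < s - (v - μ / ξ) := by linarith [h.div_pos, h.lt]

theorem time_pos (h : Data U₀ U₁ ξ μ v s) : 0 < time ξ μ v s := _root_.div_pos h.pos h.sub_pos

theorem sub_mul_time (h : Data U₀ U₁ ξ μ v s) : (s - (v - μ / ξ)) * time ξ μ v s = μ :=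
  mul_div_cancel₀ _ h.sub_pos.ne'

theorem time_le (h : Data U₀ U₁ ξ μ v s) : time ξ μ v s ≤ ξ * (μ / ξ / (s - v)) := by
  have e : ξ * (μ / ξ / (s - v)) = μ / (s - v) := by
    have := h.mass_pos.ne'
    field_simp
  rw [e, time]
  exact div_le_div_of_nonneg_left h.pos.le (by linarith [h.lt]) (by linarith [h.div_pos])

theorem two_le_growth (h : Data U₀ U₁ ξ μ v s) : 2 ≤ growth U₀ ⟨ξ / μ, v⟩ s :=
  State.two_le_flux h.rho₀ h.rho_conc (by rw [Chaplygin.lam2_mid]; exact h.left) h.left'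

theorem mass_pos' (h : Data U₀ U₁ ξ μ v s) : 0 < mass U₀ ξ μ v s :=
  mul_pos (by linarith [h.two_le_growth]) h.time_pos

theorem mass_eq (h : Data U₀ U₁ ξ μ v s) :
    mass U₀ ξ μ v s = ξ + time ξ μ v s * (U₀.mom - s * U₀.rho - 1) := by
  have h1 := h.sub_mul_time
  have h2 : ξ / μ * μ = ξ := div_mul_cancel₀ _ h.pos.ne'
  have h3 : ξ / μ * (μ / ξ) = 1 := by
    have := h.mass_pos.ne'
    have := h.pos.ne'
    field_simp
  simp only [mass, growth, State.mom]
  linear_combination (ξ / μ) * h1 + h2 - time ξ μ v s * h3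

theorem rho_mid_mul (h : Data U₀ U₁ ξ μ v s) : (mid ξ μ v).rho * (μ / ξ) = 2 := by
  have := State.rho_mul (mid ξ μ v) h.rho_mid
  rwa [lam1_mid, lam2_mid, sub_sub_cancel] at this

theorem mom_mid (h : Data U₀ U₁ ξ μ v s) : (mid ξ μ v).mom = v * (mid ξ μ v).rho - 1 := by
  have := State.mom_sub_lam2 h.rho_mid
  rw [lam2_mid] at this
  linarith

theorem momFlux_mid (h : Data U₀ U₁ ξ μ v s) :
    (mid ξ μ v).momFlux = v * (mid ξ μ v).mom - v := by
  have := State.momFlux_sub_lam2 h.rho_mid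
  rw [lam2_mid] at this
  linarith

/-- As for contacts on the left, the dense state contributes only through `rho * (μ / ξ) = 2`, so
the strength at the second collision is `mass` up to vanishing terms. -/
theorem str_eq (h : Data U₀ U₁ ξ μ v s) (hm : Meets U₀ ξ μ v s τ) :
    DeltaShock.str U₀ (mid ξ μ v) (mass U₀ ξ μ v s) s τ = mass U₀ ξ μ v s
      - U₀.rho * (v * τ + μ / ξ * time ξ μ v s) + U₀.mom * τ + 2 * time ξ μ v s + τ := by
  rw [DeltaShock.str_eq h.rho₀ h.rho_mid h.mem h.mass_pos' hm.pos.le, h.mom_mid]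
  linear_combination ((mid ξ μ v).rho - U₀.rho) * hm.eq + time ξ μ v s * h.rho_mid_mul

theorem str_mul_speed (h : Data U₀ U₁ ξ μ v s) (hm : Meets U₀ ξ μ v s τ) :
    DeltaShock.str U₀ (mid ξ μ v) (mass U₀ ξ μ v s) s τ
      * DeltaShock.speed U₀ (mid ξ μ v) (mass U₀ ξ μ v s) s τ = mass U₀ ξ μ v s * s
      - U₀.mom * (v * τ + μ / ξ * time ξ μ v s) + U₀.momFlux * τ
      + (2 * v - μ / ξ) * time ξ μ v s + v * τ := by
  rw [DeltaShock.str_mul_speed h.rho₀ h.rho_mid h.mem h.mass_pos' hm.pos.le, h.momFlux_mid]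
  have e := h.mom_mid
  linear_combination ((mid ξ μ v).mom - U₀.mom) * hm.eq + time ξ μ v s * v * h.rho_mid_mul
    + μ / ξ * time ξ μ v s * e

/-- Here the shadow wave is the faster front: `v + δ` bounds its speed from below, and the contact
of speed `v` ahead of it is caught. -/
theorem exists_meets (h : Data U₀ U₁ ξ μ v s) {δ : ℝ} (hδ : 0 < δ) (hs : v + δ ≤ s)
    (hp : (mid ξ μ v).pull (v + δ) ≤ U₀.pull (v + δ)) :
    ∃ τ, Meets U₀ ξ μ v s τ ∧ τ ≤ μ / ξ * time ξ μ v s / δ := by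
  have hT : 0 < μ / ξ * time ξ μ v s := mul_pos h.div_pos h.time_pos
  obtain ⟨τ, h0, h1, h2, h3⟩ := exists_zero_of_decay (δ := δ)
    (f := fun t => v * t + μ / ξ * time ξ μ v s
      - DeltaShock.pos U₀ (mid ξ μ v) (mass U₀ ξ μ v s) s t)
    (ContinuousOn.sub (by fun_prop)
      (DeltaShock.continuousOn_pos h.rho₀ h.rho_mid h.mem h.mass_pos'))
    (by simpa [DeltaShock.pos_zero] using hT) hδ (fun x y hx hxy => by
        have := DeltaShock.le_pos_sub h.rho₀ h.rho_mid h.mem h.mass_pos' hx hxy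
          (c := v + δ) fun t ht => DeltaShock.le_speed_of_pull h.rho₀ h.rho_mid h.left' h.mass_pos'
            ht hs (by rw [lam2_mid]; linarith) hp
        linarith)
  simp only [DeltaShock.pos_zero, mul_zero, sub_zero, zero_add] at h1
  exact ⟨τ, ⟨h0, by linarith, fun t ht ht' => by linarith [h3 t ht ht']⟩, h1⟩

theorem first_pos (t : ℝ) : (first U₀ U₁ ξ μ v s).pos 0 t = -(μ / 2) + s * t ∧
    (first U₀ U₁ ξ μ v s).pos 1 t = μ / 2 + (v - μ / ξ) * t ∧
    (first U₀ U₁ ξ μ v s).pos 2 t = μ / 2 + v * t := by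
  simp [first, twoFans, glue]

theorem first_str (t : ℝ) :
    (first U₀ U₁ ξ μ v s).str 0 t = growth U₀ ⟨ξ / μ, v⟩ s * t ∧
    (first U₀ U₁ ξ μ v s).str 1 t = 0 ∧ (first U₀ U₁ ξ μ v s).str 2 t = 0 := by
  simp [first, twoFans, glue]

theorem first_speed (t : ℝ) : (first U₀ U₁ ξ μ v s).speed 0 t = s := by
  simp [first, twoFans, glue]

theorem first_state : (first U₀ U₁ ξ μ v s).state 0 = U₀ ∧
    (first U₀ U₁ ξ μ v s).state 1 = ⟨ξ / μ, v⟩ ∧ (first U₀ U₁ ξ μ v s).state 2 = mid ξ μ v ∧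
    (first U₀ U₁ ξ μ v s).state 3 = U₁ := by
  simp [first, twoFans, glue]

theorem fan_left (h : Data U₀ U₁ ξ μ v s) : IsFan U₀ ⟨ξ / μ, v⟩ 1
    (fun i => if i = 0 then U₀ else ⟨ξ / μ, v⟩) (fun _ => s)
    (fun _ => growth U₀ ⟨ξ / μ, v⟩ s) :=
  isFan_one h.rho₀ h.rho_conc
    (.inr ⟨by rw [Chaplygin.lam2_mid]; exact h.left, h.left', rfl, h.left_pull⟩)

theorem fan_right (h : Data U₀ U₁ ξ μ v s) : IsFan ⟨ξ / μ, v⟩ U₁ 2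
    (fun i => if i = 0 then ⟨ξ / μ, v⟩ else if i = 1 then mid ξ μ v else U₁)
    (fun i => if i = 0 then v - μ / ξ else v) (fun _ => 0) := by
  have hd := h.div_pos
  have := isFan_contacts h.rho_conc h.rho₁ (by rw [h.right, Chaplygin.lam1_mid]; linarith)
    (by rw [Chaplygin.lam1_mid]; exact h.ne.symm)
    (by rw [h.right, Chaplygin.lam2_mid]; linarith)
  rwa [State.between, h.right, Chaplygin.lam1_mid] at this

theorem first_admissible (h : Data U₀ U₁ ξ μ v s) :
    (first U₀ U₁ ξ μ v s).IsAdmissibleOn 0 (Set.Icc 0 (time ξ μ v s)) := by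
  refine Pattern.affine_admissible Set.Icc_subset_Ici_self (h.fan_left.glue_rho_pos h.fan_right)
    (fun t ht i hi => ?_) (h.fan_left.glue_ray h.fan_right)
  rw [interior_Icc] at ht
  have h1 := mul_lt_mul_of_pos_left ht.2 h.sub_pos
  have h2 := mul_pos h.div_pos ht.1
  rw [h.sub_mul_time] at h1
  have hi : i < 2 := by omega
  interval_cases i <;> simp [glue] <;> linarith

theorem second_admissible (h : Data U₀ U₁ ξ μ v s) (hm : Meets U₀ ξ μ v s τ) :
    (second U₀ U₁ ξ μ v s).IsAdmissibleOn (time ξ μ v s)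
      (Set.Icc (time ξ μ v s) (time ξ μ v s + τ)) := by
  refine ⟨fun i _ => ?_, fun t ht i hi => ?_, fun i hi => ?_⟩
  · simp only [second, Pattern.pair_state]
    split_ifs
    exacts [h.rho₀, h.rho_mid, h.rho₁]
  · rw [interior_Icc] at ht
    obtain rfl : i = 0 := by
      simp only [second, Pattern.pair_n] at hi
      omega
    have := hm.lt (t - time ξ μ v s) (by linarith [ht.1]) (by linarith [ht.2])
    simp only [second, Pattern.pair_pos, if_true, zero_add, one_ne_zero, if_false]
    linarith
  · have hi : i < 2 := hi
    interval_cases i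
    · refine ⟨(DeltaShock.isFront h.rho₀ h.rho_mid h.mem h.mass_pos' _ _).mono
        Set.Icc_subset_Ici_self, .inr ⟨(DeltaShock.isShadow h.rho₀ h.rho_mid h.mem h.mass_pos' _).mono
          Set.Icc_subset_Ici_self, .inr ⟨?_, sub_one_lt _⟩⟩⟩
      simp only [second, Pattern.pair_str, if_true, sub_self, DeltaShock.str_zero h.mass_pos',
        h.mass_pos']
    · have hf : IsFront (Set.Icc (time ξ μ v s) (time ξ μ v s + τ)) (fun t => μ / 2 + v * t)
          (fun _ => v) := by
        simpa using Pattern.isFront_affine (μ / 2) v 0 _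
      refine ⟨hf, .inl ⟨fun e => h.ne ?_, fun _ _ => rfl, .inr ⟨?_, fun _ _ => ?_⟩⟩⟩
      · change mid ξ μ v = U₁ at e
        rw [← e, lam1_mid]
      · exact (lam2_mid ξ μ v).trans h.right.symm
      · exact (lam2_mid ξ μ v).symm

theorem speed_mem (h : Data U₀ U₁ ξ μ v s) {t : ℝ} (ht : 0 ≤ t) :
    v ≤ DeltaShock.speed U₀ (mid ξ μ v) (mass U₀ ξ μ v s) s t ∧
      DeltaShock.speed U₀ (mid ξ μ v) (mass U₀ ξ μ v s) s t ≤ U₀.lam1 := by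
  have := DeltaShock.speed_mem h.rho₀ h.rho_mid h.mem h.mass_pos' ht
  rwa [lam2_mid] at this

theorem isSolution (h : Data U₀ U₁ ξ μ v s) (hm : Meets U₀ ξ μ v s τ) :
    (tracking U₀ U₁ ξ μ v s τ).IsSolution (deltaData U₀ U₁ ξ μ v) := by
  obtain ⟨p0, p1, p2⟩ := first_pos (U₀ := U₀) (U₁ := U₁) (ξ := ξ) (μ := μ) (v := v) (s := s)
    (time ξ μ v s)
  obtain ⟨k0, k1, k2⟩ := first_str (U₀ := U₀) (U₁ := U₁) (ξ := ξ) (μ := μ) (v := v) (s := s)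
    (time ξ μ v s)
  have hp : -(μ / 2) + s * time ξ μ v s = μ / 2 + (v - μ / ξ) * time ξ μ v s := by
    linarith [h.sub_mul_time]
  rw [hp] at p0
  have hlt := mul_pos h.div_pos h.time_pos
  have hτ : time ξ μ v s + τ - time ξ μ v s = τ := add_sub_cancel_left _ _
  have hsp := h.speed_mem hm.pos.le
  have hw := DeltaShock.str_pos h.rho₀ h.rho_mid h.mem h.mass_pos' hm.pos.le
  have e0 : (second U₀ U₁ ξ μ v s).pos 0 (time ξ μ v s + τ)
      = μ / 2 + v * (time ξ μ v s + τ) := by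
    simp only [second, Pattern.pair_pos, if_true, hτ]
    linarith [hm.eq]
  refine WaveTracking.three_isSolution h.time_pos (by linarith [hm.pos]) h.first_admissible
    (h.second_admissible hm)
    (Pattern.single_admissible h.rho₀ h.rho₁ ⟨h.right.le.trans hsp.1, hsp.2⟩ hw)
    (h.fan_left.startsFrom h.pos h.fan_right) (i := 0) (j := 0) (show 0 + 1 < 1 + 2 by norm_num)
    (p0.trans p1.symm) ?_ (show 0 + 1 < 2 by norm_num) e0 ?_
  · refine Pattern.pair_startsFrom_left (Q := first U₀ U₁ ξ μ v s) rfl first_state.1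
      first_state.2.2.1 first_state.2.2.2 ?_ ?_ p2 ?_ ?_ k2 ?_ ?_
    · simp only [sub_self, DeltaShock.pos_zero, add_zero, p0]
    · simp only [sub_self, DeltaShock.pos_zero, add_zero, p1]
    · simp only [sub_self, DeltaShock.pos_zero, add_zero]
      linarith
    · rw [k0, k1, sub_self, DeltaShock.str_zero h.mass_pos', add_zero, mass]
    · rw [k0, k1, sub_self, DeltaShock.str_zero h.mass_pos', DeltaShock.speed_zero h.mass_pos',
        first_speed, zero_mul, add_zero, mass]
    · rw [k2, zero_mul, zero_mul]
  · refine Pattern.single_startsFrom (Q := second U₀ U₁ ξ μ v s) rfl e0 rfl hw ?_ ?_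
    · simp only [second, Pattern.pair_str, if_true, one_ne_zero, if_false, hτ, add_zero]
    · simp only [second, Pattern.pair_str, Pattern.pair_speed, if_true, one_ne_zero, if_false, hτ,
        zero_mul, add_zero]

end Data

theorem bound {g : State → ℝ} {α : ℝ → ℝ} {G : ℝ → ℝ → ℝ} {ψ : ℝ × ℝ → ℝ}
    (hG : IsContent g α G) (hψ : Continuous ψ) (hc : HasCompactSupport ψ) {σ τ : ℝ → ℝ}
    (hξ : 0 < ξ) (hdata : ∀ᶠ μ in 𝓝[>] (0 : ℝ), Data U₀ U₁ ξ μ v (σ μ))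
    (hmeet : ∀ᶠ μ in 𝓝[>] (0 : ℝ), Meets U₀ ξ μ v (σ μ) (τ μ))
    (limT : Tendsto (fun μ => time ξ μ v (σ μ)) (𝓝[>] 0) (𝓝 0))
    (limm : Tendsto (fun μ => mass U₀ ξ μ v (σ μ)) (𝓝[>] 0) (𝓝 ξ))
    (limw : Tendsto (fun μ => DeltaShock.str U₀ (mid ξ μ v) (mass U₀ ξ μ v (σ μ)) (σ μ) (τ μ))
      (𝓝[>] 0) (𝓝 ξ)) :
    ∃ C : ℝ, ∀ᶠ μ in 𝓝[>] (0 : ℝ), ∀ k < 2, ∀ t ∈ Set.Icc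
      ((tracking U₀ U₁ ξ μ v (σ μ) (τ μ)).T k) ((tracking U₀ U₁ ξ μ v (σ μ) (τ μ)).T (k + 1)),
      |((tracking U₀ U₁ ξ μ v (σ μ) (τ μ)).slab k).slice g α ψ t| ≤ C := by
  obtain ⟨-, C₀, -, hC0, hC, -⟩ := exists_bounds hψ hc
  obtain ⟨D, -, hD⟩ := exists_integral_abs_le hψ hc
  obtain ⟨A, hA0, hA⟩ := hG.flux.exists_abs_le v U₀.lam1
  obtain ⟨M, hM0, hM⟩ := hG.eventually_mid_le hξ v
  obtain ⟨N, -, hN⟩ := hG.eventually_side_le hξ v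
  refine ⟨(|g U₀| + |g U₁|) * D + C₀ * (N + M) + C₀ * (2 * ξ * A), ?_⟩
  have h2 : ξ < 2 * ξ := by linarith
  filter_upwards [hdata, hmeet, hM, hN, limT.eventually (gt_mem_nhds one_pos),
    limm.eventually (gt_mem_nhds h2), limw.eventually (gt_mem_nhds h2)]
    with μ h hm hMμ hNμ hT hmass hstr k hk t ht
  replace hNμ : |g (mid ξ μ v)| * (μ / ξ) ≤ N := hNμ.2
  have hd := h.div_pos
  have hNT : ∀ y, y ≤ μ / ξ * time ξ μ v (σ μ) → |g (mid ξ μ v)| * y ≤ N := by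
    intro y hy
    refine le_trans (mul_le_mul_of_nonneg_left (hy.trans ?_) (abs_nonneg _)) hNμ
    exact mul_le_of_le_one_right hd.le hT.le
  interval_cases k
  · change t ∈ Set.Icc 0 (time ξ μ v (σ μ)) at ht
    change |(first U₀ U₁ ξ μ v (σ μ)).slice g α ψ t| ≤ _
    obtain ⟨p0, p1, p2⟩ := Data.first_pos (U₀ := U₀) (U₁ := U₁) (ξ := ξ) (μ := μ) (v := v)
      (s := σ μ) t
    obtain ⟨k0, k1, k2⟩ := Data.first_str (U₀ := U₀) (U₁ := U₁) (ξ := ξ) (μ := μ) (v := v)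
      (s := σ μ) t
    obtain ⟨s0, s1, s2, s3⟩ := Data.first_state (U₀ := U₀) (U₁ := U₁) (ξ := ξ) (μ := μ) (v := v)
      (s := σ μ)
    have e0 := Data.first_speed (U₀ := U₀) (U₁ := U₁) (ξ := ξ) (μ := μ) (v := v) (s := σ μ) t
    refine ((h.first_admissible.sorted h.time_pos ht).abs_slice_le (m := 2) rfl g α hψ hc hC
      hD).trans ?_
    have hκ := h.two_le_growth
    simp only [Finset.sum_range_succ, Finset.sum_range_zero, zero_add, Nat.reduceAdd, p0, p1, p2,
      k0, k1, k2, e0, s0, s1, s2, s3, abs_zero, zero_mul]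
    rw [abs_of_nonneg (mul_nonneg (by linarith) ht.1)]
    have w1 := mul_le_mul_of_nonneg_left (hNT (μ / ξ * t) (mul_le_mul_of_nonneg_left ht.2 hd.le)) hC0
    have w2 : |g ⟨ξ / μ, v⟩| * (μ / 2 + (v - μ / ξ) * t - (-(μ / 2) + σ μ * t)) ≤ M := by
      refine le_trans (mul_le_mul_of_nonneg_left ?_ (abs_nonneg _)) hMμ
      have := mul_nonneg h.sub_pos.le ht.1
      linarith
    have w3 : growth U₀ ⟨ξ / μ, v⟩ (σ μ) * t * |α (σ μ)| ≤ 2 * ξ * A := by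
      have b0 : growth U₀ ⟨ξ / μ, v⟩ (σ μ) * t ≤ mass U₀ ξ μ v (σ μ) :=
        mul_le_mul_of_nonneg_left ht.2 (by linarith)
      exact mul_le_mul (b0.trans hmass.le) (hA _ h.lt.le h.left') (abs_nonneg _) (by linarith)
    have w2' := mul_le_mul_of_nonneg_left w2 hC0
    have w3' := mul_le_mul_of_nonneg_left w3 hC0
    linarith
  · change t ∈ Set.Icc (time ξ μ v (σ μ)) (time ξ μ v (σ μ) + τ μ) at ht
    change |(second U₀ U₁ ξ μ v (σ μ)).slice g α ψ t| ≤ _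
    have ht0 : 0 ≤ t - time ξ μ v (σ μ) := by linarith [ht.1]
    have ht1 : t - time ξ μ v (σ μ) ≤ τ μ := by linarith [ht.2]
    refine (((h.second_admissible hm).sorted (by linarith [hm.pos]) ht).abs_slice_le (m := 1) rfl
      g α hψ hc hC hD).trans ?_
    simp only [second, Finset.sum_range_succ, Finset.sum_range_zero, zero_add, Nat.reduceAdd,
      Pattern.pair_state, Pattern.pair_pos, Pattern.pair_str, Pattern.pair_speed, if_true,
      one_ne_zero, if_false, OfNat.ofNat_ne_zero, OfNat.ofNat_ne_one, abs_zero, zero_mul]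
    rw [abs_of_pos (DeltaShock.str_pos h.rho₀ h.rho_mid h.mem h.mass_pos' ht0)]
    have hpos := DeltaShock.le_pos_sub h.rho₀ h.rho_mid h.mem h.mass_pos' le_rfl ht0
      (c := v) fun x hx => (h.speed_mem hx).1
    rw [DeltaShock.pos_zero] at hpos
    have w1 := mul_le_mul_of_nonneg_left (hNT (μ / 2 + v * t - (μ / 2 + (v - μ / ξ) * time ξ μ v (σ μ)
      + DeltaShock.pos U₀ (mid ξ μ v) (mass U₀ ξ μ v (σ μ)) (σ μ) (t - time ξ μ v (σ μ))))
      (by linarith)) hC0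
    have hsp := h.speed_mem ht0
    have w3 := mul_le_mul_of_nonneg_left (mul_le_mul
      ((DeltaShock.str_le_str h.rho₀ h.rho_mid h.mem h.mass_pos' ht0 ht1).trans hstr.le)
      (hA _ hsp.1 hsp.2) (abs_nonneg _) (by linarith)) hC0
    have w4 := mul_nonneg hC0 hM0
    linarith

/-- The reflected computation with `δ = (σ - v) / 4`: the pull of the middle state tends to an
eighth of `U₀.pull v`, which is positive since `v` lies below λ₁(U₀). -/
theorem eventually_pull_le (hU₀ : 0 < U₀.rho) (hξ : 0 < ξ) (h₀ : v < U₀.lam1) {σ : ℝ → ℝ}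
    (hdata : ∀ᶠ μ in 𝓝[>] (0 : ℝ), Data U₀ U₁ ξ μ v (σ μ)) (lim : Tendsto σ (𝓝[>] 0) (𝓝 v)) :
    ∀ᶠ μ in 𝓝[>] (0 : ℝ),
      (mid ξ μ v).pull (v + (σ μ - v) / 4) ≤ U₀.pull (v + (σ μ - v) / 4) := by
  have hk := State.pull_pos_left hU₀ h₀
  have l1 : Tendsto (fun μ => μ / ξ / 8 + U₀.pull (σ μ) / 8 + (σ μ - v) / 2) (𝓝[>] 0)
      (𝓝 (0 / 8 + U₀.pull v / 8 + (v - v) / 2)) :=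
    ((((tendsto_div_const_nhdsGT hξ).mono_right nhdsWithin_le_nhds).div_const _).add
      ((((continuous_pull U₀).tendsto v).comp lim).div_const _)).add
      ((lim.sub_const _).div_const _)
  have l2 : Tendsto (fun μ => U₀.pull (v + (σ μ - v) / 4)) (𝓝[>] 0)
      (𝓝 (U₀.pull (v + (v - v) / 4))) :=
    ((continuous_pull U₀).tendsto _).comp
      (tendsto_const_nhds.add ((lim.sub_const _).div_const _))
  rw [sub_self, zero_div, zero_div, add_zero, zero_add] at l1
  rw [sub_self, zero_div, add_zero] at l2
  filter_upwards [hdata, l1.eventually_lt l2 (by linarith)] with μ h hlt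
  refine le_trans (le_of_eq ?_) hlt.le
  have hsq := sq_sub_eq_of_pull_eq h.mass_pos h.pos h.left_pull
  have hr := h.rho_mid_mul
  have hd := h.div_pos
  have hr' : (mid ξ μ v).rho = 2 / (μ / ξ) := by
    rw [eq_div_iff hd.ne', hr]
  rw [State.pull_eq h.rho_mid, Data.lam1_mid, Data.lam2_mid, hr']
  generalize μ / ξ = η at *
  field_simp
  linear_combination 32 * hsq

theorem nonempty_collapse (hU₀ : 0 < U₀.rho) (hU₁ : 0 < U₁.rho) (hξ : 0 < ξ) (h₀ : v < U₀.lam1)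
    (h₁ : U₁.lam2 = v) : Nonempty (Collapse U₀ U₁ ξ v) := by
  obtain ⟨σ, hσ, lim, rat⟩ := exists_speed_left hU₀ hξ h₀
  have limη : Tendsto (fun μ : ℝ => μ / ξ) (𝓝[>] 0) (𝓝 0) :=
    (tendsto_div_const_nhdsGT hξ).mono_right nhdsWithin_le_nhds
  have hdata : ∀ᶠ μ in 𝓝[>] (0 : ℝ), Data U₀ U₁ ξ μ v (σ μ) := by
    filter_upwards [hσ, self_mem_nhdsWithin, eventually_div_ne hξ (v - U₁.lam1)] with μ k hμ hne
    exact ⟨hU₀, hU₁, hξ, hμ, h₁, fun e => hne (by linarith), k.1, k.2.1, k.2.2⟩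
  have hex : ∀ᶠ μ in 𝓝[>] (0 : ℝ), ∃ τ, Meets U₀ ξ μ v (σ μ) τ ∧
      τ ≤ μ / ξ * time ξ μ v (σ μ) / ((σ μ - v) / 4) := by
    filter_upwards [hdata, eventually_pull_le hU₀ hξ h₀ hdata lim] with μ h hp
    exact h.exists_meets (by linarith [h.lt]) (by linarith [h.lt]) hp
  obtain ⟨τ, hτ⟩ := hex.choice
  have hmeet : ∀ᶠ μ in 𝓝[>] (0 : ℝ), Meets U₀ ξ μ v (σ μ) (τ μ) := hτ.mono fun _ h => h.1
  have limT : Tendsto (fun μ => time ξ μ v (σ μ)) (𝓝[>] 0) (𝓝 0) := by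
    have hz : Tendsto (fun μ => ξ * (μ / ξ / (σ μ - v))) (𝓝[>] 0) (𝓝 0) := by
      simpa using rat.const_mul ξ
    refine squeeze_zero' ?_ ?_ hz
    · filter_upwards [hdata] with μ h using h.time_pos.le
    · filter_upwards [hdata] with μ h using h.time_le
  have limτ : Tendsto τ (𝓝[>] 0) (𝓝 0) := by
    -- The waiting time is bounded by the initial gap over `(σ - v) / 4`; again `μ / ξ` is small
    -- compared with `σ - v`.
    have hz : Tendsto (fun μ => 4 * (time ξ μ v (σ μ) * (μ / ξ / (σ μ - v)))) (𝓝[>] 0) (𝓝 0) := by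
      simpa using (limT.mul rat).const_mul 4
    refine squeeze_zero' ?_ ?_ hz
    · filter_upwards [hmeet] with μ h using h.pos.le
    · filter_upwards [hτ, hdata] with μ h h'
      refine h.2.trans (le_of_eq ?_)
      have := sub_pos.2 h'.lt
      field_simp
  have limm : Tendsto (fun μ => mass U₀ ξ μ v (σ μ)) (𝓝[>] 0) (𝓝 ξ) := by
    have : Tendsto (fun μ => ξ + time ξ μ v (σ μ) * (U₀.mom - σ μ * U₀.rho - 1)) (𝓝[>] 0)
        (𝓝 (ξ + 0 * (U₀.mom - v * U₀.rho - 1))) :=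
      (limT.mul (((lim.mul_const _).const_sub _).sub_const _)).const_add _
    rw [zero_mul, add_zero] at this
    refine this.congr' ?_
    filter_upwards [hdata] with μ h using h.mass_eq.symm
  have limx : Tendsto (fun μ => v * τ μ + μ / ξ * time ξ μ v (σ μ)) (𝓝[>] 0)
      (𝓝 (v * 0 + 0 * 0)) := (limτ.const_mul v).add (limη.mul limT)
  have limw : Tendsto (fun μ => DeltaShock.str U₀ (mid ξ μ v) (mass U₀ ξ μ v (σ μ)) (σ μ) (τ μ))
      (𝓝[>] 0) (𝓝 ξ) := by
    have := (((limm.sub (limx.const_mul U₀.rho)).add (limτ.const_mul U₀.mom)).add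
      (limT.const_mul 2)).add limτ
    simp only [mul_zero, sub_zero, add_zero] at this
    refine this.congr' ?_
    filter_upwards [hdata, hmeet] with μ h hm using (h.str_eq hm).symm
  have limq : Tendsto (fun μ => DeltaShock.str U₀ (mid ξ μ v) (mass U₀ ξ μ v (σ μ)) (σ μ) (τ μ)
      * DeltaShock.speed U₀ (mid ξ μ v) (mass U₀ ξ μ v (σ μ)) (σ μ) (τ μ)) (𝓝[>] 0)
      (𝓝 (ξ * v)) := by
    have := (((((limm.mul lim).sub (limx.const_mul U₀.mom)).add (limτ.const_mul U₀.momFlux)).add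
      ((limη.const_sub (2 * v)).mul limT))).add (limτ.const_mul v)
    simp only [mul_zero, sub_zero, add_zero] at this
    refine this.congr' ?_
    filter_upwards [hdata, hmeet] with μ h hm using (h.str_mul_speed hm).symm
  have lims : Tendsto
      (fun μ => DeltaShock.speed U₀ (mid ξ μ v) (mass U₀ ξ μ v (σ μ)) (σ μ) (τ μ)) (𝓝[>] 0)
      (𝓝 v) := by
    have := limq.div limw hξ.ne'
    rw [mul_div_cancel_left₀ _ hξ.ne'] at this
    refine this.congr' ?_
    filter_upwards [hdata, hmeet] with μ h hm
    exact mul_div_cancel_left₀ _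
      (DeltaShock.str_pos h.rho₀ h.rho_mid h.mem h.mass_pos' hm.pos.le).ne'
  have limS : Tendsto (fun μ => time ξ μ v (σ μ) + τ μ) (𝓝[>] 0) (𝓝 0) := by
    simpa using limT.add limτ
  have limp : Tendsto (fun μ => μ / 2 + v * (time ξ μ v (σ μ) + τ μ)) (𝓝[>] 0) (𝓝 0) := by
    have := ((tendsto_div_const_nhdsGT (two_pos : (0 : ℝ) < 2)).mono_right
      nhdsWithin_le_nhds).add (limS.const_mul v)
    simpa using this
  refine ⟨⟨fun μ => tracking U₀ U₁ ξ μ v (σ μ) (τ μ), _, _, _, _, ?_,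
    Eventually.of_forall fun μ => ⟨rfl, rfl⟩, ?_, limw, lims, limp, limS, ?_⟩⟩
  · filter_upwards [hdata, hmeet] with μ h hm using h.isSolution hm
  · filter_upwards [hdata, hmeet] with μ h hm
    exact ⟨h.right.le.trans (h.speed_mem hm.pos.le).1, (h.speed_mem hm.pos.le).2⟩
  · intro g α G ψ hG hψ hc
    exact bound hG hψ hc hξ hdata hmeet limT limm limw

end ShadowContacts

end Chaplygin

/-! ### Assembly of the cases -/

theorem Chaplygin.nonempty_collapse {U₀ U₁ : State} {ξ v : ℝ} (hU₀ : 0 < U₀.rho)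
    (hU₁ : 0 < U₁.rho) (hξ : 0 < ξ) (h : U₁.lam2 < U₀.lam1) (h₀ : v ≤ U₀.lam1)
    (h₁ : U₁.lam2 ≤ v) : Nonempty (Collapse U₀ U₁ ξ v) := by
  rcases h₀.lt_or_eq with h₀ | h₀
  · rcases h₁.lt_or_eq with h₁ | h₁
    · exact TwoShadows.nonempty_collapse hU₀ hU₁ hξ h₀ h₁
    · exact ShadowContacts.nonempty_collapse hU₀ hU₁ hξ h₀ h₁
  -- At the upper endpoint the right side is automatically a shadow wave, since the interval has
  -- positive length.
  · exact ContactsShadow.nonempty_collapse hU₀ hU₁ hξ h₀.symm (by rwa [h₀])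

theorem mainTheorem3 (U₀ U₁ : Chaplygin.State) (ξ : ℝ)
    (hU₀ : 0 < U₀.rho) (hU₁ : 0 < U₁.rho) (hξ : 0 < ξ) :
    (U₁.lam2 < U₀.lam1 →
      ∃ (v : ℝ) (c s w : ℝ → ℝ),
        (∀ v', Chaplygin.BackwardEnergy U₀ U₁ ξ v' ↔ v' = v) ∧
        Chaplygin.IsWeightedDeltaShock U₀ U₁ ξ v c s w ∧
        (∃ W, Chaplygin.IsApproximatingFamily U₀ U₁ ξ v W) ∧
        ∀ W, Chaplygin.IsApproximatingFamily U₀ U₁ ξ v W →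
          (∀ᶠ μ in 𝓝[>] (0 : ℝ),
            Chaplygin.IsWeakSolution (W μ).net (Chaplygin.deltaData U₀ U₁ ξ μ v)) ∧
          Chaplygin.TendstoDistrib W Chaplygin.State.rho
            (Chaplygin.jumpPlusDelta U₀.rho U₁.rho c w) ∧
          Chaplygin.TendstoDistrib W Chaplygin.State.vel
            (Chaplygin.jumpPlusDelta U₀.vel U₁.vel c (fun _ => 0)) ∧
          Chaplygin.TendstoDistrib W Chaplygin.State.mom
            (Chaplygin.jumpPlusDelta U₀.mom U₁.mom c (fun t => w t * s t))) ∧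
    (U₀.lam1 ≤ U₁.lam2 →
      ∃ v : ℝ,
        v = (if U₁.lam2 < 0 then U₁.lam2 else if 0 < U₀.lam1 then U₀.lam1 else 0) ∧
        (∀ v', Chaplygin.BackwardEnergy U₀ U₁ ξ v' ↔ v' = v) ∧
        (∃ W, Chaplygin.IsApproximatingFamily U₀ U₁ ξ v W) ∧
        ∃ Λρ Λu Λm : (ℝ × ℝ → ℝ) → ℝ,
          ∀ W, Chaplygin.IsApproximatingFamily U₀ U₁ ξ v W →
            (∀ᶠ μ in 𝓝[>] (0 : ℝ),
              Chaplygin.IsWeakSolution (W μ).net (Chaplygin.deltaData U₀ U₁ ξ μ v) ∧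
              Chaplygin.ConservesEnergy (W μ).net (Chaplygin.deltaData U₀ U₁ ξ μ v)) ∧
            Chaplygin.TendstoDistrib W Chaplygin.State.rho Λρ ∧
            Chaplygin.TendstoDistrib W Chaplygin.State.vel Λu ∧
            Chaplygin.TendstoDistrib W Chaplygin.State.mom Λm) := by
  open Chaplygin in
  refine ⟨fun h => ?_, fun h => ?_⟩
  · obtain ⟨v, h₁, h₀, hv⟩ := exists_backwardEnergy_iff hU₀ hU₁ hξ h
    obtain ⟨c⟩ := nonempty_collapse hU₀ hU₁ hξ h h₀ h₁
    refine ⟨v, DeltaShock.pos U₀ U₁ ξ v, DeltaShock.speed U₀ U₁ ξ v, DeltaShock.str U₀ U₁ ξ v, hv,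
      isWeightedDeltaShock hU₀ hU₁ hξ ⟨h₁, h₀⟩, ⟨c.W, c.isApproximatingFamily⟩, fun W hW =>
      ⟨hW.mono fun μ hμ => hμ.isWeakSolution, ?_, ?_, ?_⟩⟩
    · simpa using c.tendstoDistrib hU₀ hU₁ hξ ⟨h₁, h₀⟩ isContent_rho hW
    · simpa using c.tendstoDistrib hU₀ hU₁ hξ ⟨h₁, h₀⟩ isContent_vel hW
    · exact c.tendstoDistrib hU₀ hU₁ hξ ⟨h₁, h₀⟩ isContent_mom hW
  · set v := if U₁.lam2 < 0 then U₁.lam2 else if 0 < U₀.lam1 then U₀.lam1 else 0 with hv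
    -- The projection of 0 lies between λ₁(U₀) and λ₂(U₁), which is all that the construction with
    -- contacts requires.
    have h₀ : U₀.lam1 ≤ v := by
      rw [hv]
      split_ifs <;> linarith
    have h₁ : v ≤ U₁.lam2 := by
      rw [hv]
      split_ifs <;> linarith
    obtain ⟨Λρ, hρ⟩ := Meeting.exists_tendstoDistrib hU₀ hU₁ hξ h₀ h₁ isContent_rho
    obtain ⟨Λu, hu⟩ := Meeting.exists_tendstoDistrib hU₀ hU₁ hξ h₀ h₁ isContent_vel
    obtain ⟨Λm, hm⟩ := Meeting.exists_tendstoDistrib hU₀ hU₁ hξ h₀ h₁ isContent_mom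
    exact ⟨v, rfl, fun v' => backwardEnergy_iff_of_le hU₀ hU₁ hξ h,
      Meeting.exists_approximatingFamily hU₀ hU₁ hξ h₀ h₁, Λρ, Λu, Λm, fun W hW =>
      ⟨Meeting.eventually_conservesEnergy hU₀ hU₁ hξ h₀ h₁ hW, hρ W hW, hu W hW, hm W hW⟩⟩
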